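/- Let $k$ be an algebraically closed field of characteristic $0$. A Poisson scheme over a base $S$ is an $S$-scheme whose structure sheaf is a sheaf of Poisson algebras with $\mathcal{O}_S$-linear bracket; a Poisson morphism is a morphism whose comorphism preserves brackets. Let $(X,\Lambda_0)$ and $(Y,\Pi_0)$ be nonsingular Poisson varieties over $k$ with $X$ projective, and let $f:(X,\Lambda_0)\to(Y,\Pi_0)$ be a Poisson morphism over $k$. Let $f^*T_Y^\bullet$ be the complex of sheaves $f^*T_Y\xrightarrow{\pi}\wedge^2f^*T_Y\xrightarrow{\pi}\wedge^3f^*T_Y\to\cdots$ on $X$, with $f^*T_Y$ in degree $0$, where local sections of $\wedge^q f^*T_Y$ are regarded as alternating $q$-derivations $Q$ of $\mathcal{O}_Y$ with values in $\mathcal{O}_X$ (via $f$) and $$\pi(Q)(a_1,\dots,a_{q+1})=\sum_{\sigma\in S_{q,1}}\operatorname{sgn}(\sigma)\,\Lambda_0\big(Q(a_{\sigma(1)},\dots,a_{\sigma(q)}),f(a_{\sigma(q+1)})\big)-(-1)^{q-1}\sum_{\sigma\in S_{2,q-1}}\operatorname{sgn}(\sigma)\,Q\big(\Pi_0(a_{\sigma(1)},a_{\sigma(2)}),a_{\sigma(3)},\dots,a_{\sigma(q+1)}\big),$$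 the sums running over shuffles. Let $T_X^\bullet$ be the case $f=\mathrm{id}_X$, whose differential is $[\Lambda_0,-]$. The rule $F(P)(a_1,\dots,a_q)=P(f(a_1),\dots,f(a_q))$ defines a morphism of complexes $F:T_X^\bullet\to f^*T_Y^\bullet$ and hence maps $F:\mathbb{H}^i(X,T_X^\bullet)\to\mathbb{H}^i(X,f^*T_Y^\bullet)$ on hypercohomology. (Hypercohomology is computed by the Čech double complex of any affine open cover of $X$ each member of which $f$ maps into an affine open subset of $Y$.) Assume that 1. $F:\mathbb{H}^1(X,T_X^\bullet)\to\mathbb{H}^1(X,f^*T_Y^\bullet)$ is surjective, and 2. $F:\mathbb{H}^2(X,T_X^\bullet)\to\mathbb{H}^2(X,f^*T_Y^\bullet)$ is injective. For a local Artinian $k$-algebra $A$ with residue field $k$, a flat Poisson deformation of $(Y,\Pi_0)$ over $\operatorname{Spec}A$ is a flat Poisson scheme over $\operatorname{Spec}A$ with an identification of its closed fibre with $(Y,\Pi_0)$ as Poisson schemes; a deformation of $f$ over $\operatorname{Spec}A$ consists of flat Poisson deformations of $(X,\Lambda_0)$ and $(Y,\Pi_0)$ and a Poisson morphism over $\operatorname{Spec}A$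 between them which induces $f$ on closed fibres. Let $Def_{(Y,\Pi_0)}(A)$ and $Def_f(A)$ be the sets of isomorphism classes of these objects (isomorphisms being the identity on closed fibres), and let $f_Y:Def_f\to Def_{(Y,\Pi_0)}$ be the forgetful morphism of functors. Then $f_Y$ is smooth: for every surjection $A'\to A$ of local Artinian $k$-algebras with residue field $k$, the map $$Def_f(A')\to Def_f(A)\times_{Def_{(Y,\Pi_0)}(A)}Def_{(Y,\Pi_0)}(A')$$ is surjective. In particular, for every flat Poisson deformation $(\mathcal{Y},\Pi)$ of $(Y,\Pi_0)$ over $\operatorname{Spec}A$, with $A$ a local Artinian $k$-algebra with residue field $k$, there exist a flat Poisson deformation $(\mathcal{X},\Lambda)$ of $(X,\Lambda_0)$ over $\operatorname{Spec}A$ and a Poisson morphism $\Phi:(\mathcal{X},\Lambda)\to(\mathcal{Y},\Pi)$ over $\operatorname{Spec}A$ which induces $f$. -/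

import Mathlib

open CategoryTheory AlgebraicGeometry

universe u

namespace PoissonDef

noncomputable section

/-! ### Poisson schemes and Poisson morphisms -/

/-- Restriction of sections of the structure sheaf from `U` to a smaller open set `U'`. -/
def res {X : Scheme.{u}} {U U' : X.Opens} (h : U' ≤ U) : Γ(X, U) →+* Γ(X, U') :=
  (X.presheaf.map (homOfLE h).op).hom

/-- The comorphism `Γ(Y, V) → Γ(X, U)` of a morphism of schemes, for `U ⊆ f⁻¹ V`. -/
def comorph {X Y : Scheme.{u}} (f : X ⟶ Y) (V : Y.Opens) (U : X.Opens) (h : U ≤ f ⁻¹ᵁ V) :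
    Γ(Y, V) →+* Γ(X, U) :=
  (f.appLE V U h).hom

/-- A Poisson structure on the `S`-scheme `p : X ⟶ S`: the structure sheaf is a sheaf of Poisson
algebras over `S`. Together with the Leibniz rule, `bracket_base` says that the bracket is linear
over the functions of `S`. -/
structure PoissonStructure {X S : Scheme.{u}} (p : X ⟶ S) where
  bracket : ∀ U : X.Opens, Γ(X, U) → Γ(X, U) → Γ(X, U)
  bracket_add : ∀ U a b c, bracket U (a + b) c = bracket U a c + bracket U b c
  bracket_self : ∀ U a, bracket U a a = 0
  bracket_skew : ∀ U a b, bracket U a b = -bracket U b a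
  bracket_mul : ∀ U a b c, bracket U (a * b) c = a * bracket U b c + b * bracket U a c
  bracket_base : ∀ (U : X.Opens) (W : S.Opens) (h : U ≤ p ⁻¹ᵁ W) (r : Γ(S, W)) (a : Γ(X, U)),
    bracket U (comorph p W U h r) a = 0
  jacobi : ∀ U a b c,
    bracket U a (bracket U b c) + bracket U b (bracket U c a) + bracket U c (bracket U a b) = 0
  bracket_res : ∀ (U U' : X.Opens) (h : U' ≤ U) (a b : Γ(X, U)),
    res h (bracket U a b) = bracket U' (res h a) (res h b)

/-- A morphism of Poisson schemes: the comorphism preserves the brackets. The two schemes may lie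
over different bases. -/
def IsPoisson {X Y S T : Scheme.{u}} {p : X ⟶ S} {q : Y ⟶ T}
    (P : PoissonStructure p) (Q : PoissonStructure q) (f : X ⟶ Y) : Prop :=
  ∀ (V : Y.Opens) (a b : Γ(Y, V)),
    comorph f V (f ⁻¹ᵁ V) le_rfl (Q.bracket V a b) =
      P.bracket (f ⁻¹ᵁ V) (comorph f V (f ⁻¹ᵁ V) le_rfl a) (comorph f V (f ⁻¹ᵁ V) le_rfl b)

attribute [local instance] MvPolynomial.gradedAlgebra

/-- Projective space of dimension `n` over a field, with its structure morphism. -/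
def projectiveSpaceToSpec (k : Type u) [Field k] (n : ℕ) :
    Proj (MvPolynomial.homogeneousSubmodule (Fin (n + 1)) k) ⟶ Spec (.of k) :=
  Proj.toSpecZero _ ≫ Spec.map (CommRingCat.ofHom
    (algebraMap k (MvPolynomial.homogeneousSubmodule (Fin (n + 1)) k 0)))

/-- A `k`-scheme is projective if it is a closed subscheme of some projective space over `k`. -/
def IsProjectiveOver (k : Type u) [Field k] {X : Scheme.{u}} (p : X ⟶ Spec (.of k)) : Prop :=
  ∃ (n : ℕ) (i : X ⟶ Proj (MvPolynomial.homogeneousSubmodule (Fin (n + 1)) k)),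
    IsClosedImmersion i ∧ i ≫ projectiveSpaceToSpec k n = p

/-! ### The complexes `T_X^•` and `f^* T_Y^•`

For `f : X ⟶ Y` over `S` with `Y` smooth over `S`, a section of `⋀^q f^* T_Y` over an open `U ⊆ X`
is an `O_X`-valued alternating `q`-derivation of `f⁻¹ O_Y` on `U`, equivalently (by adjunction) an
alternating `q`-derivation `O_Y → (f|_U)_* O_U`. If `U = Spec B` and `f(U) ⊆ V = Spec C`, these are
the elements of `Hom_C(⋀^q Ω_C, B)`. The complex `T_X^•` is the case `f = 𝟙 X`. -/

section Polyvectors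

variable {X Y S : Scheme.{u}} (f : X ⟶ Y)

/-- Families of functions `Γ(Y, V)^q → Γ(X, U ∩ f⁻¹ V)`, with no condition. -/
abbrev Raw (q : ℕ) (U : X.Opens) : Type u :=
  ∀ V : Y.Opens, (Fin q → Γ(Y, V)) → Γ(X, U ⊓ f ⁻¹ᵁ V)

/-- The comorphism `Γ(Y, V) → Γ(X, U ∩ f⁻¹ V)`. -/
abbrev pull (U : X.Opens) (V : Y.Opens) : Γ(Y, V) →+* Γ(X, U ⊓ f ⁻¹ᵁ V) :=
  comorph f V (U ⊓ f ⁻¹ᵁ V) inf_le_right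

/-- The family is an alternating `q`-derivation over `S`, compatible with restriction. -/
structure IsPolyvector (pY : Y ⟶ S) {q : ℕ} {U : X.Opens} (Q : Raw f q U) : Prop where
  map_add : ∀ V a i x y, Q V (Function.update a i (x + y)) =
    Q V (Function.update a i x) + Q V (Function.update a i y)
  leibniz : ∀ V a i x y, Q V (Function.update a i (x * y)) =
    pull f U V x * Q V (Function.update a i y) + pull f U V y * Q V (Function.update a i x)
  map_base : ∀ (V : Y.Opens) (W : S.Opens) (h : V ≤ pY ⁻¹ᵁ W) (r : Γ(S, W)) a i,
    Q V (Function.update a i (comorph pY W V h r)) = 0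
  alternating : ∀ V a i j, i ≠ j → a i = a j → Q V a = 0
  compat : ∀ (V V' : Y.Opens) (h : V' ≤ V) (a : Fin q → Γ(Y, V)),
    res (inf_le_inf le_rfl (f.preimage_mono h)) (Q V a) = Q V' (fun i => res h (a i))

/-- The group of sections of `⋀^q f^* T_Y` over `U`. -/
def polyvectors (pY : Y ⟶ S) (q : ℕ) (U : X.Opens) : AddSubgroup (Raw f q U) where
  carrier := {Q | IsPolyvector f pY Q}
  zero_mem' := by
    constructor <;> intros <;> simp
  add_mem' := by
    intro P Q hP hQ
    constructor
    · intro V a i x y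
      simp only [Pi.add_apply, hP.map_add, hQ.map_add]; abel
    · intro V a i x y
      simp only [Pi.add_apply, hP.leibniz, hQ.leibniz]; ring
    · intro V W h r a i
      simp only [Pi.add_apply, hP.map_base, hQ.map_base, add_zero]
    · intro V a i j hij h
      simp only [Pi.add_apply, hP.alternating V a i j hij h, hQ.alternating V a i j hij h, add_zero]
    · intro V V' h a
      have h1 := hP.compat V V' h a
      have h2 := hQ.compat V V' h a
      exact (_root_.map_add _ _ _).trans (congrArg₂ (· + ·) h1 h2)
  neg_mem' := by
    intro P hP
    constructor
    · intro V a i x y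
      simp only [Pi.neg_apply, hP.map_add]; abel
    · intro V a i x y
      simp only [Pi.neg_apply, hP.leibniz]; ring
    · intro V W h r a i
      simp only [Pi.neg_apply, hP.map_base, neg_zero]
    · intro V a i j hij h
      simp only [Pi.neg_apply, hP.alternating V a i j hij h, neg_zero]
    · intro V V' h a
      exact (_root_.map_neg _ _).trans (congrArg (- ·) (hP.compat V V' h a))

/-- Restriction of sections of `⋀^q f^* T_Y` from `U` to `U'`. -/
def Raw.restrict {q : ℕ} {U U' : X.Opens} (h : U' ≤ U) (Q : Raw f q U) : Raw f q U' :=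
  fun V a => res (inf_le_inf h le_rfl) (Q V a)

/-- The differential `π` of `f^* T_Y^•`, with `m = q + 1`:
`π(Q)(a_0, …, a_m) = ∑_i (-1)^(m+i) {Q(…, â_i, …), f a_i}
  - (-1)^(m-1) ∑_{i<j} (-1)^(i+j-1) Q({a_i, a_j}, …, â_i, …, â_j, …)`.
For `f = 𝟙 X` this is `[Λ₀, -]`. -/
def Raw.diff {pX : X ⟶ S} {pY : Y ⟶ S} (P : PoissonStructure pX) (R : PoissonStructure pY)
    {q : ℕ} {U : X.Opens} (Q : Raw f (q + 1) U) : Raw f (q + 2) U :=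
  fun V a =>
    (∑ i : Fin (q + 2), (-1) ^ (q + 1 + (i : ℕ)) *
      P.bracket (U ⊓ f ⁻¹ᵁ V) (Q V (fun l => a (i.succAbove l))) (pull f U V (a i))) +
    ∑ j : Fin (q + 2), ∑ i : Fin (q + 1),
      if i.castSucc < j then (-1) ^ (q + (i : ℕ) + (j : ℕ)) *
        Q V (Fin.cons (R.bracket V (a i.castSucc) (a j))
          (fun l => a (j.succAbove (i.succAbove l))))
      else 0

end Polyvectors

/-! ### Čech hypercohomology of `f^* T_Y^•` with respect to an open cover -/

section Cech

variable {X Y S : Scheme.{u}} (f : X ⟶ Y) {ι : Type*} (𝒰 : ι → X.Opens)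

/-- The intersection `U_{s 0} ∩ … ∩ U_{s p}`. -/
def inter {p : ℕ} (s : Fin (p + 1) → ι) : X.Opens := ⨅ j, 𝒰 (s j)

lemma inter_le {p : ℕ} (s : Fin (p + 2) → ι) (j : Fin (p + 2)) :
    inter 𝒰 s ≤ inter 𝒰 (fun l => s (j.succAbove l)) :=
  le_iInf fun l => iInf_le (fun l => 𝒰 (s l)) (j.succAbove l)

/-- The ambient group of the double complex: in position `(p, q)` the families indexed by
`ι^(p+1)` of elements of `Raw f (q + 1)` of the `(p+1)`-fold intersections. -/
abbrev Bicochain : Type _ :=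
  ∀ (p q : ℕ) (s : Fin (p + 1) → ι), Raw f (q + 1) (inter 𝒰 s)

/-- The Čech differential. -/
def cechDiff {p q : ℕ} (c : ∀ s : Fin (p + 1) → ι, Raw f (q + 1) (inter 𝒰 s))
    (s : Fin (p + 2) → ι) : Raw f (q + 1) (inter 𝒰 s) :=
  ∑ j : Fin (p + 2),
    (-1 : ℤ) ^ (j : ℕ) • Raw.restrict f (inter_le 𝒰 s j) (c (fun l => s (j.succAbove l)))

/-- The component of bidegree `(p, q)` of the Čech part of the total differential. -/
def cechPart (c : Bicochain f 𝒰) : Bicochain f 𝒰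
  | 0, _, _ => 0
  | p + 1, q, s => cechDiff f 𝒰 (c p q) s

/-- The component of bidegree `(p, q)` of the `π`-part of the total differential. -/
def piPart {pX : X ⟶ S} {pY : Y ⟶ S} (P : PoissonStructure pX) (R : PoissonStructure pY)
    (c : Bicochain f 𝒰) : Bicochain f 𝒰
  | _, 0, _ => 0
  | p, q + 1, s => (-1 : ℤ) ^ p • Raw.diff f P R (c p q s)

lemma bracket_zero_left {X S : Scheme.{u}} {p : X ⟶ S} (P : PoissonStructure p) (U : X.Opens)
    (a : Γ(X, U)) : P.bracket U 0 a = 0 := by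
  have h := P.bracket_add U 0 0 a
  rw [add_zero] at h
  exact left_eq_add.mp h

/-- The differential `δ + (-1)^p π` of the total complex. -/
def totalDiff {pX : X ⟶ S} {pY : Y ⟶ S} (P : PoissonStructure pX) (R : PoissonStructure pY) :
    Bicochain f 𝒰 →+ Bicochain f 𝒰 where
  toFun c := cechPart f 𝒰 c + piPart f 𝒰 P R c
  map_zero' := by
    funext p q s V a
    rcases p with _ | p <;> rcases q with _ | q <;>
      simp [cechPart, piPart, cechDiff, Raw.restrict, Raw.diff, bracket_zero_left]
  map_add' := by
    intro c d
    have h1 : cechPart f 𝒰 (c + d) = cechPart f 𝒰 c + cechPart f 𝒰 d := by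
      funext p q s V a
      rcases p with _ | p
      · simp [cechPart]
      · simp [cechPart, cechDiff, Raw.restrict, mul_add, Finset.sum_add_distrib]
    have h2 : piPart f 𝒰 P R (c + d) = piPart f 𝒰 P R c + piPart f 𝒰 P R d := by
      funext p q s V a
      rcases q with _ | q
      · simp [piPart]
      · simp only [piPart, Raw.diff, Pi.add_apply, Pi.smul_apply, P.bracket_add, mul_add,
          Finset.sum_add_distrib, ← smul_add, ite_add_zero]
        congr 1
        exact add_add_add_comm _ _ _ _
    rw [h1, h2]; abel

/-- The degree `n` cochains `⨁_{p+q=n} C^p(𝒰, ⋀^{q+1} f^* T_Y)` of the total complex. -/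
def totalCochains (pY : Y ⟶ S) (n : ℕ) : AddSubgroup (Bicochain f 𝒰) where
  carrier := {c | (∀ p q s, c p q s ∈ polyvectors f pY (q + 1) (inter 𝒰 s)) ∧
    ∀ p q, p + q ≠ n → c p q = 0}
  zero_mem' := ⟨fun _ _ _ => zero_mem _, fun _ _ _ => rfl⟩
  add_mem' := fun hc hd => ⟨fun p q s => add_mem (hc.1 p q s) (hd.1 p q s), fun p q h => by
    rw [Pi.add_apply, Pi.add_apply, hc.2 p q h, hd.2 p q h, add_zero]⟩
  neg_mem' := fun hc => ⟨fun p q s => neg_mem (hc.1 p q s), fun p q h => by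
    rw [Pi.neg_apply, Pi.neg_apply, hc.2 p q h, neg_zero]⟩

/-- Cocycles of degree `n`. -/
def cocycles {pX : X ⟶ S} {pY : Y ⟶ S} (P : PoissonStructure pX) (R : PoissonStructure pY)
    (n : ℕ) : AddSubgroup (Bicochain f 𝒰) :=
  totalCochains f 𝒰 pY n ⊓ (totalDiff f 𝒰 P R).ker

/-- Coboundaries of degree `n`. -/
def coboundaries {pX : X ⟶ S} {pY : Y ⟶ S} (P : PoissonStructure pX) (R : PoissonStructure pY) :
    ℕ → AddSubgroup (Bicochain f 𝒰)
  | 0 => ⊥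
  | n + 1 => (totalCochains f 𝒰 pY n).map (totalDiff f 𝒰 P R)

/-- The hypercohomology group `ℍ^n(X, f^* T_Y^•)`, with `f^* T_Y` in degree `0`, computed by the
Čech double complex of the cover `𝒰`. When `X` is separated and the members of `𝒰` are affine, it
does not depend on `𝒰`, all the terms of the complex being quasi-coherent. -/
abbrev Hypercohomology {pX : X ⟶ S} {pY : Y ⟶ S} (P : PoissonStructure pX)
    (R : PoissonStructure pY) (n : ℕ) : Type _ :=
  cocycles f 𝒰 P R n ⧸ (coboundaries f 𝒰 P R n).addSubgroupOf (cocycles f 𝒰 P R n)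

/-! ### The map `F : ℍ^n(X, T_X^•) → ℍ^n(X, f^* T_Y^•)` -/

/-- `F(Q)(a_1, …, a_q) = Q(f a_1, …, f a_q)`. -/
def Raw.push {q : ℕ} {U : X.Opens} (Q : Raw (𝟙 X) q U) : Raw f q U :=
  fun V a => Q (f ⁻¹ᵁ V) (fun i => comorph f V (f ⁻¹ᵁ V) le_rfl (a i))

/-- `F` on the double complex. -/
def pushHom : Bicochain (𝟙 X) 𝒰 →+ Bicochain f 𝒰 where
  toFun c p q s := Raw.push f (c p q s)
  map_zero' := rfl
  map_add' _ _ := rfl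

lemma pushHom_apply (c : Bicochain (𝟙 X) 𝒰) (p q : ℕ) (s : Fin (p + 1) → ι) :
    pushHom f 𝒰 c p q s = Raw.push f (c p q s) := rfl

lemma pull_comorph (U : X.Opens) (V : Y.Opens) (a : Γ(Y, V)) :
    pull (𝟙 X) U (f ⁻¹ᵁ V) (comorph f V (f ⁻¹ᵁ V) le_rfl a) = pull f U V a := by
  have h := Scheme.Hom.appLE_comp_appLE (𝟙 X) f V (f ⁻¹ᵁ V) (U ⊓ f ⁻¹ᵁ V) le_rfl inf_le_right
  have h' := congrArg (fun g => g.hom a) h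
  have h2 : (𝟙 X ≫ f).appLE V (U ⊓ f ⁻¹ᵁ V) inf_le_right = f.appLE V (U ⊓ f ⁻¹ᵁ V) inf_le_right := by
    simp
  exact h'.trans (congrArg (fun g => g.hom a) h2)

lemma comorph_base {pX : X ⟶ S} {pY : Y ⟶ S} (hf : f ≫ pY = pX) (V : Y.Opens) (W : S.Opens)
    (h : V ≤ pY ⁻¹ᵁ W) (h' : f ⁻¹ᵁ V ≤ pX ⁻¹ᵁ W) (r : Γ(S, W)) :
    comorph f V (f ⁻¹ᵁ V) le_rfl (comorph pY W V h r) = comorph pX W (f ⁻¹ᵁ V) h' r := by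
  subst hf
  have h1 := Scheme.Hom.appLE_comp_appLE f pY W V (f ⁻¹ᵁ V) h le_rfl
  exact congrArg (fun g => g.hom r) h1

lemma comorph_res {V V' : Y.Opens} (h : V' ≤ V) (a : Γ(Y, V)) :
    res (f.preimage_mono h) (comorph f V (f ⁻¹ᵁ V) le_rfl a) =
      comorph f V' (f ⁻¹ᵁ V') le_rfl (res h a) := by
  have h1 := f.appLE_map (U := V) (V := f ⁻¹ᵁ V) le_rfl (homOfLE (f.preimage_mono h)).op
  have h2 := f.map_appLE (U := V') (V := f ⁻¹ᵁ V') le_rfl (homOfLE h).op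
  have h3 := congrArg (fun g => g.hom a) (h1.trans h2.symm)
  exact h3

lemma push_update {q : ℕ} (V : Y.Opens) (a : Fin q → Γ(Y, V)) (i : Fin q) (x : Γ(Y, V)) :
    (fun l => comorph f V (f ⁻¹ᵁ V) le_rfl (Function.update a i x l)) =
      Function.update (fun l => comorph f V (f ⁻¹ᵁ V) le_rfl (a l)) i
        (comorph f V (f ⁻¹ᵁ V) le_rfl x) := by
  funext l
  by_cases hl : l = i
  · subst hl; simp
  · simp [Function.update_of_ne hl]

lemma push_mem {pX : X ⟶ S} {pY : Y ⟶ S} (hf : f ≫ pY = pX) {q : ℕ} {U : X.Opens}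
    {Q : Raw (𝟙 X) q U} (hQ : Q ∈ polyvectors (𝟙 X) pX q U) :
    Raw.push f Q ∈ polyvectors f pY q U := by
  have hQ' : IsPolyvector (𝟙 X) pX Q := hQ
  refine (show IsPolyvector f pY (Raw.push f Q) from ⟨?_, ?_, ?_, ?_, ?_⟩)
  · intro V a i x y
    simp only [Raw.push, push_update, map_add]
    exact hQ'.map_add _ _ _ _ _
  · intro V a i x y
    have h := hQ'.leibniz (f ⁻¹ᵁ V) (fun l => comorph f V (f ⁻¹ᵁ V) le_rfl (a l)) i
      (comorph f V (f ⁻¹ᵁ V) le_rfl x) (comorph f V (f ⁻¹ᵁ V) le_rfl y)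
    rw [pull_comorph, pull_comorph] at h
    simp only [Raw.push, push_update, map_mul]
    exact h
  · intro V W h r a i
    have h' : f ⁻¹ᵁ V ≤ pX ⁻¹ᵁ W := by
      subst hf
      exact f.preimage_mono h
    simp only [Raw.push, push_update, comorph_base f hf V W h h']
    exact hQ'.map_base _ _ _ _ _ _
  · intro V a i j hij h
    exact hQ'.alternating _ _ i j hij (by simp only [h])
  · intro V V' h a
    have e : (fun i => res (f.preimage_mono h) (comorph f V (f ⁻¹ᵁ V) le_rfl (a i))) =
        fun i => comorph f V' (f ⁻¹ᵁ V') le_rfl (res h (a i)) :=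
      funext fun i => comorph_res f h (a i)
    exact (hQ'.compat (f ⁻¹ᵁ V) (f ⁻¹ᵁ V') (f.preimage_mono h)
      (fun i => comorph f V (f ⁻¹ᵁ V) le_rfl (a i))).trans (congrArg _ e)

lemma push_diff {pX : X ⟶ S} {pY : Y ⟶ S} (P : PoissonStructure pX) (R : PoissonStructure pY)
    (hP : IsPoisson P R f) {q : ℕ} {U : X.Opens} (Q : Raw (𝟙 X) (q + 1) U) :
    Raw.push f (Raw.diff (𝟙 X) P P Q) = Raw.diff f P R (Raw.push f Q) := by
  funext V a
  simp only [Raw.push, Raw.diff, pull_comorph]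
  congr 1
  refine Finset.sum_congr rfl fun j _ => Finset.sum_congr rfl fun i _ => ?_
  split_ifs
  · congr 2
    funext l
    refine Fin.cases ?_ (fun l => ?_) l
    · exact (hP V _ _).symm
    · rfl
  · rfl

lemma push_totalDiff {pX : X ⟶ S} {pY : Y ⟶ S} (P : PoissonStructure pX)
    (R : PoissonStructure pY) (hP : IsPoisson P R f) (c : Bicochain (𝟙 X) 𝒰) :
    pushHom f 𝒰 (totalDiff (𝟙 X) 𝒰 P P c) = totalDiff f 𝒰 P R (pushHom f 𝒰 c) := by
  have h1 : pushHom f 𝒰 (cechPart (𝟙 X) 𝒰 c) = cechPart f 𝒰 (pushHom f 𝒰 c) := by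
    funext p q s V a
    rcases p with _ | p
    · rfl
    · rw [pushHom_apply]
      simp only [cechPart, cechDiff, Raw.push, Finset.sum_apply, Pi.smul_apply]
      rfl
  have h2 : pushHom f 𝒰 (piPart (𝟙 X) 𝒰 P P c) = piPart f 𝒰 P R (pushHom f 𝒰 c) := by
    funext p q s
    rcases q with _ | q
    · rfl
    · have := push_diff f P R hP (c p q s)
      rw [pushHom_apply]
      simp only [piPart]
      rw [pushHom_apply, ← this]
      rfl
  calc pushHom f 𝒰 (cechPart (𝟙 X) 𝒰 c + piPart (𝟙 X) 𝒰 P P c)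
      = pushHom f 𝒰 (cechPart (𝟙 X) 𝒰 c) + pushHom f 𝒰 (piPart (𝟙 X) 𝒰 P P c) := map_add _ _ _
    _ = _ := by rw [h1, h2]; rfl

lemma push_totalCochains {pX : X ⟶ S} {pY : Y ⟶ S} (hf : f ≫ pY = pX) {n : ℕ}
    {c : Bicochain (𝟙 X) 𝒰} (hc : c ∈ totalCochains (𝟙 X) 𝒰 pX n) :
    pushHom f 𝒰 c ∈ totalCochains f 𝒰 pY n := by
  refine ⟨fun p q s => push_mem f hf (hc.1 p q s), fun p q h => ?_⟩
  funext s V a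
  rw [pushHom_apply, hc.2 p q h]
  rfl

/-- `F` on cocycles. -/
def pushCocycles {pX : X ⟶ S} {pY : Y ⟶ S} (P : PoissonStructure pX) (R : PoissonStructure pY)
    (hf : f ≫ pY = pX) (hP : IsPoisson P R f) (n : ℕ) :
    cocycles (𝟙 X) 𝒰 P P n →+ cocycles f 𝒰 P R n :=
  ((pushHom f 𝒰).comp (cocycles (𝟙 X) 𝒰 P P n).subtype).codRestrict (cocycles f 𝒰 P R n)
    fun c => ⟨push_totalCochains f 𝒰 hf c.2.1, by
      have h : totalDiff (𝟙 X) 𝒰 P P c = 0 := c.2.2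
      change totalDiff f 𝒰 P R (pushHom f 𝒰 c) = 0
      rw [← push_totalDiff f 𝒰 P R hP, h, map_zero]⟩

/-- The map `F : ℍ^n(X, T_X^•) → ℍ^n(X, f^* T_Y^•)` induced by a Poisson morphism `f`. -/
def hyperMap {pX : X ⟶ S} {pY : Y ⟶ S} (P : PoissonStructure pX) (R : PoissonStructure pY)
    (hf : f ≫ pY = pX) (hP : IsPoisson P R f) (n : ℕ) :
    Hypercohomology (𝟙 X) 𝒰 P P n →+ Hypercohomology f 𝒰 P R n :=
  QuotientAddGroup.map _ _ (pushCocycles f 𝒰 P R hf hP n) (by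
    rintro ⟨c, hc⟩ hb
    rw [AddSubgroup.mem_addSubgroupOf] at hb
    rw [AddSubgroup.mem_comap, AddSubgroup.mem_addSubgroupOf]
    change pushHom f 𝒰 c ∈ coboundaries f 𝒰 P R n
    rcases n with _ | n
    · have h0 : c = 0 := hb
      rw [h0, map_zero]
      exact zero_mem _
    · obtain ⟨b, hb, rfl⟩ := hb
      exact ⟨pushHom f 𝒰 b, push_totalCochains f 𝒰 hf hb, (push_totalDiff f 𝒰 P R hP b).symm⟩)

end Cech

/-- An affine open cover `𝒰` of `X` such that `f` maps each member into an affine open of `Y`. -/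
structure IsAdaptedAffineCover {X Y : Scheme.{u}} (f : X ⟶ Y) {ι : Type*} (𝒰 : ι → X.Opens) :
    Prop where
  isAffineOpen : ∀ i, IsAffineOpen (𝒰 i)
  iSup_eq_top : ⨆ i, 𝒰 i = ⊤
  le_preimage : ∀ i, ∃ V : Y.Opens, IsAffineOpen V ∧ 𝒰 i ≤ f ⁻¹ᵁ V

/-! ### Deformations over local Artinian algebras -/

/-- A local Artinian `k`-algebra with residue field `k`. -/
structure ArtAlg (k : Type u) [Field k] where
  carrier : Type u
  [commRing : CommRing carrier]
  [algebra : Algebra k carrier]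
  [isLocalRing : IsLocalRing carrier]
  [isArtinianRing : IsArtinianRing carrier]
  residue_bijective : Function.Bijective (algebraMap k (IsLocalRing.ResidueField carrier))

attribute [instance] ArtAlg.commRing ArtAlg.algebra ArtAlg.isLocalRing ArtAlg.isArtinianRing

section Deformations

variable {k : Type u} [Field k]

/-- `Spec A`. -/
abbrev ArtAlg.spec (A : ArtAlg k) : Scheme.{u} := Spec (.of A.carrier)

/-- The closed point `Spec k ⟶ Spec A`, given by `A → A/𝔪 ≅ k`. -/
def ArtAlg.closedPoint (A : ArtAlg k) : Spec (.of k) ⟶ A.spec :=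
  Spec.map (CommRingCat.ofHom
    (((RingEquiv.ofBijective _ A.residue_bijective).symm : _ →+* k).comp
      (IsLocalRing.residue A.carrier)))

/-- The morphism `Spec A ⟶ Spec A'` given by a homomorphism `A' → A`. -/
def ArtAlg.specMap {A' A : ArtAlg k} (φ : A'.carrier →ₐ[k] A.carrier) : A.spec ⟶ A'.spec :=
  Spec.map (CommRingCat.ofHom (φ : A'.carrier →+* A.carrier))

variable {X Y : Scheme.{u}} {pX : X ⟶ Spec (.of k)} {pY : Y ⟶ Spec (.of k)}

/-- A flat Poisson deformation of `(Y, R)` over `Spec A`: a flat Poisson scheme over `Spec A`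
together with an identification of its closed fibre with `(Y, R)` as Poisson schemes. -/
structure Deformation (R : PoissonStructure pY) (A : ArtAlg k) where
  total : Scheme.{u}
  toBase : total ⟶ A.spec
  flat : Flat toBase
  poisson : PoissonStructure toBase
  incl : Y ⟶ total
  isPullback : IsPullback incl pY toBase A.closedPoint
  incl_isPoisson : IsPoisson R poisson incl

/-- An isomorphism of Poisson deformations of `(Y, R)`: a Poisson isomorphism over `Spec A` which
is the identity on the closed fibre. -/
structure Deformation.Iso {R : PoissonStructure pY} {A : ArtAlg k} (η η' : Deformation R A) where
  iso : η.total ≅ η'.total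
  hom_toBase : iso.hom ≫ η'.toBase = η.toBase
  isPoisson : IsPoisson η.poisson η'.poisson iso.hom
  incl : η.incl ≫ iso.hom = η'.incl

/-- An identification of the deformation `η` over `A` with the base change along `φ : A' → A` of
the deformation `η'` over `A'`. -/
structure Deformation.BaseChange {R : PoissonStructure pY} {A' A : ArtAlg k}
    (φ : A'.carrier →ₐ[k] A.carrier) (η' : Deformation R A') (η : Deformation R A) where
  hom : η.total ⟶ η'.total
  isPullback : IsPullback hom η.toBase η'.toBase (ArtAlg.specMap φ)
  isPoisson : IsPoisson η.poisson η'.poisson hom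
  incl : η.incl ≫ hom = η'.incl

/-- A deformation of the Poisson morphism `f : (X, P) ⟶ (Y, R)` over `Spec A`: Poisson deformations
of source and target, and a Poisson morphism over `Spec A` between them which induces `f`. -/
structure MorphismDeformation (P : PoissonStructure pX) (R : PoissonStructure pY) (f : X ⟶ Y)
    (A : ArtAlg k) where
  source : Deformation P A
  target : Deformation R A
  map : source.total ⟶ target.total
  map_over : map ≫ target.toBase = source.toBase
  map_isPoisson : IsPoisson source.poisson target.poisson map
  map_incl : source.incl ≫ map = f ≫ target.incl

/-- The deformation `ξ` of `f` over `A` is isomorphic to the base change along `φ : A' → A` of the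
deformation `ξ'` of `f` over `A'`. -/
def MorphismDeformation.RestrictsTo {P : PoissonStructure pX} {R : PoissonStructure pY} {f : X ⟶ Y}
    {A' A : ArtAlg k} (φ : A'.carrier →ₐ[k] A.carrier)
    (ξ' : MorphismDeformation P R f A') (ξ : MorphismDeformation P R f A) : Prop :=
  ∃ (r : Deformation.BaseChange φ ξ'.source ξ.source)
    (s : Deformation.BaseChange φ ξ'.target ξ.target), r.hom ≫ ξ'.map = ξ.map ≫ s.hom

/-- Smoothness of the forgetful morphism of functors of Artin rings `f_Y : Def_f → Def_{(Y, R)}`,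
where both functors consist of isomorphism classes: for every surjection `A' → A`, the map
`Def_f(A') → Def_f(A) ×_{Def_Y(A)} Def_Y(A')` is surjective. -/
def ForgetTargetSmooth (P : PoissonStructure pX) (R : PoissonStructure pY) (f : X ⟶ Y) : Prop :=
  ∀ (A' A : ArtAlg k) (φ : A'.carrier →ₐ[k] A.carrier), Function.Surjective φ →
    ∀ (ξ : MorphismDeformation P R f A) (η' : Deformation R A'),
      Nonempty (Deformation.BaseChange φ η' ξ.target) →
      ∃ ξ' : MorphismDeformation P R f A',
        ξ'.RestrictsTo φ ξ ∧ Nonempty (Deformation.Iso ξ'.target η')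

end Deformations

end

end PoissonDef

/-! The two hypotheses on `F` say together that the first hypercohomology of the mapping cone of `F`
vanishes; that group contains the obstruction to deforming the source along with a prescribed
deformation of the target.

By induction on the length of a surjection it is enough to treat a small extension `A' → A`, with
kernel spanned by an element `t` killed by the maximal ideal. The target is a fixed deformation `η`
over some `B` with a map `β : B → A'`. Given are a deformation `σ` of `X` over `A` and a Poisson
morphism `ψ : σ → η`; both have to be lifted to `A'`.

Locally nothing is in the way. Since `X` is smooth, `σ` is trivial over every affine open subset `V`
contained in a member of the cover, so its functions are `A ⊗ Γ(X, V)`, and the functions of the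
lift should be `A' ⊗ Γ(X, V)`. The gluing isomorphisms lift to `θ_ij` by smoothness of `X`, the
brackets lift to skew biderivations `λ_i` by means of a linear section of `A' → A`, and the
comorphism of `ψ` lifts to `p_i` by smoothness of `η` over `B`. The lifts need not be compatible,
but all failures lie in `t ⊗ Γ(X, V) ≅ Γ(X, V)`, so they are tensors on the closed fibres: `θ_ij
θ_jk - θ_ik = t c_ijk`, `θ_ij λ_j - λ_i(θ_ij, θ_ij) = t L_ij`, `Jac(λ_i) = t J_i`, `θ_ij p_j - p_i =
t M_ij`, and `λ_i(p_i, p_i) - p_i{ , } = t N_i`.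

Here `(c, L, J)` is a Čech cochain of degree two of `T_X^•` and `(M, N)` one of degree one of `f^*
T_Y^•`. Associativity of composition, the identity `[λ, [λ, λ]] = 0` and the Jacobi identity on `η`
give `D(c, L, J) = 0` and `F(c, L, J) = D(M, N)`. Injectivity on `ℍ²` yields `y₀` with `(c, L, J) =
D y₀`. Then `(M, N) - F y₀` is a cocycle, and surjectivity on `ℍ¹` allows `y₀` to be changed by a
cocycle into `y = (u, v)` with `(M, N) = F y + D w`; this is `exists_primitive`. Subtracting `t u`,
`t v`, `t w` from the local lifts removes all errors at once (`LiftData.correct_isCompatible`), and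
the corrected charts glue to a flat Poisson deformation with a Poisson morphism to `η`
(`LiftData.IsCompatible.nonempty_lift`).

The passage from small extensions to all surjections is `nonempty_lift_of_surjective`. The last
assertion of the theorem is the case of the surjection `A → k`, starting from the trivial
deformation of `X`.

Local data are recorded on all affine open subsets of the members of the cover, compatibly with
restriction, because they have to define sections of sheaves. Compatibility costs nothing:
restriction between affine open subsets is étale, so a lift on the largest one extends uniquely to
the smaller ones (`exists_compatible_lift`). -/

namespace PoissonDef
open TensorProduct

/-! ### Infinitesimal lifting for ring homomorphisms -/

section Lifting

variable {R C C₁ E' E : Type u} [CommRing R] [CommRing C] [CommRing C₁] [CommRing E'] [CommRing E]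

/-- Phrased for bare ring homomorphisms, since rings of sections are algebras over many rings at
once; the algebra structures are installed only inside the proof. -/
lemma exists_lift_of_formallySmooth {b : R →+* C} (hb : b.FormallySmooth) {q : E' →+* E}
    (hq : Function.Surjective q) (hn : IsNilpotent (RingHom.ker q)) {b' : R →+* E'} {h : C →+* E}
    (comm : ∀ x, q (b' x) = h (b x)) : ∃ h' : C →+* E', (∀ x, q (h' x) = h x) ∧ ∀ x, h' (b x) = b' x := by
  let := b.toAlgebra
  let := b'.toAlgebra
  let := (h.comp b).toAlgebra
  have : Algebra.FormallySmooth R C := hb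
  let f : C →ₐ[R] E := ⟨h, fun _ => rfl⟩
  let g : E' →ₐ[R] E := ⟨q, fun x => comm x⟩
  refine ⟨(Algebra.FormallySmooth.liftOfSurjective f g hq hn : C →ₐ[R] E'), fun x => ?_, fun x => ?_⟩
  · exact Algebra.FormallySmooth.liftOfSurjective_apply f g hq hn x
  · exact (Algebra.FormallySmooth.liftOfSurjective f g hq hn).commutes x

lemma eq_of_formallyUnramified {b : R →+* C} (hb : b.FormallyUnramified) {q : E' →+* E}
    (hn : IsNilpotent (RingHom.ker q)) {g₁ g₂ : C →+* E'}
    (h₁ : ∀ x, g₁ (b x) = g₂ (b x)) (h₂ : ∀ x, q (g₁ x) = q (g₂ x)) : g₁ = g₂ := by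
  let := b.toAlgebra
  let := (g₁.comp b).toAlgebra
  have : Algebra.FormallyUnramified R C := hb
  let f₁ : C →ₐ[R] E' := ⟨g₁, fun _ => rfl⟩
  let f₂ : C →ₐ[R] E' := ⟨g₂, fun x => (h₁ x).symm⟩
  have := Algebra.FormallyUnramified.ext' q hn f₁ f₂ h₂
  exact congrArg (fun f : C →ₐ[R] E' => (f : C →+* E')) this

end Lifting

/-- Compatible lifting along a family of surjections with nilpotent kernel, for a presheaf of
algebras whose value at the largest index is formally smooth and whose restriction maps from it are
formally étale. -/
lemma exists_compatible_lift {P : Type*} [Preorder P] (top : P) (htop : ∀ v, v ≤ top)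
    {R : Type u} [CommRing R] {C E' E : P → Type u} [∀ v, CommRing (C v)] [∀ v, CommRing (E' v)]
    [∀ v, CommRing (E v)]
    (rC : ∀ {v w : P}, v ≤ w → C w →+* C v) (rE' : ∀ {v w : P}, v ≤ w → E' w →+* E' v)
    (rE : ∀ {v w : P}, v ≤ w → E w →+* E v)
    (rC_comp : ∀ {v w x : P} (h : v ≤ w) (h' : w ≤ x) a, rC h (rC h' a) = rC (h.trans h') a)
    (rE'_comp : ∀ {v w x : P} (h : v ≤ w) (h' : w ≤ x) a, rE' h (rE' h' a) = rE' (h.trans h') a)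
    (b : ∀ v, R →+* C v) (b' : ∀ v, R →+* E' v)
    (hb : ∀ {v w : P} (h : v ≤ w) x, rC h (b w x) = b v x)
    (hb' : ∀ {v w : P} (h : v ≤ w) x, rE' h (b' w x) = b' v x)
    (q : ∀ v, E' v →+* E v) (hq : ∀ v, Function.Surjective (q v))
    (hn : ∀ v, IsNilpotent (RingHom.ker (q v)))
    (q_nat : ∀ {v w : P} (h : v ≤ w) x, rE h (q w x) = q v (rE' h x))
    (g : ∀ v, C v →+* E v) (g_nat : ∀ {v w : P} (h : v ≤ w) x, rE h (g w x) = g v (rC h x))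
    (comm : ∀ v x, q v (b' v x) = g v (b v x))
    (smooth : (b top).FormallySmooth)
    (etale : ∀ v, (rC (htop v)).FormallyEtale) :
    ∃ g' : ∀ v, C v →+* E' v, (∀ v x, q v (g' v x) = g v x) ∧ (∀ v x, g' v (b v x) = b' v x) ∧
      ∀ {v w : P} (h : v ≤ w) x, rE' h (g' w x) = g' v (rC h x) := by
  -- Smoothness is used once, at `top`. Every other value is then forced by étaleness of the
  -- restriction from `top`.
  obtain ⟨g₀, hg₀, hg₀'⟩ := exists_lift_of_formallySmooth smooth (hq top) (hn top) (comm top)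
  have hs : ∀ v, (rC (htop v)).FormallySmooth := fun v =>
    letI := (rC (htop v)).toAlgebra
    haveI : Algebra.FormallyEtale (C top) (C v) := etale v
    (inferInstance : Algebra.FormallySmooth (C top) (C v))
  have hu : ∀ v, (rC (htop v)).FormallyUnramified := fun v =>
    letI := (rC (htop v)).toAlgebra
    haveI : Algebra.FormallyEtale (C top) (C v) := etale v
    (inferInstance : Algebra.FormallyUnramified (C top) (C v))
  have key : ∀ v, ∃ h' : C v →+* E' v, (∀ x, q v (h' x) = g v x) ∧
      ∀ x, h' (rC (htop v) x) = rE' (htop v) (g₀ x) := fun v =>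
    exists_lift_of_formallySmooth (hs v) (hq v) (hn v)
      (b' := (rE' (htop v)).comp g₀) (h := g v) (fun x => by
        rw [RingHom.comp_apply, ← q_nat, hg₀, g_nat])
  choose g' hg' hg'' using key
  refine ⟨g', hg', fun v x => ?_, fun {v w} h x => ?_⟩
  · rw [← hb (htop v), hg'', hg₀', hb']
  -- Both sides lift the same map along `q v` and agree on the image of `C top`, over which `C w` is
  -- unramified.
  · have := eq_of_formallyUnramified (hu w) (q := q v) (hn v) (g₁ := (rE' h).comp (g' w))
      (g₂ := (g' v).comp (rC h)) (fun x => by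
        simp only [RingHom.comp_apply, hg'', rE'_comp, rC_comp]) (fun x => by
        simp only [RingHom.comp_apply]
        rw [← q_nat, hg', hg', g_nat])
    exact congrArg (fun f : C w →+* E' v => f x) this

/-! ### Nakayama's lemma for nilpotent ideals -/

section Nakayama

variable {R M : Type*} [CommRing R] [AddCommGroup M] [Module R M] {I : Ideal R}

/-- Iterating the hypothesis gives `N ≤ I ^ m • N` for all `m`; nilpotency replaces the usual
finiteness of `N`. -/
lemma eq_bot_of_le_smul_of_isNilpotent (hI : IsNilpotent I) {N : Submodule R M} (h : N ≤ I • N) :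
    N = ⊥ := by
  obtain ⟨n, hn⟩ := hI
  have : ∀ m : ℕ, N ≤ I ^ m • N := by
    intro m
    induction m with
    | zero => simp
    | succ m ih =>
      calc N ≤ I ^ m • N := ih
        _ ≤ I ^ m • (I • N) := smul_mono_right _ h
        _ = I ^ (m + 1) • N := by rw [pow_succ, Submodule.mul_smul]
  have := this n
  rw [hn] at this
  simpa using this

lemma eq_top_of_sup_smul_eq_top_of_isNilpotent (hI : IsNilpotent I) {N : Submodule R M}
    (h : N ⊔ I • ⊤ = ⊤) : N = ⊤ := by
  have key : (⊤ : Submodule R (M ⧸ N)) = ⊥ := by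
    refine eq_bot_of_le_smul_of_isNilpotent hI ?_
    have h' := congrArg (Submodule.map N.mkQ) h
    rw [Submodule.map_sup, Submodule.map_smul'', Submodule.map_top, Submodule.range_mkQ] at h'
    simp only [Submodule.mkQ_map_self, bot_sup_eq] at h'
    exact h'.ge
  have : Subsingleton (M ⧸ N) := by
    rw [← Submodule.subsingleton_iff R]
    exact subsingleton_of_bot_eq_top key.symm
  exact Submodule.Quotient.subsingleton_iff.mp this

/-- A linear map to a flat module which is bijective modulo a nilpotent ideal is bijective. -/
lemma bijective_of_isNilpotent_of_flat {G : Type*} [AddCommGroup G] [Module R G] [Module.Flat R G]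
    (hI : IsNilpotent I) (f : M →ₗ[R] G)
    (hs : LinearMap.range f ⊔ I • ⊤ = ⊤) (hi : ∀ x, f x ∈ I • (⊤ : Submodule R G) → x ∈ I • (⊤ : Submodule R M)) :
    Function.Bijective f := by
  have hsurj : Function.Surjective f :=
    LinearMap.range_eq_top.mp (eq_top_of_sup_smul_eq_top_of_isNilpotent hI hs)
  refine ⟨?_, hsurj⟩
  rw [← LinearMap.ker_eq_bot]
  refine eq_bot_of_le_smul_of_isNilpotent hI fun x hx => ?_
  have hx' : x ∈ I • (⊤ : Submodule R M) := hi x (by rw [LinearMap.mem_ker.mp hx]; exact zero_mem _)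
  -- Flatness of `G` keeps `ker f → M` injective after tensoring with `R ⧸ I`. Hence an element of
  -- `ker f` lying in `I • M` already lies in `I • ker f`, and Nakayama applies to the kernel.
  have hexact : Function.Exact (LinearMap.ker f).subtype f := by
    intro y; simp
  have hinj := LinearMap.lTensor_injective_of_exact_of_flat f hsurj (LinearMap.ker f).subtype
    Subtype.val_injective hexact (R ⧸ I)
  have h0 : (1 : R ⧸ I) ⊗ₜ[R] (⟨x, hx⟩ : LinearMap.ker f) = 0 := by
    apply hinj
    rw [map_zero, LinearMap.lTensor_tmul, Submodule.subtype_apply]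
    apply (TensorProduct.quotTensorEquivQuotSMul M I).injective
    rw [map_zero]
    have : TensorProduct.quotTensorEquivQuotSMul M I ((1 : R ⧸ I) ⊗ₜ[R] x) =
      Submodule.Quotient.mk x := by
      simp
    rw [this]
    exact (Submodule.Quotient.mk_eq_zero _).mpr hx'
  have h1 := congrArg (TensorProduct.quotTensorEquivQuotSMul (LinearMap.ker f) I) h0
  have h2 := TensorProduct.quotTensorEquivQuotSMul_mk_tmul (M := LinearMap.ker f) I 1 ⟨x, hx⟩
  rw [map_one, one_smul] at h2
  rw [h2, map_zero, Submodule.Quotient.mk_eq_zero] at h1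
  have h3 := Submodule.mem_map_of_mem (f := (LinearMap.ker f).subtype) h1
  rwa [Submodule.map_smul'', Submodule.map_top, Submodule.range_subtype] at h3

end Nakayama

end PoissonDef
namespace PoissonDef
open TensorProduct

noncomputable section

/-! ### Local Artinian algebras and small extensions -/

section Residue

variable {k : Type u} [Field k] (A : ArtAlg k)

/-- The residue homomorphism `A → A/𝔪 ≅ k`. -/
def ArtAlg.residue : A.carrier →+* k :=
  ((RingEquiv.ofBijective _ A.residue_bijective).symm : _ →+* k).comp
    (IsLocalRing.residue A.carrier)

/-- The maximal ideal. -/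
abbrev ArtAlg.maxIdeal : Ideal A.carrier := IsLocalRing.maximalIdeal A.carrier

lemma ArtAlg.residue_algebraMap (c : k) : A.residue (algebraMap k A.carrier c) = c := by
  have : IsLocalRing.residue A.carrier (algebraMap k A.carrier c) =
      algebraMap k (IsLocalRing.ResidueField A.carrier) c := rfl
  rw [ArtAlg.residue, RingHom.comp_apply, this]
  exact (RingEquiv.ofBijective _ A.residue_bijective).symm_apply_apply c

lemma ArtAlg.residue_surjective : Function.Surjective A.residue := fun c =>
  ⟨_, A.residue_algebraMap c⟩

lemma ArtAlg.residue_eq_zero_iff (a : A.carrier) : A.residue a = 0 ↔ a ∈ A.maxIdeal := by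
  rw [ArtAlg.residue, RingHom.comp_apply, ← IsLocalRing.residue_eq_zero_iff]
  exact map_eq_zero_iff _ (RingEquiv.injective _)

lemma ArtAlg.ker_residue : RingHom.ker A.residue = A.maxIdeal := by
  ext a; rw [RingHom.mem_ker, A.residue_eq_zero_iff]

lemma ArtAlg.sub_residue_mem (a : A.carrier) : a - algebraMap k _ (A.residue a) ∈ A.maxIdeal := by
  rw [← A.residue_eq_zero_iff, map_sub, A.residue_algebraMap, sub_self]

lemma ArtAlg.isNilpotent_maxIdeal : IsNilpotent A.maxIdeal := by
  have := IsArtinianRing.isNilpotent_jacobson_bot (R := A.carrier)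
  rwa [IsLocalRing.jacobson_eq_maximalIdeal ⊥ bot_ne_top] at this

variable {A} {A' : ArtAlg k}

/-- Algebra homomorphisms are automatically local here: an element of the nilpotent maximal ideal
has nilpotent image, which is not a unit. -/
lemma ArtAlg.residue_comp (φ : A'.carrier →ₐ[k] A.carrier) (a : A'.carrier) :
    A.residue (φ a) = A'.residue a := by
  have h := A'.sub_residue_mem a
  have h' : φ (a - algebraMap k _ (A'.residue a)) ∈ A.maxIdeal := by
    obtain ⟨n, hn⟩ := A'.isNilpotent_maxIdeal
    have h1 : (a - algebraMap k _ (A'.residue a)) ^ n = 0 := by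
      have := Ideal.pow_mem_pow h n
      rwa [hn] at this
    refine (IsLocalRing.mem_maximalIdeal _).mpr fun hu => ?_
    have h2 := hu.pow n
    rw [← map_pow, h1, map_zero] at h2
    exact not_isUnit_zero h2
  rw [map_sub, AlgHom.commutes, ← A.residue_eq_zero_iff, map_sub, A.residue_algebraMap, sub_eq_zero]
    at h'
  exact h'

/-- A surjection of local Artinian algebras whose kernel is spanned over `k` by the element `t`,
which is killed by the maximal ideal. -/
structure IsSmallExtension (φ : A'.carrier →ₐ[k] A.carrier) (t : A'.carrier) : Prop where
  surjective : Function.Surjective φ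
  ne_zero : t ≠ 0
  map_eq_zero : φ t = 0
  mul_eq_zero : ∀ x ∈ A'.maxIdeal, x * t = 0
  exists_of_map_eq_zero : ∀ x, φ x = 0 → ∃ c : k, x = c • t

/-- The maximal ideal kills `t`, so `A'` acts on `t` through its residue field. -/
lemma IsSmallExtension.mul_eq {φ : A'.carrier →ₐ[k] A.carrier} {t : A'.carrier}
    (h : IsSmallExtension φ t) (a : A'.carrier) : a * t = A'.residue a • t := by
  have := h.mul_eq_zero _ (A'.sub_residue_mem a)
  rw [sub_mul, sub_eq_zero] at this
  rw [this, Algebra.smul_def]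

lemma IsSmallExtension.residue_eq_zero {φ : A'.carrier →ₐ[k] A.carrier} {t : A'.carrier}
    (h : IsSmallExtension φ t) : A'.residue t = 0 := by
  rw [← ArtAlg.residue_comp φ, h.map_eq_zero, map_zero]

end Residue

section TensorAlgebra

variable {k : Type u} [Field k] {A O G : Type u} [CommRing A] [Algebra k A]
  [CommRing O] [Algebra k O] [CommRing G]

/-- The homomorphism from a tensor product of algebras given by homomorphisms on the factors. -/
def tlift (a : A →+* G) (τ : O →+* G) (h : ∀ c : k, a (algebraMap k A c) = τ (algebraMap k O c)) :
    A ⊗[k] O →+* G :=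
  letI := (a.comp (algebraMap k A)).toAlgebra
  (Algebra.TensorProduct.lift (⟨a, fun _ => rfl⟩ : A →ₐ[k] G) (⟨τ, fun c => (h c).symm⟩ : O →ₐ[k] G)
    (fun _ _ => .all _ _) : A ⊗[k] O →ₐ[k] G)

@[simp]
lemma tlift_tmul (a : A →+* G) (τ : O →+* G) (h) (x : A) (y : O) :
    tlift (k := k) a τ h (x ⊗ₜ y) = a x * τ y :=
  letI := (a.comp (algebraMap k A)).toAlgebra
  Algebra.TensorProduct.lift_tmul _ _ (fun _ _ => .all _ _) x y

lemma tensor_ringHom_ext {f g : A ⊗[k] O →+* G} (h₁ : ∀ a, f (a ⊗ₜ 1) = g (a ⊗ₜ 1))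
    (h₂ : ∀ b, f (1 ⊗ₜ b) = g (1 ⊗ₜ b)) : f = g := by
  ext x
  · exact h₁ x
  · exact h₂ x

/-- Left inclusion. -/
abbrev inl : A →+* A ⊗[k] O := Algebra.TensorProduct.includeLeftRingHom

/-- Right inclusion. -/
abbrev inr : O →+* A ⊗[k] O := (Algebra.TensorProduct.includeRight : O →ₐ[k] A ⊗[k] O)

lemma inl_mul_inr (a : A) (b : O) : (inl a * inr b : A ⊗[k] O) = a ⊗ₜ b := by
  simp [inl, inr]

end TensorAlgebra

/-! ### Trivialization of flat deformations of algebras -/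

section Trivialization

variable {k : Type u} [Field k] {A : ArtAlg k} {O G : Type u} [CommRing O] [Algebra k O]
  [CommRing G]

/-- A flat deformation of an algebra over a local Artinian algebra is trivialized by a section of
the reduction map. -/
lemma bijective_tlift {a : A.carrier →+* G} (ha : a.Flat) {r : G →+* O}
    (hker : RingHom.ker r = A.maxIdeal.map a)
    (hra : ∀ x, r (a x) = algebraMap k O (A.residue x))
    {τ : O →+* G} (hτ : ∀ x, r (τ x) = x)
    (h : ∀ c : k, a (algebraMap k _ c) = τ (algebraMap k O c)) :
    Function.Bijective (tlift a τ h) := by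
  let := a.toAlgebra
  have : Module.Flat A.carrier G := ha
  let f : A.carrier ⊗[k] O →ₗ[A.carrier] G :=
    { toFun := tlift a τ h
      map_add' := map_add _
      map_smul' := fun x y => by
        rw [RingHom.id_apply, Algebra.smul_def, Algebra.smul_def, map_mul]
        congr 1
        exact (tlift_tmul a τ h x 1).trans (by rw [map_one, mul_one]; rfl) }
  have hmem : ∀ x : G, r x = 0 → x ∈ A.maxIdeal • (⊤ : Submodule A.carrier G) := by
    intro x hx
    rw [Ideal.smul_top_eq_map]
    have : x ∈ RingHom.ker r := hx
    rw [hker] at this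
    exact this
  have hmem' : ∀ x ∈ A.maxIdeal • (⊤ : Submodule A.carrier G), r x = 0 := by
    intro x hx
    rw [Ideal.smul_top_eq_map] at hx
    change x ∈ RingHom.ker r
    rw [hker]
    exact hx
  refine bijective_of_isNilpotent_of_flat A.isNilpotent_maxIdeal f ?_ ?_
  · rw [eq_top_iff]
    intro x _
    have h1 : x - τ (r x) ∈ A.maxIdeal • (⊤ : Submodule A.carrier G) :=
      hmem _ (by rw [map_sub, hτ, sub_self])
    have h2 : τ (r x) ∈ LinearMap.range f := ⟨1 ⊗ₜ r x, (tlift_tmul a τ h 1 (r x)).trans (by simp)⟩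
    have := add_mem (Submodule.mem_sup_left (T := A.maxIdeal • ⊤) h2)
      (Submodule.mem_sup_right (S := LinearMap.range f) h1)
    rwa [add_sub_cancel] at this
  -- Modulo the maximal ideal every `x` is `1 ⊗ r (f x)`; if `f x` vanishes modulo the maximal
  -- ideal, then so does `x`.
  · have key : ∀ x, x - 1 ⊗ₜ r (f x) ∈ A.maxIdeal • (⊤ : Submodule A.carrier (A.carrier ⊗[k] O)) := by
      intro x
      induction x with
      | zero => simp
      | add x y hx hy =>
        have := add_mem hx hy
        rw [map_add, map_add, TensorProduct.tmul_add]
        convert this using 1; abel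
      | tmul x y =>
        have : r (f (x ⊗ₜ y)) = A.residue x • y := by
          change r (tlift a τ h (x ⊗ₜ y)) = _
          rw [tlift_tmul, map_mul, hτ, hra, Algebra.smul_def]
        rw [this, ← TensorProduct.smul_tmul, ← TensorProduct.sub_tmul]
        have h1 := A.sub_residue_mem x
        rw [Algebra.algebraMap_eq_smul_one] at h1
        have h2 := Submodule.smul_mem_smul h1
          (Submodule.mem_top (x := ((1 : A.carrier) ⊗ₜ[k] y)))
        rwa [TensorProduct.smul_tmul', smul_eq_mul, mul_one] at h2
    intro x hx
    have := key x
    rwa [hmem' _ hx, TensorProduct.tmul_zero, sub_zero] at this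

/-- Smoothness of `O` over `k` gives a section of the nilpotent surjection `r`. The section
trivializes the deformation, and formal smoothness of `A ⊗ O` over `A` is a base change. -/
lemma formallySmooth_of_flat_deformation (hO : Algebra.FormallySmooth k O)
    {a : A.carrier →+* G} (ha : a.Flat) {r : G →+* O}
    (hr : Function.Surjective r) (hker : RingHom.ker r = A.maxIdeal.map a)
    (hra : ∀ x, r (a x) = algebraMap k O (A.residue x)) : a.FormallySmooth := by
  have hn : IsNilpotent (RingHom.ker r) := by
    obtain ⟨n, hn⟩ := A.isNilpotent_maxIdeal
    refine ⟨n, ?_⟩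
    rw [hker, ← Ideal.map_pow, hn, Ideal.zero_eq_bot, Ideal.map_bot, Ideal.zero_eq_bot]
  obtain ⟨τ, hτ, h⟩ := exists_lift_of_formallySmooth (b := algebraMap k O)
    (RingHom.formallySmooth_algebraMap.mpr hO) hr hn (b' := a.comp (algebraMap k _))
    (h := RingHom.id O) (fun x => by simp [hra, A.residue_algebraMap])
  have hb := bijective_tlift ha hker hra hτ (fun c => (h c).symm)
  let := a.toAlgebra
  let e : A.carrier ⊗[k] O ≃ₐ[A.carrier] G :=
    AlgEquiv.ofRingEquiv (f := RingEquiv.ofBijective _ hb) (fun x => by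
      exact (tlift_tmul a τ (fun c => (h c).symm) x 1).trans (by rw [map_one, mul_one]; rfl))
  exact Algebra.FormallySmooth.of_equiv e

end Trivialization

end

end PoissonDef
namespace PoissonDef
open TensorProduct

noncomputable section

/-! ### The ideal `t ⊗ O` of `A' ⊗ O` -/

section SmallExtension

variable {k : Type u} [Field k] {A A' : ArtAlg k} (O : Type u) [CommRing O] [Algebra k O]

/-- The reduction `A ⊗ O → O` modulo the maximal ideal of `A`. -/
def augm (A : ArtAlg k) : A.carrier ⊗[k] O →+* O :=
  tlift ((algebraMap k O).comp A.residue) (RingHom.id O) (fun c => by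
    simp [A.residue_algebraMap])

variable {O}

@[simp]
lemma augm_tmul (x : A.carrier) (y : O) : augm O A (x ⊗ₜ y) = A.residue x • y := by
  rw [augm, tlift_tmul, Algebra.smul_def]; rfl

lemma augm_inl (x : A.carrier) : augm O A (inl x) = algebraMap k O (A.residue x) := by
  change augm O A (x ⊗ₜ 1) = _
  rw [augm_tmul, Algebra.algebraMap_eq_smul_one]

lemma augm_inr (y : O) : augm O A (inr y) = y := by
  change augm O A (1 ⊗ₜ y) = _
  rw [augm_tmul, map_one, one_smul]

lemma augm_surjective : Function.Surjective (augm O A) := fun y => ⟨inr y, augm_inr y⟩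

lemma sub_inr_augm_mem (x : A.carrier ⊗[k] O) : x - inr (augm O A x) ∈ A.maxIdeal.map inl := by
  induction x with
  | zero => simp
  | add x y hx hy =>
    have := add_mem hx hy
    rw [map_add, map_add]
    convert this using 1; abel
  | tmul x y =>
    have h1 : (x ⊗ₜ[k] y : A.carrier ⊗[k] O) - inr (augm O A (x ⊗ₜ y)) =
        inr y * inl (x - algebraMap k _ (A.residue x)) := by
      rw [augm_tmul, mul_comm, inl_mul_inr, TensorProduct.sub_tmul, Algebra.algebraMap_eq_smul_one,
        TensorProduct.smul_tmul]
      rfl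
    rw [h1]
    exact Ideal.mul_mem_left _ _ (Ideal.mem_map_of_mem _ (A.sub_residue_mem x))

lemma ker_augm : RingHom.ker (augm O A) = A.maxIdeal.map inl := by
  apply le_antisymm
  · intro x hx
    have := sub_inr_augm_mem x
    rwa [RingHom.mem_ker.mp hx, map_zero, sub_zero] at this
  · rw [Ideal.map_le_iff_le_comap]
    intro x hx
    rw [Ideal.mem_comap, RingHom.mem_ker, augm_inl, (A.residue_eq_zero_iff x).mpr hx, map_zero]

/-- Multiplication by `t`, as a map `O → A' ⊗ O`. -/
def tmulBy (t : A'.carrier) : O →+ A'.carrier ⊗[k] O :=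
  (TensorProduct.mk k A'.carrier O t).toAddMonoidHom

lemma tmulBy_apply (t : A'.carrier) (b : O) : tmulBy t b = t ⊗ₜ[k] b := rfl

variable {φ : A'.carrier →ₐ[k] A.carrier} {t : A'.carrier}

/-- The ideal `t ⊗ O` is a module over `A' ⊗ O` through the reduction to `O`. For this reason errors
with values in `t ⊗ O` become tensors on the closed fibre. -/
lemma IsSmallExtension.mul_tmulBy (h : IsSmallExtension φ t) (x : A'.carrier ⊗[k] O) (b : O) :
    x * tmulBy t b = tmulBy t (augm O A' x * b) := by
  induction x with
  | zero => simp
  | add x y hx hy => rw [add_mul, hx, hy, map_add, add_mul, map_add]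
  | tmul x y =>
    rw [tmulBy_apply, tmulBy_apply, Algebra.TensorProduct.tmul_mul_tmul, h.mul_eq, augm_tmul,
      TensorProduct.smul_tmul, smul_mul_assoc]

lemma IsSmallExtension.augm_tmulBy (h : IsSmallExtension φ t) (b : O) :
    augm O A' (tmulBy t b) = 0 := by
  rw [tmulBy_apply, augm_tmul, h.residue_eq_zero, zero_smul]

/-- `k → A'`, `c ↦ c • t`, is injective and `O` is flat over the field `k`. This allows `t` to be
cancelled in every comparison of errors below. -/
lemma IsSmallExtension.tmulBy_injective (h : IsSmallExtension φ t) :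
    Function.Injective (tmulBy t : O →+ A'.carrier ⊗[k] O) := by
  have h1 : Function.Injective (LinearMap.toSpanSingleton k A'.carrier t) := by
    rw [← LinearMap.ker_eq_bot]
    exact LinearMap.ker_toSpanSingleton k h.ne_zero
  have h2 := Module.Flat.rTensor_preserves_injective_linearMap (M := O) _ h1
  intro x y hxy
  have h3 : ∀ z : O, LinearMap.rTensor O (LinearMap.toSpanSingleton k A'.carrier t)
      (1 ⊗ₜ z) = tmulBy t z := fun z => by
    rw [LinearMap.rTensor_tmul, LinearMap.toSpanSingleton_apply, one_smul]; rfl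
  have h4 := h2 ((h3 x).trans (hxy.trans (h3 y).symm))
  have := congrArg (TensorProduct.lid k O) h4
  simpa using this

/-- The base change map `A' ⊗ O → A ⊗ O`. -/
def tmap (φ : A'.carrier →ₐ[k] A.carrier) : A'.carrier ⊗[k] O →+* A.carrier ⊗[k] O :=
  (Algebra.TensorProduct.map φ (AlgHom.id k O) : A'.carrier ⊗[k] O →ₐ[k] A.carrier ⊗[k] O)

@[simp]
lemma tmap_tmul (x : A'.carrier) (y : O) : tmap φ (x ⊗ₜ[k] y) = φ x ⊗ₜ y := rfl

/-- The sequence `k → A' → A` given by `t` and `φ` is exact in the middle, and stays so after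
tensoring with `O`. -/
lemma IsSmallExtension.exists_of_tmap_eq_zero (h : IsSmallExtension φ t) {x : A'.carrier ⊗[k] O}
    (hx : tmap φ x = 0) : ∃ b, x = tmulBy t b := by
  have hex : Function.Exact (LinearMap.toSpanSingleton k A'.carrier t) φ.toLinearMap := by
    intro y
    constructor
    · intro hy
      obtain ⟨c, rfl⟩ := h.exists_of_map_eq_zero y hy
      exact ⟨c, rfl⟩
    · rintro ⟨c, rfl⟩
      change φ (c • t) = 0
      rw [map_smul, h.map_eq_zero, smul_zero]
  have h1 : ∀ x : A'.carrier ⊗[k] O, LinearMap.rTensor O φ.toLinearMap x = tmap φ x := by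
    intro x
    induction x with
    | zero => simp
    | add x y hx hy => rw [map_add, map_add, hx, hy]
    | tmul x y => rfl
  have h2 : ∀ y : k ⊗[k] O, LinearMap.rTensor O (LinearMap.toSpanSingleton k A'.carrier t) y =
      tmulBy t (TensorProduct.lid k O y) := by
    intro y
    induction y with
    | zero => simp
    | add x y hx hy => rw [map_add, map_add, hx, hy, map_add]
    | tmul c y =>
      rw [LinearMap.rTensor_tmul, TensorProduct.lid_tmul, tmulBy_apply,
        LinearMap.toSpanSingleton_apply, TensorProduct.smul_tmul]
  obtain ⟨y, rfl⟩ := (Module.Flat.rTensor_exact O hex x).mp (by rw [h1, hx])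
  exact ⟨_, h2 y⟩

lemma tmap_surjective (h : Function.Surjective φ) :
    Function.Surjective (tmap φ : A'.carrier ⊗[k] O →+* _) :=
  LinearMap.rTensor_surjective O (g := φ.toLinearMap) h

lemma IsSmallExtension.tmulBy_mul (h : IsSmallExtension φ t) (x : A'.carrier ⊗[k] O) (b : O) :
    tmulBy t b * x = tmulBy t (b * augm O A' x) := by
  rw [mul_comm, h.mul_tmulBy, mul_comm]

lemma tmulBy_eq (b : O) : (tmulBy t b : A'.carrier ⊗[k] O) = inl t * inr b :=
  (inl_mul_inr t b).symm

/-- An additive map with values in `t ⊗ O`, linear over the base, vanishes on the kernel of the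
reduction map. -/
lemma IsSmallExtension.eq_zero_of_red_eq_zero (h : IsSmallExtension φ t) {B : ArtAlg k}
    (β : B.carrier →ₐ[k] A'.carrier) {S C : Type*} [CommRing S] [CommRing C]
    {b : B.carrier →+* S} {r : S →+* C} (hr : RingHom.ker r = B.maxIdeal.map b)
    (E : S → A'.carrier ⊗[k] O) (hadd : ∀ x y, E (x + y) = E x + E y)
    (hlin : ∀ s x, E (b s * x) = inl (β s) * E x) (hE : ∀ x, ∃ o, E x = tmulBy t o)
    {x : S} (hx : r x = 0) : E x = 0 := by
  have h0 : E 0 = 0 := by simpa using hlin 0 0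
  have hx' : x ∈ B.maxIdeal.map b := by rw [← hr]; exact hx
  -- All multiples `a * x` are treated together, so that the induction over the generated ideal
  -- closes under multiplication. On a generator `b s`, the scalar `β s` lies in the maximal ideal
  -- and kills `t ⊗ O`.
  have key : ∀ x ∈ B.maxIdeal.map b, ∀ a, E (a * x) = 0 := by
    intro x hx
    induction hx using Submodule.span_induction with
    | mem x hx' =>
      obtain ⟨s, hs, rfl⟩ := hx'
      intro a
      obtain ⟨o, ho⟩ := hE a
      have h2 : A'.residue (β s) = 0 := by
        rw [ArtAlg.residue_comp]; exact (B.residue_eq_zero_iff s).mpr hs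
      rw [mul_comm, hlin, ho, h.mul_tmulBy, augm_inl, h2, map_zero, zero_mul, map_zero]
    | zero => intro a; rw [mul_zero, h0]
    | add x y _ _ h1 h2 => intro a; rw [mul_add, hadd, h1, h2, add_zero]
    | smul c x _ h1 => intro a; rw [smul_eq_mul, ← mul_assoc, h1]
  rw [← one_mul x, key x hx' 1]

lemma IsSmallExtension.eq_of_red_eq (h : IsSmallExtension φ t) {B : ArtAlg k}
    (β : B.carrier →ₐ[k] A'.carrier) {S C : Type*} [CommRing S] [CommRing C]
    {b : B.carrier →+* S} {r : S →+* C} (hr : RingHom.ker r = B.maxIdeal.map b)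
    (E : S → A'.carrier ⊗[k] O) (hadd : ∀ x y, E (x + y) = E x + E y)
    (hlin : ∀ s x, E (b s * x) = inl (β s) * E x) (hE : ∀ x, ∃ o, E x = tmulBy t o)
    {x y : S} (hx : r x = r y) : E x = E y := by
  have h1 := h.eq_zero_of_red_eq_zero β hr E hadd hlin hE (x := x - y) (by rw [map_sub, hx, sub_self])
  have h2 := hadd (x - y) y
  rwa [sub_add_cancel, h1, zero_add] at h2

end SmallExtension

end

end PoissonDef
namespace PoissonDef
open TensorProduct

noncomputable section

/-- A skew-symmetric biderivation of a commutative ring. -/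
structure IsBiderivation {R : Type*} [CommRing R] (br : R → R → R) : Prop where
  add_left : ∀ a b c, br (a + b) c = br a c + br b c
  skew : ∀ a b, br a b = -br b a
  mul_left : ∀ a b c, br (a * b) c = a * br b c + b * br a c

namespace IsBiderivation

variable {R : Type*} [CommRing R] {br : R → R → R} (h : IsBiderivation br)
include h

lemma add_right (a b c : R) : br a (b + c) = br a b + br a c := by
  rw [h.skew, h.add_left, h.skew b, h.skew c]; ring

lemma mul_right (a b c : R) : br a (b * c) = b * br a c + c * br a b := by
  rw [h.skew, h.mul_left, h.skew b, h.skew c]; ring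

lemma zero_left (a : R) : br 0 a = 0 := by
  have := h.add_left 0 0 a
  simpa using this

lemma neg_left (a b : R) : br (-a) b = -br a b := by
  have := h.add_left a (-a) b
  rw [add_neg_cancel, h.zero_left] at this
  exact (neg_eq_of_add_eq_zero_right this.symm).symm

lemma sub_left (a b c : R) : br (a - b) c = br a c - br b c := by
  rw [sub_eq_add_neg, h.add_left, h.neg_left, sub_eq_add_neg]

lemma sub_right (a b c : R) : br a (b - c) = br a b - br a c := by
  rw [h.skew, h.sub_left, h.skew b, h.skew c]; ring

lemma zero_right (a : R) : br a 0 = 0 := by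
  rw [h.skew, h.zero_left, neg_zero]

end IsBiderivation

/-! ### Twists and lifted brackets over a small extension -/

section Lifts

variable {k : Type u} [Field k] {A A' : ArtAlg k} {O : Type u} [CommRing O] [Algebra k O]
  {φ : A'.carrier →ₐ[k] A.carrier} {t : A'.carrier}

/-- An `A'`-linear ring endomorphism of `A' ⊗ O` which is the identity modulo the maximal ideal. -/
structure IsTwist (θ : A'.carrier ⊗[k] O →+* A'.carrier ⊗[k] O) : Prop where
  map_inl : ∀ a, θ (inl a) = inl a
  augm_map : ∀ x, augm O A' (θ x) = augm O A' x

/-- The product `inl t * x` depends only on the reduction of `x`, which a twist preserves. -/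
lemma IsTwist.map_tmulBy {θ : A'.carrier ⊗[k] O →+* A'.carrier ⊗[k] O} (hθ : IsTwist θ)
    (h : IsSmallExtension φ t) (b : O) : θ (tmulBy t b) = tmulBy t b := by
  have h1 : ∀ x : A'.carrier ⊗[k] O, inl t * x = tmulBy t (augm O A' x) := fun x => by
    have : (inl t : A'.carrier ⊗[k] O) = tmulBy t 1 := rfl
    rw [this, h.tmulBy_mul, one_mul]
  rw [tmulBy_eq, map_mul, hθ.map_inl, h1, h1, hθ.augm_map]

/-- An `A'`-bilinear skew biderivation of `A' ⊗ O` which reduces to `br` modulo the maximal ideal. -/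
structure IsBracketLift (br : O → O → O)
    (lam : A'.carrier ⊗[k] O → A'.carrier ⊗[k] O → A'.carrier ⊗[k] O) : Prop
    extends IsBiderivation lam where
  inl_left : ∀ a y, lam (inl a) y = 0
  augm_lam : ∀ x y, augm O A' (lam x y) = br (augm O A' x) (augm O A' y)

section

variable {br : O → O → O} {lam : A'.carrier ⊗[k] O → A'.carrier ⊗[k] O → A'.carrier ⊗[k] O}
  (hl : IsBracketLift br lam)
include hl

lemma IsBracketLift.inl_mul_left (a x y) : lam (inl a * x) y = inl a * lam x y := by
  rw [hl.mul_left, hl.inl_left, mul_zero, add_zero]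

lemma IsBracketLift.tmulBy_left (h : IsSmallExtension φ t) (b : O) (y) :
    lam (tmulBy t b) y = tmulBy t (br b (augm O A' y)) := by
  have h1 : ∀ x : A'.carrier ⊗[k] O, inl t * x = tmulBy t (augm O A' x) := fun x => by
    have : (inl t : A'.carrier ⊗[k] O) = tmulBy t 1 := rfl
    rw [this, h.tmulBy_mul, one_mul]
  rw [tmulBy_eq, hl.inl_mul_left, h1, hl.augm_lam, augm_inr]

lemma IsBracketLift.tmulBy_right (hb : IsBiderivation br) (h : IsSmallExtension φ t) (b : O) (y) :
    lam y (tmulBy t b) = tmulBy t (br (augm O A' y) b) := by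
  rw [hl.skew, hl.tmulBy_left h, hb.skew, map_neg, neg_neg]

end

/-! ### Cocycle identities satisfied by the errors of the source -/

section Errors

variable {br : O → O → O} (hb : IsBiderivation br) (h : IsSmallExtension φ t)
  {li lj lk : A'.carrier ⊗[k] O → A'.carrier ⊗[k] O → A'.carrier ⊗[k] O}
  (hli : IsBracketLift br li) (hlj : IsBracketLift br lj) (hlk : IsBracketLift br lk)
  {θij θjk θik θkl θjl θil : A'.carrier ⊗[k] O →+* A'.carrier ⊗[k] O}
  (hij : IsTwist θij) (hjk : IsTwist θjk) (hik : IsTwist θik)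
  {cijk cikl cijl cjkl : O → O} {Lij Ljk Lik : O → O → O} {Ji Jj : O → O → O → O}

include h hij in
-- Associativity of `θij ∘ θjk ∘ θkl`: composing from the left or from the right produces the same
-- multiple of `t`.
lemma cech_twist_error
    (h1 : ∀ x, θij (θjk x) = θik x + tmulBy t (cijk (augm O A' x)))
    (h2 : ∀ x, θik (θkl x) = θil x + tmulBy t (cikl (augm O A' x)))
    (h3 : ∀ x, θij (θjl x) = θil x + tmulBy t (cijl (augm O A' x)))
    (h4 : ∀ x, θjk (θkl x) = θjl x + tmulBy t (cjkl (augm O A' x)))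
    (hkl : IsTwist θkl) (o : O) : cjkl o - cikl o + cijl o - cijk o = 0 := by
  apply h.tmulBy_injective
  have e := h1 (θkl (inr o))
  rw [h4, map_add, h3, h2, hij.map_tmulBy h, hkl.augm_map, augm_inr] at e
  rw [map_sub, map_add, map_sub, map_zero]
  linear_combination e

include hb h hij hli hlk hjk hik in
-- Two computations of `θij (θjk {a, b})`: either the bracket is carried through one twist after the
-- other, or the composite is first replaced by `θik` plus its error. The bracket terms with `cijk`
-- come from expanding the second form.
lemma cech_bracket_error
    (h1 : ∀ x, θij (θjk x) = θik x + tmulBy t (cijk (augm O A' x)))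
    (h2 : ∀ x y, θij (lj x y) = li (θij x) (θij y) + tmulBy t (Lij (augm O A' x) (augm O A' y)))
    (h3 : ∀ x y, θjk (lk x y) = lj (θjk x) (θjk y) + tmulBy t (Ljk (augm O A' x) (augm O A' y)))
    (h4 : ∀ x y, θik (lk x y) = li (θik x) (θik y) + tmulBy t (Lik (augm O A' x) (augm O A' y)))
    (a b : O) : Ljk a b - Lik a b + Lij a b + (br (cijk a) b - br (cijk b) a - cijk (br a b)) = 0 := by
  apply h.tmulBy_injective
  have e := h1 (lk (inr a) (inr b))
  rw [h3, map_add, h2, h4, h1, h1] at e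
  simp only [hij.map_tmulBy h, hli.add_left, hli.add_right, hli.tmulBy_left h,
    hli.tmulBy_right hb h, hjk.augm_map, hik.augm_map, augm_inr, hlk.augm_lam, h.augm_tmulBy,
    hb.zero_right, map_zero] at e
  simp only [map_add, map_sub, map_zero, hb.skew (cijk b) a, map_neg]
  linear_combination e

/-- The Jacobiator of a bracket. -/
def jacobiator {R : Type*} [Add R] (l : R → R → R) (x y z : R) : R :=
  l (l x y) z + l (l y z) x + l (l z x) y

/-- This is `[λ, [λ, λ]] = 0`, valid for every biadditive skew bracket whether or not it satisfies
the Jacobi identity. -/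
lemma map_jacobiator_aux {R : Type*} [CommRing R] {l : R → R → R} (hl : IsBiderivation l)
    (x y z w : R) :
    -l (jacobiator l y z w) x + l (jacobiator l x z w) y - l (jacobiator l x y w) z +
        l (jacobiator l x y z) w + (-(jacobiator l (l x y) z w) + jacobiator l (l x z) y w -
        jacobiator l (l x w) y z - jacobiator l (l y z) x w + jacobiator l (l y w) x z -
        jacobiator l (l z w) x y) = 0 := by
  simp only [jacobiator, hl.add_left]
  have e1 : ∀ a b c d, l (l a b) (l c d) = -l (l c d) (l a b) := fun a b c d => hl.skew _ _
  have e2 : ∀ a b c d, l (l c (l a b)) d = -l (l (l a b) c) d := fun a b c d => by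
    rw [hl.skew c, hl.neg_left]
  have e3 : ∀ a b c d, l (l (l b a) c) d = -l (l (l a b) c) d := fun a b c d => by
    rw [hl.skew b, hl.neg_left, hl.neg_left]
  -- The terms have the shapes `{{a, b}, {c, d}}` and `{{{a, b}, c}, d}`; skew symmetry brings each
  -- to one normal form, after which they cancel in pairs.
  rw [e1 z w x y, e1 y w x z, e1 y z x w]
  simp only [e2]
  rw [e3 y w z x, e3 x w z y, e3 x w y z, e3 x z y w]
  ring

include hb h hij hli hlj in
-- The Jacobiator of `lj`, transported by `θij`, is compared with that of `li` at the transported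
-- elements.
lemma cech_jacobi_error
    (h1 : ∀ x y, θij (lj x y) = li (θij x) (θij y) + tmulBy t (Lij (augm O A' x) (augm O A' y)))
    (h2 : ∀ x y z, jacobiator li x y z = tmulBy t (Ji (augm O A' x) (augm O A' y) (augm O A' z)))
    (h3 : ∀ x y z, jacobiator lj x y z = tmulBy t (Jj (augm O A' x) (augm O A' y) (augm O A' z)))
    (hL : ∀ a b, Lij a b = -Lij b a) (hL' : ∀ a b, Lij (-a) b = -Lij a b)
    (a b c : O) : Jj a b c - Ji a b c - ((br (Lij b c) a - br (Lij a c) b + br (Lij a b) c) +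
      (Lij (br a b) c - Lij (br a c) b + Lij (br b c) a)) = 0 := by
  apply h.tmulBy_injective
  have e := congrArg θij (h3 (inr a) (inr b) (inr c))
  have e' := h2 (θij (inr a)) (θij (inr b)) (θij (inr c))
  simp only [jacobiator, map_add, h1, hij.map_tmulBy h, hli.add_left, hli.tmulBy_left h,
    hlj.augm_lam, hij.augm_map, augm_inr] at e e'
  -- The Jacobiator is written cyclically, with `c` before `a`, while the differential keeps the
  -- arguments in increasing order.
  rw [hL a c, hb.skew a c, hL', hb.neg_left]
  simp only [map_add, map_sub, map_zero, map_neg]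
  linear_combination - e + e'

include h hli in
-- In `map_jacobiator_aux` every Jacobiator is replaced by the corresponding multiple of `t`.
lemma diff_jacobi_error
    (h2 : ∀ x y z, jacobiator li x y z = tmulBy t (Ji (augm O A' x) (augm O A' y) (augm O A' z)))
    (a b c d : O) : (-br (Ji b c d) a + br (Ji a c d) b - br (Ji a b d) c + br (Ji a b c) d) +
      (-Ji (br a b) c d + Ji (br a c) b d - Ji (br a d) b c - Ji (br b c) a d + Ji (br b d) a c -
        Ji (br c d) a b) = 0 := by
  apply h.tmulBy_injective
  have e := map_jacobiator_aux hli.toIsBiderivation (inr a) (inr b) (inr c) (inr d)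
  simp only [h2, hli.tmulBy_left h, hli.augm_lam, augm_inr] at e
  simp only [map_add, map_sub, map_zero, map_neg]
  linear_combination e

end Errors

/-! ### Relations between the errors of the source and of the morphism -/

section PushErrors

variable {br : O → O → O} (hb : IsBiderivation br) (h : IsSmallExtension φ t)
  {li lj : A'.carrier ⊗[k] O → A'.carrier ⊗[k] O → A'.carrier ⊗[k] O}
  (hli : IsBracketLift br li) (hlj : IsBracketLift br lj)
  {θij θjk θik : A'.carrier ⊗[k] O →+* A'.carrier ⊗[k] O}
  (hij : IsTwist θij)
  {cijk : O → O} {Lij : O → O → O} {Ji : O → O → O → O}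
  {S C : Type*} [CommRing S] [CommRing C] {r : S →+* C} (hr : Function.Surjective r)
  {f : C →+* O} {brS : S → S → S} {brC : C → C → C}
  (hbr : ∀ x y, r (brS x y) = brC (r x) (r y))
  {pi pj pk : S →+* A'.carrier ⊗[k] O} (hpi : ∀ x, augm O A' (pi x) = f (r x))
  (hpj : ∀ x, augm O A' (pj x) = f (r x)) (hpk : ∀ x, augm O A' (pk x) = f (r x))
  {Mij Mjk Mik : C → O} {Ni Nj : C → C → O}

include h hij hr hpk in
-- The defining relation of `cijk` is evaluated on elements `pk x` coming from the target; the
-- twists then carry `pk` to `pj` and `pi`. Since `r` is onto, every function on the closed fibre of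
-- the target is reached.
lemma push_twist_error
    (h1 : ∀ x, θij (θjk x) = θik x + tmulBy t (cijk (augm O A' x)))
    (h2 : ∀ x, θij (pj x) = pi x + tmulBy t (Mij (r x)))
    (h3 : ∀ x, θjk (pk x) = pj x + tmulBy t (Mjk (r x)))
    (h4 : ∀ x, θik (pk x) = pi x + tmulBy t (Mik (r x))) (a : C) :
    cijk (f a) = Mjk a - Mik a + Mij a := by
  obtain ⟨x, rfl⟩ := hr a
  apply h.tmulBy_injective
  have e := h1 (pk x)
  rw [h3, map_add, h2, h4, hij.map_tmulBy h, hpk] at e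
  simp only [map_add, map_sub]
  linear_combination - e

include hb h hli hij hr hbr hpi hpj in
-- Here the relation between `lj` and `li` is evaluated on a pair `pj x`, `pj y`. The products of
-- two errors disappear because `t ⊗ O` reduces to zero.
lemma push_bracket_error
    (h1 : ∀ x y, θij (lj x y) = li (θij x) (θij y) + tmulBy t (Lij (augm O A' x) (augm O A' y)))
    (h2 : ∀ x, θij (pj x) = pi x + tmulBy t (Mij (r x)))
    (h3 : ∀ x y, li (pi x) (pi y) = pi (brS x y) + tmulBy t (Ni (r x) (r y)))
    (h4 : ∀ x y, lj (pj x) (pj y) = pj (brS x y) + tmulBy t (Nj (r x) (r y))) (a b : C) :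
    Lij (f a) (f b) =
      Nj a b - Ni a b - (br (Mij a) (f b) - br (Mij b) (f a) - Mij (brC a b)) := by
  obtain ⟨x, rfl⟩ := hr a
  obtain ⟨y, rfl⟩ := hr b
  apply h.tmulBy_injective
  have e := h1 (pj x) (pj y)
  rw [h4, map_add, h2, h2, h2, hij.map_tmulBy h] at e
  simp only [hli.add_left, hli.add_right, hli.tmulBy_left h, hli.tmulBy_right hb h, hpi, hpj,
    h.augm_tmulBy, hb.zero_right, map_zero, h3, hbr] at e
  simp only [map_sub, map_neg, hb.skew (Mij (r y))]
  linear_combination - e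

include h hli hr hbr hpi in
-- The bracket of `S` does satisfy the Jacobi identity, so the Jacobiator of `li` on the image of
-- `pi` is expressed by the failure `Ni` of `pi` to preserve brackets.
lemma push_jacobi_error
    (h2 : ∀ x y z, jacobiator li x y z = tmulBy t (Ji (augm O A' x) (augm O A' y) (augm O A' z)))
    (h3 : ∀ x y, li (pi x) (pi y) = pi (brS x y) + tmulBy t (Ni (r x) (r y)))
    (hN : ∀ a b, Ni a b = -Ni b a) (hN' : ∀ a b, Ni (-a) b = -Ni a b)
    (hbC : ∀ a b, brC a b = -brC b a) (hb : IsBiderivation br)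
    (hj : ∀ x y z, jacobiator brS x y z = 0)
    (a b c : C) : Ji (f a) (f b) (f c) = (br (Ni b c) (f a) - br (Ni a c) (f b) + br (Ni a b) (f c)) +
      (Ni (brC a b) c - Ni (brC a c) b + Ni (brC b c) a) := by
  obtain ⟨x, rfl⟩ := hr a
  obtain ⟨y, rfl⟩ := hr b
  obtain ⟨z, rfl⟩ := hr c
  apply h.tmulBy_injective
  have e := h2 (pi x) (pi y) (pi z)
  have e' := congrArg pi (hj x y z)
  simp only [jacobiator, h3, hli.add_left, hli.tmulBy_left h, hpi, hbr, map_add, map_zero] at e e'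
  rw [hN (r x) (r z), hbC (r x) (r z), hN', hb.neg_left]
  simp only [map_add, map_sub, map_neg]
  linear_combination - e + e'

end PushErrors

section Modify

variable {br : O → O → O} (hb : IsBiderivation br) (h : IsSmallExtension φ t)

/-- The correction of a ring homomorphism to `A' ⊗ O` by a derivation. -/
def IsSmallExtension.modifyHom (h : IsSmallExtension φ t) {S C : Type*} [CommRing S] [CommRing C]
    (p : S →+* A'.carrier ⊗[k] O) (r : S →+* C) (f : C →+* O)
    (hp : ∀ x, augm O A' (p x) = f (r x)) (w : C → O) (hadd : ∀ a b, w (a + b) = w a + w b)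
    (hmul : ∀ a b, w (a * b) = f a * w b + f b * w a) : S →+* A'.carrier ⊗[k] O where
  toFun x := p x - tmulBy t (w (r x))
  map_one' := by
    have := hmul 1 1
    simp only [map_one, one_mul, left_eq_add] at this
    rw [map_one, map_one, this, map_zero, sub_zero]
  map_zero' := by
    have := hadd 0 0
    simp only [add_zero, left_eq_add] at this
    rw [map_zero, map_zero, this, map_zero, sub_zero]
  map_add' x y := by
    rw [map_add, map_add, hadd, map_add]; ring
  map_mul' x y := by
    rw [map_mul, map_mul, hmul, map_add, sub_mul, mul_sub, mul_sub, h.mul_tmulBy, h.tmulBy_mul,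
      h.tmulBy_mul, hp, hp, h.augm_tmulBy, mul_zero, map_zero, mul_comm (w (r x))]
    ring

lemma IsSmallExtension.modifyHom_apply (h : IsSmallExtension φ t) {S C : Type*} [CommRing S]
    [CommRing C] (p : S →+* A'.carrier ⊗[k] O) (r : S →+* C) (f : C →+* O)
    (hp : ∀ x, augm O A' (p x) = f (r x)) (w : C → O) (hadd : ∀ a b, w (a + b) = w a + w b)
    (hmul : ∀ a b, w (a * b) = f a * w b + f b * w a) (x : S) :
    h.modifyHom p r f hp w hadd hmul x = p x - tmulBy t (w (r x)) := rfl

/-- The correction of a bracket on `A' ⊗ O` by a bivector. -/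
def modifyBracket (t : A'.carrier)
    (l : A'.carrier ⊗[k] O → A'.carrier ⊗[k] O → A'.carrier ⊗[k] O) (v : O → O → O)
    (x y : A'.carrier ⊗[k] O) : A'.carrier ⊗[k] O :=
  l x y - tmulBy t (v (augm O A' x) (augm O A' y))

include h in
lemma IsBracketLift.modifyBracket
    {l : A'.carrier ⊗[k] O → A'.carrier ⊗[k] O → A'.carrier ⊗[k] O} (hl : IsBracketLift br l)
    {v : O → O → O} (hv : IsBiderivation v) (hv0 : ∀ (c : k) b, v (algebraMap k O c) b = 0) :
    IsBracketLift br (modifyBracket t l v) where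
  add_left x y z := by
    simp only [PoissonDef.modifyBracket, hl.add_left, map_add, hv.add_left]; ring
  skew x y := by
    simp only [PoissonDef.modifyBracket, hl.skew x y, hv.skew (augm O A' x), map_neg]; ring
  mul_left x y z := by
    simp only [PoissonDef.modifyBracket, hl.mul_left, map_mul, hv.mul_left, map_add, mul_sub,
      h.mul_tmulBy]
    ring
  inl_left a y := by
    simp only [PoissonDef.modifyBracket, hl.inl_left, augm_inl, hv0, map_zero, sub_zero]
  augm_lam x y := by
    simp only [PoissonDef.modifyBracket, map_sub, hl.augm_lam, h.augm_tmulBy, sub_zero]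

end Modify

end Lifts

end

end PoissonDef
namespace PoissonDef
open TensorProduct

noncomputable section

/-! ### Vanishing of the errors after correction -/

section Corrected

variable {k : Type u} [Field k] {A A' : ArtAlg k} {O : Type u} [CommRing O] [Algebra k O]
  {φ : A'.carrier →ₐ[k] A.carrier} {t : A'.carrier}
  {br : O → O → O} (hb : IsBiderivation br) (h : IsSmallExtension φ t)
  {li lj : A'.carrier ⊗[k] O → A'.carrier ⊗[k] O → A'.carrier ⊗[k] O}
  (hli : IsBracketLift br li) (hlj : IsBracketLift br lj)
  {θij θjk θik : A'.carrier ⊗[k] O →+* A'.carrier ⊗[k] O}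
  (hij : IsTwist θij) (hjk : IsTwist θjk)
  {cijk uij ujk uik : O → O} {Lij vi vj : O → O → O} {Ji : O → O → O → O}

include h hij hjk in
-- Correcting the twists by `u` subtracts from `c` the Čech coboundary of `u`; terms of second order
-- in the corrections vanish. The next lemmas do the same in the other bidegrees.
lemma corrected_twist
    (h1 : ∀ x, θij (θjk x) = θik x + tmulBy t (cijk (augm O A' x)))
    (hc : ∀ a, cijk a = ujk a - uik a + uij a) (x : A'.carrier ⊗[k] O) :
    θij (θjk x - tmulBy t (ujk (augm O A' x))) - tmulBy t
        (uij (augm O A' (θjk x - tmulBy t (ujk (augm O A' x))))) =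
      θik x - tmulBy t (uik (augm O A' x)) := by
  simp only [map_sub, h1, hij.map_tmulBy h, h.augm_tmulBy, sub_zero, hjk.augm_map, hc, map_add]
  ring

include hb h hli hij hlj in
lemma corrected_bracket
    (h1 : ∀ x y, θij (lj x y) = li (θij x) (θij y) + tmulBy t (Lij (augm O A' x) (augm O A' y)))
    (hL : ∀ a b, Lij a b = vj a b - vi a b - (br (uij a) b - br (uij b) a - uij (br a b)))
    (x y : A'.carrier ⊗[k] O) :
    θij (modifyBracket t lj vj x y) - tmulBy t (uij (augm O A' (modifyBracket t lj vj x y))) =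
      modifyBracket t li vi (θij x - tmulBy t (uij (augm O A' x)))
        (θij y - tmulBy t (uij (augm O A' y))) := by
  simp only [modifyBracket, map_sub, h1, hij.map_tmulBy h, h.augm_tmulBy, sub_zero, hij.augm_map,
    hL, hli.sub_left, hli.sub_right, hli.tmulBy_left h, hli.tmulBy_right hb h, hlj.augm_lam,
    hb.zero_right, map_zero, hb.skew (uij (augm O A' y)), map_neg]
  ring

include hb h hli in
lemma corrected_jacobi
    (h2 : ∀ x y z, jacobiator li x y z = tmulBy t (Ji (augm O A' x) (augm O A' y) (augm O A' z)))
    (hv : IsBiderivation vi)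
    (hJ : ∀ a b c, Ji a b c = (br (vi b c) a - br (vi a c) b + br (vi a b) c) +
      (vi (br a b) c - vi (br a c) b + vi (br b c) a))
    (x y z : A'.carrier ⊗[k] O) : jacobiator (modifyBracket t li vi) x y z = 0 := by
  have e := h2 x y z
  simp only [jacobiator] at e
  simp only [jacobiator, modifyBracket, map_sub, h.augm_tmulBy, sub_zero, hli.augm_lam,
    hli.sub_left, hli.tmulBy_left h]
  rw [hJ, hv.skew (augm O A' x) (augm O A' z), hb.neg_left, hb.skew (augm O A' x) (augm O A' z),
    hv.neg_left] at e
  simp only [map_add, map_sub, map_neg] at e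
  linear_combination e

variable {S C : Type*} [CommRing S] [CommRing C] {r : S →+* C}
  {f : C →+* O} {brS : S → S → S} {brC : C → C → C}
  (hbr : ∀ x y, r (brS x y) = brC (r x) (r y))
  {pi pj : S →+* A'.carrier ⊗[k] O} (hpi : ∀ x, augm O A' (pi x) = f (r x))
  (hpj : ∀ x, augm O A' (pj x) = f (r x))
  {Mij wi wj : C → O} {Ni : C → C → O}

include h hij hpj in
lemma corrected_push_twist
    (h2 : ∀ x, θij (pj x) = pi x + tmulBy t (Mij (r x)))
    (hM : ∀ a, Mij a = uij (f a) + (wj a - wi a)) (x : S) :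
    θij (pj x - tmulBy t (wj (r x))) - tmulBy t (uij (augm O A' (pj x - tmulBy t (wj (r x))))) =
      pi x - tmulBy t (wi (r x)) := by
  simp only [map_sub, h2, hij.map_tmulBy h, h.augm_tmulBy, sub_zero, hpj, hM, map_add]
  ring

include hb h hli hpi hbr in
lemma corrected_push_bracket
    (h3 : ∀ x y, li (pi x) (pi y) = pi (brS x y) + tmulBy t (Ni (r x) (r y)))
    (hN : ∀ a b, Ni a b = vi (f a) (f b) + (br (wi a) (f b) - br (wi b) (f a) - wi (brC a b)))
    (x y : S) :
    modifyBracket t li vi (pi x - tmulBy t (wi (r x))) (pi y - tmulBy t (wi (r y))) =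
      pi (brS x y) - tmulBy t (wi (r (brS x y))) := by
  simp only [modifyBracket, map_sub, h3, h.augm_tmulBy, sub_zero, hpi, hN, map_add, hbr,
    hli.sub_left, hli.sub_right, hli.tmulBy_left h, hli.tmulBy_right hb h, hb.zero_right, map_zero,
    hb.skew (wi (r y)), map_neg]
  ring

end Corrected

/-! ### Lifting a bracket along a linear section of `A' → A` -/

section BracketLift

variable {k : Type u} [Field k] {A A' : ArtAlg k} {O : Type u} [CommRing O] [Algebra k O]

/-- The `A'`-bilinear extension of a `k`-bilinear map `O × O → A' ⊗ O`. -/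
def bilinExtend (d : O →ₗ[k] O →ₗ[k] A'.carrier ⊗[k] O) :
    A'.carrier ⊗[k] O →ₗ[A'.carrier] A'.carrier ⊗[k] O →ₗ[A'.carrier] A'.carrier ⊗[k] O :=
  LinearMap.liftBaseChange A'.carrier
    (((LinearMap.liftBaseChangeEquiv A'.carrier).toLinearMap.restrictScalars k).comp d)

lemma bilinExtend_tmul (d : O →ₗ[k] O →ₗ[k] A'.carrier ⊗[k] O) (a b : A'.carrier) (x y : O) :
    bilinExtend d (a ⊗ₜ x) (b ⊗ₜ y) = inl a * (inl b * d x y) := by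
  simp only [bilinExtend, LinearMap.liftBaseChange_tmul, LinearMap.smul_apply, LinearMap.comp_apply]
  change a • b • d x y = _
  simp only [Algebra.smul_def]
  rfl

lemma bilinExtend_isBiderivation {d : O →ₗ[k] O →ₗ[k] A'.carrier ⊗[k] O}
    (hskew : ∀ x y, d x y = -d y x) (hmul : ∀ x y z, d (x * y) z = inr x * d y z + inr y * d x z) :
    IsBiderivation (fun x y => bilinExtend d x y) where
  add_left x y z := by simp only [map_add, LinearMap.add_apply]
  skew x y := by
    induction x with
    | zero => simp
    | add x x' hx hx' => simp only [map_add, LinearMap.add_apply, hx, hx', neg_add]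
    | tmul a x =>
      induction y with
      | zero => simp
      | add y y' hy hy' => simp only [map_add, LinearMap.add_apply, hy, hy', neg_add]
      | tmul b y => simp only [bilinExtend_tmul]; rw [hskew]; ring
  mul_left x y z := by
    induction x with
    | zero => simp
    | add x x' hx hx' =>
      simp only [add_mul, map_add, LinearMap.add_apply, hx, hx']; ring
    | tmul a x =>
      induction y with
      | zero => simp
      | add y y' hx hx' =>
          simp only [mul_add, add_mul, map_add, LinearMap.add_apply, hx, hx']; ring
      | tmul b y =>
        induction z with
        | zero => simp
        | add z z' hx hx' =>
              simp only [map_add, hx, hx']; ring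
        | tmul c z =>
          simp only [Algebra.TensorProduct.tmul_mul_tmul, bilinExtend_tmul, hmul, map_mul]
          rw [← inl_mul_inr a x, ← inl_mul_inr b y]
          ring

lemma bilinExtend_inl_left {d : O →ₗ[k] O →ₗ[k] A'.carrier ⊗[k] O}
    (hmul : ∀ x y z, d (x * y) z = inr x * d y z + inr y * d x z) (a y) :
    bilinExtend d (inl a) y = 0 := by
  have h1 : ∀ z, d 1 z = 0 := fun z => by
    have := hmul 1 1 z
    rwa [mul_one, RingHom.map_one, one_mul, left_eq_add] at this
  induction y with
  | zero => simp
  | add y y' hx hx' => rw [map_add, hx, hx', add_zero]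
  | tmul b y =>
    change bilinExtend d (a ⊗ₜ 1) _ = 0
    rw [bilinExtend_tmul, h1, mul_zero, mul_zero]

/-- A map out of `(A' ⊗ O)²` which is additive and linear over the base in both variables is
determined by its values on `O`. -/
lemma eq_of_biadditive {M : Type*} [CommRing M] (b : A'.carrier →+* M)
    (E E' : A'.carrier ⊗[k] O → A'.carrier ⊗[k] O → M)
    (h1 : ∀ x y z, E (x + y) z = E x z + E y z) (h2 : ∀ x y z, E x (y + z) = E x y + E x z)
    (h3 : ∀ a x y, E (inl a * x) y = b a * E x y) (h4 : ∀ a x y, E x (inl a * y) = b a * E x y)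
    (h1' : ∀ x y z, E' (x + y) z = E' x z + E' y z) (h2' : ∀ x y z, E' x (y + z) = E' x y + E' x z)
    (h3' : ∀ a x y, E' (inl a * x) y = b a * E' x y) (h4' : ∀ a x y, E' x (inl a * y) = b a * E' x y)
    (h : ∀ x y, E (inr x) (inr y) = E' (inr x) (inr y)) (x y) : E x y = E' x y := by
  induction x with
  | zero =>
    have e := h3 0 0 y
    have e' := h3' 0 0 y
    simp only [map_zero, mul_zero, zero_mul] at e e'
    rw [e, e']
  | add x x' hx hx' => rw [h1, h1', hx, hx']
  | tmul a x =>
    induction y with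
    | zero =>
      have e := h4 0 (a ⊗ₜ x) 0
      have e' := h4' 0 (a ⊗ₜ x) 0
      simp only [map_zero, mul_zero, zero_mul] at e e'
      rw [e, e']
    | add y y' hy hy' => rw [h2, h2', hy, hy']
    | tmul b y => rw [← inl_mul_inr, ← inl_mul_inr, h3, h4, h3', h4', h]

section Transport

variable {φ : A'.carrier →ₐ[k] A.carrier} {G : Type u} [CommRing G] (a : A.carrier →+* G)
  (τ : O →+* G) (h : ∀ c : k, a (algebraMap k _ c) = τ (algebraMap k O c))
  (s : A.carrier →ₗ[k] A'.carrier)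

/-- The `O`-linear map `A ⊗ O → A' ⊗ O` given by a `k`-linear map `A → A'`. -/
def sectionMap : A.carrier ⊗[k] O →ₗ[k] A'.carrier ⊗[k] O := LinearMap.rTensor O s

/-- The section `s` is only `k`-linear, not multiplicative. Linearity over `O` is all that the
Leibniz rule of the lifted bracket requires. -/
lemma sectionMap_inr_mul (o : O) (x : A.carrier ⊗[k] O) :
    sectionMap s (inr o * x) = inr o * sectionMap s x := by
  induction x with
  | zero => simp
  | add x y hx hy => rw [mul_add, map_add, hx, hy, map_add, mul_add]
  | tmul x y => simp [sectionMap]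

lemma tlift_comp_sectionMap (hs : ∀ x, φ (s x) = x)
    (h' : ∀ c : k, a.comp (φ : A'.carrier →+* A.carrier) (algebraMap k _ c) = τ (algebraMap k O c))
    (x : A.carrier ⊗[k] O) :
    tlift (a.comp (φ : A'.carrier →+* A.carrier)) τ h' (sectionMap s x) = tlift a τ h x := by
  induction x with
  | zero => simp
  | add x y hx hy => rw [map_add, map_add, hx, hy, map_add]
  | tmul x y => simp [sectionMap, hs]

variable {a τ h} (he : Function.Bijective (tlift a τ h)) (brG : G → G → G) (hG : IsBiderivation brG)
  (hGa : ∀ x y, brG (a x) y = 0)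

/-- The inverse of the trivialization, followed by the linear lift to `A' ⊗ O`. -/
def trivLift (g : G) : A'.carrier ⊗[k] O :=
  sectionMap s ((RingEquiv.ofBijective _ he).symm g)

lemma trivLift_add (x y : G) : trivLift s he (x + y) = trivLift s he x + trivLift s he y := by
  simp only [trivLift, map_add]

lemma trivLift_mul (o : O) (y : G) : trivLift s he (τ o * y) = inr o * trivLift s he y := by
  have : (RingEquiv.ofBijective _ he).symm (τ o) = inr o := by
    rw [RingEquiv.symm_apply_eq]
    change τ o = tlift a τ h (1 ⊗ₜ o)
    rw [tlift_tmul, map_one, one_mul]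
  rw [trivLift, map_mul, this, sectionMap_inr_mul]
  rfl

include hG hGa in
lemma bracket_mul_left (c : A.carrier) (x y : G) : brG (a c * x) y = a c * brG x y := by
  rw [hG.mul_left, hGa, mul_zero, add_zero]

/-- The bilinear map `O × O → A' ⊗ O` obtained from a bracket on `G`. -/
def bracketForm : O →ₗ[k] O →ₗ[k] A'.carrier ⊗[k] O :=
  have hsm : ∀ (c : k) (g : G), trivLift s he (τ (algebraMap k O c) * g) = c • trivLift s he g :=
    fun c g => by rw [trivLift_mul, Algebra.smul_def]; simp [inr, Algebra.TensorProduct.algebraMap_apply]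
  LinearMap.mk₂ k (fun x y => trivLift s he (brG (τ x) (τ y)))
    (fun x y z => by rw [map_add, hG.add_left, trivLift_add])
    (fun c x y => by
      rw [Algebra.smul_def, map_mul, ← h, bracket_mul_left brG hG hGa, h, hsm])
    (fun x y z => by rw [map_add, hG.add_right, trivLift_add])
    (fun c x y => by
      rw [Algebra.smul_def, map_mul, ← h, hG.mul_right, hG.skew _ (a _), hGa, neg_zero, mul_zero,
        add_zero, h, hsm])

lemma bracketForm_apply (x y : O) :
    bracketForm s he brG hG hGa x y = trivLift s he (brG (τ x) (τ y)) := rfl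

/-- The lift of a bracket on `G` to `A' ⊗ O`. -/
def liftBracket (x y : A'.carrier ⊗[k] O) : A'.carrier ⊗[k] O :=
  bilinExtend (bracketForm s he brG hG hGa) x y

lemma bracketForm_mul (x y z : O) : bracketForm s he brG hG hGa (x * y) z =
    inr x * bracketForm s he brG hG hGa y z + inr y * bracketForm s he brG hG hGa x z := by
  simp only [bracketForm_apply, map_mul, hG.mul_left, trivLift_add, trivLift_mul]

lemma liftBracket_isBiderivation : IsBiderivation (liftBracket s he brG hG hGa) :=
  bilinExtend_isBiderivation (fun x y => by
    have h0 : ∀ g, trivLift s he (-g) = -trivLift s he g := fun g => by simp [trivLift]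
    rw [bracketForm_apply, hG.skew, h0, bracketForm_apply]) (bracketForm_mul s he brG hG hGa)

lemma liftBracket_inl_left (c : A'.carrier) (y) : liftBracket s he brG hG hGa (inl c) y = 0 :=
  bilinExtend_inl_left (bracketForm_mul s he brG hG hGa) c y

lemma liftBracket_inr_inr (x y : O) :
    liftBracket s he brG hG hGa (inr x) (inr y) = trivLift s he (brG (τ x) (τ y)) := by
  change bilinExtend _ (1 ⊗ₜ x) (1 ⊗ₜ y) = _
  rw [bilinExtend_tmul, map_one, one_mul, one_mul, bracketForm_apply]

lemma liftBracket_inl_mul_left (c : A'.carrier) (x y) : liftBracket s he brG hG hGa (inl c * x) y =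
    inl c * liftBracket s he brG hG hGa x y := by
  rw [(liftBracket_isBiderivation s he brG hG hGa).mul_left, liftBracket_inl_left, mul_zero, add_zero]

lemma liftBracket_inl_mul_right (c : A'.carrier) (x y) : liftBracket s he brG hG hGa x (inl c * y) =
    inl c * liftBracket s he brG hG hGa x y := by
  have H := liftBracket_isBiderivation s he brG hG hGa
  rw [H.skew, liftBracket_inl_mul_left, H.skew y]; ring

/-- Both sides are biadditive and linear over `A'`, so it suffices to compare them on `O`, where the
statement is that `s` is a section of `φ`. -/
lemma tlift_liftBracket (hs : ∀ x, φ (s x) = x)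
    (h' : ∀ c : k, a.comp (φ : A'.carrier →+* A.carrier) (algebraMap k _ c) = τ (algebraMap k O c))
    (x y : A'.carrier ⊗[k] O) :
    tlift (a.comp (φ : A'.carrier →+* A.carrier)) τ h' (liftBracket s he brG hG hGa x y) =
      brG (tlift (a.comp (φ : A'.carrier →+* A.carrier)) τ h' x)
        (tlift (a.comp (φ : A'.carrier →+* A.carrier)) τ h' y) := by
  have H := liftBracket_isBiderivation s he brG hG hGa
  have hp : ∀ c, tlift (a.comp (φ : A'.carrier →+* A.carrier)) τ h' (inl c) = a (φ c) := fun c => by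
    change tlift _ τ h' (c ⊗ₜ 1) = _
    rw [tlift_tmul, map_one, mul_one]; rfl
  have hp' : ∀ c, tlift (a.comp (φ : A'.carrier →+* A.carrier)) τ h' (inr c) = τ c := fun c => by
    change tlift _ τ h' (1 ⊗ₜ c) = _
    rw [tlift_tmul, map_one, one_mul]
  refine eq_of_biadditive (a.comp (φ : A'.carrier →+* A.carrier))
    (fun x y => tlift (a.comp (φ : A'.carrier →+* A.carrier)) τ h' (liftBracket s he brG hG hGa x y))
    (fun x y => brG (tlift (a.comp (φ : A'.carrier →+* A.carrier)) τ h' x)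
        (tlift (a.comp (φ : A'.carrier →+* A.carrier)) τ h' y)) ?_ ?_ ?_ ?_ ?_ ?_ ?_ ?_ ?_ x y
  · intro x y z; simp only [H.add_left, map_add]
  · intro x y z; simp only [H.add_right, map_add]
  · intro c x y; simp only [liftBracket_inl_mul_left, map_mul, hp]; rfl
  · intro c x y; simp only [liftBracket_inl_mul_right, map_mul, hp]; rfl
  · intro x y z; simp only [hG.add_left, map_add]
  · intro x y z; simp only [hG.add_right, map_add]
  · intro c x y; simp only [map_mul, hp, bracket_mul_left brG hG hGa]; rfl
  · intro c x y
    simp only [map_mul, hp, hG.mul_right, hG.skew _ (a _), hGa, neg_zero, mul_zero, add_zero]; rfl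
  · intro x y
    simp only [liftBracket_inr_inr, hp']
    rw [trivLift, tlift_comp_sectionMap a τ h s hs h']
    exact (RingEquiv.ofBijective _ he).apply_symm_apply _

/-- Naturality of the lift of a bracket. -/
lemma liftBracket_natural {O₁ G₁ : Type u} [CommRing O₁] [Algebra k O₁] [CommRing G₁]
    {a₁ : A.carrier →+* G₁} {τ₁ : O₁ →+* G₁} {h₁ : ∀ c : k, a₁ (algebraMap k _ c) = τ₁ (algebraMap k O₁ c)}
    (he₁ : Function.Bijective (tlift a₁ τ₁ h₁)) (brG₁ : G₁ → G₁ → G₁) (hG₁ : IsBiderivation brG₁)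
    (hGa₁ : ∀ x y, brG₁ (a₁ x) y = 0) (ρ : O →ₐ[k] O₁) (ρG : G →+* G₁)
    (ha : ∀ x, ρG (a x) = a₁ x) (hτ : ∀ x, ρG (τ x) = τ₁ (ρ x))
    (hbr : ∀ x y, ρG (brG x y) = brG₁ (ρG x) (ρG y))
    (x y : A'.carrier ⊗[k] O) :
    Algebra.TensorProduct.map (AlgHom.id k A'.carrier) ρ (liftBracket s he brG hG hGa x y) =
      liftBracket s he₁ brG₁ hG₁ hGa₁ (Algebra.TensorProduct.map (AlgHom.id k A'.carrier) ρ x)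
        (Algebra.TensorProduct.map (AlgHom.id k A'.carrier) ρ y) := by
  have H := liftBracket_isBiderivation s he brG hG hGa
  have H₁ := liftBracket_isBiderivation s he₁ brG₁ hG₁ hGa₁
  have hl : ∀ c : A'.carrier, Algebra.TensorProduct.map (AlgHom.id k A'.carrier) ρ (inl c) = inl c :=
    fun c => by simp [inl]
  have hr : ∀ c : O, Algebra.TensorProduct.map (AlgHom.id k A'.carrier) ρ (inr c) = inr (ρ c) :=
    fun c => by simp [inr]
  -- The same linear section `s` of `φ` serves on every open subset, which makes the lift compatible
  -- with restriction.
  have key : ∀ g, Algebra.TensorProduct.map (AlgHom.id k A'.carrier) ρ (trivLift s he g) =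
      trivLift s he₁ (ρG g) := by
    intro g
    obtain ⟨z, rfl⟩ := he.2 g
    have e1 : ρG (tlift a τ h z) =
        tlift a₁ τ₁ h₁ (Algebra.TensorProduct.map (AlgHom.id k A.carrier) ρ z) := by
      induction z with
      | zero => simp
      | add x y hx hy => simp only [map_add, hx, hy]
      | tmul x y => simp [ha, hτ]
    have e2 : (RingEquiv.ofBijective _ he).symm (tlift a τ h z) = z :=
      (RingEquiv.ofBijective _ he).symm_apply_apply z
    have e3 : ∀ w, (RingEquiv.ofBijective _ he₁).symm (tlift a₁ τ₁ h₁ w) = w :=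
      (RingEquiv.ofBijective _ he₁).symm_apply_apply
    rw [e1, trivLift, trivLift, e2, e3]
    clear e1 e2
    induction z with
    | zero => simp
    | add x y hx hy => simp only [map_add, hx, hy]
    | tmul x y => simp [sectionMap]
  refine eq_of_biadditive inl
    (fun x y => Algebra.TensorProduct.map (AlgHom.id k A'.carrier) ρ (liftBracket s he brG hG hGa x y))
    (fun x y => liftBracket s he₁ brG₁ hG₁ hGa₁ (Algebra.TensorProduct.map (AlgHom.id k A'.carrier) ρ x)
        (Algebra.TensorProduct.map (AlgHom.id k A'.carrier) ρ y)) ?_ ?_ ?_ ?_ ?_ ?_ ?_ ?_ ?_ x y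
  · intro x y z; simp only [H.add_left, map_add]
  · intro x y z; simp only [H.add_right, map_add]
  · intro c x y; simp only [liftBracket_inl_mul_left, map_mul, hl]
  · intro c x y; simp only [liftBracket_inl_mul_right, map_mul, hl]
  · intro x y z; simp only [H₁.add_left, map_add]
  · intro x y z; simp only [H₁.add_right, map_add]
  · intro c x y; simp only [liftBracket_inl_mul_left, map_mul, hl]
  · intro c x y; simp only [liftBracket_inl_mul_right, map_mul, hl]
  · intro x y
    simp only [liftBracket_inr_inr, hr, key, hbr, hτ]

end Transport

end BracketLift

end

end PoissonDef
namespace PoissonDef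
open TensorProduct

noncomputable section

/-! ### Restriction, comorphisms and gluing of sections -/

section Sections

variable {X Y Z : Scheme.{u}}

lemma res_res {U U' U'' : X.Opens} (h : U' ≤ U) (h' : U'' ≤ U') (a : Γ(X, U)) :
    res h' (res h a) = res (h'.trans h) a := by
  change (X.presheaf.map (homOfLE h).op ≫ X.presheaf.map (homOfLE h').op).hom a = _
  rw [← Functor.map_comp]; rfl

lemma res_self {U : X.Opens} (h : U ≤ U) (a : Γ(X, U)) : res h a = a := by
  have : (homOfLE h).op = 𝟙 _ := rfl
  rw [res, this, X.presheaf.map_id]; rfl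

lemma res_comorph (f : X ⟶ Y) {V : Y.Opens} {U U' : X.Opens} (h : U ≤ f ⁻¹ᵁ V) (h' : U' ≤ U)
    (a : Γ(Y, V)) : res h' (comorph f V U h a) = comorph f V U' (h'.trans h) a :=
  congrArg (fun g => g.hom a) (f.appLE_map h (homOfLE h').op)

lemma comorph_res' (f : X ⟶ Y) {V V' : Y.Opens} {U : X.Opens} (h' : V' ≤ V) (h : U ≤ f ⁻¹ᵁ V')
    (a : Γ(Y, V)) : comorph f V' U h (res h' a) = comorph f V U (h.trans (f.preimage_mono h')) a :=
  congrArg (fun g => g.hom a) (f.map_appLE h (homOfLE h').op)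

lemma comorph_comorph (f : X ⟶ Y) (g : Y ⟶ Z) {W : Z.Opens} {V : Y.Opens} {U : X.Opens}
    (h : V ≤ g ⁻¹ᵁ W) (h' : U ≤ f ⁻¹ᵁ V) (a : Γ(Z, W)) :
    comorph f V U h' (comorph g W V h a) =
      comorph (f ≫ g) W U (h'.trans (f.preimage_mono h)) a :=
  congrArg (fun g => g.hom a) (Scheme.Hom.appLE_comp_appLE f g W V U h h')

lemma comorph_id {U V : X.Opens} (h : V ≤ 𝟙 X ⁻¹ᵁ U) (a : Γ(X, U)) : comorph (𝟙 X) U V h a = res h a := by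
  have : (𝟙 X : X ⟶ X).appLE U V h = X.presheaf.map (homOfLE h).op := by
    rw [Scheme.Hom.appLE, Scheme.Hom.id_app]; exact Category.id_comp _
  rw [comorph, this]; rfl

lemma comorph_app (f : X ⟶ Y) (V : Y.Opens) (h) (a : Γ(Y, V)) :
    comorph f V (f ⁻¹ᵁ V) h a = f.app V a := by
  rw [comorph, Scheme.Hom.appLE_eq_app]

lemma section_ext {U : X.Opens} {x y : Γ(X, U)}
    (h : ∀ p ∈ U, ∃ (W : X.Opens) (hW : W ≤ U), p ∈ W ∧ res hW x = res hW y) : x = y := by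
  choose W hW hp he using h
  exact X.sheaf.eq_of_locally_eq' (fun p : U => W p.1 p.2) U (fun p => homOfLE (hW p.1 p.2))
    (fun p hpU => TopologicalSpace.Opens.mem_iSup.mpr ⟨⟨p, hpU⟩, hp p hpU⟩) x y
    (fun p => he p.1 p.2)

/-- Agreement is asked only near each common point, so the lemma applies to families of affine open
subsets that are not closed under intersection. -/
lemma exists_glue {ι : Type*} {U : X.Opens} (W : ι → X.Opens) (hW : ∀ i, W i ≤ U)
    (hcov : ∀ p ∈ U, ∃ i, p ∈ W i) (s : ∀ i, Γ(X, W i))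
    (hs : ∀ i j, ∀ p ∈ W i, p ∈ W j → ∃ (V : X.Opens) (hi : V ≤ W i) (hj : V ≤ W j), p ∈ V ∧
      res hi (s i) = res hj (s j)) : ∃ x : Γ(X, U), ∀ i, res (hW i) x = s i := by
  -- The cover is reindexed by the points of `U`, which puts the index type in the universe of `X`.
  choose c hc using hcov
  have hcomp : TopCat.Presheaf.IsCompatible X.sheaf.1 (fun p : U => W (c p.1 p.2))
      (fun p => s (c p.1 p.2)) := by
    intro p q
    refine section_ext (X := X) (x := res inf_le_left (s _)) (y := res inf_le_right (s _)) ?_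
    rintro z ⟨hz, hz'⟩
    obtain ⟨V, hi, hj, hV, e⟩ := hs _ _ z hz hz'
    refine ⟨V, le_inf hi hj, hV, ?_⟩
    rw [res_res, res_res, e]
  obtain ⟨x, hx, -⟩ := X.sheaf.existsUnique_gluing' (fun p : U => W (c p.1 p.2)) U
    (fun p => homOfLE (hW _)) (fun p hpU => TopologicalSpace.Opens.mem_iSup.mpr ⟨⟨p, hpU⟩, hc p hpU⟩)
    (fun p => s (c p.1 p.2)) hcomp
  refine ⟨x, fun i => section_ext (y := s i) fun p hp => ?_⟩
  have hpU := hW i hp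
  obtain ⟨V, hi, hj, hV, e⟩ := hs i (c p hpU) p hp (hc p hpU)
  refine ⟨V, hi, hV, ?_⟩
  rw [e]
  exact (res_res (X := X) (hW i) hi x).trans ((res_res (X := X) (hW _) hj x).symm.trans
    (congrArg (res hj) (hx ⟨p, hpU⟩)))

lemma exists_affine_mem_le {U : X.Opens} {p : X} (hp : p ∈ U) :
    ∃ W : X.Opens, IsAffineOpen W ∧ p ∈ W ∧ W ≤ U := by
  obtain ⟨_, ⟨W, hW, rfl⟩, hpW, hWU⟩ := X.isBasis_affineOpens.exists_subset_of_mem_open hp U.isOpen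
  exact ⟨W, hW, hpW, hWU⟩

end Sections

section ClosedHomeo

variable {Z' Z : Scheme.{u}} (i : Z' ⟶ Z) [Surjective i]

lemma preimage_le_iff {U V : Z.Opens} : i ⁻¹ᵁ U ≤ i ⁻¹ᵁ V ↔ U ≤ V := by
  refine ⟨fun h x hx => ?_, fun h => i.preimage_mono h⟩
  obtain ⟨y, rfl⟩ := i.surjective x
  exact h hx

lemma preimage_injective : Function.Injective (i ⁻¹ᵁ · : Z.Opens → Z'.Opens) := fun _ _ h =>
  le_antisymm ((preimage_le_iff i).mp (le_of_eq h)) ((preimage_le_iff i).mp (le_of_eq h.symm))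

variable [IsClosedImmersion i]

lemma isHomeomorph_of_closed_surjective : IsHomeomorph i :=
  isHomeomorph_iff_isEmbedding_surjective.mpr ⟨i.isClosedEmbedding.isEmbedding, i.surjective⟩

/-- The open subset of `Z` corresponding to an open subset of `Z'`. -/
def imageOpen (V : Z'.Opens) : Z.Opens :=
  ⟨i '' V, (isHomeomorph_of_closed_surjective i).isOpenMap _ V.isOpen⟩

lemma preimage_imageOpen (V : Z'.Opens) : i ⁻¹ᵁ (imageOpen i V) = V :=
  TopologicalSpace.Opens.ext (Set.preimage_image_eq _ i.isClosedEmbedding.injective)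

end ClosedHomeo

end

end PoissonDef
namespace PoissonDef
open TensorProduct

noncomputable section

/-! ### Square-zero thickenings of affine schemes are affine -/

section Thickening

variable {Z' Z : Scheme.{u}} (i : Z' ⟶ Z)

/-- Restriction of functions to the preimage of an open subset. -/
abbrev pre (W : Z.Opens) : Γ(Z, W) →+* Γ(Z', i ⁻¹ᵁ W) := comorph i W (i ⁻¹ᵁ W) le_rfl

lemma basicOpen_pre (W : Z.Opens) (b : Γ(Z, W)) : Z'.basicOpen (pre i W b) = i ⁻¹ᵁ Z.basicOpen b := by
  rw [Scheme.preimage_basicOpen, comorph_app]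

/-- Quasi-coherence of the kernel, by hand: a power of `b` clears the denominator of `d`, and a
further power makes the resulting section reduce to zero on all of `W`. -/
lemma exists_extend_kernel [IsAffineHom i] {W : Z.Opens} (hW : IsAffineOpen W) (b : Γ(Z, W))
    {D : Z.Opens} (hD : D = Z.basicOpen b) (hDW : D ≤ W) (d : Γ(Z, D)) (hd : pre i D d = 0) :
    ∃ (N : ℕ) (e : Γ(Z, W)), pre i W e = 0 ∧ res hDW e = res hDW b ^ N * d := by
  subst hD
  have := hW.isLocalization_basicOpen b
  obtain ⟨n, a, ha⟩ := IsLocalization.Away.surj (S := Γ(Z, Z.basicOpen b)) b d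
  replace ha : d * res hDW b ^ n = res hDW a := ha
  have h1 : res (i.preimage_mono hDW) (pre i W a) = 0 := by
    rw [comorph_res i hDW, ← ha, map_mul, hd, zero_mul]
  obtain ⟨M, hM⟩ := exists_pow_mul_eq_zero_of_res_basicOpen_eq_zero_of_isCompact Z'
    (hW.preimage i).isCompact (pre i W a) (pre i W b) (by
      have hle : Z'.basicOpen (pre i W b) ≤ i ⁻¹ᵁ Z.basicOpen b := (basicOpen_pre i W b).le
      have := congrArg (res hle) h1
      rw [res_res, map_zero] at this
      exact this)
  refine ⟨M + n, b ^ M * a, ?_, ?_⟩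
  · rw [map_mul, map_pow]; exact hM
  · rw [map_mul, map_pow, ← ha]; ring

variable [IsClosedImmersion i] [Surjective i]
  (hsq : ∀ (U : Z.Opens) (x y : Γ(Z, U)), pre i U x = 0 → pre i U y = 0 → x * y = 0)

include hsq in
omit [IsClosedImmersion i] [Surjective i] in
-- The square-zero kernel is a module over the functions on `Z'`: a factor may be exchanged for any
-- other with the same reduction.
lemma mul_eq_mul_of_pre_eq {U : Z.Opens} {x x' y : Γ(Z, U)} (h : pre i U x = pre i U x')
    (hy : pre i U y = 0) : x * y = x' * y := by
  have := hsq U (x - x') y (by rw [map_sub, h, sub_self]) hy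
  rwa [sub_mul, sub_eq_zero] at this

omit [Surjective i] in
lemma pre_surjective {W : Z.Opens} (hW : IsAffineOpen W) : Function.Surjective (pre i W) := by
  intro x
  obtain ⟨y, hy⟩ := i.app_surjective W hW x
  exact ⟨y, (comorph_app i W le_rfl y).trans hy⟩

omit [Surjective i] in
/-- A finite family of affine open subsets adapted to an affine closed subscheme with the same
underlying space. -/
lemma exists_adapted_cover [IsAffine Z'] : ∃ s : Finset Γ(Z', ⊤), Ideal.span (s : Set Γ(Z', ⊤)) = ⊤ ∧
    ∀ h ∈ s, ∃ W : Z.Opens, IsAffineOpen W ∧ i ⁻¹ᵁ W = Z'.basicOpen h := by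
  let H : Set Γ(Z', ⊤) := {h | ∃ W : Z.Opens, IsAffineOpen W ∧ i ⁻¹ᵁ W = Z'.basicOpen h}
  have hspan : Ideal.span H = ⊤ := by
    rw [← (isAffineOpen_top Z').self_le_iSup_basicOpen_iff]
    intro z _
    obtain ⟨W, hW, hz, -⟩ := exists_affine_mem_le (U := ⊤) (p := i z) trivial
    obtain ⟨h, hh, hzh⟩ := (isAffineOpen_top Z').exists_basicOpen_le (V := i ⁻¹ᵁ W) ⟨z, hz⟩ trivial
    obtain ⟨b, hb⟩ := pre_surjective i hW (res le_top h)
    refine TopologicalSpace.Opens.mem_iSup.mpr ⟨⟨h, Z.basicOpen b, hW.basicOpen b, ?_⟩, hzh⟩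
    rw [← basicOpen_pre, hb]
    have := Z'.basicOpen_res h (homOfLE (le_top : i ⁻¹ᵁ W ≤ ⊤)).op
    refine Eq.trans this ?_
    exact inf_eq_right.mpr hh
  obtain ⟨s, hs, hs'⟩ := (Ideal.span_eq_top_iff_finite H).mp hspan
  exact ⟨s, hs', fun h hh => hs hh⟩

include hsq in
-- The obstruction is a class in the first cohomology of the kernel, a quasi-coherent module on the
-- affine scheme `Z'`. Its vanishing is made explicit by a Čech computation with a partition of
-- unity.
theorem exists_global_lift [IsAffine Z'] (c : Γ(Z', ⊤)) :
    ∃ x : Γ(Z, ⊤), comorph i ⊤ ⊤ le_rfl x = c := by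
  obtain ⟨s, hs, hW⟩ := exists_adapted_cover i
  choose W hW hWeq using fun h : s => hW h.1 h.2
  have hcov : ∀ p : Z, ∃ w, p ∈ W w := by
    intro p
    obtain ⟨p, rfl⟩ := i.surjective p
    have := (isAffineOpen_top Z').self_le_iSup_basicOpen_iff.mpr hs (x := p) trivial
    obtain ⟨h, hh⟩ := TopologicalSpace.Opens.mem_iSup.mp this
    refine ⟨h, ?_⟩
    change p ∈ i ⁻¹ᵁ W h
    rw [hWeq h]; exact hh
  choose C hC using fun w => pre_surjective i (hW w) (res le_top c)
  choose b hb using fun w v : s => pre_surjective i (hW v) (res le_top w.1)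
  have hbasic : ∀ w v, W w ⊓ W v = Z.basicOpen (b w v) := fun w v => by
    apply preimage_injective i
    change i ⁻¹ᵁ W w ⊓ i ⁻¹ᵁ W v = i ⁻¹ᵁ Z.basicOpen (b w v)
    rw [← basicOpen_pre, hb]
    have := Z'.basicOpen_res w.1 (homOfLE (le_top : i ⁻¹ᵁ W v ≤ ⊤)).op
    refine Eq.trans ?_ this.symm
    rw [hWeq w, inf_comm]
  -- differences of the local lifts of `c`
  let d : ∀ w v, Γ(Z, W w ⊓ W v) := fun w v => res inf_le_left (C w) - res inf_le_right (C v)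
  have hd : ∀ w v, pre i _ (d w v) = 0 := fun w v => by
    simp only [d, map_sub]
    rw [← comorph_res, ← comorph_res, hC, hC, res_res, res_res, sub_self]
  choose N e he he' using fun w v =>
    exists_extend_kernel i (hW v) (b w v) (hbasic w v) inf_le_right (d w v) (hd w v)
  -- One exponent for all pairs: `e₁ w v` extends `b w v ^ N₀ * d w v` from the overlap to the whole
  -- of `W v`.
  let N₀ := Finset.univ.sup fun p : s × s => N p.1 p.2
  have hN : ∀ w v, N w v ≤ N₀ := fun w v =>
    Finset.le_sup (f := fun p : s × s => N p.1 p.2) (Finset.mem_univ (w, v))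
  let e₁ : ∀ w v, Γ(Z, W v) := fun w v => b w v ^ (N₀ - N w v) * e w v
  have he₁ : ∀ w v, pre i _ (e₁ w v) = 0 := fun w v => by simp only [e₁, map_mul, he, mul_zero]
  have he₁' : ∀ w v, res inf_le_right (e₁ w v) = res inf_le_right (b w v) ^ N₀ * d w v := fun w v => by
    simp only [e₁, map_mul, he', map_pow]
    rw [← mul_assoc, ← pow_add, Nat.sub_add_cancel (hN w v)]
  have hbv : ∀ w v v', pre i (W v ⊓ W v') (res inf_le_left (b w v)) =
      pre i (W v ⊓ W v') (res inf_le_right (b w v')) := fun w v v' => by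
    rw [← comorph_res, ← comorph_res, hb, hb, res_res, res_res]
  have heT : ∀ w v (T : Z.Opens) (hw : T ≤ W w) (hv : T ≤ W v),
      res hv (e₁ w v) = res hv (b w v) ^ N₀ * (res hw (C w) - res hv (C v)) := fun w v T hw hv => by
    have := congrArg (res (le_inf hw hv)) (he₁' w v)
    simpa only [d, map_mul, map_sub, map_pow, res_res] using this
  have hdT : ∀ w v (T : Z.Opens) (hw : T ≤ W w) (hv : T ≤ W v),
      pre i T (res hw (C w) - res hv (C v)) = 0 := fun w v T hw hv => by
    rw [map_sub, ← comorph_res, ← comorph_res, hC, hC, res_res, res_res, sub_self]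
  have hbT : ∀ w v v' (T : Z.Opens) (hv : T ≤ W v) (hv' : T ≤ W v') (n : ℕ),
      pre i T (res hv (b w v) ^ n) = pre i T (res hv' (b w v') ^ n) := fun w v v' T hv hv' n => by
    rw [map_pow, map_pow, ← comorph_res, ← comorph_res, hb, hb, res_res, res_res]
  -- On the locus where `b w v` is invertible both `e₁` are known, and their difference is `b ^ N₀`
  -- times `(C w - C v) - (C w - C v') = C v' - C v`. On the rest of the overlap this holds after
  -- multiplication by a power of `b`.
  have hpow : ∀ w v v', ∃ n : ℕ, res (inf_le_left : W v ⊓ W v' ≤ W v) (b w v) ^ n *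
      (res inf_le_left (e₁ w v) - res inf_le_right (e₁ w v') - res inf_le_left (b w v) ^ N₀ *
        (res inf_le_right (C v') - res inf_le_left (C v))) = 0 := by
    intro w v v'
    have hcomp : IsCompact (W v ⊓ W v').1 := by
      rw [hbasic]; exact ((hW v').basicOpen _).isCompact
    refine exists_pow_mul_eq_zero_of_res_basicOpen_eq_zero_of_isCompact Z hcomp _ _ ?_
    have hT : Z.basicOpen (res (inf_le_left : W v ⊓ W v' ≤ W v) (b w v)) ≤ W v ⊓ W v' :=
      Z.basicOpen_le _
    have hTw : Z.basicOpen (res (inf_le_left : W v ⊓ W v' ≤ W v) (b w v)) ≤ W w := by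
      have h1 := Z.basicOpen_res (b w v) (homOfLE (inf_le_left : W v ⊓ W v' ≤ W v)).op
      refine (le_of_eq h1).trans (inf_le_right.trans ?_)
      rw [← hbasic]; exact inf_le_left
    change res hT _ = 0
    have hTv := hT.trans inf_le_left
    have hTv' := hT.trans inf_le_right
    simp only [map_sub, map_mul, map_pow, res_res]
    rw [heT w v _ hTw hTv, heT w v' _ hTw hTv', mul_eq_mul_of_pre_eq i hsq
      (hbT w v' v _ hTv' hTv N₀) (hdT w v' _ hTw hTv')]
    ring
  choose n hn using hpow
  let M := Finset.univ.sup fun p : s × s × s => n p.1 p.2.1 p.2.2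
  have hM : ∀ w v v', n w v v' ≤ M := fun w v v' =>
    Finset.le_sup (f := fun p : s × s × s => n p.1 p.2.1 p.2.2) (Finset.mem_univ (w, v, v'))
  have hkey : ∀ w v v', res (inf_le_left : W v ⊓ W v' ≤ W v) (b w v) ^ M * res inf_le_left (e₁ w v) -
      res inf_le_right (b w v') ^ M * res inf_le_right (e₁ w v') =
        res inf_le_left (b w v) ^ (M + N₀) * (res inf_le_right (C v') - res inf_le_left (C v)) := by
    intro w v v'
    have h1 := congrArg (res inf_le_left (b w v) ^ (M - n w v v') * ·) (hn w v v')
    simp only [mul_zero] at h1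
    rw [← mul_assoc, ← pow_add, Nat.sub_add_cancel (hM w v v')] at h1
    rw [← mul_eq_mul_of_pre_eq i hsq (hbT w v v' _ inf_le_left inf_le_right M)
      (by rw [← comorph_res, he₁, map_zero])]
    linear_combination h1
  have hspan : Ideal.span ((fun x : Γ(Z', ⊤) => x ^ (M + N₀)) '' (s : Set Γ(Z', ⊤))) = ⊤ :=
    Ideal.span_pow_eq_top _ hs _
  obtain ⟨r, hr⟩ : ∃ r : s → Γ(Z', ⊤), ∑ w, r w * w.1 ^ (M + N₀) = 1 := by
    have h1 : (1 : Γ(Z', ⊤)) ∈ Ideal.span (Set.range fun w : s => w.1 ^ (M + N₀)) := by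
      have : (Set.range fun w : s => w.1 ^ (M + N₀)) =
          ((fun x : Γ(Z', ⊤) => x ^ (M + N₀)) '' (s : Set Γ(Z', ⊤))) := by
        rw [Set.image_eq_range]; rfl
      rw [this, hspan]; trivial
    exact (Ideal.mem_span_range_iff_exists_fun).mp h1
  choose ρ hρ using fun w v => pre_surjective i (hW v) (res le_top (r w))
  -- The usual primitive of the cocycle `d`, built with the partition of unity `∑ r w * w ^ (M + N₀)
  -- = 1`; the sections `C v + β v` agree on overlaps.
  let β : ∀ v, Γ(Z, W v) := fun v => ∑ w, ρ w v * (b w v ^ M * e₁ w v)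
  have hβ : ∀ v, pre i _ (β v) = 0 := fun v => by
    simp only [β, map_sum, map_mul, he₁, mul_zero, Finset.sum_const_zero]
  have hβ' : ∀ v v', res (inf_le_left : W v ⊓ W v' ≤ W v) (β v) - res inf_le_right (β v') =
      res inf_le_right (C v') - res inf_le_left (C v) := by
    intro v v'
    have hρv : ∀ w, pre i (W v ⊓ W v') (res inf_le_right (ρ w v')) =
        pre i (W v ⊓ W v') (res inf_le_left (ρ w v)) := fun w => by
      rw [← comorph_res, ← comorph_res, hρ, hρ, res_res, res_res]
    simp only [β, map_sum, map_mul, map_pow]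
    rw [← Finset.sum_sub_distrib]
    calc ∑ w, (res inf_le_left (ρ w v) * (res inf_le_left (b w v) ^ M * res inf_le_left (e₁ w v)) -
          res inf_le_right (ρ w v') * (res inf_le_right (b w v') ^ M * res inf_le_right (e₁ w v')))
        = ∑ w, (res inf_le_left (ρ w v) * res inf_le_left (b w v) ^ (M + N₀)) *
            (res inf_le_right (C v') - res inf_le_left (C v)) := by
          refine Finset.sum_congr rfl fun w _ => ?_
          rw [mul_eq_mul_of_pre_eq i hsq (hρv w)
            (by rw [map_mul, ← comorph_res i _ (e₁ w v'), he₁, map_zero, mul_zero]), ← mul_sub, hkey,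
            mul_assoc]
      _ = 1 * (res inf_le_right (C v') - res inf_le_left (C v)) := by
          rw [← Finset.sum_mul]
          refine mul_eq_mul_of_pre_eq i hsq ?_ (hdT v' v _ _ _)
          have h1 : ∀ w, pre i (W v ⊓ W v') (res inf_le_left (ρ w v) *
              res inf_le_left (b w v) ^ (M + N₀)) = res le_top (r w * w.1 ^ (M + N₀)) := fun w => by
            rw [map_mul, map_pow, ← comorph_res, ← comorph_res, hρ, hb, res_res, res_res, map_mul,
              map_pow]
          rw [map_sum, Finset.sum_congr rfl fun w _ => h1 w, ← map_sum, hr, map_one, map_one]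
      _ = _ := one_mul _
  obtain ⟨x, hx⟩ := exists_glue (U := ⊤) W (fun _ => le_top) (fun p _ => hcov p)
    (fun v => C v + β v) (fun v v' p hp hp' => ⟨W v ⊓ W v', inf_le_left, inf_le_right, ⟨hp, hp'⟩, by
      have := hβ' v v'
      rw [map_add, map_add]
      linear_combination this⟩)
  refine ⟨x, section_ext fun p _ => ?_⟩
  obtain ⟨w, hw⟩ := hcov (i p)
  refine ⟨i ⁻¹ᵁ W w, le_top, hw, ?_⟩
  have h1 := congrArg (pre i (W w)) (hx w)
  rw [map_add, hC, hβ, add_zero] at h1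
  rw [← h1, comorph_res']
  exact res_comorph i (U := ⊤) _ _ x

include hsq in
/-- A scheme with an affine closed subscheme defined by a square-zero ideal is affine. -/
theorem isAffine_of_squareZero [IsAffine Z'] : IsAffine Z := by
  obtain ⟨s, hs, hW⟩ := exists_adapted_cover i
  choose g hg using exists_global_lift i hsq
  refine isAffine_of_isAffineOpen_basicOpen (g '' s) ?_ ?_
  · obtain ⟨r, hr⟩ : ∃ r : s → Γ(Z', ⊤), ∑ w, r w * w.1 = 1 := by
      have h1 : (1 : Γ(Z', ⊤)) ∈ Ideal.span (Set.range fun w : s => w.1) := by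
        have : (Set.range fun w : s => w.1) = (s : Set Γ(Z', ⊤)) := Subtype.range_coe
        rw [this, hs]; trivial
      exact (Ideal.mem_span_range_iff_exists_fun).mp h1
    -- The chosen lifts satisfy `∑ g (r w) * g w = 1` only modulo the kernel. As `(1 - y) ^ 2 = 0`,
    -- the element `y` is still a unit, with inverse `2 - y`.
    let y : Γ(Z, ⊤) := ∑ w : s, g (r w) * g w.1
    have hy : pre i ⊤ (1 - y) = 0 := by
      have : comorph i ⊤ ⊤ le_rfl (1 - y) = 0 := by
        simp only [y, map_sub, map_one, map_sum, map_mul, hg, hr, sub_self]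
      exact this
    have hyy := hsq ⊤ _ _ hy hy
    have hmem : y ∈ Ideal.span (g '' s) :=
      Ideal.sum_mem _ fun w _ => Ideal.mul_mem_left _ _ (Ideal.subset_span ⟨w.1, w.2, rfl⟩)
    rw [Ideal.eq_top_iff_one]
    have : (1 : Γ(Z, ⊤)) = (2 - y) * y := by linear_combination hyy
    rw [this]
    exact Ideal.mul_mem_left _ _ hmem
  · rintro _ ⟨h, hh, rfl⟩
    obtain ⟨W, hW, hWeq⟩ := hW h hh
    have : Z.basicOpen (g h) = W := by
      apply preimage_injective i
      change i ⁻¹ᵁ Z.basicOpen (g h) = i ⁻¹ᵁ W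
      rw [← basicOpen_pre, hWeq]
      have := hg h
      exact congrArg Z'.basicOpen this
    rw [this]; exact hW

end Thickening

end

end PoissonDef
namespace PoissonDef
open TensorProduct

noncomputable section

/-! ### Structure homomorphisms, and affineness along nilpotent base change -/

section StrHom

variable {X Y : Scheme.{u}} {R T : Type u} [CommRing R] [CommRing T]

/-- The homomorphism from the base ring to the functions on an open subset. -/
def strHom (p : X ⟶ Spec (.of R)) (V : X.Opens) : R →+* Γ(X, V) :=
  (comorph p ⊤ V le_top).comp (Scheme.ΓSpecIso (.of R)).inv.hom

lemma res_strHom (p : X ⟶ Spec (.of R)) {V V' : X.Opens} (h : V' ≤ V) (x : R) :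
    res h (strHom p V x) = strHom p V' x := res_comorph p le_top h _

lemma comorph_strHom (f : X ⟶ Y) {p : X ⟶ Spec (.of R)} {q : Y ⟶ Spec (.of R)} (hf : f ≫ q = p)
    {V : Y.Opens} {U : X.Opens} (h : U ≤ f ⁻¹ᵁ V) (x : R) :
    comorph f V U h (strHom q V x) = strHom p U x := by
  subst hf
  exact comorph_comorph f q le_top h _

lemma strHom_specMap (p : X ⟶ Spec (.of T)) (g : R →+* T) (V : X.Opens) (x : R) :
    strHom (p ≫ Spec.map (CommRingCat.ofHom g)) V x = strHom p V (g x) := by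
  have h1 := congrArg (fun φ => φ.hom x) (Scheme.ΓSpecIso_inv_naturality (CommRingCat.ofHom g))
  have h2 := comorph_comorph p (Spec.map (CommRingCat.ofHom g)) (W := ⊤) (V := ⊤) (U := V) le_top
    le_top ((Scheme.ΓSpecIso (.of R)).inv.hom x)
  refine h2.symm.trans ?_
  change _ = comorph p ⊤ V le_top ((Scheme.ΓSpecIso (.of T)).inv.hom (g x))
  congr 1
  refine Eq.trans ?_ h1.symm
  exact comorph_app (Spec.map (CommRingCat.ofHom g)) ⊤ le_rfl _

lemma exists_eq_strHom {W : (Spec (.of R)).Opens} (hW : W = ⊤) {p : X ⟶ Spec (.of R)} {V : X.Opens}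
    (h : V ≤ p ⁻¹ᵁ W) (r : Γ(Spec (.of R), W)) : ∃ x, comorph p W V h r = strHom p V x := by
  subst hW
  refine ⟨(Scheme.ΓSpecIso (.of R)).hom.hom r, ?_⟩
  change _ = comorph p ⊤ V le_top _
  congr 1
  exact (congrArg (fun φ => φ.hom r) (Scheme.ΓSpecIso (.of R)).hom_inv_id).symm

end StrHom

section Pushout

/-- The universal property gives a map from the pushout to `G ⧸ J`, where `J` is the extension of
the kernel of `g`; an element of `G` that dies in the pushout therefore lies in `J`. -/
lemma ker_of_isPushout {S G T O : CommRingCat.{u}} {a : S ⟶ G} {g : S ⟶ T} {inl : G ⟶ O}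
    {inr : T ⟶ O} (h : IsPushout a g inl inr) (hg : Function.Surjective g.hom) :
    RingHom.ker inl.hom = (RingHom.ker g.hom).map a.hom := by
  apply le_antisymm
  · let J := (RingHom.ker g.hom).map a.hom
    let m : G ⟶ .of (G ⧸ J) := CommRingCat.ofHom (Ideal.Quotient.mk J)
    have hk : ∀ x, g.hom x = 0 → (Ideal.Quotient.mk J) (a.hom x) = 0 := fun x hx =>
      Ideal.Quotient.eq_zero_iff_mem.mpr (Ideal.mem_map_of_mem _ hx)
    let l : T →+* G ⧸ J := RingHom.liftOfSurjective g.hom hg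
      ⟨(Ideal.Quotient.mk J).comp a.hom, hk⟩
    have hl : ∀ x, l (g.hom x) = Ideal.Quotient.mk J (a.hom x) := fun x =>
      RingHom.liftOfRightInverse_comp_apply _ _ _ ⟨(Ideal.Quotient.mk J).comp a.hom, hk⟩ x
    have comm : a ≫ m = g ≫ CommRingCat.ofHom l := by
      ext x; exact (hl x).symm
    intro x hx
    have h1 := congrArg (fun φ => φ.hom x) (h.inl_desc m (CommRingCat.ofHom l) comm)
    have h2 : (h.desc m (CommRingCat.ofHom l) comm).hom (inl.hom x) = m.hom x := h1
    rw [RingHom.mem_ker.mp hx, map_zero] at h2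
    exact Ideal.Quotient.eq_zero_iff_mem.mp h2.symm
  · rw [Ideal.map_le_iff_le_comap]
    intro x hx
    have h1 := congrArg (fun φ => φ.hom x) h.w
    have h2 : inl.hom (a.hom x) = inr.hom (g.hom x) := h1
    rw [Ideal.mem_comap, RingHom.mem_ker, h2, RingHom.mem_ker.mp hx, map_zero]

end Pushout

section Fibre

variable {Z' Z : Scheme.{u}} {S T : Type u} [CommRing S] [CommRing T] {g : S →+* T}
  {i : Z' ⟶ Z} {p' : Z' ⟶ Spec (.of T)} {p : Z ⟶ Spec (.of S)}

/-- Over affine open subsets the sections of a base change form a pushout, which reduces the claim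
to `ker_of_isPushout`. -/
lemma ker_pre_of_isPullback (h : IsPullback i p' p (Spec.map (CommRingCat.ofHom g)))
    (hg : Function.Surjective g) {U : Z.Opens} (hU : IsAffineOpen U) :
    RingHom.ker (pre i U) = (RingHom.ker g).map (strHom p U) := by
  have h1 := (isIso_pushoutSection_iff h (US := ⊤) (UT := ⊤) (UX := U) (UY := i ⁻¹ᵁ U)
    le_top le_top (by simp)).mp (isIso_pushoutSection_of_isAffineOpen h le_top le_top (by simp)
      (isAffineOpen_top _) (isAffineOpen_top _) hU)
  have hnat := Scheme.ΓSpecIso_inv_naturality (CommRingCat.ofHom g)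
  have e1 : ∀ x, ((Spec.map (CommRingCat.ofHom g)).appLE ⊤ ⊤ le_top).hom
      ((Scheme.ΓSpecIso (.of S)).inv.hom x) = (Scheme.ΓSpecIso (.of T)).inv.hom (g x) := fun x => by
    have := congrArg (fun φ => φ.hom x) hnat
    refine Eq.trans ?_ this.symm
    exact comorph_app (Spec.map (CommRingCat.ofHom g)) ⊤ le_rfl _
  have eT : Function.Bijective (Scheme.ΓSpecIso (.of T)).inv.hom :=
    (Scheme.ΓSpecIso (.of T)).symm.commRingCatIsoToRingEquiv.bijective
  have eS : Function.Bijective (Scheme.ΓSpecIso (.of S)).inv.hom :=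
    (Scheme.ΓSpecIso (.of S)).symm.commRingCatIsoToRingEquiv.bijective
  have h2 := ker_of_isPushout h1 (by
    intro x
    obtain ⟨y, rfl⟩ := eT.2 x
    obtain ⟨z, rfl⟩ := hg y
    exact ⟨_, e1 z⟩)
  refine Eq.trans h2 ?_
  have h3 : RingHom.ker ((Spec.map (CommRingCat.ofHom g)).appLE ⊤ ⊤ le_top).hom =
      (RingHom.ker g).map (Scheme.ΓSpecIso (.of S)).inv.hom := by
    apply le_antisymm
    · intro x hx
      obtain ⟨y, rfl⟩ := eS.2 x
      rw [RingHom.mem_ker, e1, map_eq_zero_iff _ eT.1] at hx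
      exact Ideal.mem_map_of_mem _ hx
    · rw [Ideal.map_le_iff_le_comap]
      intro x hx
      rw [Ideal.mem_comap, RingHom.mem_ker, e1, RingHom.mem_ker.mp hx, map_zero]
  rw [h3, Ideal.map_map]
  rfl

lemma surjective_specMap_of_isNilpotent_ker (hg : Function.Surjective g)
    (hn : IsNilpotent (RingHom.ker g)) : Surjective (Spec.map (CommRingCat.ofHom g)) := by
  refine ⟨?_⟩
  have hr := range_comap_of_surjective _ g hg
  intro x
  have : x ∈ Set.range (PrimeSpectrum.comap g) := by
    rw [hr]
    intro y hy
    obtain ⟨n, hn⟩ := hn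
    have h1 : y ^ n = 0 := by
      have := Ideal.pow_mem_pow hy n
      rwa [hn] at this
    exact x.2.mem_of_pow_mem n (by rw [h1]; exact zero_mem _)
  exact this

lemma isClosedImmersion_of_isPullback (h : IsPullback i p' p (Spec.map (CommRingCat.ofHom g)))
    (hg : Function.Surjective g) : IsClosedImmersion i :=
  have : IsClosedImmersion (Spec.map (CommRingCat.ofHom g)) :=
    IsClosedImmersion.spec_of_surjective _ hg
  MorphismProperty.of_isPullback (P := @IsClosedImmersion) h.flip this

lemma surjective_of_isPullback (h : IsPullback i p' p (Spec.map (CommRingCat.ofHom g)))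
    (hg : Function.Surjective g) (hn : IsNilpotent (RingHom.ker g)) : Surjective i :=
  MorphismProperty.of_isPullback (P := @Surjective) h.flip
    (surjective_specMap_of_isNilpotent_ker hg hn)

lemma mul_eq_zero_of_squareZero (h : IsPullback i p' p (Spec.map (CommRingCat.ofHom g)))
    (hg : Function.Surjective g) (hsq : RingHom.ker g ^ 2 = ⊥) (U : Z.Opens) (x y : Γ(Z, U))
    (hx : pre i U x = 0) (hy : pre i U y = 0) : x * y = 0 := by
  refine section_ext fun z hz => ?_
  obtain ⟨W, hW, hzW, hWU⟩ := exists_affine_mem_le hz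
  refine ⟨W, hWU, hzW, ?_⟩
  have key : ∀ a : Γ(Z, U), pre i U a = 0 → res hWU a ∈ (RingHom.ker g).map (strHom p W) := by
    intro a ha
    rw [← ker_pre_of_isPullback h hg hW, RingHom.mem_ker, ← comorph_res, ha, map_zero]
  have h1 := Ideal.mul_mem_mul (key x hx) (key y hy)
  rw [← Ideal.map_mul, ← pow_two, hsq, Ideal.map_bot, Ideal.mem_bot] at h1
  rw [map_mul, map_zero, h1]

end Fibre

/-- A scheme over a ring `S` is affine if its base change to a quotient of `S` by a nilpotent ideal
is affine. -/
theorem isAffine_of_isPullback {Z' Z : Scheme.{u}} {S T : Type u} [CommRing S] [CommRing T]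
    {g : S →+* T} {i : Z' ⟶ Z} {p' : Z' ⟶ Spec (.of T)} {p : Z ⟶ Spec (.of S)}
    (h : IsPullback i p' p (Spec.map (CommRingCat.ofHom g)))
    (hg : Function.Surjective g) (hn : IsNilpotent (RingHom.ker g)) [IsAffine Z'] : IsAffine Z := by
  let P : ∀ ⦃S : Type u⦄ [CommRing S], Ideal S → Prop := fun S _ I =>
    ∀ (T : Type u) [CommRing T] (g : S →+* T), Function.Surjective g → RingHom.ker g = I →
      ∀ (Z' Z : Scheme.{u}) (i : Z' ⟶ Z) (p' : Z' ⟶ Spec (.of T)) (p : Z ⟶ Spec (.of S)),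
        IsPullback i p' p (Spec.map (CommRingCat.ofHom g)) → IsNilpotent I → IsAffine Z' → IsAffine Z
  have key : P (RingHom.ker g) := by
    refine Ideal.IsNilpotent.induction_on _ hn ?_ ?_
    · intro S _ I hI T _ g hg hgI Z' Z i p' p h hn _
      subst hgI
      have := isClosedImmersion_of_isPullback h hg
      have := surjective_of_isPullback h hg hn
      exact isAffine_of_squareZero i (mul_eq_zero_of_squareZero h hg hI)
    · intro S _ I J hIJ hI hJ T _ g hg hgJ Z' Z i p' p h hn _
      subst hgJ
      -- The thickening is factored through the base change `Z₁` to `S ⧸ I`: `Z'` is cut out in `Z₁`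
      -- by the image of `J`, and `Z₁` in `Z` by `I`.
      let g₁ : S →+* S ⧸ I := Ideal.Quotient.mk I
      let g₂ : S ⧸ I →+* T := Ideal.Quotient.lift I g (fun x hx => hIJ hx)
      have hcomp : Spec.map (CommRingCat.ofHom g) =
          Spec.map (CommRingCat.ofHom g₂) ≫ Spec.map (CommRingCat.ofHom g₁) := by
        rw [← Spec.map_comp]; rfl
      let Z₁ := Limits.pullback p (Spec.map (CommRingCat.ofHom g₁))
      have hb : IsPullback (Limits.pullback.fst p (Spec.map (CommRingCat.ofHom g₁)))
        (Limits.pullback.snd p (Spec.map (CommRingCat.ofHom g₁))) p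
        (Spec.map (CommRingCat.ofHom g₁)) := IsPullback.of_hasPullback _ _
      let j : Z' ⟶ Z₁ := Limits.pullback.lift i (p' ≫ Spec.map (CommRingCat.ofHom g₂)) (by
        rw [h.w, hcomp, Category.assoc])
      have hj : IsPullback j p' (Limits.pullback.snd p (Spec.map (CommRingCat.ofHom g₁)))
          (Spec.map (CommRingCat.ofHom g₂)) := by
        refine IsPullback.of_right ?_ (Limits.pullback.lift_snd _ _ _) hb
        rw [Limits.pullback.lift_fst, ← hcomp]
        exact h
      have hg₂ : Function.Surjective g₂ := Ideal.Quotient.lift_surjective_of_surjective _ _ hg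
      have hker : RingHom.ker g₂ = (RingHom.ker g).map (Ideal.Quotient.mk I) := by
        apply le_antisymm
        · intro x hx
          obtain ⟨y, rfl⟩ := Ideal.Quotient.mk_surjective x
          exact Ideal.mem_map_of_mem _ hx
        · rw [Ideal.map_le_iff_le_comap]
          intro x hx
          exact hx
      have hn₂ : IsNilpotent ((RingHom.ker g).map (Ideal.Quotient.mk I)) := by
        obtain ⟨n, hn⟩ := hn
        exact ⟨n, by rw [← Ideal.map_pow, hn, Ideal.zero_eq_bot, Ideal.map_bot, Ideal.zero_eq_bot]⟩
      have hn₁ : IsNilpotent I := by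
        obtain ⟨n, hn⟩ := hn
        refine ⟨n, ?_⟩
        rw [Ideal.zero_eq_bot, eq_bot_iff, ← Ideal.zero_eq_bot, ← hn]
        exact Ideal.pow_right_mono hIJ n
      have hZ₁ : IsAffine Z₁ := hJ T g₂ hg₂ hker _ _ j p' _ hj hn₂ inferInstance
      exact hI (S ⧸ I) g₁ Ideal.Quotient.mk_surjective Ideal.mk_ker _ _ _ _ _ hb hn₁ hZ₁
  exact key T g hg rfl _ _ i p' p h hn inferInstance

end

end PoissonDef
namespace PoissonDef
open TensorProduct

noncomputable section

/-! ### Functions on a deformation over open subsets of the closed fibre -/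

section RingProperties

variable {X : Scheme.{u}}

/-- Restriction is the comorphism of the identity between two affine open subsets, and the identity
is étale. -/
lemma formallyEtale_res {U V : X.Opens} (hU : IsAffineOpen U) (hV : IsAffineOpen V) (h : V ≤ U) :
    (res h).FormallyEtale := by
  have h1 := HasRingHomProperty.appLE @Etale (𝟙 X) inferInstance ⟨U, hU⟩ ⟨V, hV⟩ h
  have h2 : ((𝟙 X : X ⟶ X).appLE U V h).hom = res h := RingHom.ext fun a => comorph_id h a
  change ((𝟙 X : X ⟶ X).appLE U V h).hom.Etale at h1
  rw [h2] at h1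
  let := (res h).toAlgebra
  have : Algebra.Etale Γ(X, U) Γ(X, V) := h1
  exact (inferInstance : Algebra.FormallyEtale Γ(X, U) Γ(X, V))

variable {R : Type u} [CommRing R]

lemma bijective_ΓSpecIso_inv (R : Type u) [CommRing R] :
    Function.Bijective (Scheme.ΓSpecIso (.of R)).inv.hom :=
  (Scheme.ΓSpecIso (.of R)).symm.commRingCatIsoToRingEquiv.bijective

lemma flat_strHom (p : X ⟶ Spec (.of R)) [Flat p] {V : X.Opens} (hV : IsAffineOpen V) :
    (strHom p V).Flat :=
  RingHom.Flat.comp (RingHom.Flat.of_bijective (bijective_ΓSpecIso_inv R))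
    (p.flat_appLE (isAffineOpen_top _) hV le_top)

lemma formallySmooth_strHom (p : X ⟶ Spec (.of R)) [Smooth p] {V : X.Opens} (hV : IsAffineOpen V) :
    (strHom p V).FormallySmooth := by
  have h1 : (comorph p ⊤ V le_top).Smooth := p.smooth_appLE (isAffineOpen_top _) hV le_top
  have h2 : (strHom p V).Smooth :=
    RingHom.Smooth.comp (RingHom.Smooth.of_bijective (bijective_ΓSpecIso_inv R)) h1
  let := (strHom p V).toAlgebra
  have : Algebra.Smooth R Γ(X, V) := h2
  exact (inferInstance : Algebra.FormallySmooth R Γ(X, V))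

end RingProperties

namespace Deformation

variable {k : Type u} [Field k] {Y : Scheme.{u}} {pY : Y ⟶ Spec (.of k)} {R : PoissonStructure pY}
  {A : ArtAlg k} (η : Deformation R A)

lemma isPullback' : IsPullback η.incl pY η.toBase (Spec.map (CommRingCat.ofHom A.residue)) :=
  η.isPullback

lemma isNilpotent_ker_residue : IsNilpotent (RingHom.ker A.residue) := by
  rw [A.ker_residue]; exact A.isNilpotent_maxIdeal

instance : IsClosedImmersion η.incl :=
  isClosedImmersion_of_isPullback η.isPullback' A.residue_surjective

instance : Surjective η.incl :=
  surjective_of_isPullback η.isPullback' A.residue_surjective isNilpotent_ker_residue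

/-- The open subset of the total space corresponding to an open subset of the closed fibre. -/
def up (V : Y.Opens) : η.total.Opens := imageOpen η.incl V

lemma incl_preimage_up (V : Y.Opens) : η.incl ⁻¹ᵁ η.up V = V := preimage_imageOpen η.incl V

lemma up_le_iff {V : Y.Opens} {W : η.total.Opens} : η.up V ≤ W ↔ V ≤ η.incl ⁻¹ᵁ W := by
  rw [← preimage_le_iff η.incl, incl_preimage_up]

lemma up_mono {V V' : Y.Opens} (h : V' ≤ V) : η.up V' ≤ η.up V := by
  rw [up_le_iff, incl_preimage_up]; exact h

/-- The part of the total space over `V` is a nilpotent thickening of the affine scheme `V`. -/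
lemma isAffineOpen_up {V : Y.Opens} (hV : IsAffineOpen V) : IsAffineOpen (η.up V) := by
  have h1 := (isPullback_morphismRestrict η.incl (η.up V)).paste_vert η.isPullback'
  have h2 : IsAffineOpen (η.incl ⁻¹ᵁ η.up V) := by rwa [incl_preimage_up]
  have : IsAffine (η.incl ⁻¹ᵁ η.up V).toScheme := h2
  exact isAffine_of_isPullback h1 A.residue_surjective isNilpotent_ker_residue

/-- Reduction of functions to the closed fibre. -/
def red (V : Y.Opens) : Γ(η.total, η.up V) →+* Γ(Y, V) :=
  comorph η.incl (η.up V) V (η.incl_preimage_up V).ge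

/-- The structure homomorphism over an open subset. -/
def str (V : Y.Opens) : A.carrier →+* Γ(η.total, η.up V) := strHom η.toBase (η.up V)

/-- Restriction of functions on the total space. -/
def rs {V V' : Y.Opens} (h : V' ≤ V) : Γ(η.total, η.up V) →+* Γ(η.total, η.up V') :=
  res (η.up_mono h)

lemma rs_rs {V V' V'' : Y.Opens} (h : V' ≤ V) (h' : V'' ≤ V') (a) :
    η.rs h' (η.rs h a) = η.rs (h'.trans h) a := res_res _ _ _

lemma rs_self {V : Y.Opens} (h : V ≤ V) (a) : η.rs h a = a := res_self _ _

lemma rs_str {V V' : Y.Opens} (h : V' ≤ V) (a) : η.rs h (η.str V a) = η.str V' a :=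
  res_strHom _ _ _

lemma red_rs {V V' : Y.Opens} (h : V' ≤ V) (a) : η.red V' (η.rs h a) = res h (η.red V a) :=
  (comorph_res' _ _ _ _).trans (res_comorph _ _ _ _).symm

lemma red_str (V : Y.Opens) (a : A.carrier) : η.red V (η.str V a) = strHom pY V (A.residue a) := by
  have := comorph_strHom η.incl (p := pY ≫ Spec.map (CommRingCat.ofHom A.residue)) η.isPullback'.w
    (η.incl_preimage_up V).ge a
  exact this.trans (strHom_specMap _ _ _ _)

lemma red_eq (V : Y.Opens) (a) :
    η.red V a = res (η.incl_preimage_up V).ge (pre η.incl (η.up V) a) :=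
  (res_comorph _ _ _ _).symm

lemma res_bijective_of_eq {X : Scheme.{u}} {U V : X.Opens} (h : V ≤ U) (e : U = V) :
    Function.Bijective (res h) := by
  subst e
  have : res h = RingHom.id _ := RingHom.ext (res_self h)
  rw [this]; exact Function.bijective_id

lemma red_surjective {V : Y.Opens} (hV : IsAffineOpen V) : Function.Surjective (η.red V) := by
  intro x
  obtain ⟨y, rfl⟩ := (res_bijective_of_eq (η.incl_preimage_up V).ge (η.incl_preimage_up V)).2 x
  obtain ⟨z, rfl⟩ := pre_surjective η.incl (η.isAffineOpen_up hV) y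
  exact ⟨z, η.red_eq V z⟩

lemma ker_red {V : Y.Opens} (hV : IsAffineOpen V) :
    RingHom.ker (η.red V) = A.maxIdeal.map (η.str V) := by
  rw [← A.ker_residue]
  refine Eq.trans ?_ (ker_pre_of_isPullback η.isPullback' A.residue_surjective (η.isAffineOpen_up hV))
  ext x
  rw [RingHom.mem_ker, RingHom.mem_ker, red_eq, map_eq_zero_iff _
    (res_bijective_of_eq (η.incl_preimage_up V).ge (η.incl_preimage_up V)).1]

lemma isNilpotent_ker_red {V : Y.Opens} (hV : IsAffineOpen V) :
    IsNilpotent (RingHom.ker (η.red V)) := by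
  obtain ⟨n, hn⟩ := A.isNilpotent_maxIdeal
  exact ⟨n, by
    rw [η.ker_red hV, ← Ideal.map_pow, hn, Ideal.zero_eq_bot, Ideal.map_bot, Ideal.zero_eq_bot]⟩

lemma flat_str {V : Y.Opens} (hV : IsAffineOpen V) : (η.str V).Flat :=
  have := η.flat
  flat_strHom _ (η.isAffineOpen_up hV)

lemma formallyEtale_rs {V V' : Y.Opens} (hV : IsAffineOpen V) (hV' : IsAffineOpen V') (h : V' ≤ V) :
    (η.rs h).FormallyEtale :=
  formallyEtale_res (η.isAffineOpen_up hV) (η.isAffineOpen_up hV') _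

/-- Smoothness passes from the closed fibre to a flat deformation. For the deformation of the target
this is what allows the comorphism of `ψ` to be lifted to `A'`. -/
lemma formallySmooth_str [Smooth pY] {V : Y.Opens} (hV : IsAffineOpen V) :
    (η.str V).FormallySmooth := by
  let := (strHom pY V).toAlgebra
  exact formallySmooth_of_flat_deformation (formallySmooth_strHom pY hV) (η.flat_str hV)
    (η.red_surjective hV) (η.ker_red hV) (η.red_str V)

/-- The bracket over an open subset. -/
def br (V : Y.Opens) : Γ(η.total, η.up V) → Γ(η.total, η.up V) → Γ(η.total, η.up V) :=
  η.poisson.bracket (η.up V)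

end Deformation

lemma PoissonStructure.isBiderivation {X S : Scheme.{u}} {p : X ⟶ S} (P : PoissonStructure p)
    (U : X.Opens) : IsBiderivation (P.bracket U) where
  add_left := P.bracket_add U
  skew := P.bracket_skew U
  mul_left := P.bracket_mul U

lemma PoissonStructure.jacobiator_eq_zero {X S : Scheme.{u}} {p : X ⟶ S} (P : PoissonStructure p)
    (U : X.Opens) (a b c : Γ(X, U)) : jacobiator (P.bracket U) a b c = 0 := by
  have := P.jacobi U a b c
  rw [jacobiator, P.bracket_skew U (P.bracket U a b) c, P.bracket_skew U (P.bracket U b c) a,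
    P.bracket_skew U (P.bracket U c a) b]
  linear_combination - this

lemma PoissonStructure.bracket_strHom {X : Scheme.{u}} {R : Type u} [CommRing R]
    {p : X ⟶ Spec (.of R)} (P : PoissonStructure p) (U : X.Opens) (x : R) (a : Γ(X, U)) :
    P.bracket U (strHom p U x) a = 0 := P.bracket_base U ⊤ le_top _ a

lemma IsPoisson.comorph_bracket {X Y S T : Scheme.{u}} {p : X ⟶ S} {q : Y ⟶ T}
    {P : PoissonStructure p} {Q : PoissonStructure q} {f : X ⟶ Y} (hf : IsPoisson P Q f)
    {V : Y.Opens} {U : X.Opens} (h : U ≤ f ⁻¹ᵁ V) (a b : Γ(Y, V)) :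
    comorph f V U h (Q.bracket V a b) = P.bracket U (comorph f V U h a) (comorph f V U h b) := by
  have := congrArg (res h) (hf V a b)
  rw [P.bracket_res, res_comorph, res_comorph, res_comorph] at this
  exact this

namespace Deformation

variable {k : Type u} [Field k] {Y : Scheme.{u}} {pY : Y ⟶ Spec (.of k)} {R : PoissonStructure pY}
  {A : ArtAlg k} (η : Deformation R A)

lemma rs_br {V V' : Y.Opens} (h : V' ≤ V) (a b) :
    η.rs h (η.br V a b) = η.br V' (η.rs h a) (η.rs h b) := η.poisson.bracket_res _ _ _ _ _

lemma red_br (V : Y.Opens) (a b) : η.red V (η.br V a b) = R.bracket V (η.red V a) (η.red V b) :=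
  η.incl_isPoisson.comorph_bracket _ a b

lemma isBiderivation_br (V : Y.Opens) : IsBiderivation (η.br V) := η.poisson.isBiderivation _

lemma br_str (V : Y.Opens) (x : A.carrier) (a) : η.br V (η.str V x) a = 0 :=
  η.poisson.bracket_strHom _ _ _

end Deformation

end

end PoissonDef
namespace PoissonDef
open TensorProduct

noncomputable section

set_option linter.unusedSectionVars false

/-- The algebra structures on the rings of functions are those given by the structure morphism. -/
class IsAlgOver {k : Type u} [Field k] {X : Scheme.{u}} (pX : X ⟶ Spec (.of k))
    [∀ V : X.Opens, Algebra k Γ(X, V)] : Prop where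
  algebraMap_eq : ∀ (V : X.Opens) (c : k), algebraMap k Γ(X, V) c = strHom pX V c

/-! ### The trivial deformation and trivializing charts -/

section Rings

variable {k : Type u} [Field k] {X : Scheme.{u}} (pX : X ⟶ Spec (.of k))
  [∀ V : X.Opens, Algebra k Γ(X, V)] [IsAlgOver pX]

/-- Restriction as an algebra homomorphism. -/
def resAlg {V V' : X.Opens} (h : V' ≤ V) : Γ(X, V) →ₐ[k] Γ(X, V') :=
  ⟨res h, fun c => by
    change res h (algebraMap k Γ(X, V) c) = _
    rw [IsAlgOver.algebraMap_eq (pX := pX), IsAlgOver.algebraMap_eq (pX := pX), res_strHom]⟩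

lemma resAlg_apply {V V' : X.Opens} (h : V' ≤ V) (x : Γ(X, V)) : resAlg pX h x = res h x := rfl

/-- The ring of functions of the trivial deformation over an open subset. -/
abbrev Rg (A' : ArtAlg k) (V : X.Opens) : Type u := A'.carrier ⊗[k] Γ(X, V)

variable (A' : ArtAlg k)

/-- Restriction for the trivial deformation. -/
def resR {V V' : X.Opens} (h : V' ≤ V) : Rg A' V →+* Rg A' V' :=
  (Algebra.TensorProduct.map (AlgHom.id k A'.carrier) (resAlg pX h) : Rg A' V →ₐ[k] Rg A' V')

variable {A'} {V V' V'' : X.Opens}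

lemma resR_tmul (h : V' ≤ V) (a : A'.carrier) (x : Γ(X, V)) :
    resR pX A' h (a ⊗ₜ x) = a ⊗ₜ res h x := rfl

lemma resR_inl (h : V' ≤ V) (a : A'.carrier) : resR pX A' h (inl a) = inl a := by
  change resR pX A' h (a ⊗ₜ 1) = a ⊗ₜ 1
  rw [resR_tmul, map_one]

lemma resR_inr (h : V' ≤ V) (x : Γ(X, V)) : resR pX A' h (inr x) = inr (res h x) := rfl

lemma resR_tmulBy (h : V' ≤ V) (t : A'.carrier) (x : Γ(X, V)) :
    resR pX A' h (tmulBy t x) = tmulBy t (res h x) := rfl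

lemma resR_resR (h : V' ≤ V) (h' : V'' ≤ V') (x : Rg A' V) :
    resR pX A' h' (resR pX A' h x) = resR pX A' (h'.trans h) x := by
  induction x using TensorProduct.induction_on with
  | zero => simp
  | add x y hx hy => simp only [map_add, hx, hy]
  | tmul a x => simp only [resR_tmul, res_res]

lemma resR_self (h : V ≤ V) (x : Rg A' V) : resR pX A' h x = x := by
  induction x using TensorProduct.induction_on with
  | zero => simp
  | add x y hx hy => simp only [map_add, hx, hy]
  | tmul a x => simp only [resR_tmul, res_self]

lemma augm_resR (h : V' ≤ V) (x : Rg A' V) :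
    augm Γ(X, V') A' (resR pX A' h x) = res h (augm Γ(X, V) A' x) := by
  induction x using TensorProduct.induction_on with
  | zero => simp
  | add x y hx hy => simp only [map_add, hx, hy]
  | tmul a x =>
    rw [resR_tmul, augm_tmul, augm_tmul, ← resAlg_apply pX, ← resAlg_apply pX, map_smul]

end Rings

lemma up_le_preimage {k : Type u} [Field k] {X Y : Scheme.{u}} {pX : X ⟶ Spec (.of k)}
    {pY : Y ⟶ Spec (.of k)} {Λ₀ : PoissonStructure pX} {P₀ : PoissonStructure pY} {f : X ⟶ Y}
    {A B : ArtAlg k} {σ : Deformation Λ₀ A} {η : Deformation P₀ B} {ψ : σ.total ⟶ η.total}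
    (hψ : σ.incl ≫ ψ = f ≫ η.incl) {V : Y.Opens} {W : X.Opens} (h : W ≤ f ⁻¹ᵁ V) :
    σ.up W ≤ ψ ⁻¹ᵁ η.up V := by
  rw [σ.up_le_iff, ← Scheme.Hom.comp_preimage, hψ, Scheme.Hom.comp_preimage, η.incl_preimage_up]
  exact h

section Charts

variable {k : Type u} [Field k] {X : Scheme.{u}} {pX : X ⟶ Spec (.of k)}
  [∀ V : X.Opens, Algebra k Γ(X, V)] [IsAlgOver pX] {Λ₀ : PoissonStructure pX} {A A' : ArtAlg k}
  (σ : Deformation Λ₀ A) {ι : Type*} (𝒰 : ι → X.Opens)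

/-- Trivializations of the underlying schemes over the members of an affine cover. -/
structure Charts where
  τ : ∀ (i : ι) (V : X.Opens), IsAffineOpen V → V ≤ 𝒰 i → (Γ(X, V) →+* Γ(σ.total, σ.up V))
  red_τ : ∀ i V hV hi x, σ.red V (τ i V hV hi x) = x
  τ_algebraMap : ∀ i V hV hi (c : k),
    τ i V hV hi (algebraMap k _ c) = σ.str V (algebraMap k _ c)
  rs_τ : ∀ i V V' hV hV' hi hi' (h : V' ≤ V) x, σ.rs h (τ i V hV hi x) = τ i V' hV' hi' (res h x)

/-- The identity of `Γ(X, V)` is lifted along the nilpotent surjection `red`, using smoothness of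
`X` over `k` on `𝒰 i` and étaleness of restriction below it. -/
lemma exists_charts [Smooth pX] (h𝒰 : ∀ i, IsAffineOpen (𝒰 i)) : Nonempty (Charts σ 𝒰) := by
  have key : ∀ i, ∃ τ : ∀ v : {V : X.Opens // IsAffineOpen V ∧ V ≤ 𝒰 i},
      Γ(X, v.1) →+* Γ(σ.total, σ.up v.1), (∀ v x, σ.red v.1 (τ v x) = x) ∧
      (∀ v x, τ v (strHom pX v.1 x) = σ.str v.1 (algebraMap k _ x)) ∧
      ∀ {v w : {V : X.Opens // IsAffineOpen V ∧ V ≤ 𝒰 i}} (h : v ≤ w) x, σ.rs h (τ w x) = τ v (res h x) := fun i =>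
    exists_compatible_lift (P := {V : X.Opens // IsAffineOpen V ∧ V ≤ 𝒰 i})
      (C := fun v => Γ(X, v.1)) (E' := fun v => Γ(σ.total, σ.up v.1)) (E := fun v => Γ(X, v.1))
      ⟨𝒰 i, h𝒰 i, le_rfl⟩ (fun v => v.2.2) (fun h => res h) (fun h => σ.rs h) (fun h => res h)
      (fun h h' a => res_res h' h a) (fun h h' a => σ.rs_rs h' h a) (fun v => strHom pX v.1)
      (fun v => (σ.str v.1).comp (algebraMap k _)) (fun h x => res_strHom _ _ _)
      (fun h x => σ.rs_str _ _) (fun v => σ.red v.1) (fun v => σ.red_surjective v.2.1)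
      (fun v => σ.isNilpotent_ker_red v.2.1) (fun h x => (σ.red_rs h x).symm) (fun v => RingHom.id _)
      (fun h x => rfl) (fun v x => by
        rw [RingHom.comp_apply, σ.red_str, A.residue_algebraMap]; rfl)
      (formallySmooth_strHom pX (h𝒰 i)) (fun v => formallyEtale_res (h𝒰 i) v.2.1 _)
  choose τ h1 h2 h3 using key
  refine ⟨⟨fun i V hV hi => τ i ⟨V, hV, hi⟩, fun i V hV hi => h1 i ⟨V, hV, hi⟩,
    fun i V hV hi c => ?_, fun i V V' hV hV' hi hi' h x => h3 i (v := ⟨V', hV', hi'⟩) (w := ⟨V, hV, hi⟩) h x⟩⟩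
  rw [IsAlgOver.algebraMap_eq (pX := pX)]
  exact h2 i ⟨V, hV, hi⟩ c

variable {σ 𝒰} (T : Charts σ 𝒰) (φ : A'.carrier →ₐ[k] A.carrier)

namespace Charts

lemma tlift_compat (i V hV hi) (c : k) : ((σ.str V).comp (φ : A'.carrier →+* A.carrier))
    (algebraMap k _ c) = T.τ i V hV hi (algebraMap k _ c) := by
  rw [T.τ_algebraMap, RingHom.comp_apply]
  congr 1
  exact φ.commutes c

/-- The chart `A' ⊗ Γ(X, V) → Γ(σ, V)`. -/
def p (i : ι) (V : X.Opens) (hV : IsAffineOpen V) (hi : V ≤ 𝒰 i) :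
    Rg A' V →+* Γ(σ.total, σ.up V) :=
  tlift ((σ.str V).comp (φ : A'.carrier →+* A.carrier)) (T.τ i V hV hi) (T.tlift_compat φ i V hV hi)

variable {i : ι} {V : X.Opens} (hV : IsAffineOpen V) (hi : V ≤ 𝒰 i)

lemma p_tmul (a : A'.carrier) (x : Γ(X, V)) :
    T.p φ i V hV hi (a ⊗ₜ x) = σ.str V (φ a) * T.τ i V hV hi x := tlift_tmul _ _ _ _ _

lemma p_inl (a : A'.carrier) : T.p φ i V hV hi (inl a) = σ.str V (φ a) := by
  change T.p φ i V hV hi (a ⊗ₜ 1) = _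
  rw [p_tmul, map_one, mul_one]

lemma p_inr (x : Γ(X, V)) : T.p φ i V hV hi (inr x) = T.τ i V hV hi x := by
  change T.p φ i V hV hi (1 ⊗ₜ x) = _
  rw [p_tmul, map_one, map_one, one_mul]

lemma rs_p {V' : X.Opens} (hV' : IsAffineOpen V') (h : V' ≤ V) (x : Rg A' V) :
    σ.rs h (T.p φ i V hV hi x) = T.p φ i V' hV' (h.trans hi) (resR pX A' h x) := by
  induction x using TensorProduct.induction_on with
  | zero => simp
  | add x y hx hy => simp only [map_add, hx, hy]
  | tmul a x => rw [resR_tmul, p_tmul, p_tmul, map_mul, σ.rs_str, T.rs_τ]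

lemma red_p (x : Rg A' V) : σ.red V (T.p φ i V hV hi x) = augm Γ(X, V) A' x := by
  induction x using TensorProduct.induction_on with
  | zero => simp
  | add x y hx hy => simp only [map_add, hx, hy]
  | tmul a x =>
    rw [p_tmul, map_mul, σ.red_str, T.red_τ, augm_tmul, Algebra.smul_def,
      IsAlgOver.algebraMap_eq (pX := pX), ArtAlg.residue_comp]

lemma tlift_compat' (c : k) : σ.str V (algebraMap k _ c) = T.τ i V hV hi (algebraMap k _ c) :=
  (T.τ_algebraMap i V hV hi c).symm

lemma bijective_triv : Function.Bijective (tlift (σ.str V) (T.τ i V hV hi) (T.tlift_compat' hV hi)) :=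
  bijective_tlift (σ.flat_str hV) (σ.ker_red hV)
    (fun x => by rw [σ.red_str, IsAlgOver.algebraMap_eq (pX := pX)]) (T.red_τ i V hV hi) _

lemma p_eq (x : Rg A' V) : T.p φ i V hV hi x =
    tlift (σ.str V) (T.τ i V hV hi) (T.tlift_compat' hV hi) (tmap φ x) := by
  induction x using TensorProduct.induction_on with
  | zero => simp
  | add x y hx hy => simp only [map_add, hx, hy]
  | tmul a x => rw [p_tmul, tmap_tmul, tlift_tmul]

variable {φ} {t : A'.carrier} (h : IsSmallExtension φ t)
include h

lemma p_surjective : Function.Surjective (T.p φ i V hV hi) := by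
  intro x
  obtain ⟨y, rfl⟩ := (T.bijective_triv hV hi).2 x
  obtain ⟨z, rfl⟩ := tmap_surjective h.surjective y
  exact ⟨z, T.p_eq φ hV hi z⟩

lemma exists_of_p_eq_zero {x : Rg A' V} (hx : T.p φ i V hV hi x = 0) : ∃ o, x = tmulBy t o := by
  rw [p_eq, map_eq_zero_iff _ (T.bijective_triv hV hi).1] at hx
  exact h.exists_of_tmap_eq_zero hx

lemma exists_of_p_eq {x y : Rg A' V} (hx : T.p φ i V hV hi x = T.p φ i V hV hi y) :
    ∃ o, x = y + tmulBy t o := by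
  obtain ⟨o, ho⟩ := T.exists_of_p_eq_zero hV hi h (x := x - y) (by rw [map_sub, hx, sub_self])
  exact ⟨o, by rw [← ho]; ring⟩

lemma p_tmulBy (o : Γ(X, V)) : T.p φ i V hV hi (tmulBy t o) = 0 := by
  rw [tmulBy_apply, p_tmul, h.map_eq_zero, map_zero, zero_mul]

lemma isNilpotent_ker_p : IsNilpotent (RingHom.ker (T.p φ i V hV hi)) := by
  refine ⟨2, ?_⟩
  rw [Ideal.zero_eq_bot, eq_bot_iff, pow_two, Ideal.mul_le]
  intro x hx y hy
  obtain ⟨o, rfl⟩ := T.exists_of_p_eq_zero hV hi h hx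
  obtain ⟨o', rfl⟩ := T.exists_of_p_eq_zero hV hi h hy
  rw [h.mul_tmulBy, h.augm_tmulBy, zero_mul, map_zero]
  exact zero_mem _

end Charts

end Charts

end

end PoissonDef
namespace PoissonDef
open TensorProduct

noncomputable section

set_option linter.unusedSectionVars false

/-! ### Local lifts of gluing maps, brackets and the morphism -/

section LiftData

variable {k : Type u} [Field k] {X Y : Scheme.{u}} {pX : X ⟶ Spec (.of k)} {pY : Y ⟶ Spec (.of k)}
  [∀ V : X.Opens, Algebra k Γ(X, V)] [IsAlgOver pX] {Λ₀ : PoissonStructure pX}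
  {P₀ : PoissonStructure pY} {f : X ⟶ Y} {A A' B : ArtAlg k}
  {σ : Deformation Λ₀ A} {η : Deformation P₀ B} {ψ : σ.total ⟶ η.total}
  (hψ : σ.incl ≫ ψ = f ≫ η.incl) {ι : Type*} {𝒰 : ι → X.Opens} (T : Charts σ 𝒰)
  (φ : A'.carrier →ₐ[k] A.carrier) (β : B.carrier →ₐ[k] A'.carrier)

/-- The comorphism of `ψ` over open subsets of the closed fibres. -/
def psi {V : Y.Opens} {W : X.Opens} (h : W ≤ f ⁻¹ᵁ V) :
    Γ(η.total, η.up V) →+* Γ(σ.total, σ.up W) :=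
  comorph ψ (η.up V) (σ.up W) (up_le_preimage hψ h)

lemma rs_psi {V V' : Y.Opens} {W W' : X.Opens} (h : W ≤ f ⁻¹ᵁ V) (h' : W' ≤ f ⁻¹ᵁ V') (hV : V' ≤ V)
    (hW : W' ≤ W) (x) : σ.rs hW (psi hψ h x) = psi hψ h' (η.rs hV x) :=
  (res_comorph _ _ _ _).trans (comorph_res' _ _ _ _).symm

lemma red_psi {V : Y.Opens} {W : X.Opens} (h : W ≤ f ⁻¹ᵁ V) (x) :
    σ.red W (psi hψ h x) = comorph f V W h (η.red V x) := by
  have e1 := comorph_comorph σ.incl ψ (up_le_preimage hψ h) (σ.incl_preimage_up W).ge x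
  have e2 := comorph_comorph f η.incl (η.incl_preimage_up V).ge h x
  refine e1.trans (Eq.trans ?_ e2.symm)
  congr 2

/-- Local lifts to `A'` of the gluing isomorphisms, of the brackets and of the morphism `ψ`. -/
structure LiftData where
  θ : ∀ (i j : ι) (V : X.Opens), IsAffineOpen V → V ≤ 𝒰 i → V ≤ 𝒰 j → (Rg A' V →+* Rg A' V)
  θ_inl : ∀ i j V hV hi hj a, θ i j V hV hi hj (inl a) = inl a
  p_θ : ∀ i j V hV hi hj x, T.p φ i V hV hi (θ i j V hV hi hj x) = T.p φ j V hV hj x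
  res_θ : ∀ i j V V' hV hV' hi hj hi' hj' (h : V' ≤ V) x,
    resR pX A' h (θ i j V hV hi hj x) = θ i j V' hV' hi' hj' (resR pX A' h x)
  lam : ∀ (i : ι) (V : X.Opens), IsAffineOpen V → V ≤ 𝒰 i → Rg A' V → Rg A' V → Rg A' V
  isBiderivation : ∀ i V hV hi, IsBiderivation (lam i V hV hi)
  lam_inl : ∀ i V hV hi a x, lam i V hV hi (inl a) x = 0
  p_lam : ∀ i V hV hi x y, T.p φ i V hV hi (lam i V hV hi x y) =
    σ.br V (T.p φ i V hV hi x) (T.p φ i V hV hi y)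
  res_lam : ∀ i V V' hV hV' hi hi' (h : V' ≤ V) x y,
    resR pX A' h (lam i V hV hi x y) = lam i V' hV' hi' (resR pX A' h x) (resR pX A' h y)
  ph : ∀ (i : ι) (V : Y.Opens) (W : X.Opens), IsAffineOpen V → IsAffineOpen W → W ≤ 𝒰 i →
    W ≤ f ⁻¹ᵁ V → (Γ(η.total, η.up V) →+* Rg A' W)
  ph_str : ∀ i V W hV hW hi h a, ph i V W hV hW hi h (η.str V a) = inl (β a)
  p_ph : ∀ i V W hV hW hi h x, T.p φ i W hW hi (ph i V W hV hW hi h x) = psi hψ h x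
  res_ph : ∀ i V V' W W' hV hV' hW hW' hi hi' h h' (hVV : V' ≤ V) (hWW : W' ≤ W) x,
    resR pX A' hWW (ph i V W hV hW hi h x) = ph i V' W' hV' hW' hi' h' (η.rs hVV x)

variable {φ} {t : A'.carrier}

/-- The trivialization with index `j` is lifted through the chart with index `i`, whose kernel has
square zero; this is the restriction of `θ_ij` to `Γ(X, V)`. -/
lemma exists_chart_lifts [Smooth pX] (hs : IsSmallExtension φ t) {U : X.Opens} (hU : IsAffineOpen U)
    {i j : ι} (hi : U ≤ 𝒰 i) (hj : U ≤ 𝒰 j) :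
    ∃ g : ∀ v : {V : X.Opens // IsAffineOpen V ∧ V ≤ U}, Γ(X, v.1) →+* Rg A' v.1,
      (∀ v x, T.p φ i v.1 v.2.1 (v.2.2.trans hi) (g v x) = T.τ j v.1 v.2.1 (v.2.2.trans hj) x) ∧
      (∀ v x, g v (strHom pX v.1 x) = inl (algebraMap k A'.carrier x)) ∧
      ∀ {v w : {V : X.Opens // IsAffineOpen V ∧ V ≤ U}} (h : v ≤ w) x,
        resR pX A' h (g w x) = g v (res h x) :=
  exists_compatible_lift (P := {V : X.Opens // IsAffineOpen V ∧ V ≤ U})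
    (C := fun v => Γ(X, v.1)) (E' := fun v => Rg A' v.1) (E := fun v => Γ(σ.total, σ.up v.1))
    ⟨U, hU, le_rfl⟩ (fun v => v.2.2) (fun h => res h) (fun h => resR pX A' h)
    (fun h => σ.rs h) (fun h h' a => res_res h' h a) (fun h h' a => resR_resR pX h' h a)
    (fun v => strHom pX v.1) (fun v => (inl).comp (algebraMap k A'.carrier))
    (fun h x => res_strHom _ _ _) (fun h x => resR_inl _ _ _)
    (fun v => T.p φ i v.1 v.2.1 (v.2.2.trans hi)) (fun v => T.p_surjective _ _ hs)
    (fun v => T.isNilpotent_ker_p _ _ hs) (fun h x => T.rs_p φ _ _ _ h x)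
    (fun v => T.τ j v.1 v.2.1 (v.2.2.trans hj)) (fun h x => T.rs_τ _ _ _ _ _ _ _ h x)
    (fun v x => by
      rw [RingHom.comp_apply, T.p_inl, ← IsAlgOver.algebraMap_eq (pX := pX), T.τ_algebraMap]
      congr 1
      exact φ.commutes x)
    (formallySmooth_strHom pX hU) (fun v => formallyEtale_res hU v.2.1 _)

lemma p_tlift {i j : ι} {V : X.Opens} (hV : IsAffineOpen V) (hi : V ≤ 𝒰 i) (hj : V ≤ 𝒰 j)
    (g : Γ(X, V) →+* Rg A' V) (hc : ∀ c : k, inl (algebraMap k A'.carrier c) = g (algebraMap k _ c))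
    (hg : ∀ x, T.p φ i V hV hi (g x) = T.τ j V hV hj x) (x : Rg A' V) :
    T.p φ i V hV hi (tlift inl g hc x) = T.p φ j V hV hj x := by
  refine congrArg (fun m : Rg A' V →+* Γ(σ.total, σ.up V) => m x) (tensor_ringHom_ext
    (f := (T.p φ i V hV hi).comp (tlift inl g hc)) (g := T.p φ j V hV hj)
    (fun a => ?_) (fun a => ?_))
  · rw [RingHom.comp_apply, tlift_tmul, map_one, mul_one, T.p_inl, T.p_tmul, map_one, mul_one]
  · rw [RingHom.comp_apply, tlift_tmul, map_one, one_mul, T.p_tmul, map_one, map_one, one_mul, hg]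

lemma resR_tlift {V V' : X.Opens} (h : V' ≤ V) (g : Γ(X, V) →+* Rg A' V)
    (hc : ∀ c : k, inl (algebraMap k A'.carrier c) = g (algebraMap k _ c))
    (g' : Γ(X, V') →+* Rg A' V')
    (hc' : ∀ c : k, inl (algebraMap k A'.carrier c) = g' (algebraMap k _ c))
    (hg : ∀ x, resR pX A' h (g x) = g' (res h x)) (x : Rg A' V) :
    resR pX A' h (tlift inl g hc x) = tlift inl g' hc' (resR pX A' h x) := by
  refine congrArg (fun m : Rg A' V →+* Rg A' V' => m x) (tensor_ringHom_ext
    (f := (resR pX A' h).comp (tlift inl g hc)) (g := (tlift inl g' hc').comp (resR pX A' h))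
    (fun a => ?_) (fun a => ?_))
  · rw [RingHom.comp_apply, tlift_tmul, map_one, mul_one, RingHom.comp_apply, resR_tmul,
      tlift_tmul, map_one, map_one, mul_one, resR_inl]
  · rw [RingHom.comp_apply, tlift_tmul, map_one, one_mul, RingHom.comp_apply, resR_tmul,
      tlift_tmul, map_one, one_mul, hg]

/-- `hX` makes the overlap of two members of the cover affine, so that it can serve as the largest
index of the lifting problem. The lift found on `Γ(X, V)` is then extended linearly over `A'`. -/
lemma exists_twists [Smooth pX] (hs : IsSmallExtension φ t) (h𝒰 : ∀ i, IsAffineOpen (𝒰 i))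
    (hX : ∀ V W : X.Opens, IsAffineOpen V → IsAffineOpen W → IsAffineOpen (V ⊓ W)) (i j : ι) :
    ∃ θ : ∀ (V : X.Opens), IsAffineOpen V → V ≤ 𝒰 i → V ≤ 𝒰 j → (Rg A' V →+* Rg A' V),
      (∀ V hV hi hj a, θ V hV hi hj (inl a) = inl a) ∧
      (∀ V hV hi hj x, T.p φ i V hV hi (θ V hV hi hj x) = T.p φ j V hV hj x) ∧
      ∀ V V' hV hV' hi hj hi' hj' (h : V' ≤ V) x,
        resR pX A' h (θ V hV hi hj x) = θ V' hV' hi' hj' (resR pX A' h x) := by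
  have hij := hX _ _ (h𝒰 i) (h𝒰 j)
  obtain ⟨g, h1, h2, h3⟩ := exists_chart_lifts T hs hij (inf_le_left : _ ≤ 𝒰 i) inf_le_right
  have hc : ∀ (v : {V : X.Opens // IsAffineOpen V ∧ V ≤ 𝒰 i ⊓ 𝒰 j}) (c : k),
      (inl (algebraMap k A'.carrier c) : Rg A' v.1) = g v (algebraMap k _ c) := fun v c => by
    rw [IsAlgOver.algebraMap_eq (pX := pX), h2]
  refine ⟨fun V hV hi hj => tlift inl (g ⟨V, hV, le_inf hi hj⟩) (hc ⟨V, hV, le_inf hi hj⟩), ?_, ?_, ?_⟩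
  · intro V hV hi hj a
    exact (tlift_tmul inl (g ⟨V, hV, le_inf hi hj⟩) (hc ⟨V, hV, le_inf hi hj⟩) a 1).trans
      (by rw [map_one, mul_one])
  · intro V hV hi hj x
    exact p_tlift T hV hi hj _ _ (h1 ⟨V, hV, le_inf hi hj⟩) x
  · intro V V' hV hV' hi hj hi' hj' h x
    exact resR_tlift h _ _ _ _ (h3 (v := ⟨V', hV', le_inf hi' hj'⟩) (w := ⟨V, hV, le_inf hi hj⟩) h) x

/-- On a trivial deformation an `A'`-bilinear biderivation is determined by its values on `Γ(X, V)`,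
which are lifted along a linear section of `φ`. Only the Jacobi identity can get lost. -/
lemma exists_brackets (hs : IsSmallExtension φ t) :
    ∃ lam : ∀ (i : ι) (V : X.Opens), IsAffineOpen V → V ≤ 𝒰 i → Rg A' V → Rg A' V → Rg A' V,
      (∀ i V hV hi, IsBiderivation (lam i V hV hi)) ∧
      (∀ i V hV hi a x, lam i V hV hi (inl a) x = 0) ∧
      (∀ i V hV hi x y, T.p φ i V hV hi (lam i V hV hi x y) =
        σ.br V (T.p φ i V hV hi x) (T.p φ i V hV hi y)) ∧
      ∀ i V V' hV hV' hi hi' (h : V' ≤ V) x y,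
        resR pX A' h (lam i V hV hi x y) = lam i V' hV' hi' (resR pX A' h x) (resR pX A' h y) := by
  obtain ⟨s, hs'⟩ := φ.toLinearMap.exists_rightInverse_of_surjective
    (LinearMap.range_eq_top.mpr hs.surjective)
  have hs'' : ∀ x, φ (s x) = x := fun x => congrArg (fun l => l x) hs'
  refine ⟨fun i V hV hi => liftBracket s (T.bijective_triv hV hi) (σ.br V) (σ.isBiderivation_br V)
    (σ.br_str V), ?_, ?_, ?_, ?_⟩
  · intro i V hV hi
    exact liftBracket_isBiderivation _ _ _ _ _
  · intro i V hV hi a x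
    exact liftBracket_inl_left _ _ _ _ _ _ _
  · intro i V hV hi x y
    exact tlift_liftBracket s (T.bijective_triv hV hi) (σ.br V) (σ.isBiderivation_br V)
      (σ.br_str V) hs'' (T.tlift_compat φ i V hV hi) x y
  · intro i V V' hV hV' hi hi' h x y
    exact liftBracket_natural s (T.bijective_triv hV hi) (σ.br V) (σ.isBiderivation_br V)
      (σ.br_str V) (T.bijective_triv hV' hi') (σ.br V') (σ.isBiderivation_br V')
      (σ.br_str V') (resAlg pX h) (σ.rs h) (σ.rs_str h) (fun x => T.rs_τ _ _ _ _ _ _ _ h x)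
      (σ.rs_br h) x y

lemma psi_str (hψ' : ψ ≫ η.toBase = σ.toBase ≫ ArtAlg.specMap (φ.comp β)) {V : Y.Opens}
    {W : X.Opens} (h : W ≤ f ⁻¹ᵁ V) (a : B.carrier) :
    psi hψ h (η.str V a) = σ.str W (φ (β a)) :=
  (comorph_strHom ψ hψ' _ a).trans (strHom_specMap _ _ _ _)

/-- Pairs of affine open subsets `V ⊆ V₀`, `W ⊆ U` with `f(W) ⊆ V`. -/
structure AffinePair (f : X ⟶ Y) (V₀ : Y.Opens) (U : X.Opens) where
  V : Y.Opens
  W : X.Opens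
  hV : IsAffineOpen V
  hW : IsAffineOpen W
  hV₀ : V ≤ V₀
  hU : W ≤ U
  le : W ≤ f ⁻¹ᵁ V

instance (V₀ : Y.Opens) (U : X.Opens) : Preorder (AffinePair f V₀ U) where
  le v w := v.V ≤ w.V ∧ v.W ≤ w.W
  le_refl v := ⟨le_rfl, le_rfl⟩
  le_trans _ _ _ h h' := ⟨h.1.trans h'.1, h.2.trans h'.2⟩

lemma AffinePair.le_mk {V₀ : Y.Opens} {U : X.Opens} {v w : AffinePair f V₀ U} (h : v.V ≤ w.V)
    (h' : v.W ≤ w.W) : v ≤ w := ⟨h, h'⟩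

lemma AffinePair.le_V {V₀ : Y.Opens} {U : X.Opens} {v w : AffinePair f V₀ U} (h : v ≤ w) :
    v.V ≤ w.V := h.1

lemma AffinePair.le_W {V₀ : Y.Opens} {U : X.Opens} {v w : AffinePair f V₀ U} (h : v ≤ w) :
    v.W ≤ w.W := h.2

/-- The lifting problem is posed over `B`: its functions act on the target through `η.str` and on
`A' ⊗ Γ(X, W)` through `β`, and the former is formally smooth. -/
lemma exists_pair_lifts [Smooth pY] (hs : IsSmallExtension φ t)
    (hψ' : ψ ≫ η.toBase = σ.toBase ≫ ArtAlg.specMap (φ.comp β)) {V₀ : Y.Opens}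
    (hV₀ : IsAffineOpen V₀) {i : ι} (hU : IsAffineOpen (𝒰 i)) (hiV : 𝒰 i ≤ f ⁻¹ᵁ V₀) :
    ∃ g : ∀ v : AffinePair f V₀ (𝒰 i), Γ(η.total, η.up v.V) →+* Rg A' v.W,
      (∀ v x, T.p φ i v.W v.hW v.hU (g v x) = psi hψ v.le x) ∧
      (∀ v x, g v (η.str v.V x) = inl (β x)) ∧
      ∀ {v w : AffinePair f V₀ (𝒰 i)} (h : v ≤ w) x,
        resR pX A' (AffinePair.le_W h) (g w x) = g v (η.rs (AffinePair.le_V h) x) :=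
  exists_compatible_lift (P := AffinePair f V₀ (𝒰 i))
    (C := fun v => Γ(η.total, η.up v.V)) (E' := fun v => Rg A' v.W)
    (E := fun v => Γ(σ.total, σ.up v.W))
    ⟨V₀, 𝒰 i, hV₀, hU, le_rfl, le_rfl, hiV⟩ (fun v => AffinePair.le_mk v.hV₀ v.hU)
    (fun h => η.rs (AffinePair.le_V h)) (fun h => resR pX A' (AffinePair.le_W h))
    (fun h => σ.rs (AffinePair.le_W h))
    (fun h h' a => η.rs_rs _ _ a) (fun h h' a => resR_resR pX _ _ a)
    (fun v => η.str v.V) (fun v => (inl).comp (β : B.carrier →+* A'.carrier))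
    (fun h x => η.rs_str _ _) (fun h x => resR_inl _ _ _)
    (fun v => T.p φ i v.W v.hW v.hU) (fun v => T.p_surjective _ _ hs)
    (fun v => T.isNilpotent_ker_p _ _ hs) (fun h x => T.rs_p φ _ _ _ _ x)
    (fun v => psi hψ v.le) (fun h x => rs_psi hψ _ _ _ _ x)
    (fun v x => by
      rw [RingHom.comp_apply, T.p_inl, psi_str hψ β hψ']; rfl)
    (η.formallySmooth_str hV₀) (fun v => η.formallyEtale_rs hV₀ v.hV _)

lemma exists_morphism_lifts [Smooth pY] (hs : IsSmallExtension φ t)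
    (hψ' : ψ ≫ η.toBase = σ.toBase ≫ ArtAlg.specMap (φ.comp β)) (h𝒰 : IsAdaptedAffineCover f 𝒰)
    (hY : ∀ V W : Y.Opens, IsAffineOpen V → IsAffineOpen W → IsAffineOpen (V ⊓ W)) (i : ι) :
    ∃ ph : ∀ (V : Y.Opens) (W : X.Opens), IsAffineOpen V → IsAffineOpen W → W ≤ 𝒰 i →
      W ≤ f ⁻¹ᵁ V → (Γ(η.total, η.up V) →+* Rg A' W),
      (∀ V W hV hW hi h a, ph V W hV hW hi h (η.str V a) = inl (β a)) ∧
      (∀ V W hV hW hi h x, T.p φ i W hW hi (ph V W hV hW hi h x) = psi hψ h x) ∧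
      ∀ V V' W W' hV hV' hW hW' hi hi' h h' (hVV : V' ≤ V) (hWW : W' ≤ W) x,
        resR pX A' hWW (ph V W hV hW hi h x) = ph V' W' hV' hW' hi' h' (η.rs hVV x) := by
  obtain ⟨V₀, hV₀, hiV⟩ := h𝒰.le_preimage i
  obtain ⟨g, h1, h2, h3⟩ := exists_pair_lifts hψ T β hs hψ' hV₀ (h𝒰.isAffineOpen i) hiV
  have hle : ∀ {V : Y.Opens} {W : X.Opens}, W ≤ 𝒰 i → W ≤ f ⁻¹ᵁ V → W ≤ f ⁻¹ᵁ (V ⊓ V₀) :=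
    fun hi h => le_inf h (hi.trans hiV)
  -- An arbitrary affine `V` is first cut down to `V ⊓ V₀`, with one fixed `V₀` for each `i`, so
  -- that all values come from a single compatible family.
  refine ⟨fun V W hV hW hi h => (g ⟨V ⊓ V₀, W, hY _ _ hV hV₀, hW, inf_le_right, hi, hle hi h⟩).comp
    (η.rs inf_le_left), ?_, ?_, ?_⟩
  · intro V W hV hW hi h a
    exact (congrArg _ (η.rs_str _ a)).trans (h2 _ _)
  · intro V W hV hW hi h x
    refine (h1 ⟨V ⊓ V₀, W, hY _ _ hV hV₀, hW, inf_le_right, hi, hle hi h⟩ _).trans ?_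
    exact (rs_psi hψ h _ inf_le_left le_rfl x).symm.trans (σ.rs_self _ _)
  · intro V V' W W' hV hV' hW hW' hi hi' h h' hVV hWW x
    refine (h3 (v := ⟨V' ⊓ V₀, W', hY _ _ hV' hV₀, hW', inf_le_right, hi', hle hi' h'⟩)
      (w := ⟨V ⊓ V₀, W, hY _ _ hV hV₀, hW, inf_le_right, hi, hle hi h⟩)
      ⟨inf_le_inf_right _ hVV, hWW⟩ (η.rs inf_le_left x)).trans ?_
    exact congrArg _ ((η.rs_rs _ _ x).trans (η.rs_rs _ _ x).symm)

lemma exists_liftData [Smooth pX] [Smooth pY] (hs : IsSmallExtension φ t)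
    (hψ' : ψ ≫ η.toBase = σ.toBase ≫ ArtAlg.specMap (φ.comp β)) (h𝒰 : IsAdaptedAffineCover f 𝒰)
    (hX : ∀ V W : X.Opens, IsAffineOpen V → IsAffineOpen W → IsAffineOpen (V ⊓ W))
    (hY : ∀ V W : Y.Opens, IsAffineOpen V → IsAffineOpen W → IsAffineOpen (V ⊓ W)) :
    Nonempty (LiftData hψ T φ β) := by
  choose θ a1 a2 a3 using exists_twists T hs h𝒰.isAffineOpen hX
  obtain ⟨lam, b1, b2, b3, b4⟩ := exists_brackets T hs
  choose ph c1 c2 c3 using exists_morphism_lifts hψ T β hs hψ' h𝒰 hY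
  exact ⟨⟨θ, a1, a2, a3, lam, b1, b2, b3, b4, ph, c1, c2, c3⟩⟩

end LiftData

end

end PoissonDef
namespace PoissonDef
open TensorProduct

noncomputable section

set_option linter.unusedSectionVars false

/-! ### Polyvectors determined by their values on affine open subsets -/

section Polyvectors

variable {k : Type u} [Field k] {X Y : Scheme.{u}} {f : X ⟶ Y}

lemma AffinePair.le_inf {V₀ : Y.Opens} {U : X.Opens} (v : AffinePair f V₀ U) :
    v.W ≤ U ⊓ f ⁻¹ᵁ V₀ := _root_.le_inf v.hU (v.le.trans (f.preimage_mono v.hV₀))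

lemma exists_affinePair {V₀ : Y.Opens} {U : X.Opens} {x : X} (hx : x ∈ U ⊓ f ⁻¹ᵁ V₀) :
    ∃ v : AffinePair f V₀ U, x ∈ v.W := by
  obtain ⟨V, hV, hxV, hVV₀⟩ := exists_affine_mem_le (X := Y) (p := f x) hx.2
  obtain ⟨W, hW, hxW, hWU⟩ := exists_affine_mem_le (U := U ⊓ f ⁻¹ᵁ V) (p := x) ⟨hx.1, hxV⟩
  exact ⟨⟨V, W, hV, hW, hVV₀, hWU.trans inf_le_left, hWU.trans inf_le_right⟩, hxW⟩

lemma section_ext_pair {V₀ : Y.Opens} {U : X.Opens} {a b : Γ(X, U ⊓ f ⁻¹ᵁ V₀)}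
    (h : ∀ v : AffinePair f V₀ U, (v.W : Set X).Nonempty → res v.le_inf a = res v.le_inf b) : a = b := by
  refine section_ext fun x hx => ?_
  obtain ⟨v, hv⟩ := exists_affinePair hx
  exact ⟨v.W, v.le_inf, hv, h v ⟨x, hv⟩⟩

/-- `Spec k` is a point, so linearity over the functions of the base, tested on nonempty open sets,
is linearity over `k`. -/
lemma opens_eq_top_of_nonempty {W : (Spec (.of k)).Opens}
    (h : (W : Set (Spec (.of k))).Nonempty) : W = ⊤ := by
  obtain ⟨x, hx⟩ := h
  have : Subsingleton (Spec (.of k)) := inferInstanceAs (Subsingleton (PrimeSpectrum k))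
  ext y
  simp only [TopologicalSpace.Opens.coe_top, Set.mem_univ, iff_true]
  rw [Subsingleton.elim y x]; exact hx

variable {pY : Y ⟶ Spec (.of k)}

/-- Alternating polyderivations given on affine open subsets. -/
structure AffinePolyvector (f : X ⟶ Y) (pY : Y ⟶ Spec (.of k)) (q : ℕ) (U : X.Opens) where
  M : ∀ (V : Y.Opens) (W : X.Opens), IsAffineOpen V → IsAffineOpen W → W ≤ U → W ≤ f ⁻¹ᵁ V →
    (Fin q → Γ(Y, V)) → Γ(X, W)
  map_add : ∀ V W hV hW hU h a i x y, M V W hV hW hU h (Function.update a i (x + y)) =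
    M V W hV hW hU h (Function.update a i x) + M V W hV hW hU h (Function.update a i y)
  leibniz : ∀ V W hV hW hU h a i x y, M V W hV hW hU h (Function.update a i (x * y)) =
    comorph f V W h x * M V W hV hW hU h (Function.update a i y) +
      comorph f V W h y * M V W hV hW hU h (Function.update a i x)
  map_base : ∀ V W hV hW hU h a i c, M V W hV hW hU h (Function.update a i (strHom pY V c)) = 0
  alternating : ∀ V W hV hW hU h a i j, i ≠ j → a i = a j → M V W hV hW hU h a = 0
  compat : ∀ V V' W W' hV hV' hW hW' hU hU' h h' (hVV : V' ≤ V) (hWW : W' ≤ W) a,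
    res hWW (M V W hV hW hU h a) = M V' W' hV' hW' hU' h' (fun i => res hVV (a i))

lemma res_update {V V' : Y.Opens} (h : V' ≤ V) {q : ℕ} (a : Fin q → Γ(Y, V)) (i : Fin q)
    (x : Γ(Y, V)) : (fun l => res h (Function.update a i x l)) =
      Function.update (fun l => res h (a l)) i (res h x) := by
  funext l
  by_cases hl : l = i
  · subst hl; simp
  · simp [Function.update_of_ne hl]

/-- Affine pairs cover `U ⊓ f ⁻¹ᵁ V`, and two pairs through a point are refined by a third. Hence
the values glue, and each identity can be checked on pairs. -/
lemma AffinePolyvector.exists_polyvector {q : ℕ} {U : X.Opens} (Q : AffinePolyvector f pY q U) :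
    ∃ P ∈ polyvectors f pY q U, ∀ (V : Y.Opens) (a : Fin q → Γ(Y, V)) (v : AffinePair f V U),
      res v.le_inf (P V a) = Q.M v.V v.W v.hV v.hW v.hU v.le (fun l => res v.hV₀ (a l)) := by
  have key : ∀ (V : Y.Opens) (a : Fin q → Γ(Y, V)), ∃ x : Γ(X, U ⊓ f ⁻¹ᵁ V), ∀ v : AffinePair f V U,
      res v.le_inf x = Q.M v.V v.W v.hV v.hW v.hU v.le (fun l => res v.hV₀ (a l)) := by
    intro V a
    refine exists_glue (fun v : AffinePair f V U => v.W) (fun v => v.le_inf)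
      (fun p hp => exists_affinePair hp) _ fun v w p hp hp' => ?_
    obtain ⟨z, hz⟩ := exists_affinePair (f := f) (U := v.W ⊓ w.W) (V₀ := v.V ⊓ w.V) (x := p)
      ⟨⟨hp, hp'⟩, v.le hp, w.le hp'⟩
    refine ⟨z.W, z.hU.trans inf_le_left, z.hU.trans inf_le_right, hz, ?_⟩
    rw [Q.compat v.V z.V v.W z.W v.hV z.hV v.hW z.hW v.hU ((z.hU.trans inf_le_left).trans v.hU) v.le
        z.le (z.hV₀.trans inf_le_left),
      Q.compat w.V z.V w.W z.W w.hV z.hV w.hW z.hW w.hU ((z.hU.trans inf_le_left).trans v.hU) w.le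
        z.le (z.hV₀.trans inf_le_right)]
    simp only [res_res]
  choose P hP using key
  refine ⟨P, (show IsPolyvector f pY P from ⟨?_, ?_, ?_, ?_, ?_⟩), hP⟩
  · intro V a i x y
    refine section_ext_pair fun v _ => ?_
    rw [_root_.map_add, hP, hP, hP, res_update, res_update, res_update, _root_.map_add, Q.map_add]
  · intro V a i x y
    refine section_ext_pair fun v _ => ?_
    rw [_root_.map_add, map_mul, map_mul, hP, hP, hP, res_update, res_update, res_update, map_mul,
      Q.leibniz, comorph_res', comorph_res', res_comorph, res_comorph]
  · intro V W h r a i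
    refine section_ext_pair fun v hv => ?_
    obtain ⟨x, hx⟩ := hv
    obtain rfl : W = ⊤ := opens_eq_top_of_nonempty ⟨_, h (v.hV₀ (v.le hx))⟩
    obtain ⟨c, hc⟩ := exists_eq_strHom rfl h r
    rw [hc, hP, res_update, res_strHom, Q.map_base, map_zero]
  · intro V a i j hij h
    refine section_ext_pair fun v _ => ?_
    rw [hP, Q.alternating _ _ _ _ _ _ _ i j hij (by simp only [h]), map_zero]
  · intro V V' h a
    refine section_ext_pair fun v _ => ?_
    rw [res_res, hP]
    have := hP V a ⟨v.V, v.W, v.hV, v.hW, v.hV₀.trans h, v.hU, v.le⟩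
    refine this.trans ?_
    simp only [res_res]

/-- The polyvector with the given values on affine open subsets. -/
def AffinePolyvector.toRaw {q : ℕ} {U : X.Opens} (Q : AffinePolyvector f pY q U) : Raw f q U :=
  Q.exists_polyvector.choose

lemma AffinePolyvector.toRaw_mem {q : ℕ} {U : X.Opens} (Q : AffinePolyvector f pY q U) :
    Q.toRaw ∈ polyvectors f pY q U := Q.exists_polyvector.choose_spec.1

lemma AffinePolyvector.res_toRaw {q : ℕ} {U : X.Opens} (Q : AffinePolyvector f pY q U) (V : Y.Opens)
    (a : Fin q → Γ(Y, V)) (v : AffinePair f V U) :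
    res v.le_inf (Q.toRaw V a) = Q.M v.V v.W v.hV v.hW v.hU v.le (fun l => res v.hV₀ (a l)) :=
  Q.exists_polyvector.choose_spec.2 V a v

end Polyvectors

section Constructors

variable {k : Type u} [Field k] {X Y : Scheme.{u}} {f : X ⟶ Y} {pY : Y ⟶ Spec (.of k)} {U : X.Opens}

lemma eq_of_ne_fin_two {α : Type*} {a : Fin 2 → α} {i j : Fin 2} (hij : i ≠ j) (e : a i = a j) :
    a 0 = a 1 := by
  fin_cases i <;> fin_cases j <;> simp_all

lemma eq_of_ne_fin_three {α : Type*} {a : Fin 3 → α} {i j : Fin 3} (hij : i ≠ j) (e : a i = a j) :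
    a 0 = a 1 ∨ a 1 = a 2 ∨ a 2 = a 0 := by
  fin_cases i <;> fin_cases j <;> simp_all

/-- A vector field along `f` from its values on affine open subsets. -/
def AffinePolyvector.mk₁
    (M : ∀ (V : Y.Opens) (W : X.Opens), IsAffineOpen V → IsAffineOpen W → W ≤ U → W ≤ f ⁻¹ᵁ V →
      Γ(Y, V) → Γ(X, W))
    (map_add : ∀ V W hV hW hU h x y, M V W hV hW hU h (x + y) =
      M V W hV hW hU h x + M V W hV hW hU h y)
    (leibniz : ∀ V W hV hW hU h x y, M V W hV hW hU h (x * y) =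
      comorph f V W h x * M V W hV hW hU h y + comorph f V W h y * M V W hV hW hU h x)
    (map_base : ∀ V W hV hW hU h c, M V W hV hW hU h (strHom pY V c) = 0)
    (compat : ∀ V V' W W' hV hV' hW hW' hU hU' h h' (hVV : V' ≤ V) (hWW : W' ≤ W) a,
      res hWW (M V W hV hW hU h a) = M V' W' hV' hW' hU' h' (res hVV a)) :
    AffinePolyvector f pY 1 U where
  M V W hV hW hU h a := M V W hV hW hU h (a 0)
  map_add V W hV hW hU h a i x y := by
    obtain rfl := Subsingleton.elim i 0
    simp only [Function.update_self, map_add]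
  leibniz V W hV hW hU h a i x y := by
    obtain rfl := Subsingleton.elim i 0
    simp only [Function.update_self, leibniz]
  map_base V W hV hW hU h a i c := by
    obtain rfl := Subsingleton.elim i 0
    simp only [Function.update_self, map_base]
  alternating V W hV hW hU h a i j hij _ := absurd (Subsingleton.elim i j) hij
  compat V V' W W' hV hV' hW hW' hU hU' h h' hVV hWW a :=
    compat V V' W W' hV hV' hW hW' hU hU' h h' hVV hWW (a 0)

/-- A bivector field along `f` from its values on affine open subsets. -/
def AffinePolyvector.mk₂
    (M : ∀ (V : Y.Opens) (W : X.Opens), IsAffineOpen V → IsAffineOpen W → W ≤ U → W ≤ f ⁻¹ᵁ V →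
      Γ(Y, V) → Γ(Y, V) → Γ(X, W))
    (map_add : ∀ V W hV hW hU h x y z, M V W hV hW hU h (x + y) z =
      M V W hV hW hU h x z + M V W hV hW hU h y z)
    (leibniz : ∀ V W hV hW hU h x y z, M V W hV hW hU h (x * y) z =
      comorph f V W h x * M V W hV hW hU h y z + comorph f V W h y * M V W hV hW hU h x z)
    (map_base : ∀ V W hV hW hU h c z, M V W hV hW hU h (strHom pY V c) z = 0)
    (self : ∀ V W hV hW hU h x, M V W hV hW hU h x x = 0)
    (skew : ∀ V W hV hW hU h x y, M V W hV hW hU h x y = - M V W hV hW hU h y x)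
    (compat : ∀ V V' W W' hV hV' hW hW' hU hU' h h' (hVV : V' ≤ V) (hWW : W' ≤ W) a b,
      res hWW (M V W hV hW hU h a b) = M V' W' hV' hW' hU' h' (res hVV a) (res hVV b)) :
    AffinePolyvector f pY 2 U where
  M V W hV hW hU h a := M V W hV hW hU h (a 0) (a 1)
  map_add V W hV hW hU h a i x y := by
    fin_cases i
    · simp [map_add]
    · have e := skew V W hV hW hU h (a 0)
      simp; rw [e (x + y), e x, e y, map_add]; ring
  leibniz V W hV hW hU h a i x y := by
    fin_cases i
    · simp [leibniz]
    · have e := skew V W hV hW hU h (a 0)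
      simp; rw [e (x * y), e x, e y, leibniz]; ring
  map_base V W hV hW hU h a i c := by
    fin_cases i
    · simp [map_base]
    · have e := skew V W hV hW hU h (a 0)
      simp; rw [e, map_base, neg_zero]
  alternating V W hV hW hU h a i j hij e := by
    have := eq_of_ne_fin_two hij e
    rw [this, self]
  compat V V' W W' hV hV' hW hW' hU hU' h h' hVV hWW a :=
    compat V V' W W' hV hV' hW hW' hU hU' h h' hVV hWW (a 0) (a 1)

/-- A trivector field along `f` from its values on affine open subsets. -/
def AffinePolyvector.mk₃
    (M : ∀ (V : Y.Opens) (W : X.Opens), IsAffineOpen V → IsAffineOpen W → W ≤ U → W ≤ f ⁻¹ᵁ V →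
      Γ(Y, V) → Γ(Y, V) → Γ(Y, V) → Γ(X, W))
    (map_add : ∀ V W hV hW hU h x y z w, M V W hV hW hU h (x + y) z w =
      M V W hV hW hU h x z w + M V W hV hW hU h y z w)
    (leibniz : ∀ V W hV hW hU h x y z w, M V W hV hW hU h (x * y) z w =
      comorph f V W h x * M V W hV hW hU h y z w + comorph f V W h y * M V W hV hW hU h x z w)
    (map_base : ∀ V W hV hW hU h c z w, M V W hV hW hU h (strHom pY V c) z w = 0)
    (self : ∀ V W hV hW hU h x y, M V W hV hW hU h x x y = 0)
    (cyclic : ∀ V W hV hW hU h x y z, M V W hV hW hU h x y z = M V W hV hW hU h y z x)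
    (compat : ∀ V V' W W' hV hV' hW hW' hU hU' h h' (hVV : V' ≤ V) (hWW : W' ≤ W) a b c,
      res hWW (M V W hV hW hU h a b c) =
        M V' W' hV' hW' hU' h' (res hVV a) (res hVV b) (res hVV c)) :
    AffinePolyvector f pY 3 U where
  M V W hV hW hU h a := M V W hV hW hU h (a 0) (a 1) (a 2)
  map_add V W hV hW hU h a i x y := by
    fin_cases i
    · simp [map_add]
    · have e := fun z => cyclic V W hV hW hU h (a 0) z (a 2)
      simp; rw [e (x + y), e x, e y, map_add]
    · have e := fun z => (cyclic V W hV hW hU h z (a 0) (a 1)).symm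
      simp; rw [e (x + y), e x, e y, map_add]
  leibniz V W hV hW hU h a i x y := by
    fin_cases i
    · simp [leibniz]
    · have e := fun z => cyclic V W hV hW hU h (a 0) z (a 2)
      simp; rw [e (x * y), e x, e y, leibniz]
    · have e := fun z => (cyclic V W hV hW hU h z (a 0) (a 1)).symm
      simp; rw [e (x * y), e x, e y, leibniz]
  map_base V W hV hW hU h a i c := by
    fin_cases i
    · simp [map_base]
    · have e := fun z => cyclic V W hV hW hU h (a 0) z (a 2)
      simp; rw [e, map_base]
    · have e := fun z => (cyclic V W hV hW hU h z (a 0) (a 1)).symm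
      simp; rw [e, map_base]
  alternating V W hV hW hU h a i j hij e := by
    rcases eq_of_ne_fin_three hij e with h1 | h1 | h1
    · rw [h1, self]
    · rw [h1, cyclic, self]
    · rw [h1, cyclic, cyclic, self]
  compat V V' W W' hV hV' hW hW' hU hU' h h' hVV hWW a :=
    compat V V' W W' hV hV' hW hW' hU hU' h h' hVV hWW (a 0) (a 1) (a 2)

end Constructors

end

end PoissonDef
namespace PoissonDef
open TensorProduct

noncomputable section

set_option linter.unusedSectionVars false

/-! ### Errors descend to tensors on the closed fibres -/

section Descent

variable {k : Type u} [Field k] {A A' B : ArtAlg k} {O : Type u} [CommRing O] [Algebra k O]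
  {φ : A'.carrier →ₐ[k] A.carrier} {t : A'.carrier} (h : IsSmallExtension φ t)
  (β : B.carrier →ₐ[k] A'.carrier) {S C : Type u} [CommRing S] [CommRing C]
  {b : B.carrier →+* S} {r : S →+* C} (hr : RingHom.ker r = B.maxIdeal.map b)
  (hr' : Function.Surjective r) (f : C →+* O) {P Q : S → A'.carrier ⊗[k] O}
  (hP : ∀ x, augm O A' (P x) = f (r x)) (hQ : ∀ x, augm O A' (Q x) = f (r x))
  (hPb : ∀ s, P (b s) = inl (β s))

include h hr hr' hP hQ hPb

/-- A derivation with values in `t ⊗ O` comes from a derivation of the reduction. -/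
lemma descend₁ (E : S → A'.carrier ⊗[k] O) (hadd : ∀ x y, E (x + y) = E x + E y)
    (hmul : ∀ x y, E (x * y) = P x * E y + Q y * E x) (hb : ∀ s, E (b s) = 0)
    (hE : ∀ x, ∃ o, E x = tmulBy t o) :
    ∃ c : C → O, (∀ x, E x = tmulBy t (c (r x))) ∧ (∀ a b, c (a + b) = c a + c b) ∧
      (∀ a b, c (a * b) = f a * c b + f b * c a) ∧ ∀ s, c (r (b s)) = 0 := by
  obtain ⟨s, hs⟩ := hr'.hasRightInverse
  choose o ho using hE
  -- `E` is additive, linear over `B` and takes values in `t ⊗ O`, so it depends only on the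
  -- reduction of its argument; `s` is a merely set-theoretic section.
  have key : ∀ x, E x = tmulBy t (o (s (r x))) := fun x => by
    rw [← ho]
    refine h.eq_of_red_eq β hr E hadd (fun s x => ?_) (fun x => ⟨o x, ho x⟩) (hs (r x)).symm
    rw [hmul, hb, mul_zero, add_zero, hPb]
  refine ⟨fun a => o (s a), key, fun a b => ?_, fun a b => ?_, fun a => ?_⟩
  · obtain ⟨x, rfl⟩ := hr' a
    obtain ⟨y, rfl⟩ := hr' b
    apply h.tmulBy_injective
    rw [← map_add, ← key, hadd, key, key, map_add]
  · obtain ⟨x, rfl⟩ := hr' a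
    obtain ⟨y, rfl⟩ := hr' b
    apply h.tmulBy_injective
    rw [← map_mul, ← key, hmul, key, key, map_add, h.mul_tmulBy, h.mul_tmulBy, hP, hQ]
  · apply h.tmulBy_injective
    rw [← key, hb, map_zero]

/-- The same for skew-symmetric biderivations. -/
lemma descend₂ (E : S → S → A'.carrier ⊗[k] O) (hadd : ∀ x y z, E (x + y) z = E x z + E y z)
    (hmul : ∀ x y z, E (x * y) z = P x * E y z + Q y * E x z) (hb : ∀ s z, E (b s) z = 0)
    (hE : ∀ x y, ∃ o, E x y = tmulBy t o) (hskew : ∀ x y, E x y = -E y x) :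
    ∃ c : C → C → O, (∀ x y, E x y = tmulBy t (c (r x) (r y))) ∧
      (∀ a b d, c (a + b) d = c a d + c b d) ∧
      (∀ a b d, c (a * b) d = f a * c b d + f b * c a d) ∧ (∀ s d, c (r (b s)) d = 0) ∧
      ∀ a b, c a b = -c b a := by
  obtain ⟨s, hs⟩ := hr'.hasRightInverse
  have := fun z => descend₁ h β hr hr' f hP hQ hPb (fun x => E x z) (fun x y => hadd x y z)
    (fun x y => hmul x y z) (fun x => hb x z) (fun x => hE x z)
  choose c h1 h2 h3 h4 using this
  -- Descent in the first variable is the previous lemma; skew symmetry carries it over to the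
  -- second.
  have key : ∀ x y, E x y = tmulBy t (c (s (r y)) (r x)) := fun x y => by
    rw [← h1, hskew x y, hskew x, h1, h1, hs]
  refine ⟨fun a b => c (s b) a, key, fun a b d => h2 _ _ _, fun a b d => h3 _ _ _,
    fun a d => h4 _ _, fun a b => ?_⟩
  obtain ⟨x, rfl⟩ := hr' a
  obtain ⟨y, rfl⟩ := hr' b
  apply h.tmulBy_injective
  rw [map_neg, ← key, ← key, hskew]

/-- The same for triderivations invariant under cyclic permutations. -/
lemma descend₃ (E : S → S → S → A'.carrier ⊗[k] O)
    (hadd : ∀ x y z w, E (x + y) z w = E x z w + E y z w)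
    (hmul : ∀ x y z w, E (x * y) z w = P x * E y z w + Q y * E x z w)
    (hb : ∀ s z w, E (b s) z w = 0)
    (hE : ∀ x y z, ∃ o, E x y z = tmulBy t o) (hcyc : ∀ x y z, E x y z = E y z x)
    (hself : ∀ x y, E x x y = 0) :
    ∃ c : C → C → C → O, (∀ x y z, E x y z = tmulBy t (c (r x) (r y) (r z))) ∧
      (∀ a b d e, c (a + b) d e = c a d e + c b d e) ∧
      (∀ a b d e, c (a * b) d e = f a * c b d e + f b * c a d e) ∧
      (∀ s d e, c (r (b s)) d e = 0) ∧ (∀ a b, c a a b = 0) ∧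
      ∀ a b d, c a b d = c b d a := by
  obtain ⟨s, hs⟩ := hr'.hasRightInverse
  have := fun z w => descend₁ h β hr hr' f hP hQ hPb (fun x => E x z w) (fun x y => hadd x y z w)
    (fun x y => hmul x y z w) (fun x => hb x z w) (fun x => hE x z w)
  choose c h1 h2 h3 h4 using this
  have e1 : ∀ x x' y z, r x = r x' → E x y z = E x' y z := fun x x' y z h => by rw [h1, h1, h]
  have e : ∀ x, r x = r (s (r x)) := fun x => (hs _).symm
  have key : ∀ x y z, E x y z = tmulBy t (c (s (r y)) (s (r z)) (r x)) := fun x y z => by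
    rw [← h1, hcyc, e1 _ _ _ _ (e y), hcyc, e1 _ _ _ _ (e z), hcyc]
  refine ⟨fun a b d => c (s b) (s d) a, key, fun a b d e => h2 _ _ _ _, fun a b d e => h3 _ _ _ _,
    fun a d e => h4 _ _ _, fun a b => ?_, fun a b d => ?_⟩
  · obtain ⟨x, rfl⟩ := hr' a
    obtain ⟨y, rfl⟩ := hr' b
    apply h.tmulBy_injective
    rw [map_zero, ← key, hself]
  · obtain ⟨x, rfl⟩ := hr' a
    obtain ⟨y, rfl⟩ := hr' b
    obtain ⟨z, rfl⟩ := hr' d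
    apply h.tmulBy_injective
    rw [← key, ← key, hcyc]

end Descent

/-- This is where characteristic zero enters: errors are found to be skew-symmetric, while
polyvectors have to be alternating. -/
lemma eq_zero_of_eq_neg (k : Type u) [Field k] [CharZero k] {R : Type*} [CommRing R] [Algebra k R]
    {x : R} (h : x = -x) : x = 0 := by
  have h2 : (2 : k) • x = 0 := by
    rw [two_smul]
    nth_rewrite 2 [h]
    exact add_neg_cancel x
  have := congrArg (fun y => (2 : k)⁻¹ • y) h2
  simpa [smul_smul] using this

lemma jacobiator_add {R : Type*} [CommRing R] {l : R → R → R} (hl : IsBiderivation l) (x y z w : R) :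
    jacobiator l (x + y) z w = jacobiator l x z w + jacobiator l y z w := by
  simp only [jacobiator, hl.add_left, hl.add_right]; ring

/-- An iterated bracket is a second-order operator in its inner arguments, but in the cyclic sum the
products of first derivatives cancel and a derivation remains. -/
lemma jacobiator_mul {R : Type*} [CommRing R] {l : R → R → R} (hl : IsBiderivation l) (x y z w : R) :
    jacobiator l (x * y) z w = x * jacobiator l y z w + y * jacobiator l x z w := by
  simp only [jacobiator, hl.mul_left, hl.mul_right, hl.add_left, hl.skew w x, hl.skew w y,
    hl.neg_left]
  ring

lemma jacobiator_cyclic {R : Type*} [CommRing R] (l : R → R → R) (x y z : R) :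
    jacobiator l x y z = jacobiator l y z x := by
  simp only [jacobiator]; ring

lemma jacobiator_self (k : Type u) [Field k] [CharZero k] {R : Type*} [CommRing R] [Algebra k R]
    {l : R → R → R} (hl : IsBiderivation l) (x y : R) : jacobiator l x x y = 0 := by
  have h0 : l x x = 0 := eq_zero_of_eq_neg k (hl.skew x x)
  simp only [jacobiator, h0, hl.zero_left, hl.skew y x, hl.neg_left]; ring

/-! ### The five families of errors -/

section Errors

variable {k : Type u} [Field k] [CharZero k] {X Y : Scheme.{u}} {pX : X ⟶ Spec (.of k)} {pY : Y ⟶ Spec (.of k)}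
  [∀ V : X.Opens, Algebra k Γ(X, V)] [IsAlgOver pX] {Λ₀ : PoissonStructure pX}
  {P₀ : PoissonStructure pY} {f : X ⟶ Y} {A A' B : ArtAlg k}
  {σ : Deformation Λ₀ A} {η : Deformation P₀ B} {ψ : σ.total ⟶ η.total}
  {hψ : σ.incl ≫ ψ = f ≫ η.incl} {ι : Type*} {𝒰 : ι → X.Opens} {T : Charts σ 𝒰}
  {φ : A'.carrier →ₐ[k] A.carrier} {β : B.carrier →ₐ[k] A'.carrier} (D : LiftData hψ T φ β)
  {t : A'.carrier} (hs : IsSmallExtension φ t)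

namespace LiftData

lemma isTwist (i j V hV hi hj) : IsTwist (D.θ i j V hV hi hj) :=
  ⟨D.θ_inl i j V hV hi hj, fun x => by
    rw [← T.red_p φ hV hi, D.p_θ, T.red_p]⟩

lemma isBracketLift (i V hV hi) : IsBracketLift (Λ₀.bracket V) (D.lam i V hV hi) :=
  ⟨D.isBiderivation i V hV hi, D.lam_inl i V hV hi, fun x y => by
    rw [← T.red_p φ hV hi, D.p_lam, σ.red_br, T.red_p, T.red_p]⟩

lemma augm_ph (i V W hV hW hi h x) : augm Γ(X, W) A' (D.ph i V W hV hW hi h x) =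
    comorph f V W h (η.red V x) := by
  rw [← T.red_p φ hW hi, D.p_ph, red_psi]

include hs

/-- The difference `E = P - Q` of two ring homomorphisms satisfies `E (x y) = P x * E y + Q y * E
x`. Both reduce to the same map, so `E` becomes an honest derivation on the closed fibre. -/
lemma exists_twist_error {i j l V} (hV : IsAffineOpen V) (hi : V ≤ 𝒰 i) (hj : V ≤ 𝒰 j)
    (hl : V ≤ 𝒰 l) :
    ∃ c : Γ(X, V) → Γ(X, V), (∀ x, D.θ i j V hV hi hj (D.θ j l V hV hj hl x) =
        D.θ i l V hV hi hl x + tmulBy t (c (augm Γ(X, V) A' x))) ∧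
      (∀ a b, c (a + b) = c a + c b) ∧ (∀ a b, c (a * b) = a * c b + b * c a) ∧
      ∀ s, c (strHom pX V s) = 0 := by
  obtain ⟨c, h1, h2, h3, h4⟩ := descend₁ hs (AlgHom.id k A'.carrier) (b := inl) (r := augm Γ(X, V) A')
    ker_augm augm_surjective (RingHom.id _)
    (P := fun x => D.θ i j V hV hi hj (D.θ j l V hV hj hl x)) (Q := fun x => D.θ i l V hV hi hl x)
    (fun x => by rw [(D.isTwist _ _ _ _ _ _).augm_map, (D.isTwist _ _ _ _ _ _).augm_map]; rfl)
    (fun x => by rw [(D.isTwist _ _ _ _ _ _).augm_map]; rfl)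
    (fun s => by rw [D.θ_inl, D.θ_inl]; rfl)
    (fun x => D.θ i j V hV hi hj (D.θ j l V hV hj hl x) - D.θ i l V hV hi hl x)
    (fun x y => by simp only [map_add]; ring) (fun x y => by simp only [map_mul]; ring)
    (fun s => by simp only [D.θ_inl, sub_self])
    (fun x => T.exists_of_p_eq_zero hV hi hs (by
      rw [map_sub, D.p_θ, D.p_θ, D.p_θ, sub_self]))
  refine ⟨c, fun x => by rw [← h1]; ring, h2, h3, fun s => ?_⟩
  have := h4 (algebraMap k _ s)
  rwa [augm_inl, A'.residue_algebraMap, IsAlgOver.algebraMap_eq (pX := pX)] at this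

lemma exists_bracket_error {i j V} (hV : IsAffineOpen V) (hi : V ≤ 𝒰 i) (hj : V ≤ 𝒰 j) :
    ∃ c : Γ(X, V) → Γ(X, V) → Γ(X, V), (∀ x y, D.θ i j V hV hi hj (D.lam j V hV hj x y) =
        D.lam i V hV hi (D.θ i j V hV hi hj x) (D.θ i j V hV hi hj y) +
          tmulBy t (c (augm Γ(X, V) A' x) (augm Γ(X, V) A' y))) ∧
      (∀ a b d, c (a + b) d = c a d + c b d) ∧ (∀ a b d, c (a * b) d = a * c b d + b * c a d) ∧
      (∀ s d, c (strHom pX V s) d = 0) ∧ ∀ a b, c a b = -c b a := by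
  have hi' := D.isBiderivation i V hV hi
  have hj' := D.isBiderivation j V hV hj
  obtain ⟨c, h1, h2, h3, h4, h5⟩ := descend₂ hs (AlgHom.id k A'.carrier) (b := inl) (r := augm Γ(X, V) A')
    ker_augm augm_surjective (RingHom.id _)
    (P := fun x => D.θ i j V hV hi hj x) (Q := fun x => D.θ i j V hV hi hj x)
    (fun x => by rw [(D.isTwist _ _ _ _ _ _).augm_map]; rfl)
    (fun x => by rw [(D.isTwist _ _ _ _ _ _).augm_map]; rfl)
    (fun s => by rw [D.θ_inl]; rfl)
    (fun x y => D.θ i j V hV hi hj (D.lam j V hV hj x y) -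
      D.lam i V hV hi (D.θ i j V hV hi hj x) (D.θ i j V hV hi hj y))
    (fun x y z => by simp only [map_add, hi'.add_left, hj'.add_left]; ring)
    (fun x y z => by simp only [map_mul, hi'.mul_left, hj'.mul_left, map_add]; ring)
    (fun s z => by simp only [D.θ_inl, D.lam_inl, map_zero, sub_self])
    (fun x y => T.exists_of_p_eq_zero hV hi hs (by
      rw [map_sub, D.p_θ, D.p_lam, D.p_lam, D.p_θ, D.p_θ, sub_self]))
    (fun x y => by rw [hj'.skew x y, hi'.skew (D.θ i j V hV hi hj x), map_neg]; ring)
  refine ⟨c, fun x y => by rw [← h1]; ring, h2, h3, fun s d => ?_, h5⟩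
  have := h4 (algebraMap k _ s) d
  rwa [augm_inl, A'.residue_algebraMap, IsAlgOver.algebraMap_eq (pX := pX)] at this

/-- The Jacobiator of a biderivation is itself a derivation in each variable, and it vanishes over
`A` because `σ` is Poisson. -/
lemma exists_jacobi_error {i V} (hV : IsAffineOpen V) (hi : V ≤ 𝒰 i) :
    ∃ c : Γ(X, V) → Γ(X, V) → Γ(X, V) → Γ(X, V),
      (∀ x y z, jacobiator (D.lam i V hV hi) x y z =
          tmulBy t (c (augm Γ(X, V) A' x) (augm Γ(X, V) A' y) (augm Γ(X, V) A' z))) ∧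
      (∀ a b d e, c (a + b) d e = c a d e + c b d e) ∧
      (∀ a b d e, c (a * b) d e = a * c b d e + b * c a d e) ∧
      (∀ s d e, c (strHom pX V s) d e = 0) ∧ (∀ a b, c a a b = 0) ∧ ∀ a b d, c a b d = c b d a := by
  have hi' := D.isBiderivation i V hV hi
  obtain ⟨c, h1, h2, h3, h4, h5⟩ := descend₃ hs (AlgHom.id k A'.carrier) (b := inl) (r := augm Γ(X, V) A')
    ker_augm augm_surjective (RingHom.id _)
    (P := fun x => x) (Q := fun x => x) (fun x => rfl) (fun x => rfl) (fun s => rfl)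
    (jacobiator (D.lam i V hV hi)) (jacobiator_add hi') (jacobiator_mul hi')
    (fun s z w => by
      simp only [jacobiator, D.lam_inl, hi'.zero_left, hi'.skew _ (inl s), neg_zero, add_zero])
    (fun x y z => T.exists_of_p_eq_zero hV hi hs (by
      simp only [jacobiator, map_add, D.p_lam]
      exact σ.poisson.jacobiator_eq_zero _ _ _ _))
    (jacobiator_cyclic _) (jacobiator_self k hi')
  refine ⟨c, h1, h2, h3, fun s d e => ?_, h5⟩
  have := h4 (algebraMap k _ s) d e
  rwa [augm_inl, A'.residue_algebraMap, IsAlgOver.algebraMap_eq (pX := pX)] at this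

lemma exists_push_error {i j V W} (hV : IsAffineOpen V) (hW : IsAffineOpen W) (hi : W ≤ 𝒰 i)
    (hj : W ≤ 𝒰 j) (h : W ≤ f ⁻¹ᵁ V) :
    ∃ c : Γ(Y, V) → Γ(X, W), (∀ x, D.θ i j W hW hi hj (D.ph j V W hV hW hj h x) =
        D.ph i V W hV hW hi h x + tmulBy t (c (η.red V x))) ∧
      (∀ a b, c (a + b) = c a + c b) ∧
      (∀ a b, c (a * b) = comorph f V W h a * c b + comorph f V W h b * c a) ∧
      ∀ s, c (strHom pY V s) = 0 := by
  obtain ⟨c, h1, h2, h3, h4⟩ := descend₁ hs β (b := η.str V) (r := η.red V)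
    (η.ker_red hV) (η.red_surjective hV) (comorph f V W h)
    (P := fun x => D.θ i j W hW hi hj (D.ph j V W hV hW hj h x))
    (Q := fun x => D.ph i V W hV hW hi h x)
    (fun x => by rw [(D.isTwist _ _ _ _ _ _).augm_map, D.augm_ph])
    (fun x => by rw [D.augm_ph])
    (fun s => by rw [D.ph_str, D.θ_inl])
    (fun x => D.θ i j W hW hi hj (D.ph j V W hV hW hj h x) - D.ph i V W hV hW hi h x)
    (fun x y => by simp only [map_add]; ring) (fun x y => by simp only [map_mul]; ring)
    (fun s => by simp only [D.ph_str, D.θ_inl, sub_self])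
    (fun x => T.exists_of_p_eq_zero hW hi hs (by
      rw [map_sub, D.p_θ, D.p_ph, D.p_ph, sub_self]))
  refine ⟨c, fun x => by rw [← h1]; ring, h2, h3, fun s => ?_⟩
  have := h4 (algebraMap k _ s)
  rwa [η.red_str, B.residue_algebraMap] at this

/-- The error has values in `t ⊗ Γ(X, W)` because `ψ` preserves brackets over `A`. -/
lemma exists_push_bracket_error (hψP : IsPoisson σ.poisson η.poisson ψ) {i V W}
    (hV : IsAffineOpen V) (hW : IsAffineOpen W) (hi : W ≤ 𝒰 i) (h : W ≤ f ⁻¹ᵁ V) :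
    ∃ c : Γ(Y, V) → Γ(Y, V) → Γ(X, W),
      (∀ x y, D.lam i W hW hi (D.ph i V W hV hW hi h x) (D.ph i V W hV hW hi h y) =
        D.ph i V W hV hW hi h (η.br V x y) + tmulBy t (c (η.red V x) (η.red V y))) ∧
      (∀ a b d, c (a + b) d = c a d + c b d) ∧
      (∀ a b d, c (a * b) d = comorph f V W h a * c b d + comorph f V W h b * c a d) ∧
      (∀ s d, c (strHom pY V s) d = 0) ∧ ∀ a b, c a b = -c b a := by
  have hi' := D.isBiderivation i W hW hi
  have hη := η.isBiderivation_br V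
  obtain ⟨c, h1, h2, h3, h4, h5⟩ := descend₂ hs β (b := η.str V) (r := η.red V)
    (η.ker_red hV) (η.red_surjective hV) (comorph f V W h)
    (P := fun x => D.ph i V W hV hW hi h x)
    (Q := fun x => D.ph i V W hV hW hi h x)
    (fun x => by rw [D.augm_ph]) (fun x => by rw [D.augm_ph]) (fun s => by rw [D.ph_str])
    (fun x y => D.lam i W hW hi (D.ph i V W hV hW hi h x) (D.ph i V W hV hW hi h y) -
      D.ph i V W hV hW hi h (η.br V x y))
    (fun x y z => by simp only [map_add, hi'.add_left, hη.add_left]; ring)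
    (fun x y z => by simp only [map_mul, hi'.mul_left, hη.mul_left, map_add]; ring)
    (fun s z => by simp only [D.ph_str, D.lam_inl, η.br_str, map_zero, sub_self])
    (fun x y => T.exists_of_p_eq_zero hW hi hs (by
      rw [map_sub, D.p_lam, D.p_ph, D.p_ph, D.p_ph, sub_eq_zero]
      exact (hψP.comorph_bracket _ _ _).symm))
    (fun x y => by rw [hi'.skew (D.ph i V W hV hW hi h x), hη.skew x, map_neg]; ring)
  refine ⟨c, fun x y => by rw [← h1]; ring, h2, h3, fun s d => ?_, h5⟩
  have := h4 (algebraMap k _ s) d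
  rwa [η.red_str, B.residue_algebraMap] at this

end LiftData

end Errors

end

end PoissonDef
namespace PoissonDef
open TensorProduct

noncomputable section

set_option linter.unusedSectionVars false

/-! ### Explicit differentials in low degrees -/

section DiffFormulas

variable {S X Y : Scheme.{u}} {f : X ⟶ Y} {pX : X ⟶ S} {pY : Y ⟶ S} (P : PoissonStructure pX)
  (R : PoissonStructure pY) {U W : X.Opens} {V V' : Y.Opens} (hU : W ≤ U ⊓ f ⁻¹ᵁ V)
  (hV : V' ≤ V) (h : W ≤ f ⁻¹ᵁ V')

include h in
-- The differential is local: if the restrictions to `W` of the values of `Q` are given by a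
-- function `m` of the restricted arguments, then so are those of its differential.
lemma res_diff {q : ℕ} (Q : Raw f (q + 1) U) (m : (Fin (q + 1) → Γ(Y, V')) → Γ(X, W))
    (hm : ∀ a : Fin (q + 1) → Γ(Y, V), res hU (Q V a) = m (fun l => res hV (a l)))
    (a : Fin (q + 2) → Γ(Y, V)) :
    res hU (Raw.diff f P R Q V a) =
      (∑ i : Fin (q + 2), (-1) ^ (q + 1 + (i : ℕ)) *
        P.bracket W (m (fun l => res hV (a (i.succAbove l)))) (comorph f V' W h (res hV (a i)))) +
      ∑ j : Fin (q + 2), ∑ i : Fin (q + 1),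
        if i.castSucc < j then (-1) ^ (q + (i : ℕ) + (j : ℕ)) *
          m (Fin.cons (R.bracket V' (res hV (a i.castSucc)) (res hV (a j)))
            (fun l => res hV (a (j.succAbove (i.succAbove l)))))
        else 0 := by
  rw [Raw.diff, map_add, map_sum, map_sum]
  congr 1
  · refine Finset.sum_congr rfl fun i _ => ?_
    rw [map_mul, map_pow, map_neg, map_one, P.bracket_res, hm, res_comorph, comorph_res']
  · refine Finset.sum_congr rfl fun j _ => ?_
    rw [map_sum]
    refine Finset.sum_congr rfl fun i _ => ?_
    rw [apply_ite (res hU), map_zero]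
    refine if_congr Iff.rfl ?_ rfl
    rw [map_mul, map_pow, map_neg, map_one, hm]
    congr 2
    funext l
    refine Fin.cases ?_ (fun l => ?_) l
    · exact R.bracket_res _ _ _ _ _
    · rfl

lemma res_diff_one (Q : Raw f 1 U) (m : Γ(Y, V') → Γ(X, W))
    (hm : ∀ a : Fin 1 → Γ(Y, V), res hU (Q V a) = m (res hV (a 0))) (a : Fin 2 → Γ(Y, V)) :
    res hU (Raw.diff f P R Q V a) =
      P.bracket W (m (res hV (a 0))) (comorph f V' W h (res hV (a 1))) -
      P.bracket W (m (res hV (a 1))) (comorph f V' W h (res hV (a 0))) -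
      m (R.bracket V' (res hV (a 0)) (res hV (a 1))) := by
  rw [res_diff P R hU hV h Q (fun a => m (a 0)) hm]
  simp [Fin.sum_univ_succ]
  ring

lemma res_diff_two (Q : Raw f 2 U) (m : Γ(Y, V') → Γ(Y, V') → Γ(X, W))
    (hm : ∀ a : Fin 2 → Γ(Y, V), res hU (Q V a) = m (res hV (a 0)) (res hV (a 1)))
    (a : Fin 3 → Γ(Y, V)) {x y z} (hx : x = res hV (a 0)) (hy : y = res hV (a 1))
    (hz : z = res hV (a 2)) :
    res hU (Raw.diff f P R Q V a) =
      (P.bracket W (m y z) (comorph f V' W h x) - P.bracket W (m x z) (comorph f V' W h y) +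
        P.bracket W (m x y) (comorph f V' W h z)) +
      (m (R.bracket V' x y) z - m (R.bracket V' x z) y + m (R.bracket V' y z) x) := by
  subst hx hy hz
  rw [res_diff P R hU hV h Q (fun a => m (a 0) (a 1)) hm]
  simp [Fin.sum_univ_succ, Fin.succAbove]
  ring

lemma res_diff_three (Q : Raw f 3 U) (m : Γ(Y, V') → Γ(Y, V') → Γ(Y, V') → Γ(X, W))
    (hm : ∀ a : Fin 3 → Γ(Y, V), res hU (Q V a) = m (res hV (a 0)) (res hV (a 1)) (res hV (a 2)))
    (a : Fin 4 → Γ(Y, V)) {x y z w} (hx : x = res hV (a 0)) (hy : y = res hV (a 1))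
    (hz : z = res hV (a 2)) (hw : w = res hV (a 3)) :
    res hU (Raw.diff f P R Q V a) =
      (-P.bracket W (m y z w) (comorph f V' W h x) + P.bracket W (m x z w) (comorph f V' W h y) -
        P.bracket W (m x y w) (comorph f V' W h z) + P.bracket W (m x y z) (comorph f V' W h w)) +
      (-m (R.bracket V' x y) z w + m (R.bracket V' x z) y w - m (R.bracket V' x w) y z -
        m (R.bracket V' y z) x w + m (R.bracket V' y w) x z - m (R.bracket V' z w) x y) := by
  subst hx hy hz hw
  rw [res_diff P R hU hV h Q (fun a => m (a 0) (a 1) (a 2)) hm]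
  have e : ∀ (x : Γ(Y, V')) (g : Fin 2 → Γ(Y, V')), (Fin.cons x g : Fin 3 → Γ(Y, V')) 2 = g 1 :=
    fun _ _ => rfl
  simp only [e]
  simp [Fin.sum_univ_succ, Fin.succAbove]
  ring

end DiffFormulas

section CechFormulas

variable {X Y : Scheme.{u}} {f : X ⟶ Y} {ι : Type*} {𝒰 : ι → X.Opens} {W : X.Opens} {V : Y.Opens}
  {q : ℕ} {a : Fin (q + 1) → Γ(Y, V)}

lemma inter_le_apply {p : ℕ} (s : Fin (p + 1) → ι) (j : Fin (p + 1)) : inter 𝒰 s ≤ 𝒰 (s j) :=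
  iInf_le _ j

lemma le_inter {p : ℕ} {s : Fin (p + 1) → ι} (h : ∀ j, W ≤ 𝒰 (s j)) : W ≤ inter 𝒰 s := le_iInf h

lemma le_of_le_inter {p : ℕ} {s : Fin (p + 1) → ι} {U : X.Opens} (h : W ≤ inter 𝒰 s ⊓ U)
    (j : Fin (p + 1)) : W ≤ 𝒰 (s j) := h.trans (inf_le_left.trans (inter_le_apply s j))

lemma res_cechDiff {p : ℕ} (c : ∀ s : Fin (p + 1) → ι, Raw f (q + 1) (inter 𝒰 s))
    (s : Fin (p + 2) → ι) (h : W ≤ inter 𝒰 s ⊓ f ⁻¹ᵁ V) :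
    res h (cechDiff f 𝒰 c s V a) = ∑ j : Fin (p + 2), (-1 : ℤ) ^ (j : ℕ) •
      res (h.trans (inf_le_inf (inter_le 𝒰 s j) le_rfl)) (c (fun l => s (j.succAbove l)) V a) := by
  rw [cechDiff, Finset.sum_apply, Finset.sum_apply, map_sum]
  refine Finset.sum_congr rfl fun j _ => ?_
  rw [Pi.smul_apply, Pi.smul_apply, map_zsmul, Raw.restrict, res_res]

/-- Values on `W` are recorded as a function of indices instead of tuples, so that omitting an entry
of the tuple becomes a definitional evaluation. -/
lemma res_cechDiff_one (c : ∀ s : Fin 1 → ι, Raw f (q + 1) (inter 𝒰 s))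
    (g : ∀ i, W ≤ 𝒰 i → Γ(X, W))
    (hc : ∀ s (h : W ≤ inter 𝒰 s ⊓ f ⁻¹ᵁ V), res h (c s V a) = g (s 0) (le_of_le_inter h 0))
    (s : Fin 2 → ι) (h : W ≤ inter 𝒰 s ⊓ f ⁻¹ᵁ V) :
    res h (cechDiff f 𝒰 c s V a) =
      g (s 1) (le_of_le_inter h 1) - g (s 0) (le_of_le_inter h 0) := by
  rw [res_cechDiff, Fin.sum_univ_two, hc, hc]
  change (-1 : ℤ) ^ 0 • g (s 1) (le_of_le_inter h 1) + (-1 : ℤ) ^ 1 • g (s 0) (le_of_le_inter h 0) = _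
  rw [pow_zero, pow_one, one_smul, neg_one_smul, sub_eq_add_neg]

lemma res_cechDiff_two (c : ∀ s : Fin 2 → ι, Raw f (q + 1) (inter 𝒰 s))
    (g : ∀ i j, W ≤ 𝒰 i → W ≤ 𝒰 j → Γ(X, W))
    (hc : ∀ s (h : W ≤ inter 𝒰 s ⊓ f ⁻¹ᵁ V), res h (c s V a) =
      g (s 0) (s 1) (le_of_le_inter h 0) (le_of_le_inter h 1))
    (s : Fin 3 → ι) (h : W ≤ inter 𝒰 s ⊓ f ⁻¹ᵁ V) :
    res h (cechDiff f 𝒰 c s V a) =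
      g (s 1) (s 2) (le_of_le_inter h 1) (le_of_le_inter h 2) -
      g (s 0) (s 2) (le_of_le_inter h 0) (le_of_le_inter h 2) +
      g (s 0) (s 1) (le_of_le_inter h 0) (le_of_le_inter h 1) := by
  rw [res_cechDiff, Fin.sum_univ_three, hc, hc, hc]
  change (-1 : ℤ) ^ 0 • g (s 1) (s 2) (le_of_le_inter h 1) (le_of_le_inter h 2) +
    (-1 : ℤ) ^ 1 • g (s 0) (s 2) (le_of_le_inter h 0) (le_of_le_inter h 2) +
    (-1 : ℤ) ^ 2 • g (s 0) (s 1) (le_of_le_inter h 0) (le_of_le_inter h 1) = _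
  rw [pow_zero, pow_one, one_smul, neg_one_smul, neg_one_sq, one_smul, sub_eq_add_neg]

lemma res_cechDiff_three (c : ∀ s : Fin 3 → ι, Raw f (q + 1) (inter 𝒰 s))
    (g : ∀ i j l, W ≤ 𝒰 i → W ≤ 𝒰 j → W ≤ 𝒰 l → Γ(X, W))
    (hc : ∀ s (h : W ≤ inter 𝒰 s ⊓ f ⁻¹ᵁ V), res h (c s V a) =
      g (s 0) (s 1) (s 2) (le_of_le_inter h 0) (le_of_le_inter h 1) (le_of_le_inter h 2))
    (s : Fin 4 → ι) (h : W ≤ inter 𝒰 s ⊓ f ⁻¹ᵁ V) :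
    res h (cechDiff f 𝒰 c s V a) =
      g (s 1) (s 2) (s 3) (le_of_le_inter h 1) (le_of_le_inter h 2) (le_of_le_inter h 3) -
      g (s 0) (s 2) (s 3) (le_of_le_inter h 0) (le_of_le_inter h 2) (le_of_le_inter h 3) +
      g (s 0) (s 1) (s 3) (le_of_le_inter h 0) (le_of_le_inter h 1) (le_of_le_inter h 3) -
      g (s 0) (s 1) (s 2) (le_of_le_inter h 0) (le_of_le_inter h 1) (le_of_le_inter h 2) := by
  rw [res_cechDiff, Fin.sum_univ_four, hc, hc, hc, hc]
  change (-1 : ℤ) ^ 0 • g (s 1) (s 2) (s 3) (le_of_le_inter h 1) (le_of_le_inter h 2) (le_of_le_inter h 3) +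
    (-1 : ℤ) ^ 1 • g (s 0) (s 2) (s 3) (le_of_le_inter h 0) (le_of_le_inter h 2) (le_of_le_inter h 3) +
    (-1 : ℤ) ^ 2 • g (s 0) (s 1) (s 3) (le_of_le_inter h 0) (le_of_le_inter h 1) (le_of_le_inter h 3) +
    (-1 : ℤ) ^ 3 • g (s 0) (s 1) (s 2) (le_of_le_inter h 0) (le_of_le_inter h 1) (le_of_le_inter h 2) = _
  rw [pow_zero, pow_one, one_smul, neg_one_smul, neg_one_sq, one_smul,
    show (-1 : ℤ) ^ 3 = -1 from rfl, neg_one_smul, sub_eq_add_neg, sub_eq_add_neg]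

end CechFormulas

/-! ### The cohomological argument -/

section Primitive

variable {S X Y : Scheme.{u}} {f : X ⟶ Y} {pX : X ⟶ S} {pY : Y ⟶ S} {Λ₀ : PoissonStructure pX}
  {P₀ : PoissonStructure pY} {ι : Type*} {𝒰 : ι → X.Opens} (hf : f ≫ pY = pX)
  (hfP : IsPoisson Λ₀ P₀ f)

/-- If `F` is surjective on `ℍ¹` and injective on `ℍ²`, a pair of a cocycle and of a primitive of
its image under `F` comes from a cochain, up to a coboundary. -/
lemma exists_primitive (h₁ : Function.Surjective (hyperMap f 𝒰 Λ₀ P₀ hf hfP 1))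
    (h₂ : Function.Injective (hyperMap f 𝒰 Λ₀ P₀ hf hfP 2))
    {z : Bicochain (𝟙 X) 𝒰} (hz : z ∈ totalCochains (𝟙 X) 𝒰 pX 2)
    (hz' : totalDiff (𝟙 X) 𝒰 Λ₀ Λ₀ z = 0)
    {m : Bicochain f 𝒰} (hm : m ∈ totalCochains f 𝒰 pY 1)
    (hm' : pushHom f 𝒰 z = totalDiff f 𝒰 Λ₀ P₀ m) :
    ∃ y ∈ totalCochains (𝟙 X) 𝒰 pX 1, ∃ w ∈ totalCochains f 𝒰 pY 0,
      totalDiff (𝟙 X) 𝒰 Λ₀ Λ₀ y = z ∧ m = pushHom f 𝒰 y + totalDiff f 𝒰 Λ₀ P₀ w := by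
  obtain ⟨y₀, hy₀, e₀⟩ : ∃ y ∈ totalCochains (𝟙 X) 𝒰 pX 1, totalDiff (𝟙 X) 𝒰 Λ₀ Λ₀ y = z := by
    -- The class of `z` is killed by `F`, its image being the coboundary of `m`; injectivity on `ℍ²`
    -- makes it zero.
    have : (QuotientAddGroup.mk ⟨z, hz, hz'⟩ : Hypercohomology (𝟙 X) 𝒰 Λ₀ Λ₀ 2) = 0 := by
      apply h₂
      rw [map_zero]
      refine (QuotientAddGroup.eq_zero_iff _).mpr ?_
      rw [AddSubgroup.mem_addSubgroupOf]
      exact ⟨m, hm, hm'.symm⟩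
    exact (QuotientAddGroup.eq_zero_iff _).mp this
  -- The primitives `m` and `F y₀` of the same cochain differ by a cocycle of degree one.
  have hd : m - pushHom f 𝒰 y₀ ∈ cocycles f 𝒰 Λ₀ P₀ 1 :=
    ⟨(totalCochains f 𝒰 pY 1).sub_mem hm (push_totalCochains f 𝒰 hf hy₀), by
      change totalDiff f 𝒰 Λ₀ P₀ _ = 0
      rw [map_sub, ← hm', ← e₀, push_totalDiff f 𝒰 Λ₀ P₀ hfP, sub_self]⟩
  -- Surjectivity on `ℍ¹` represents that cocycle by `F y₁` up to a coboundary, where `y₁` is a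
  -- cocycle; hence `y₀ + y₁` is still a primitive of `z`.
  obtain ⟨c, hc⟩ := h₁ (QuotientAddGroup.mk ⟨_, hd⟩)
  obtain ⟨⟨y₁, hy₁⟩, rfl⟩ := QuotientAddGroup.mk_surjective c
  have := QuotientAddGroup.eq.mp hc
  rw [AddSubgroup.mem_addSubgroupOf] at this
  obtain ⟨w, hw, ew⟩ := this
  refine ⟨y₀ + y₁, add_mem hy₀ hy₁.1, w, hw, ?_, ?_⟩
  · rw [map_add, e₀, show totalDiff (𝟙 X) 𝒰 Λ₀ Λ₀ y₁ = 0 from hy₁.2, add_zero]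
  · rw [ew, map_add]
    change m = _ + (-(pushHom f 𝒰 y₁) + (m - pushHom f 𝒰 y₀))
    abel

end Primitive

end

end PoissonDef
namespace PoissonDef
open TensorProduct

noncomputable section

set_option linter.unusedSectionVars false
set_option linter.unusedVariables false

/-- Čech cochains of polyvectors of total degrees two along `𝟙 X` and one along `f`, given by their
values on affine open subsets: `(c, L, J)` is a cocycle whose image is the coboundary of `(M, N)`. -/
structure AffineCochains {k : Type u} [Field k] {X Y : Scheme.{u}} {pX : X ⟶ Spec (.of k)}
    {pY : Y ⟶ Spec (.of k)} (Λ₀ : PoissonStructure pX) (P₀ : PoissonStructure pY) (f : X ⟶ Y)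
    {ι : Type*} (𝒰 : ι → X.Opens) where
  c : ∀ (i j l : ι) (V : X.Opens), IsAffineOpen V → V ≤ 𝒰 i → V ≤ 𝒰 j → V ≤ 𝒰 l → Γ(X, V) → Γ(X, V)
  c_add : ∀ i j l V hV hi hj hl a b,
    c i j l V hV hi hj hl (a + b) = c i j l V hV hi hj hl a + c i j l V hV hi hj hl b
  c_mul : ∀ i j l V hV hi hj hl a b,
    c i j l V hV hi hj hl (a * b) = a * c i j l V hV hi hj hl b + b * c i j l V hV hi hj hl a
  c_str : ∀ i j l V hV hi hj hl s, c i j l V hV hi hj hl (strHom pX V s) = 0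
  c_res : ∀ i j l V V' hV hV' hi hj hl hi' hj' hl' (h : V' ≤ V) a,
    res h (c i j l V hV hi hj hl a) = c i j l V' hV' hi' hj' hl' (res h a)
  L : ∀ (i j : ι) (V : X.Opens), IsAffineOpen V → V ≤ 𝒰 i → V ≤ 𝒰 j → Γ(X, V) → Γ(X, V) → Γ(X, V)
  L_add : ∀ i j V hV hi hj a b d,
    L i j V hV hi hj (a + b) d = L i j V hV hi hj a d + L i j V hV hi hj b d
  L_mul : ∀ i j V hV hi hj a b d,
    L i j V hV hi hj (a * b) d = a * L i j V hV hi hj b d + b * L i j V hV hi hj a d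
  L_str : ∀ i j V hV hi hj s d, L i j V hV hi hj (strHom pX V s) d = 0
  L_self : ∀ i j V hV hi hj a, L i j V hV hi hj a a = 0
  L_skew : ∀ i j V hV hi hj a b, L i j V hV hi hj a b = -L i j V hV hi hj b a
  L_res : ∀ i j V V' hV hV' hi hj hi' hj' (h : V' ≤ V) a b,
    res h (L i j V hV hi hj a b) = L i j V' hV' hi' hj' (res h a) (res h b)
  J : ∀ (i : ι) (V : X.Opens), IsAffineOpen V → V ≤ 𝒰 i → Γ(X, V) → Γ(X, V) → Γ(X, V) → Γ(X, V)
  J_add : ∀ i V hV hi a b d e, J i V hV hi (a + b) d e = J i V hV hi a d e + J i V hV hi b d e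
  J_mul : ∀ i V hV hi a b d e,
    J i V hV hi (a * b) d e = a * J i V hV hi b d e + b * J i V hV hi a d e
  J_str : ∀ i V hV hi s d e, J i V hV hi (strHom pX V s) d e = 0
  J_self : ∀ i V hV hi a b, J i V hV hi a a b = 0
  J_cyclic : ∀ i V hV hi a b d, J i V hV hi a b d = J i V hV hi b d a
  J_res : ∀ i V V' hV hV' hi hi' (h : V' ≤ V) a b d,
    res h (J i V hV hi a b d) = J i V' hV' hi' (res h a) (res h b) (res h d)
  M : ∀ (i j : ι) (V : Y.Opens) (W : X.Opens), IsAffineOpen V → IsAffineOpen W → W ≤ 𝒰 i → W ≤ 𝒰 j →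
    W ≤ f ⁻¹ᵁ V → Γ(Y, V) → Γ(X, W)
  M_add : ∀ i j V W hV hW hi hj h a b,
    M i j V W hV hW hi hj h (a + b) = M i j V W hV hW hi hj h a + M i j V W hV hW hi hj h b
  M_mul : ∀ i j V W hV hW hi hj h a b, M i j V W hV hW hi hj h (a * b) =
    comorph f V W h a * M i j V W hV hW hi hj h b + comorph f V W h b * M i j V W hV hW hi hj h a
  M_str : ∀ i j V W hV hW hi hj h s, M i j V W hV hW hi hj h (strHom pY V s) = 0
  M_res : ∀ i j V V' W W' hV hV' hW hW' hi hj hi' hj' h h' (hVV : V' ≤ V) (hWW : W' ≤ W) a,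
    res hWW (M i j V W hV hW hi hj h a) = M i j V' W' hV' hW' hi' hj' h' (res hVV a)
  N : ∀ (i : ι) (V : Y.Opens) (W : X.Opens), IsAffineOpen V → IsAffineOpen W → W ≤ 𝒰 i →
    W ≤ f ⁻¹ᵁ V → Γ(Y, V) → Γ(Y, V) → Γ(X, W)
  N_add : ∀ i V W hV hW hi h a b d,
    N i V W hV hW hi h (a + b) d = N i V W hV hW hi h a d + N i V W hV hW hi h b d
  N_mul : ∀ i V W hV hW hi h a b d, N i V W hV hW hi h (a * b) d =
    comorph f V W h a * N i V W hV hW hi h b d + comorph f V W h b * N i V W hV hW hi h a d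
  N_str : ∀ i V W hV hW hi h s d, N i V W hV hW hi h (strHom pY V s) d = 0
  N_self : ∀ i V W hV hW hi h a, N i V W hV hW hi h a a = 0
  N_skew : ∀ i V W hV hW hi h a b, N i V W hV hW hi h a b = -N i V W hV hW hi h b a
  N_res : ∀ i V V' W W' hV hV' hW hW' hi hi' h h' (hVV : V' ≤ V) (hWW : W' ≤ W) a b,
    res hWW (N i V W hV hW hi h a b) = N i V' W' hV' hW' hi' h' (res hVV a) (res hVV b)
  cech_c : ∀ i j l m V hV hi hj hl hm a, c j l m V hV hj hl hm a - c i l m V hV hi hl hm a +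
    c i j m V hV hi hj hm a - c i j l V hV hi hj hl a = 0
  cech_L : ∀ i j l V hV hi hj hl a b,
    L j l V hV hj hl a b - L i l V hV hi hl a b + L i j V hV hi hj a b +
      (Λ₀.bracket V (c i j l V hV hi hj hl a) b - Λ₀.bracket V (c i j l V hV hi hj hl b) a -
        c i j l V hV hi hj hl (Λ₀.bracket V a b)) = 0
  cech_J : ∀ i j V hV hi hj a b d, J j V hV hj a b d - J i V hV hi a b d -
    ((Λ₀.bracket V (L i j V hV hi hj b d) a - Λ₀.bracket V (L i j V hV hi hj a d) b +
      Λ₀.bracket V (L i j V hV hi hj a b) d) +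
      (L i j V hV hi hj (Λ₀.bracket V a b) d - L i j V hV hi hj (Λ₀.bracket V a d) b +
        L i j V hV hi hj (Λ₀.bracket V b d) a)) = 0
  diff_J : ∀ i V hV hi a b d e,
    (-Λ₀.bracket V (J i V hV hi b d e) a + Λ₀.bracket V (J i V hV hi a d e) b -
      Λ₀.bracket V (J i V hV hi a b e) d + Λ₀.bracket V (J i V hV hi a b d) e) +
    (-J i V hV hi (Λ₀.bracket V a b) d e + J i V hV hi (Λ₀.bracket V a d) b e -
      J i V hV hi (Λ₀.bracket V a e) b d - J i V hV hi (Λ₀.bracket V b d) a e +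
      J i V hV hi (Λ₀.bracket V b e) a d - J i V hV hi (Λ₀.bracket V d e) a b) = 0
  push_c : ∀ i j l V W hV hW hi hj hl h a, c i j l W hW hi hj hl (comorph f V W h a) =
    M j l V W hV hW hj hl h a - M i l V W hV hW hi hl h a + M i j V W hV hW hi hj h a
  push_L : ∀ i j V W hV hW hi hj h a b,
    L i j W hW hi hj (comorph f V W h a) (comorph f V W h b) =
      N j V W hV hW hj h a b - N i V W hV hW hi h a b -
      (Λ₀.bracket W (M i j V W hV hW hi hj h a) (comorph f V W h b) -
        Λ₀.bracket W (M i j V W hV hW hi hj h b) (comorph f V W h a) -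
        M i j V W hV hW hi hj h (P₀.bracket V a b))
  push_J : ∀ i V W hV hW hi h a b d,
    J i W hW hi (comorph f V W h a) (comorph f V W h b) (comorph f V W h d) =
      (Λ₀.bracket W (N i V W hV hW hi h b d) (comorph f V W h a) -
        Λ₀.bracket W (N i V W hV hW hi h a d) (comorph f V W h b) +
        Λ₀.bracket W (N i V W hV hW hi h a b) (comorph f V W h d)) +
      (N i V W hV hW hi h (P₀.bracket V a b) d - N i V W hV hW hi h (P₀.bracket V a d) b +
        N i V W hV hW hi h (P₀.bracket V b d) a)

/-! ### The errors as cochains of the Čech double complex -/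

namespace AffineCochains

variable {k : Type u} [Field k] {X Y : Scheme.{u}} {pX : X ⟶ Spec (.of k)}
  {pY : Y ⟶ Spec (.of k)} {Λ₀ : PoissonStructure pX} {P₀ : PoissonStructure pY} {f : X ⟶ Y}
  {ι : Type*} {𝒰 : ι → X.Opens} (E : AffineCochains Λ₀ P₀ f 𝒰)

lemma comorph_id_strHom {V W : X.Opens} (h : W ≤ 𝟙 X ⁻¹ᵁ V) (c : k) :
    comorph (𝟙 X) V W h (strHom pX V c) = strHom pX W c := by
  rw [comorph_id]
  exact res_strHom _ _ _

lemma res_comorph_id {V V' W W' : X.Opens} (h : W ≤ 𝟙 X ⁻¹ᵁ V) (h' : W' ≤ 𝟙 X ⁻¹ᵁ V') (hV : V' ≤ V)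
    (hW : W' ≤ W) (a : Γ(X, V)) :
    res hW (comorph (𝟙 X) V W h a) = comorph (𝟙 X) V' W' h' (res hV a) := by
  rw [res_comorph, comorph_res']

/-- Along `𝟙 X`, the value on a pair `(V, W)` is computed on `W` alone, after restricting the
arguments from `V`. -/
def polyC (s : Fin 3 → ι) : AffinePolyvector (𝟙 X) pX 1 (inter 𝒰 s) :=
  AffinePolyvector.mk₁ (fun V W _ hW hU h a => E.c (s 0) (s 1) (s 2) W hW
      (hU.trans (inter_le_apply s 0)) (hU.trans (inter_le_apply s 1)) (hU.trans (inter_le_apply s 2))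
      (comorph (𝟙 X) V W h a))
    (fun V W hV hW hU h x y => by rw [map_add, E.c_add])
    (fun V W hV hW hU h x y => by rw [map_mul, E.c_mul])
    (fun V W hV hW hU h c => by rw [comorph_id_strHom, E.c_str])
    (fun V V' W W' hV hV' hW hW' hU hU' h h' hVV hWW a => by
      rw [E.c_res, res_comorph_id])

def polyL (s : Fin 2 → ι) : AffinePolyvector (𝟙 X) pX 2 (inter 𝒰 s) :=
  AffinePolyvector.mk₂ (fun V W _ hW hU h a b => E.L (s 0) (s 1) W hW
      (hU.trans (inter_le_apply s 0)) (hU.trans (inter_le_apply s 1))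
      (comorph (𝟙 X) V W h a) (comorph (𝟙 X) V W h b))
    (fun V W hV hW hU h x y z => by rw [map_add, E.L_add])
    (fun V W hV hW hU h x y z => by rw [map_mul, E.L_mul])
    (fun V W hV hW hU h c z => by rw [comorph_id_strHom, E.L_str])
    (fun V W hV hW hU h x => E.L_self _ _ _ _ _ _ _)
    (fun V W hV hW hU h x y => E.L_skew _ _ _ _ _ _ _ _)
    (fun V V' W W' hV hV' hW hW' hU hU' h h' hVV hWW a b => by
      rw [E.L_res, res_comorph_id, res_comorph_id])

def polyJ (s : Fin 1 → ι) : AffinePolyvector (𝟙 X) pX 3 (inter 𝒰 s) :=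
  AffinePolyvector.mk₃ (fun V W _ hW hU h a b d => E.J (s 0) W hW (hU.trans (inter_le_apply s 0))
      (comorph (𝟙 X) V W h a) (comorph (𝟙 X) V W h b) (comorph (𝟙 X) V W h d))
    (fun V W hV hW hU h x y z w => by rw [map_add, E.J_add])
    (fun V W hV hW hU h x y z w => by rw [map_mul, E.J_mul])
    (fun V W hV hW hU h c z w => by rw [comorph_id_strHom, E.J_str])
    (fun V W hV hW hU h x y => E.J_self _ _ _ _ _ _)
    (fun V W hV hW hU h x y z => E.J_cyclic _ _ _ _ _ _ _)
    (fun V V' W W' hV hV' hW hW' hU hU' h h' hVV hWW a b d => by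
      rw [E.J_res, res_comorph_id, res_comorph_id, res_comorph_id])

def polyM (s : Fin 2 → ι) : AffinePolyvector f pY 1 (inter 𝒰 s) :=
  AffinePolyvector.mk₁ (fun V W hV hW hU h a => E.M (s 0) (s 1) V W hV hW
      (hU.trans (inter_le_apply s 0)) (hU.trans (inter_le_apply s 1)) h a)
    (fun V W hV hW hU h x y => E.M_add _ _ _ _ _ _ _ _ _ _ _)
    (fun V W hV hW hU h x y => E.M_mul _ _ _ _ _ _ _ _ _ _ _)
    (fun V W hV hW hU h c => E.M_str _ _ _ _ _ _ _ _ _ _)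
    (fun V V' W W' hV hV' hW hW' hU hU' h h' hVV hWW a => E.M_res _ _ _ _ _ _ _ _ _ _ _ _ _ _ _ _ _ _ _)

def polyN (s : Fin 1 → ι) : AffinePolyvector f pY 2 (inter 𝒰 s) :=
  AffinePolyvector.mk₂ (fun V W hV hW hU h a b => E.N (s 0) V W hV hW
      (hU.trans (inter_le_apply s 0)) h a b)
    (fun V W hV hW hU h x y z => E.N_add _ _ _ _ _ _ _ _ _ _)
    (fun V W hV hW hU h x y z => E.N_mul _ _ _ _ _ _ _ _ _ _)
    (fun V W hV hW hU h c z => E.N_str _ _ _ _ _ _ _ _ _)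
    (fun V W hV hW hU h x => E.N_self _ _ _ _ _ _ _ _)
    (fun V W hV hW hU h x y => E.N_skew _ _ _ _ _ _ _ _ _)
    (fun V V' W W' hV hV' hW hW' hU hU' h h' hVV hWW a b => E.N_res _ _ _ _ _ _ _ _ _ _ _ _ _ _ _ _ _)

/-- The cochain `(c, L, J)` of degree two. -/
def cochainX : Bicochain (𝟙 X) 𝒰
  | 2, 0, s => (E.polyC s).toRaw
  | 1, 1, s => (E.polyL s).toRaw
  | 0, 2, s => (E.polyJ s).toRaw
  | _, _, _ => 0

/-- The cochain `(M, N)` of degree one. -/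
def cochainY : Bicochain f 𝒰
  | 1, 0, s => (E.polyM s).toRaw
  | 0, 1, s => (E.polyN s).toRaw
  | _, _, _ => 0

lemma cochainX_mem : E.cochainX ∈ totalCochains (𝟙 X) 𝒰 pX 2 := by
  refine ⟨fun p q s => ?_, fun p q h => ?_⟩
  · rcases p with _ | _ | _ | p <;> rcases q with _ | _ | _ | q <;>
      first
        | exact zero_mem _
        | exact AffinePolyvector.toRaw_mem _
  · rcases p with _ | _ | _ | p <;> rcases q with _ | _ | _ | q <;>
      first
        | rfl
        | exact absurd rfl h

lemma cochainY_mem : E.cochainY ∈ totalCochains f 𝒰 pY 1 := by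
  refine ⟨fun p q s => ?_, fun p q h => ?_⟩
  · rcases p with _ | _ | p <;> rcases q with _ | _ | q <;>
      first
        | exact zero_mem _
        | exact AffinePolyvector.toRaw_mem _
  · rcases p with _ | _ | p <;> rcases q with _ | _ | q <;>
      first
        | rfl
        | exact absurd rfl h

end AffineCochains

section Degree

variable {S X Y : Scheme.{u}} {f : X ⟶ Y} {pX : X ⟶ S} {pY : Y ⟶ S} (P : PoissonStructure pX)
  (R : PoissonStructure pY) {ι : Type*} {𝒰 : ι → X.Opens}

/-- The differential raises the total degree by one, so only finitely many bidegrees have to be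
examined in each identity of cochains. -/
lemma totalDiff_apply_eq_zero {n : ℕ} {c : Bicochain f 𝒰} (hc : c ∈ totalCochains f 𝒰 pY n)
    {p q : ℕ} (h : p + q ≠ n + 1) : totalDiff f 𝒰 P R c p q = 0 := by
  have h1 : cechPart f 𝒰 c p q = 0 := by
    rcases p with _ | p
    · rfl
    · have : c p q = 0 := hc.2 p q (by omega)
      funext s V a
      simp [cechPart, cechDiff, this, Raw.restrict]
  have h2 : piPart f 𝒰 P R c p q = 0 := by
    rcases q with _ | q
    · rfl
    · have : c p q = 0 := hc.2 p q (by omega)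
      funext s V a
      simp [piPart, this, Raw.diff, bracket_zero_left]
  change cechPart f 𝒰 c p q + piPart f 𝒰 P R c p q = 0
  rw [h1, h2, add_zero]

lemma totalDiff_apply_zero (c : Bicochain f 𝒰) (q : ℕ) (s : Fin 1 → ι) :
    totalDiff f 𝒰 P R c 0 (q + 1) s = Raw.diff f P R (c 0 q s) := by
  change (0 : Raw f (q + 2) (inter 𝒰 s)) + (-1 : ℤ) ^ 0 • Raw.diff f P R (c 0 q s) = _
  rw [pow_zero, one_smul, zero_add]

lemma totalDiff_apply_succ_zero (c : Bicochain f 𝒰) (p : ℕ) (s : Fin (p + 2) → ι) :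
    totalDiff f 𝒰 P R c (p + 1) 0 s = cechDiff f 𝒰 (c p 0) s := by
  change cechDiff f 𝒰 (c p 0) s + 0 = _
  rw [add_zero]

end Degree

end

end PoissonDef
namespace PoissonDef
open TensorProduct

noncomputable section

set_option linter.unusedSectionVars false

namespace AffineCochains

variable {k : Type u} [Field k] {X Y : Scheme.{u}} {pX : X ⟶ Spec (.of k)}
  {pY : Y ⟶ Spec (.of k)} {Λ₀ : PoissonStructure pX} {P₀ : PoissonStructure pY} {f : X ⟶ Y}
  {ι : Type*} {𝒰 : ι → X.Opens} (E : AffineCochains Λ₀ P₀ f 𝒰)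

lemma le_id_preimage (W : X.Opens) : W ≤ 𝟙 X ⁻¹ᵁ W := le_rfl

lemma comorph_id_self {W : X.Opens} (h : W ≤ 𝟙 X ⁻¹ᵁ W) (a : Γ(X, W)) :
    comorph (𝟙 X) W W h a = a := by
  rw [comorph_id]; exact res_self _ _

lemma _root_.PoissonDef.AffinePair.le_of_id {V U : X.Opens} (v : AffinePair (𝟙 X) V U) : v.W ≤ V :=
  v.le.trans v.hV₀

section Values

variable {V W : X.Opens} (hW : IsAffineOpen W) (h : W ≤ V)

lemma res_polyC (s : Fin 3 → ι) (hU : W ≤ inter 𝒰 s ⊓ 𝟙 X ⁻¹ᵁ V) (a : Fin 1 → Γ(X, V)) :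
    res hU ((E.polyC s).toRaw V a) = E.c (s 0) (s 1) (s 2) W hW (le_of_le_inter hU 0)
      (le_of_le_inter hU 1) (le_of_le_inter hU 2) (res h (a 0)) := by
  refine ((E.polyC s).res_toRaw V a ⟨W, W, hW, hW, h, hU.trans inf_le_left, le_rfl⟩).trans ?_
  refine (congrArg (E.c (s 0) (s 1) (s 2) W hW _ _ _) ?_)
  exact comorph_id_self _ _

lemma res_polyL (s : Fin 2 → ι) (hU : W ≤ inter 𝒰 s ⊓ 𝟙 X ⁻¹ᵁ V) (a : Fin 2 → Γ(X, V)) :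
    res hU ((E.polyL s).toRaw V a) = E.L (s 0) (s 1) W hW (le_of_le_inter hU 0)
      (le_of_le_inter hU 1) (res h (a 0)) (res h (a 1)) := by
  refine ((E.polyL s).res_toRaw V a ⟨W, W, hW, hW, h, hU.trans inf_le_left, le_rfl⟩).trans ?_
  refine (congrArg₂ (E.L (s 0) (s 1) W hW _ _) ?_ ?_) <;>
  exact comorph_id_self _ _

lemma res_polyJ (s : Fin 1 → ι) (hU : W ≤ inter 𝒰 s ⊓ 𝟙 X ⁻¹ᵁ V) (a : Fin 3 → Γ(X, V)) :
    res hU ((E.polyJ s).toRaw V a) = E.J (s 0) W hW (le_of_le_inter hU 0)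
      (res h (a 0)) (res h (a 1)) (res h (a 2)) := by
  refine ((E.polyJ s).res_toRaw V a ⟨W, W, hW, hW, h, hU.trans inf_le_left, le_rfl⟩).trans ?_
  refine congr (congrArg₂ (E.J (s 0) W hW _) ?_ ?_) ?_ <;>
  exact comorph_id_self _ _

end Values

section ValuesY

variable {V₀ V : Y.Opens} {W : X.Opens} (hV : IsAffineOpen V) (hW : IsAffineOpen W) (hV₀ : V ≤ V₀)
  (h : W ≤ f ⁻¹ᵁ V)

include hV

lemma res_polyM (s : Fin 2 → ι) (hU : W ≤ inter 𝒰 s ⊓ f ⁻¹ᵁ V₀) (a : Fin 1 → Γ(Y, V₀)) :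
    res hU ((E.polyM s).toRaw V₀ a) = E.M (s 0) (s 1) V W hV hW (le_of_le_inter hU 0)
      (le_of_le_inter hU 1) h (res hV₀ (a 0)) :=
  (E.polyM s).res_toRaw V₀ a ⟨V, W, hV, hW, hV₀, hU.trans inf_le_left, h⟩

lemma res_polyN (s : Fin 1 → ι) (hU : W ≤ inter 𝒰 s ⊓ f ⁻¹ᵁ V₀) (a : Fin 2 → Γ(Y, V₀)) :
    res hU ((E.polyN s).toRaw V₀ a) = E.N (s 0) V W hV hW (le_of_le_inter hU 0) h (res hV₀ (a 0))
      (res hV₀ (a 1)) :=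
  (E.polyN s).res_toRaw V₀ a ⟨V, W, hV, hW, hV₀, hU.trans inf_le_left, h⟩

end ValuesY

/-- The components of `D(c, L, J)` in bidegrees `(3, 0)`, `(2, 1)`, `(1, 2)`, `(0, 3)` are the
relations `cech_c`, `cech_L`, `cech_J`, `diff_J`; the sign `(-1)^p` of the total differential
accounts for the minus sign in `cech_J`. -/
lemma totalDiff_cochainX_three_zero (s : Fin 4 → ι) :
    totalDiff (𝟙 X) 𝒰 Λ₀ Λ₀ E.cochainX 3 0 s = 0 := by
  rw [totalDiff_apply_succ_zero]
  funext V a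
  refine section_ext_pair fun v _ => ?_
  rw [res_cechDiff_three (E.cochainX 2 0)
    (fun i j l hi hj hl => E.c i j l v.W v.hW hi hj hl (res v.le_of_id (a 0)))
    (fun s h => E.res_polyC v.hW v.le_of_id s h a)]
  rw [E.cech_c]
  exact (map_zero _).symm

lemma totalDiff_cochainX_two_one (s : Fin 3 → ι) :
    totalDiff (𝟙 X) 𝒰 Λ₀ Λ₀ E.cochainX 2 1 s = 0 := by
  change cechDiff (𝟙 X) 𝒰 (E.cochainX 1 1) s +
    (-1 : ℤ) ^ 2 • Raw.diff (𝟙 X) Λ₀ Λ₀ (E.cochainX 2 0 s) = 0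
  funext V a
  refine section_ext_pair fun v _ => ?_
  rw [Pi.add_apply, Pi.add_apply, map_add, Pi.smul_apply, Pi.smul_apply, map_zsmul,
    res_cechDiff_two (E.cochainX 1 1)
    (fun i j hi hj => E.L i j v.W v.hW hi hj (res v.le_of_id (a 0))
      (res v.le_of_id (a 1)))
    (fun s h => E.res_polyL v.hW v.le_of_id s h a),
    res_diff_one Λ₀ Λ₀ v.le_inf (V' := v.W) v.le_of_id (le_id_preimage _) (E.cochainX 2 0 s) _ (E.res_polyC v.hW v.le_of_id s _),
    comorph_id_self, comorph_id_self, neg_one_sq, one_smul, E.cech_L]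
  exact (map_zero _).symm

lemma totalDiff_cochainX_one_two (s : Fin 2 → ι) :
    totalDiff (𝟙 X) 𝒰 Λ₀ Λ₀ E.cochainX 1 2 s = 0 := by
  change cechDiff (𝟙 X) 𝒰 (E.cochainX 0 2) s +
    (-1 : ℤ) ^ 1 • Raw.diff (𝟙 X) Λ₀ Λ₀ (E.cochainX 1 1 s) = 0
  funext V a
  refine section_ext_pair fun v _ => ?_
  rw [Pi.add_apply, Pi.add_apply, map_add, Pi.smul_apply, Pi.smul_apply, map_zsmul,
    res_cechDiff_one (E.cochainX 0 2)
    (fun i hi => E.J i v.W v.hW hi (res v.le_of_id (a 0))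
      (res v.le_of_id (a 1)) (res v.le_of_id (a 2)))
    (fun s h => E.res_polyJ v.hW v.le_of_id s h a),
    res_diff_two Λ₀ Λ₀ v.le_inf (V' := v.W) v.le_of_id (le_id_preimage _) (E.cochainX 1 1 s) _ (E.res_polyL v.hW v.le_of_id s _)
      a rfl rfl rfl]
  simp only [comorph_id_self]
  rw [pow_one, neg_one_smul, ← sub_eq_add_neg, E.cech_J]
  exact (map_zero _).symm

lemma totalDiff_cochainX_zero_three (s : Fin 1 → ι) :
    totalDiff (𝟙 X) 𝒰 Λ₀ Λ₀ E.cochainX 0 3 s = 0 := by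
  rw [totalDiff_apply_zero]
  funext V a
  refine section_ext_pair fun v _ => ?_
  rw [res_diff_three Λ₀ Λ₀ v.le_inf (V' := v.W) v.le_of_id (le_id_preimage _) (E.cochainX 0 2 s) _ (E.res_polyJ v.hW v.le_of_id s _)
      a rfl rfl rfl rfl]
  simp only [comorph_id_self]
  rw [E.diff_J]
  exact (map_zero _).symm

lemma totalDiff_cochainX : totalDiff (𝟙 X) 𝒰 Λ₀ Λ₀ E.cochainX = 0 := by
  funext p q
  by_cases h : p + q = 3
  · obtain ⟨rfl, rfl⟩ | ⟨rfl, rfl⟩ | ⟨rfl, rfl⟩ | ⟨rfl, rfl⟩ : (p = 3 ∧ q = 0) ∨ (p = 2 ∧ q = 1) ∨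
        (p = 1 ∧ q = 2) ∨ (p = 0 ∧ q = 3) := by omega
    · exact funext E.totalDiff_cochainX_three_zero
    · exact funext E.totalDiff_cochainX_two_one
    · exact funext E.totalDiff_cochainX_one_two
    · exact funext E.totalDiff_cochainX_zero_three
  · exact totalDiff_apply_eq_zero Λ₀ Λ₀ E.cochainX_mem h

lemma res_comorph_preimage {V V' : Y.Opens} {W : X.Opens} (hV : V' ≤ V) (h : W ≤ f ⁻¹ᵁ V')
    (hW : W ≤ f ⁻¹ᵁ V) (a : Γ(Y, V)) :
    res hW (comorph f V (f ⁻¹ᵁ V) le_rfl a) = comorph f V' W h (res hV a) := by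
  rw [res_comorph, comorph_res']

/-- The three components of `F(c, L, J) = D(M, N)` are the relations `push_c`, `push_L`, `push_J`.
-/
lemma pushHom_cochainX_two_zero (s : Fin 3 → ι) :
    pushHom f 𝒰 E.cochainX 2 0 s = totalDiff f 𝒰 Λ₀ P₀ E.cochainY 2 0 s := by
  rw [totalDiff_apply_succ_zero]
  funext V a
  refine section_ext_pair fun v _ => ?_
  rw [res_cechDiff_two (E.cochainY 1 0)
    (fun i j hi hj => E.M i j v.V v.W v.hV v.hW hi hj v.le (res v.hV₀ (a 0)))
    (fun s h => E.res_polyM v.hV v.hW v.hV₀ v.le s h a), ← E.push_c]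
  refine (E.res_polyC (V := f ⁻¹ᵁ V) v.hW (v.le.trans (f.preimage_mono v.hV₀)) s _ _).trans ?_
  rw [res_comorph_preimage v.hV₀ v.le]

lemma pushHom_cochainX_one_one (s : Fin 2 → ι) :
    pushHom f 𝒰 E.cochainX 1 1 s = totalDiff f 𝒰 Λ₀ P₀ E.cochainY 1 1 s := by
  change _ = cechDiff f 𝒰 (E.cochainY 0 1) s +
    (-1 : ℤ) ^ 1 • Raw.diff f Λ₀ P₀ (E.cochainY 1 0 s)
  funext V a
  refine section_ext_pair fun v _ => ?_
  rw [Pi.add_apply, Pi.add_apply, map_add, Pi.smul_apply, Pi.smul_apply, map_zsmul,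
    res_cechDiff_one (E.cochainY 0 1)
    (fun i hi => E.N i v.V v.W v.hV v.hW hi v.le (res v.hV₀ (a 0)) (res v.hV₀ (a 1)))
    (fun s h => E.res_polyN v.hV v.hW v.hV₀ v.le s h a),
    res_diff_one Λ₀ P₀ _ v.hV₀ v.le (E.cochainY 1 0 s) _ (E.res_polyM v.hV v.hW v.hV₀ v.le s _),
    pow_one, neg_one_smul, ← sub_eq_add_neg, ← E.push_L]
  refine (E.res_polyL (V := f ⁻¹ᵁ V) v.hW (v.le.trans (f.preimage_mono v.hV₀)) s _ _).trans ?_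
  rw [res_comorph_preimage v.hV₀ v.le, res_comorph_preimage v.hV₀ v.le]

lemma pushHom_cochainX_zero_two (s : Fin 1 → ι) :
    pushHom f 𝒰 E.cochainX 0 2 s = totalDiff f 𝒰 Λ₀ P₀ E.cochainY 0 2 s := by
  rw [totalDiff_apply_zero]
  funext V a
  refine section_ext_pair fun v _ => ?_
  rw [res_diff_two Λ₀ P₀ _ v.hV₀ v.le (E.cochainY 0 1 s) _ (E.res_polyN v.hV v.hW v.hV₀ v.le s _)
      a rfl rfl rfl, ← E.push_J]
  refine (E.res_polyJ (V := f ⁻¹ᵁ V) v.hW (v.le.trans (f.preimage_mono v.hV₀)) s _ _).trans ?_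
  rw [res_comorph_preimage v.hV₀ v.le, res_comorph_preimage v.hV₀ v.le,
    res_comorph_preimage v.hV₀ v.le]

lemma pushHom_cochainX (hf : f ≫ pY = pX) :
    pushHom f 𝒰 E.cochainX = totalDiff f 𝒰 Λ₀ P₀ E.cochainY := by
  funext p q
  by_cases h : p + q = 2
  · obtain ⟨rfl, rfl⟩ | ⟨rfl, rfl⟩ | ⟨rfl, rfl⟩ : (p = 2 ∧ q = 0) ∨ (p = 1 ∧ q = 1) ∨
        (p = 0 ∧ q = 2) := by omega
    · exact funext E.pushHom_cochainX_two_zero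
    · exact funext E.pushHom_cochainX_one_one
    · exact funext E.pushHom_cochainX_zero_two
  · rw [totalDiff_apply_eq_zero Λ₀ P₀ E.cochainY_mem h]
    exact (push_totalCochains f 𝒰 hf E.cochainX_mem).2 p q h

end AffineCochains

end

end PoissonDef
namespace PoissonDef
open TensorProduct

noncomputable section

set_option linter.unusedSectionVars false

/-! ### Evaluating polyvectors on affine open subsets -/

section Evaluation

variable {k : Type u} [Field k] {X Y : Scheme.{u}} {f : X ⟶ Y} {pY : Y ⟶ Spec (.of k)} {U : X.Opens}

lemma res_polyvector {q : ℕ} {Q : Raw f q U} (hQ : Q ∈ polyvectors f pY q U) {V V' : Y.Opens}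
    {W W' : X.Opens} (h : W ≤ U ⊓ f ⁻¹ᵁ V) (h' : W' ≤ U ⊓ f ⁻¹ᵁ V') (hV : V' ≤ V) (hW : W' ≤ W)
    (a : Fin q → Γ(Y, V)) :
    res hW (res h (Q V a)) = res h' (Q V' (fun i => res hV (a i))) := by
  have hQ' : IsPolyvector f pY Q := hQ
  rw [← hQ'.compat V V' hV a, res_res, res_res]

/-- The value of a vector field. -/
def ev₁ (Q : Raw f 1 U) {V : Y.Opens} {W : X.Opens} (h : W ≤ U ⊓ f ⁻¹ᵁ V) (a : Γ(Y, V)) : Γ(X, W) :=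
  res h (Q V (fun _ => a))

/-- The value of a bivector field. -/
def ev₂ (Q : Raw f 2 U) {V : Y.Opens} {W : X.Opens} (h : W ≤ U ⊓ f ⁻¹ᵁ V) (a b : Γ(Y, V)) : Γ(X, W) :=
  res h (Q V ![a, b])

variable {V : Y.Opens} {W : X.Opens} (h : W ≤ U ⊓ f ⁻¹ᵁ V)

lemma res_eq_ev₁ (Q : Raw f 1 U) (a : Fin 1 → Γ(Y, V)) : res h (Q V a) = ev₁ Q h (a 0) := by
  have : a = fun _ => a 0 := funext fun i => by rw [Subsingleton.elim i 0]
  rw [this]; rfl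

lemma res_eq_ev₂ (Q : Raw f 2 U) (a : Fin 2 → Γ(Y, V)) : res h (Q V a) = ev₂ Q h (a 0) (a 1) := by
  have : a = ![a 0, a 1] := by
    funext i; fin_cases i <;> rfl
  rw [ev₂, ← this]

section

variable {Q : Raw f 1 U} (hQ : Q ∈ polyvectors f pY 1 U)
include hQ

lemma ev₁_add (a b : Γ(Y, V)) : ev₁ Q h (a + b) = ev₁ Q h a + ev₁ Q h b := by
  have := congrArg (res h) ((show IsPolyvector f pY Q from hQ).map_add V (fun _ => 0) 0 a b)
  simpa only [map_add, res_eq_ev₁, Function.update_self] using this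

lemma ev₁_mul (a b : Γ(Y, V)) : ev₁ Q h (a * b) =
    comorph f V W (h.trans inf_le_right) a * ev₁ Q h b +
      comorph f V W (h.trans inf_le_right) b * ev₁ Q h a := by
  have := congrArg (res h) ((show IsPolyvector f pY Q from hQ).leibniz V (fun _ => 0) 0 a b)
  simpa only [map_add, map_mul, res_eq_ev₁, Function.update_self, res_comorph] using this

lemma ev₁_str (c : k) : ev₁ Q h (strHom pY V c) = 0 := by
  have := congrArg (res h) ((show IsPolyvector f pY Q from hQ).map_base V ⊤ le_top
    ((Scheme.ΓSpecIso (.of k)).inv.hom c) (fun _ => 0) 0)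
  rw [res_eq_ev₁, Function.update_self, map_zero] at this
  exact this

lemma res_ev₁ {V' : Y.Opens} {W' : X.Opens} (h' : W' ≤ U ⊓ f ⁻¹ᵁ V') (hV : V' ≤ V) (hW : W' ≤ W)
    (a : Γ(Y, V)) : res hW (ev₁ Q h a) = ev₁ Q h' (res hV a) :=
  res_polyvector hQ h h' hV hW _

end

section

variable {Q : Raw f 2 U} (hQ : Q ∈ polyvectors f pY 2 U)
include hQ

lemma ev₂_add (a b c : Γ(Y, V)) : ev₂ Q h (a + b) c = ev₂ Q h a c + ev₂ Q h b c := by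
  have := congrArg (res h) ((show IsPolyvector f pY Q from hQ).map_add V ![0, c] 0 a b)
  simpa [map_add, res_eq_ev₂] using this

lemma ev₂_add_right (a b c : Γ(Y, V)) : ev₂ Q h c (a + b) = ev₂ Q h c a + ev₂ Q h c b := by
  have := congrArg (res h) ((show IsPolyvector f pY Q from hQ).map_add V ![c, 0] 1 a b)
  simpa [map_add, res_eq_ev₂] using this

lemma ev₂_mul (a b c : Γ(Y, V)) : ev₂ Q h (a * b) c =
    comorph f V W (h.trans inf_le_right) a * ev₂ Q h b c +
      comorph f V W (h.trans inf_le_right) b * ev₂ Q h a c := by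
  have := congrArg (res h) ((show IsPolyvector f pY Q from hQ).leibniz V ![0, c] 0 a b)
  simpa [map_add, map_mul, res_eq_ev₂, res_comorph] using this

lemma ev₂_str (s : k) (c : Γ(Y, V)) : ev₂ Q h (strHom pY V s) c = 0 := by
  have := congrArg (res h) ((show IsPolyvector f pY Q from hQ).map_base V ⊤ le_top
    ((Scheme.ΓSpecIso (.of k)).inv.hom s) ![0, c] 0)
  rw [res_eq_ev₂, Function.update_self, map_zero] at this
  exact this

lemma ev₂_self (a : Γ(Y, V)) : ev₂ Q h a a = 0 := by
  have := congrArg (res h) ((show IsPolyvector f pY Q from hQ).alternating V ![a, a] 0 1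
    (by decide) rfl)
  rw [res_eq_ev₂, map_zero] at this
  exact this

lemma ev₂_skew (a b : Γ(Y, V)) : ev₂ Q h a b = -ev₂ Q h b a := by
  have := ev₂_self h hQ (a + b)
  rw [ev₂_add h hQ, ev₂_add_right h hQ, ev₂_add_right h hQ, ev₂_self h hQ, ev₂_self h hQ] at this
  linear_combination this

lemma res_ev₂ {V' : Y.Opens} {W' : X.Opens} (h' : W' ≤ U ⊓ f ⁻¹ᵁ V') (hV : V' ≤ V) (hW : W' ≤ W)
    (a b : Γ(Y, V)) : res hW (ev₂ Q h a b) = ev₂ Q h' (res hV a) (res hV b) := by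
  refine (res_polyvector hQ h h' hV hW _).trans ?_
  rw [res_eq_ev₂]
  rfl

end

end Evaluation

/-- A cochain `(u, v)` along `𝟙 X` and a cochain `w` along `f`, given by their values on affine open
subsets, with `(c, L, J) = D (u, v)` and `(M, N) = F (u, v) + D w`. -/
structure AffineCochains.Correction {k : Type u} [Field k] {X Y : Scheme.{u}}
    {pX : X ⟶ Spec (.of k)} {pY : Y ⟶ Spec (.of k)} {Λ₀ : PoissonStructure pX}
    {P₀ : PoissonStructure pY} {f : X ⟶ Y} {ι : Type*} {𝒰 : ι → X.Opens}
    (E : AffineCochains Λ₀ P₀ f 𝒰) where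
  u : ∀ (i j : ι) (V : X.Opens), IsAffineOpen V → V ≤ 𝒰 i → V ≤ 𝒰 j → Γ(X, V) → Γ(X, V)
  u_add : ∀ i j V hV hi hj a b,
    u i j V hV hi hj (a + b) = u i j V hV hi hj a + u i j V hV hi hj b
  u_mul : ∀ i j V hV hi hj a b,
    u i j V hV hi hj (a * b) = a * u i j V hV hi hj b + b * u i j V hV hi hj a
  u_str : ∀ i j V hV hi hj s, u i j V hV hi hj (strHom pX V s) = 0
  u_res : ∀ i j V V' hV hV' hi hj hi' hj' (h : V' ≤ V) a,
    res h (u i j V hV hi hj a) = u i j V' hV' hi' hj' (res h a)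
  v : ∀ (i : ι) (V : X.Opens), IsAffineOpen V → V ≤ 𝒰 i → Γ(X, V) → Γ(X, V) → Γ(X, V)
  isBiderivation : ∀ i V hV hi, IsBiderivation (v i V hV hi)
  v_str : ∀ i V hV hi s d, v i V hV hi (strHom pX V s) d = 0
  v_res : ∀ i V V' hV hV' hi hi' (h : V' ≤ V) a b,
    res h (v i V hV hi a b) = v i V' hV' hi' (res h a) (res h b)
  w : ∀ (i : ι) (V : Y.Opens) (W : X.Opens), IsAffineOpen V → IsAffineOpen W → W ≤ 𝒰 i →
    W ≤ f ⁻¹ᵁ V → Γ(Y, V) → Γ(X, W)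
  w_add : ∀ i V W hV hW hi h a b,
    w i V W hV hW hi h (a + b) = w i V W hV hW hi h a + w i V W hV hW hi h b
  w_mul : ∀ i V W hV hW hi h a b, w i V W hV hW hi h (a * b) =
    comorph f V W h a * w i V W hV hW hi h b + comorph f V W h b * w i V W hV hW hi h a
  w_str : ∀ i V W hV hW hi h s, w i V W hV hW hi h (strHom pY V s) = 0
  w_res : ∀ i V V' W W' hV hV' hW hW' hi hi' h h' (hVV : V' ≤ V) (hWW : W' ≤ W) a,
    res hWW (w i V W hV hW hi h a) = w i V' W' hV' hW' hi' h' (res hVV a)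
  eq_c : ∀ i j l V hV hi hj hl a, E.c i j l V hV hi hj hl a =
    u j l V hV hj hl a - u i l V hV hi hl a + u i j V hV hi hj a
  eq_L : ∀ i j V hV hi hj a b, E.L i j V hV hi hj a b = v j V hV hj a b - v i V hV hi a b -
    (Λ₀.bracket V (u i j V hV hi hj a) b - Λ₀.bracket V (u i j V hV hi hj b) a -
      u i j V hV hi hj (Λ₀.bracket V a b))
  eq_J : ∀ i V hV hi a b d, E.J i V hV hi a b d =
    (Λ₀.bracket V (v i V hV hi b d) a - Λ₀.bracket V (v i V hV hi a d) b +
      Λ₀.bracket V (v i V hV hi a b) d) +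
      (v i V hV hi (Λ₀.bracket V a b) d - v i V hV hi (Λ₀.bracket V a d) b +
        v i V hV hi (Λ₀.bracket V b d) a)
  eq_M : ∀ i j V W hV hW hi hj h a, E.M i j V W hV hW hi hj h a =
    u i j W hW hi hj (comorph f V W h a) + (w j V W hV hW hj h a - w i V W hV hW hi h a)
  eq_N : ∀ i V W hV hW hi h a b, E.N i V W hV hW hi h a b =
    v i W hW hi (comorph f V W h a) (comorph f V W h b) +
      (Λ₀.bracket W (w i V W hV hW hi h a) (comorph f V W h b) -
        Λ₀.bracket W (w i V W hV hW hi h b) (comorph f V W h a) -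
        w i V W hV hW hi h (P₀.bracket V a b))

section Index

variable {X Y : Scheme.{u}} {f : X ⟶ Y} {ι : Type*} {𝒰 : ι → X.Opens} {q : ℕ} {V : Y.Opens}
  {W : X.Opens}

lemma le_inter_one {i : ι} (hi : W ≤ 𝒰 i) : W ≤ inter 𝒰 ![i] :=
  le_inter fun j => by fin_cases j; exact hi

lemma le_inter_two {i j : ι} (hi : W ≤ 𝒰 i) (hj : W ≤ 𝒰 j) : W ≤ inter 𝒰 ![i, j] :=
  le_inter fun l => by
    fin_cases l
    · exact hi
    · exact hj

lemma le_inter_three {i j l : ι} (hi : W ≤ 𝒰 i) (hj : W ≤ 𝒰 j) (hl : W ≤ 𝒰 l) :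
    W ≤ inter 𝒰 ![i, j, l] :=
  le_inter fun m => by
    fin_cases m
    · exact hi
    · exact hj
    · exact hl

/-- `s` and `![s 0]` are equal only propositionally, and the open set `inter 𝒰 s` depends on the
tuple, so the change of tuple needs a transport. -/
lemma res_eta_one (y : ∀ s : Fin 1 → ι, Raw f q (inter 𝒰 s)) (s : Fin 1 → ι)
    (h : W ≤ inter 𝒰 s ⊓ f ⁻¹ᵁ V) (h' : W ≤ inter 𝒰 ![s 0] ⊓ f ⁻¹ᵁ V) (a : Fin q → Γ(Y, V)) :
    res h (y s V a) = res h' (y ![s 0] V a) := by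
  have e : ![s 0] = s := by funext j; fin_cases j; rfl
  revert h'
  rw [e]
  intro _; rfl

lemma res_eta_two (y : ∀ s : Fin 2 → ι, Raw f q (inter 𝒰 s)) (s : Fin 2 → ι)
    (h : W ≤ inter 𝒰 s ⊓ f ⁻¹ᵁ V) (h' : W ≤ inter 𝒰 ![s 0, s 1] ⊓ f ⁻¹ᵁ V) (a : Fin q → Γ(Y, V)) :
    res h (y s V a) = res h' (y ![s 0, s 1] V a) := by
  have e : ![s 0, s 1] = s := by funext j; fin_cases j <;> rfl
  revert h'
  rw [e]
  intro _; rfl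

end Index

/-! ### Reading off the correction from a primitive -/

section Extract

variable {k : Type u} [Field k] {X Y : Scheme.{u}}
    {pX : X ⟶ Spec (.of k)} {pY : Y ⟶ Spec (.of k)} {Λ₀ : PoissonStructure pX}
    {P₀ : PoissonStructure pY} {f : X ⟶ Y} {ι : Type*} {𝒰 : ι → X.Opens}
    (E : AffineCochains Λ₀ P₀ f 𝒰)

lemma le_inf_id {U V : X.Opens} (h : V ≤ U) : V ≤ U ⊓ 𝟙 X ⁻¹ᵁ V := le_inf h le_rfl

variable {y : Bicochain (𝟙 X) 𝒰} {w : Bicochain f 𝒰}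

/-- The value of the component of bidegree `(1, 0)`. -/
def valU (y : Bicochain (𝟙 X) 𝒰) (i j : ι) (V : X.Opens) (hi : V ≤ 𝒰 i) (hj : V ≤ 𝒰 j)
    (a : Γ(X, V)) : Γ(X, V) := ev₁ (y 1 0 ![i, j]) (le_inf_id (le_inter_two hi hj)) a

/-- The value of the component of bidegree `(0, 1)`. -/
def valV (y : Bicochain (𝟙 X) 𝒰) (i : ι) (V : X.Opens) (hi : V ≤ 𝒰 i)
    (a b : Γ(X, V)) : Γ(X, V) := ev₂ (y 0 1 ![i]) (le_inf_id (le_inter_one hi)) a b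

/-- The value of the component of bidegree `(0, 0)`. -/
def valW (w : Bicochain f 𝒰) (i : ι) (V : Y.Opens) (W : X.Opens) (hi : W ≤ 𝒰 i) (h : W ≤ f ⁻¹ᵁ V)
    (a : Γ(Y, V)) : Γ(X, W) := ev₁ (w 0 0 ![i]) (le_inf (le_inter_one hi) h) a

lemma res_valW (w : Bicochain f 𝒰) {V : Y.Opens} {W : X.Opens} (s : Fin 1 → ι)
    (h : W ≤ inter 𝒰 s ⊓ f ⁻¹ᵁ V) (a : Fin 1 → Γ(Y, V)) :
    res h (w 0 0 s V a) = valW w (s 0) V W (le_of_le_inter h 0) (h.trans inf_le_right) (a 0) := by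
  rw [res_eta_one (w 0 0) s h (le_inf (le_inter_one (le_of_le_inter h 0)) (h.trans inf_le_right)),
    res_eq_ev₁]
  rfl

lemma res_valU (hy : y ∈ totalCochains (𝟙 X) 𝒰 pX 1) {V W : X.Opens} (hWV : W ≤ V) (s : Fin 2 → ι)
    (h : W ≤ inter 𝒰 s ⊓ 𝟙 X ⁻¹ᵁ V) (a : Fin 1 → Γ(X, V)) :
    res h (y 1 0 s V a) =
      valU y (s 0) (s 1) W (le_of_le_inter h 0) (le_of_le_inter h 1) (res hWV (a 0)) := by
  rw [res_eta_two (y 1 0) s h (le_inf (le_inter_two (le_of_le_inter h 0) (le_of_le_inter h 1))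
    (h.trans inf_le_right))]
  have := res_polyvector (hy.1 1 0 ![s 0, s 1]) (le_inf (le_inter_two (le_of_le_inter h 0)
    (le_of_le_inter h 1)) (h.trans inf_le_right)) (le_inf_id (le_inter_two (le_of_le_inter h 0)
    (le_of_le_inter h 1))) hWV le_rfl a
  rw [res_self] at this
  refine this.trans ?_
  rw [res_eq_ev₁]
  rfl

lemma res_valV (hy : y ∈ totalCochains (𝟙 X) 𝒰 pX 1) {V W : X.Opens} (hWV : W ≤ V) (s : Fin 1 → ι)
    (h : W ≤ inter 𝒰 s ⊓ 𝟙 X ⁻¹ᵁ V) (a : Fin 2 → Γ(X, V)) :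
    res h (y 0 1 s V a) =
      valV y (s 0) W (le_of_le_inter h 0) (res hWV (a 0)) (res hWV (a 1)) := by
  rw [res_eta_one (y 0 1) s h (le_inf (le_inter_one (le_of_le_inter h 0))
    (h.trans inf_le_right))]
  have := res_polyvector (hy.1 0 1 ![s 0]) (le_inf (le_inter_one (le_of_le_inter h 0))
    (h.trans inf_le_right)) (le_inf_id (le_inter_one (le_of_le_inter h 0))) hWV le_rfl a
  rw [res_self] at this
  refine this.trans ?_
  rw [res_eq_ev₂]
  rfl

variable (hy : y ∈ totalCochains (𝟙 X) 𝒰 pX 1) (hyE : totalDiff (𝟙 X) 𝒰 Λ₀ Λ₀ y = E.cochainX)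
include hy hyE

/-- Component `(2, 0)` of `D y = (c, L, J)`, restricted to `V`. The two lemmas that follow treat the
components `(1, 1)` and `(0, 2)`. -/
lemma eq_c_of_primitive (i j l V hV hi hj hl a) : E.c i j l V hV hi hj hl a =
    valU y j l V hj hl a - valU y i l V hi hl a + valU y i j V hi hj a := by
  have e := congrArg (fun z : Bicochain (𝟙 X) 𝒰 =>
    res (le_inf_id (le_inter_three hi hj hl)) (z 2 0 ![i, j, l] V (fun _ => a))) hyE
  have e1 := E.res_polyC hV le_rfl ![i, j, l] (le_inf_id (le_inter_three hi hj hl)) (fun _ => a)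
  have e2 := res_cechDiff_two (V := V) (W := V) (a := fun _ => a) (y 1 0) (fun i j hi hj => valU y i j V hi hj a)
    (fun s h => (res_valU hy le_rfl s h _).trans (by rw [res_self])) ![i, j, l]
    (le_inf_id (le_inter_three hi hj hl))
  rw [res_self] at e1
  refine e1.symm.trans (e.symm.trans ?_)
  rw [totalDiff_apply_succ_zero]
  exact e2

lemma eq_L_of_primitive (i j V hV hi hj a b) : E.L i j V hV hi hj a b =
    valV y j V hj a b - valV y i V hi a b -
    (Λ₀.bracket V (valU y i j V hi hj a) b - Λ₀.bracket V (valU y i j V hi hj b) a -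
      valU y i j V hi hj (Λ₀.bracket V a b)) := by
  have hU := le_inf_id (le_inter_two hi hj)
  have e := congrArg (fun z : Bicochain (𝟙 X) 𝒰 => res hU (z 1 1 ![i, j] V ![a, b])) hyE
  have e1 := E.res_polyL hV le_rfl ![i, j] hU ![a, b]
  have e2 := res_cechDiff_one (V := V) (W := V) (a := ![a, b]) (y 0 1) (fun i hi => valV y i V hi a b)
    (fun s h => (res_valV hy le_rfl s h _).trans (by rw [res_self, res_self]; rfl)) ![i, j] hU
  have e3 := res_diff_one Λ₀ Λ₀ hU (V' := V) le_rfl (AffineCochains.le_id_preimage V) (y 1 0 ![i, j])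
    _ (res_valU hy le_rfl ![i, j] hU) ![a, b]
  simp only [res_self, AffineCochains.comorph_id_self] at e1 e3
  refine e1.symm.trans (e.symm.trans ?_)
  change res hU (cechDiff (𝟙 X) 𝒰 (y 0 1) ![i, j] V ![a, b] +
    ((-1 : ℤ) ^ 1 • Raw.diff (𝟙 X) Λ₀ Λ₀ (y 1 0 ![i, j])) V ![a, b]) = _
  rw [map_add, Pi.smul_apply, Pi.smul_apply, map_zsmul, pow_one, neg_one_smul, ← sub_eq_add_neg]
  exact congrArg₂ (· - ·) e2 e3

lemma eq_J_of_primitive (i V hV hi a b d) : E.J i V hV hi a b d =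
    (Λ₀.bracket V (valV y i V hi b d) a - Λ₀.bracket V (valV y i V hi a d) b +
      Λ₀.bracket V (valV y i V hi a b) d) +
      (valV y i V hi (Λ₀.bracket V a b) d - valV y i V hi (Λ₀.bracket V a d) b +
        valV y i V hi (Λ₀.bracket V b d) a) := by
  have hU := le_inf_id (le_inter_one hi)
  have e := congrArg (fun z : Bicochain (𝟙 X) 𝒰 => res hU (z 0 2 ![i] V ![a, b, d])) hyE
  have e1 := E.res_polyJ hV le_rfl ![i] hU ![a, b, d]
  have e3 := res_diff_two Λ₀ Λ₀ hU (V' := V) le_rfl (AffineCochains.le_id_preimage V) (y 0 1 ![i])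
    _ (res_valV hy le_rfl ![i] hU) ![a, b, d] rfl rfl rfl
  simp only [res_self, AffineCochains.comorph_id_self] at e1 e3
  refine e1.symm.trans (e.symm.trans ?_)
  rw [totalDiff_apply_zero]
  exact e3

variable (hw : w ∈ totalCochains f 𝒰 pY 0)
  (hwE : E.cochainY = pushHom f 𝒰 y + totalDiff f 𝒰 Λ₀ P₀ w)
include hw hwE

/-- Component `(1, 0)` of `(M, N) = F y + D w`; the component `(0, 1)` comes next. -/
lemma eq_M_of_primitive (i j V W hV hW hi hj h a) : E.M i j V W hV hW hi hj h a =
    valU y i j W hi hj (comorph f V W h a) + (valW w j V W hj h a - valW w i V W hi h a) := by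
  have hU : W ≤ inter 𝒰 ![i, j] ⊓ f ⁻¹ᵁ V := le_inf (le_inter_two hi hj) h
  have e := congrArg (fun z : Bicochain f 𝒰 => res hU (z 1 0 ![i, j] V (fun _ => a))) hwE
  have e1 := E.res_polyM hV hW le_rfl h ![i, j] hU (fun _ => a)
  have e2 := res_cechDiff_one (V := V) (W := W) (a := fun _ => a) (w 0 0) (fun i hi => valW w i V W hi h a)
    (fun s h => res_valW w s h _) ![i, j] hU
  have e3 := res_valU hy (V := f ⁻¹ᵁ V) h ![i, j] hU (fun _ => comorph f V (f ⁻¹ᵁ V) le_rfl a)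
  rw [res_self] at e1
  rw [res_comorph] at e3
  refine e1.symm.trans (e.trans ?_)
  change res hU (Raw.push f (y 1 0 ![i, j]) V (fun _ => a) +
    (totalDiff f 𝒰 Λ₀ P₀ w 1 0 ![i, j]) V (fun _ => a)) = _
  rw [map_add, totalDiff_apply_succ_zero]
  exact congrArg₂ (· + ·) e3 e2

lemma eq_N_of_primitive (i V W hV hW hi h a b) : E.N i V W hV hW hi h a b =
    valV y i W hi (comorph f V W h a) (comorph f V W h b) +
      (Λ₀.bracket W (valW w i V W hi h a) (comorph f V W h b) -
        Λ₀.bracket W (valW w i V W hi h b) (comorph f V W h a) -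
        valW w i V W hi h (P₀.bracket V a b)) := by
  have hU : W ≤ inter 𝒰 ![i] ⊓ f ⁻¹ᵁ V := le_inf (le_inter_one hi) h
  have e := congrArg (fun z : Bicochain f 𝒰 => res hU (z 0 1 ![i] V ![a, b])) hwE
  have e1 := E.res_polyN hV hW le_rfl h ![i] hU ![a, b]
  have e2 := res_diff_one Λ₀ P₀ hU (V' := V) le_rfl h (w 0 0 ![i]) (valW w i V W hi h)
    (fun a => (res_valW w ![i] hU a).trans (by rw [res_self]; rfl)) ![a, b]
  have e3 := res_valV hy (V := f ⁻¹ᵁ V) h ![i] hU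
    (fun l => comorph f V (f ⁻¹ᵁ V) le_rfl (![a, b] l))
  simp only [res_self] at e1 e2
  rw [res_comorph, res_comorph] at e3
  refine e1.symm.trans (e.trans ?_)
  change res hU (Raw.push f (y 0 1 ![i]) V ![a, b] +
    (totalDiff f 𝒰 Λ₀ P₀ w 0 1 ![i]) V ![a, b]) = _
  rw [map_add, totalDiff_apply_zero]
  exact congrArg₂ (· + ·) e3 e2

omit hw hwE in
lemma isBiderivation_valV (i V hi) : IsBiderivation (valV y i V hi) where
  add_left a b c := ev₂_add _ (hy.1 0 1 ![i]) a b c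
  skew a b := ev₂_skew _ (hy.1 0 1 ![i]) a b
  mul_left a b c := by
    have := ev₂_mul (le_inf_id (le_inter_one hi)) (hy.1 0 1 ![i]) a b c
    rwa [AffineCochains.comorph_id_self, AffineCochains.comorph_id_self] at this

lemma nonempty_correction : Nonempty E.Correction :=
  ⟨{u := fun i j V _ hi hj => valU y i j V hi hj
    u_add := fun i j V _ hi hj a b => ev₁_add _ (hy.1 1 0 ![i, j]) a b
    u_mul := fun i j V _ hi hj a b => by
      have := ev₁_mul (le_inf_id (le_inter_two hi hj)) (hy.1 1 0 ![i, j]) a b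
      rwa [AffineCochains.comorph_id_self, AffineCochains.comorph_id_self] at this
    u_str := fun i j V _ hi hj s => ev₁_str _ (hy.1 1 0 ![i, j]) s
    u_res := fun i j V V' _ _ hi hj hi' hj' h a => res_ev₁ _ (hy.1 1 0 ![i, j]) _ h h a
    v := fun i V _ hi => valV y i V hi
    isBiderivation := fun i V _ hi => isBiderivation_valV E hy hyE i V hi
    v_str := fun i V _ hi s d => ev₂_str _ (hy.1 0 1 ![i]) s d
    v_res := fun i V V' _ _ hi hi' h a b => res_ev₂ _ (hy.1 0 1 ![i]) _ h h a b
    w := fun i V W _ _ hi h => valW w i V W hi h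
    w_add := fun i V W _ _ hi h a b => ev₁_add _ (hw.1 0 0 ![i]) a b
    w_mul := fun i V W _ _ hi h a b => ev₁_mul _ (hw.1 0 0 ![i]) a b
    w_str := fun i V W _ _ hi h s => ev₁_str _ (hw.1 0 0 ![i]) s
    w_res := fun i V V' W W' _ _ _ _ hi hi' h h' hVV hWW a =>
      res_ev₁ _ (hw.1 0 0 ![i]) _ hVV hWW a
    eq_c := eq_c_of_primitive E hy hyE
    eq_L := eq_L_of_primitive E hy hyE
    eq_J := eq_J_of_primitive E hy hyE
    eq_M := eq_M_of_primitive E hy hyE hw hwE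
    eq_N := eq_N_of_primitive E hy hyE hw hwE }⟩

end Extract

lemma AffineCochains.exists_correction {k : Type u} [Field k] {X Y : Scheme.{u}}
    {pX : X ⟶ Spec (.of k)} {pY : Y ⟶ Spec (.of k)} {Λ₀ : PoissonStructure pX}
    {P₀ : PoissonStructure pY} {f : X ⟶ Y} {ι : Type*} {𝒰 : ι → X.Opens}
    (E : AffineCochains Λ₀ P₀ f 𝒰) (hf : f ≫ pY = pX) (hfP : IsPoisson Λ₀ P₀ f)
    (h₁ : Function.Surjective (hyperMap f 𝒰 Λ₀ P₀ hf hfP 1))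
    (h₂ : Function.Injective (hyperMap f 𝒰 Λ₀ P₀ hf hfP 2)) : Nonempty E.Correction := by
  obtain ⟨y, hy, w, hw, h, h'⟩ := exists_primitive hf hfP h₁ h₂ E.cochainX_mem E.totalDiff_cochainX
    E.cochainY_mem (E.pushHom_cochainX hf)
  exact nonempty_correction E hy h hw h'

end

end PoissonDef
namespace PoissonDef
open TensorProduct

noncomputable section

set_option linter.unusedSectionVars false

/-! ### From local lifts to compatible local lifts -/

section Good

variable {k : Type u} [Field k] [CharZero k] {X Y : Scheme.{u}} {pX : X ⟶ Spec (.of k)} {pY : Y ⟶ Spec (.of k)}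
  [∀ V : X.Opens, Algebra k Γ(X, V)] [IsAlgOver pX] {Λ₀ : PoissonStructure pX}
  {P₀ : PoissonStructure pY} {f : X ⟶ Y} {A A' B : ArtAlg k}
  {σ : Deformation Λ₀ A} {η : Deformation P₀ B} {ψ : σ.total ⟶ η.total}
  {hψ : σ.incl ≫ ψ = f ≫ η.incl} {ι : Type*} {𝒰 : ι → X.Opens} {T : Charts σ 𝒰}
  {φ : A'.carrier →ₐ[k] A.carrier} {β : B.carrier →ₐ[k] A'.carrier} (D : LiftData hψ T φ β)
  {t : A'.carrier} (hs : IsSmallExtension φ t)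

/-- The cochains measure the failure of the local lifts to be compatible. -/
structure LiftData.IsErrorOf (t : A'.carrier) (E : AffineCochains Λ₀ P₀ f 𝒰) : Prop where
  c : ∀ i j l V hV hi hj hl x, D.θ i j V hV hi hj (D.θ j l V hV hj hl x) =
    D.θ i l V hV hi hl x + tmulBy t (E.c i j l V hV hi hj hl (augm Γ(X, V) A' x))
  L : ∀ i j V hV hi hj x y, D.θ i j V hV hi hj (D.lam j V hV hj x y) =
    D.lam i V hV hi (D.θ i j V hV hi hj x) (D.θ i j V hV hi hj y) +
      tmulBy t (E.L i j V hV hi hj (augm Γ(X, V) A' x) (augm Γ(X, V) A' y))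
  J : ∀ i V hV hi x y z, jacobiator (D.lam i V hV hi) x y z =
    tmulBy t (E.J i V hV hi (augm Γ(X, V) A' x) (augm Γ(X, V) A' y) (augm Γ(X, V) A' z))
  M : ∀ i j V W hV hW hi hj h x, D.θ i j W hW hi hj (D.ph j V W hV hW hj h x) =
    D.ph i V W hV hW hi h x + tmulBy t (E.M i j V W hV hW hi hj h (η.red V x))
  N : ∀ i V W hV hW hi h x y, D.lam i W hW hi (D.ph i V W hV hW hi h x) (D.ph i V W hV hW hi h y) =
    D.ph i V W hV hW hi h (η.br V x y) + tmulBy t (E.N i V W hV hW hi h (η.red V x) (η.red V y))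

include hs

/-- The errors are chosen on each open subset separately. Injectivity of `o ↦ t ⊗ o` makes them
unique, so compatibility with restriction and all cocycle relations follow by comparing multiples of
`t`. -/
lemma LiftData.exists_error (hψP : IsPoisson σ.poisson η.poisson ψ) :
    ∃ E : AffineCochains Λ₀ P₀ f 𝒰, D.IsErrorOf t E := by
  have h1 := fun i j l V hV hi hj hl => D.exists_twist_error (i := i) (j := j) (l := l) (V := V) hs hV hi hj hl
  choose c c1 c2 c3 c4 using h1
  have h2 := fun i j V hV hi hj => D.exists_bracket_error (i := i) (j := j) (V := V) hs hV hi hj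
  choose L L1 L2 L3 L4 L5 using h2
  have h3 := fun i V hV hi => D.exists_jacobi_error (i := i) (V := V) hs hV hi
  choose J J1 J2 J3 J4 J5 J6 using h3
  have h4 := fun i j V W hV hW hi hj h =>
    D.exists_push_error (i := i) (j := j) (V := V) (W := W) hs hV hW hi hj h
  choose M M1 M2 M3 M4 using h4
  have h5 := fun i V W hV hW hi h =>
    D.exists_push_bracket_error (i := i) (V := V) (W := W) hs hψP hV hW hi h
  choose N N1 N2 N3 N4 N5 using h5
  have hb := fun V => Λ₀.isBiderivation V
  refine ⟨{ c := c, c_add := c2, c_mul := c3, c_str := c4, c_res := ?_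
            L := L, L_add := L2, L_mul := L3, L_str := L4
            L_self := fun i j V hV hi hj a => eq_zero_of_eq_neg k (L5 i j V hV hi hj a a)
            L_skew := L5, L_res := ?_
            J := J, J_add := J2, J_mul := J3, J_str := J4, J_self := J5, J_cyclic := J6, J_res := ?_
            M := M, M_add := M2, M_mul := M3, M_str := M4, M_res := ?_
            N := N, N_add := N2, N_mul := N3, N_str := N4
            N_self := fun i V W hV hW hi h a => eq_zero_of_eq_neg k (N5 i V W hV hW hi h a a)
            N_skew := N5, N_res := ?_
            cech_c := ?_, cech_L := ?_, cech_J := ?_, diff_J := ?_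
            push_c := ?_, push_L := ?_, push_J := ?_ }, ⟨c1, L1, J1, M1, N1⟩⟩
  · intro i j l V V' hV hV' hi hj hl hi' hj' hl' h a
    apply hs.tmulBy_injective
    have e := congrArg (resR pX A' h) (c1 i j l V hV hi hj hl (inr a))
    rw [map_add, resR_tmulBy, D.res_θ _ _ _ _ hV hV' hi hj hi' hj',
      D.res_θ _ _ _ _ hV hV' hj hl hj' hl', D.res_θ _ _ _ _ hV hV' hi hl hi' hl', c1, augm_inr,
      augm_resR, augm_inr] at e
    exact (add_left_cancel e).symm
  · intro i j V V' hV hV' hi hj hi' hj' h a b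
    apply hs.tmulBy_injective
    have e := congrArg (resR pX A' h) (L1 i j V hV hi hj (inr a) (inr b))
    rw [map_add, resR_tmulBy, D.res_θ _ _ _ _ hV hV' hi hj hi' hj', D.res_lam _ _ _ hV hV' hj hj',
      D.res_lam _ _ _ hV hV' hi hi', D.res_θ _ _ _ _ hV hV' hi hj hi' hj',
      D.res_θ _ _ _ _ hV hV' hi hj hi' hj', L1, augm_inr, augm_inr,
      augm_resR, augm_resR, augm_inr, augm_inr] at e
    exact (add_left_cancel e).symm
  · intro i V V' hV hV' hi hi' h a b d
    apply hs.tmulBy_injective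
    have e := congrArg (resR pX A' h) (J1 i V hV hi (inr a) (inr b) (inr d))
    have e' := J1 i V' hV' hi' (resR pX A' h (inr a)) (resR pX A' h (inr b)) (resR pX A' h (inr d))
    simp only [resR_tmulBy, augm_inr, augm_resR] at e e'
    rw [← e, ← e']
    simp only [jacobiator, map_add, D.res_lam _ _ _ hV hV' hi hi']
  · intro i j V V' W W' hV hV' hW hW' hi hj hi' hj' h h' hVV hWW a
    apply hs.tmulBy_injective
    obtain ⟨x, rfl⟩ := η.red_surjective hV a
    have e := congrArg (resR pX A' hWW) (M1 i j V W hV hW hi hj h x)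
    rw [map_add, resR_tmulBy, D.res_θ _ _ _ _ hW hW' hi hj hi' hj',
      D.res_ph _ _ _ _ _ hV hV' hW hW' hj hj' h h' hVV,
      D.res_ph _ _ _ _ _ hV hV' hW hW' hi hi' h h' hVV, M1, η.red_rs] at e
    exact (add_left_cancel e).symm
  · intro i V V' W W' hV hV' hW hW' hi hi' h h' hVV hWW a b
    apply hs.tmulBy_injective
    obtain ⟨x, rfl⟩ := η.red_surjective hV a
    obtain ⟨y, rfl⟩ := η.red_surjective hV b
    have e := congrArg (resR pX A' hWW) (N1 i V W hV hW hi h x y)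
    rw [map_add, resR_tmulBy, D.res_lam _ _ _ hW hW' hi hi',
      D.res_ph _ _ _ _ _ hV hV' hW hW' hi hi' h h' hVV,
      D.res_ph _ _ _ _ _ hV hV' hW hW' hi hi' h h' hVV,
      D.res_ph _ _ _ _ _ hV hV' hW hW' hi hi' h h' hVV, η.rs_br, N1, η.red_rs, η.red_rs] at e
    exact (add_left_cancel e).symm
  · intro i j l m V hV hi hj hl hm a
    exact cech_twist_error hs (D.isTwist _ _ _ _ _ _) (c1 i j l V hV hi hj hl)
      (c1 i l m V hV hi hl hm) (c1 i j m V hV hi hj hm) (c1 j l m V hV hj hl hm)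
      (D.isTwist _ _ _ _ _ _) a
  · intro i j l V hV hi hj hl a b
    exact cech_bracket_error (hb V) hs (D.isBracketLift i V hV hi) (D.isBracketLift l V hV hl)
      (D.isTwist _ _ _ _ _ _) (D.isTwist _ _ _ _ _ _) (D.isTwist _ _ _ _ _ _)
      (c1 i j l V hV hi hj hl) (L1 i j V hV hi hj) (L1 j l V hV hj hl) (L1 i l V hV hi hl) a b
  · intro i j V hV hi hj a b d
    exact cech_jacobi_error (hb V) hs (D.isBracketLift i V hV hi) (D.isBracketLift j V hV hj)
      (D.isTwist _ _ _ _ _ _) (L1 i j V hV hi hj) (J1 i V hV hi) (J1 j V hV hj)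
      (L5 i j V hV hi hj) (fun a b => (⟨L2 i j V hV hi hj, L5 i j V hV hi hj,
        L3 i j V hV hi hj⟩ : IsBiderivation _).neg_left a b) a b d
  · intro i V hV hi a b d e
    exact diff_jacobi_error hs (D.isBracketLift i V hV hi) (J1 i V hV hi) a b d e
  · intro i j l V W hV hW hi hj hl h a
    exact push_twist_error hs (D.isTwist _ _ _ _ _ _) (η.red_surjective hV)
      (D.augm_ph l V W hV hW hl h) (c1 i j l W hW hi hj hl) (M1 i j V W hV hW hi hj h)
      (M1 j l V W hV hW hj hl h) (M1 i l V W hV hW hi hl h) a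
  · intro i j V W hV hW hi hj h a b
    exact push_bracket_error (hb W) hs (D.isBracketLift i W hW hi)
      (D.isTwist _ _ _ _ _ _) (η.red_surjective hV) (η.red_br V) (D.augm_ph i V W hV hW hi h)
      (D.augm_ph j V W hV hW hj h) (L1 i j W hW hi hj) (M1 i j V W hV hW hi hj h)
      (N1 i V W hV hW hi h) (N1 j V W hV hW hj h) a b
  · intro i V W hV hW hi h a b d
    have hN' : ∀ a b, N i V W hV hW hi h (-a) b = -N i V W hV hW hi h a b := fun a b => by
      have e := N2 i V W hV hW hi h a (-a) b
      have e0 := N2 i V W hV hW hi h 0 0 b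
      rw [add_zero, left_eq_add] at e0
      rw [add_neg_cancel, e0] at e
      linear_combination - e
    exact push_jacobi_error hs (D.isBracketLift i W hW hi)
      (η.red_surjective hV) (η.red_br V) (D.augm_ph i V W hV hW hi h)
      (J1 i W hW hi) (N1 i V W hV hW hi h) (N5 i V W hV hW hi h) hN' (P₀.bracket_skew V) (hb W)
      (η.poisson.jacobiator_eq_zero _) a b d

omit hs in
/-- The local lifts are compatible. -/
structure LiftData.IsCompatible : Prop where
  θ_θ : ∀ i j l V hV hi hj hl x,
    D.θ i j V hV hi hj (D.θ j l V hV hj hl x) = D.θ i l V hV hi hl x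
  θ_lam : ∀ i j V hV hi hj x y, D.θ i j V hV hi hj (D.lam j V hV hj x y) =
    D.lam i V hV hi (D.θ i j V hV hi hj x) (D.θ i j V hV hi hj y)
  jacobi : ∀ i V hV hi x y z, jacobiator (D.lam i V hV hi) x y z = 0
  θ_ph : ∀ i j V W hV hW hi hj h x,
    D.θ i j W hW hi hj (D.ph j V W hV hW hj h x) = D.ph i V W hV hW hi h x
  lam_ph : ∀ i V W hV hW hi h x y,
    D.lam i W hW hi (D.ph i V W hV hW hi h x) (D.ph i V W hV hW hi h y) =
      D.ph i V W hV hW hi h (η.br V x y)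

omit [CharZero k] in
lemma LiftData.p_sub_tmulBy {i : ι} {V : X.Opens} (hV : IsAffineOpen V) (hi : V ≤ 𝒰 i) (x : Rg A' V) (o) :
    T.p φ i V hV hi (x - tmulBy t o) = T.p φ i V hV hi x := by
  rw [map_sub, T.p_tmulBy hV hi hs, sub_zero]

/-- The correction of the local lifts. -/
def LiftData.correct {E : AffineCochains Λ₀ P₀ f 𝒰} (K : E.Correction) : LiftData hψ T φ β where
  θ i j V hV hi hj := hs.modifyHom (D.θ i j V hV hi hj) (augm Γ(X, V) A') (RingHom.id _)
    (D.isTwist i j V hV hi hj).augm_map (K.u i j V hV hi hj) (K.u_add i j V hV hi hj)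
    (K.u_mul i j V hV hi hj)
  θ_inl i j V hV hi hj a := by
    rw [hs.modifyHom_apply, D.θ_inl, augm_inl, IsAlgOver.algebraMap_eq (pX := pX), K.u_str, map_zero,
      sub_zero]
  p_θ i j V hV hi hj x := by
    rw [hs.modifyHom_apply, LiftData.p_sub_tmulBy hs, D.p_θ]
  res_θ i j V V' hV hV' hi hj hi' hj' h x := by
    rw [hs.modifyHom_apply, hs.modifyHom_apply, map_sub, resR_tmulBy, augm_resR,
      D.res_θ _ _ _ _ hV hV' hi hj hi' hj', K.u_res _ _ _ _ hV hV' hi hj hi' hj']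
  lam i V hV hi := modifyBracket t (D.lam i V hV hi) (K.v i V hV hi)
  isBiderivation i V hV hi := ((D.isBracketLift i V hV hi).modifyBracket hs (K.isBiderivation i V hV hi)
    (fun c b => by rw [IsAlgOver.algebraMap_eq (pX := pX), K.v_str])).toIsBiderivation
  lam_inl i V hV hi := ((D.isBracketLift i V hV hi).modifyBracket hs (K.isBiderivation i V hV hi)
    (fun c b => by rw [IsAlgOver.algebraMap_eq (pX := pX), K.v_str])).inl_left
  p_lam i V hV hi x y := by
    rw [modifyBracket, LiftData.p_sub_tmulBy hs, D.p_lam]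
  res_lam i V V' hV hV' hi hi' h x y := by
    rw [modifyBracket, modifyBracket, map_sub, resR_tmulBy, augm_resR, augm_resR,
      D.res_lam _ _ _ hV hV' hi hi', K.v_res _ _ _ hV hV' hi hi']
  ph i V W hV hW hi h := hs.modifyHom (D.ph i V W hV hW hi h) (η.red V) (comorph f V W h)
    (D.augm_ph i V W hV hW hi h) (K.w i V W hV hW hi h) (K.w_add i V W hV hW hi h)
    (K.w_mul i V W hV hW hi h)
  ph_str i V W hV hW hi h a := by
    rw [hs.modifyHom_apply, D.ph_str, η.red_str, K.w_str, map_zero, sub_zero]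
  p_ph i V W hV hW hi h x := by
    rw [hs.modifyHom_apply, LiftData.p_sub_tmulBy hs, D.p_ph]
  res_ph i V V' W W' hV hV' hW hW' hi hi' h h' hVV hWW x := by
    rw [hs.modifyHom_apply, hs.modifyHom_apply, map_sub, resR_tmulBy, η.red_rs,
      D.res_ph _ _ _ _ _ hV hV' hW hW' hi hi' h h' hVV,
      K.w_res _ _ _ _ _ hV hV' hW hW' hi hi' h h' hVV]

/-- The errors of the corrected lifts are `(c, L, J) - D(u, v)` and `(M, N) - F(u, v) - D w`, and
these vanish by the choice of `K`. -/
lemma LiftData.correct_isCompatible {E : AffineCochains Λ₀ P₀ f 𝒰} (hE : D.IsErrorOf t E)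
    (K : E.Correction) : (D.correct hs K).IsCompatible where
  θ_θ i j l V hV hi hj hl x :=
    corrected_twist hs (D.isTwist _ _ _ _ _ _) (D.isTwist _ _ _ _ _ _)
      (hE.c i j l V hV hi hj hl) (K.eq_c i j l V hV hi hj hl) x
  θ_lam i j V hV hi hj x y :=
    corrected_bracket (Λ₀.isBiderivation V) hs (D.isBracketLift i V hV hi) (D.isBracketLift j V hV hj)
      (D.isTwist _ _ _ _ _ _) (hE.L i j V hV hi hj) (K.eq_L i j V hV hi hj) x y
  jacobi i V hV hi x y z :=
    corrected_jacobi (Λ₀.isBiderivation V) hs (D.isBracketLift i V hV hi) (hE.J i V hV hi)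
      (K.isBiderivation i V hV hi) (K.eq_J i V hV hi) x y z
  θ_ph i j V W hV hW hi hj h x :=
    corrected_push_twist hs (D.isTwist _ _ _ _ _ _) (D.augm_ph j V W hV hW hj h)
      (hE.M i j V W hV hW hi hj h) (K.eq_M i j V W hV hW hi hj h) x
  lam_ph i V W hV hW hi h x y :=
    corrected_push_bracket (Λ₀.isBiderivation W) hs (D.isBracketLift i W hW hi) (η.red_br V)
      (D.augm_ph i V W hV hW hi h) (hE.N i V W hV hW hi h) (K.eq_N i V W hV hW hi h) x y

include D in
-- The hypotheses on hypercohomology enter the deformation argument here, through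
-- `AffineCochains.exists_correction`.
lemma LiftData.exists_isCompatible (hψP : IsPoisson σ.poisson η.poisson ψ) (hf : f ≫ pY = pX)
    (hfP : IsPoisson Λ₀ P₀ f) (h₁ : Function.Surjective (hyperMap f 𝒰 Λ₀ P₀ hf hfP 1))
    (h₂ : Function.Injective (hyperMap f 𝒰 Λ₀ P₀ hf hfP 2)) :
    ∃ D' : LiftData hψ T φ β, D'.IsCompatible := by
  obtain ⟨E, hE⟩ := D.exists_error hs hψP
  obtain ⟨K⟩ := E.exists_correction hf hfP h₁ h₂
  exact ⟨_, D.correct_isCompatible hs hE K⟩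

end Good

end

end PoissonDef
namespace PoissonDef
open TensorProduct

noncomputable section

set_option linter.unusedSectionVars false

/-! ### Gluing thickened affine charts to a scheme -/

section GlueHom

open Limits

variable {J : Type u} {Z W : Scheme.{u}} {T : J → Scheme.{u}} (c : ∀ j, T j ⟶ Z)
  [∀ j, IsOpenImmersion (c j)] (hc : ∀ z, ∃ j x, c j x = z)

/-- The open cover given by a jointly surjective family of open immersions. -/
abbrev familyCover : Z.OpenCover where
  I₀ := J
  X := T
  f := c
  mem₀ := by
    rw [Scheme.presieve₀_mem_precoverage_iff]
    exact ⟨hc, fun j => inferInstance⟩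

include hc in
lemma hom_ext_of_family {g g' : Z ⟶ W} (h : ∀ j, c j ≫ g = c j ≫ g') : g = g' :=
  (familyCover c hc).hom_ext _ _ h

include hc in
/-- Morphisms out of a scheme can be glued along a directed family of open immersions. -/
lemma exists_glued_hom [Preorder J] (t : ∀ {i j : J}, i ≤ j → (T i ⟶ T j))
    (ht : ∀ {i j} (h : i ≤ j), t h ≫ c j = c i)
    (dir : ∀ i j (x : T i) (y : T j), c i x = c j y →
      ∃ l, ∃ (_ : l ≤ i) (_ : l ≤ j) (z : T l), c l z = c i x)
    (g : ∀ j, T j ⟶ W) (hg : ∀ {i j} (h : i ≤ j), t h ≫ g j = g i) :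
    ∃ Φ : Z ⟶ W, ∀ j, c j ≫ Φ = g j := by
  refine ⟨(familyCover c hc).glueMorphisms g fun i j => ?_,
    fun j => (familyCover c hc).ι_glueMorphisms g _ j⟩
  refine Scheme.hom_ext_of_forall _ _ fun x => ?_
  have e : c i (pullback.fst (c i) (c j) x) = c j (pullback.snd (c i) (c j) x) := by
    rw [← Scheme.Hom.comp_apply, ← Scheme.Hom.comp_apply, pullback.condition]
  obtain ⟨l, hi, hj, z, hz⟩ := dir _ _ _ _ e
  -- A chart `T l` below both `T i` and `T j` maps to their fibre product by an open immersion whose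
  -- range contains the given point; there the two morphisms agree.
  let α : T l ⟶ pullback (c i) (c j) := pullback.lift (t hi) (t hj) ((ht hi).trans (ht hj).symm)
  have hα : α ≫ pullback.fst (c i) (c j) ≫ c i = c l := by
    rw [pullback.lift_fst_assoc, ht]
  have : IsOpenImmersion α := by
    have : IsOpenImmersion (α ≫ pullback.fst (c i) (c j) ≫ c i) := by rw [hα]; infer_instance
    exact .of_comp _ (pullback.fst (c i) (c j) ≫ c i)
  refine ⟨α.opensRange, ⟨z, ?_⟩, ?_⟩
  · apply (pullback.fst (c i) (c j) ≫ c i).isOpenEmbedding.injective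
    rw [← Scheme.Hom.comp_apply, hα, hz, Scheme.Hom.comp_apply]
  · rw [← cancel_epi α.isoOpensRange.hom]
    simp only [Scheme.Hom.isoOpensRange_hom_ι_assoc]
    change α ≫ pullback.fst (c i) (c j) ≫ g i = α ≫ pullback.snd (c i) (c j) ≫ g j
    rw [pullback.lift_fst_assoc, pullback.lift_snd_assoc, hg, hg]

end GlueHom

/-- Affine charts of a thickening of a scheme `S`: affine open subsets of `S` forming a directed
cover, and for each of them a ring with a nilpotent extension onto the ring of functions. -/
structure ThickeningAtlas (S : Scheme.{u}) (J : Type u) [Preorder J] where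
  U : J → S.Opens
  U_mono : ∀ {i j}, i ≤ j → U i ≤ U j
  isAffineOpen : ∀ j, IsAffineOpen (U j)
  exists_mem : ∀ x : S, ∃ j, x ∈ U j
  exists_le : ∀ i j x, x ∈ U i → x ∈ U j → ∃ l, l ≤ i ∧ l ≤ j ∧ x ∈ U l
  R : J → CommRingCat.{u}
  ρ : ∀ {i j}, i ≤ j → (R j ⟶ R i)
  ρ_self : ∀ j (h : j ≤ j), ρ h = 𝟙 _
  ρ_ρ : ∀ {i j l} (h : i ≤ j) (h' : j ≤ l), ρ h' ≫ ρ h = ρ (h.trans h')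
  isOpenImmersion : ∀ {i j} (h : i ≤ j), IsOpenImmersion (Spec.map (ρ h))
  p : ∀ j, R j ⟶ Γ(S, U j)
  p_surjective : ∀ j, Function.Surjective (p j).hom
  isNilpotent_ker : ∀ j, IsNilpotent (RingHom.ker (p j).hom)
  ρ_p : ∀ {i j} (h : i ≤ j), ρ h ≫ p i = p j ≫ S.presheaf.map (homOfLE (U_mono h)).op

namespace ThickeningAtlas

variable {S : Scheme.{u}} {J : Type u} [Preorder J] (G : ThickeningAtlas S J)

/-- The chart of `S`. -/
def d (j : J) : Spec Γ(S, G.U j) ⟶ S := (G.isAffineOpen j).fromSpec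

instance (j : J) : IsOpenImmersion (G.d j) := (G.isAffineOpen j).isOpenImmersion_fromSpec

lemma opensRange_d (j : J) : (G.d j).opensRange = G.U j := (G.isAffineOpen j).opensRange_fromSpec

lemma mem_range_d {j : J} {x : S} : (∃ y, G.d j y = x) ↔ x ∈ G.U j := by
  change x ∈ (G.d j).opensRange ↔ _
  rw [G.opensRange_d j]

lemma map_d {i j : J} (h : i ≤ j) :
    Spec.map (S.presheaf.map (homOfLE (G.U_mono h)).op) ≫ G.d j = G.d i :=
  (G.isAffineOpen j).map_fromSpec (G.isAffineOpen i) _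

lemma d_surjective (x : S) : ∃ j y, G.d j y = x := by
  obtain ⟨j, hj⟩ := G.exists_mem x
  exact ⟨j, G.mem_range_d.mpr hj⟩

lemma d_directed (i j : J) (x y) (h : G.d i x = G.d j y) :
    ∃ l, ∃ (_ : l ≤ i) (_ : l ≤ j) (z : Spec Γ(S, G.U l)), G.d l z = G.d i x := by
  obtain ⟨l, hi, hj, hl⟩ := G.exists_le i j (G.d i x) (G.mem_range_d.mp ⟨x, rfl⟩)
    (G.mem_range_d.mp ⟨y, h.symm⟩)
  exact ⟨l, hi, hj, G.mem_range_d.mpr hl⟩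

/-- The homeomorphism of the spectra of a chart and of its thickening. -/
lemma bijective_p (j : J) : Function.Bijective (Spec.map (G.p j)) := by
  change Function.Bijective (PrimeSpectrum.comap (G.p j).hom)
  refine ⟨PrimeSpectrum.comap_injective_of_surjective _ (G.p_surjective j), ?_⟩
  rw [← Set.range_eq_univ, range_comap_of_surjective _ _ (G.p_surjective j),
    PrimeSpectrum.zeroLocus_eq_univ_iff]
  intro x hx
  obtain ⟨n, hn⟩ := G.isNilpotent_ker j
  exact ⟨n, by
    have := Ideal.pow_mem_pow hx n
    rwa [hn] at this⟩

lemma ρ_p_apply {i j : J} (h : i ≤ j) (x : Spec Γ(S, G.U i)) :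
    Spec.map (G.ρ h) (Spec.map (G.p i) x) =
      Spec.map (G.p j) (Spec.map (S.presheaf.map (homOfLE (G.U_mono h)).op) x) := by
  rw [← Scheme.Hom.comp_apply, ← Scheme.Hom.comp_apply, ← Spec.map_comp, ← Spec.map_comp, G.ρ_p]

/-- The spectra of `R j` and of `Γ(S, U j)` have the same points, so directedness is inherited from
the cover of `S`. -/
lemma ρ_directed {i j l : J} (hi : i ≤ l) (hj : j ≤ l) (x y)
    (h : Spec.map (G.ρ hi) x = Spec.map (G.ρ hj) y) :
    ∃ m, ∃ (hi : m ≤ i) (hj : m ≤ j) (z : Spec (G.R m)),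
      Spec.map (G.ρ hi) z = x ∧ Spec.map (G.ρ hj) z = y := by
  obtain ⟨x, rfl⟩ := (G.bijective_p i).2 x
  obtain ⟨y, rfl⟩ := (G.bijective_p j).2 y
  rw [ρ_p_apply, ρ_p_apply] at h
  have h' := congrArg (G.d l) ((G.bijective_p l).1 h)
  rw [← Scheme.Hom.comp_apply, ← Scheme.Hom.comp_apply, map_d _ hi, map_d _ hj] at h'
  obtain ⟨m, mi, mj, z, hz⟩ := G.d_directed i j x y h'
  refine ⟨m, mi, mj, Spec.map (G.p m) z, ?_, ?_⟩
  · rw [ρ_p_apply]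
    congr 1
    apply (G.d i).isOpenEmbedding.injective
    rw [← Scheme.Hom.comp_apply, map_d _ mi, hz]
  · rw [ρ_p_apply]
    congr 1
    apply (G.d j).isOpenEmbedding.injective
    rw [← Scheme.Hom.comp_apply, map_d _ mj, hz, h']

/-- The diagram of the charts. -/
def diagram : J ⥤ Scheme.{u} where
  obj j := Spec (G.R j)
  map h := Spec.map (G.ρ (leOfHom h))
  map_id j := by rw [G.ρ_self, Spec.map_id]
  map_comp h h' := by rw [← Spec.map_comp, G.ρ_ρ]

instance {i j : J} (h : i ⟶ j) : IsOpenImmersion (G.diagram.map h) := G.isOpenImmersion (leOfHom h)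

/-- With transition maps that are open immersions, this condition guarantees a colimit of schemes
covered by the charts, with no separate cocycle data. -/
instance : (G.diagram ⋙ Scheme.forget).IsLocallyDirected where
  cond {i j l} hi hj x y h := by
    obtain ⟨m, mi, mj, z, h1, h2⟩ := G.ρ_directed (leOfHom hi) (leOfHom hj) x y h
    exact ⟨m, homOfLE mi, homOfLE mj, z, h1, h2⟩

/-- The scheme glued from the charts. -/
def glued : Scheme.{u} := Limits.colimit G.diagram

/-- The charts of the glued scheme. -/
def c (j : J) : Spec (G.R j) ⟶ G.glued := Limits.colimit.ι G.diagram j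

instance (j : J) : IsOpenImmersion (G.c j) :=
  inferInstanceAs (IsOpenImmersion (Limits.colimit.ι G.diagram j))

lemma map_c {i j : J} (h : i ≤ j) : Spec.map (G.ρ h) ≫ G.c j = G.c i :=
  Limits.colimit.w G.diagram (homOfLE h)

lemma c_surjective (z : G.glued) : ∃ j x, G.c j x = z :=
  Scheme.IsLocallyDirected.ι_jointly_surjective G.diagram z

lemma exists_of_c_eq {i j : J} {x y} (h : G.c i x = G.c j y) :
    ∃ m, ∃ (hi : m ≤ i) (hj : m ≤ j) (z : Spec (G.R m)),
      Spec.map (G.ρ hi) z = x ∧ Spec.map (G.ρ hj) z = y := by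
  obtain ⟨m, hi, hj, z, h1, h2⟩ := (Scheme.IsLocallyDirected.ι_eq_ι_iff G.diagram).mp h
  exact ⟨m, leOfHom hi, leOfHom hj, z, h1, h2⟩

lemma exists_hom {W : Scheme.{u}} (g : ∀ j, Spec (G.R j) ⟶ W)
    (hg : ∀ {i j} (h : i ≤ j), Spec.map (G.ρ h) ≫ g j = g i) :
    ∃ Φ : G.glued ⟶ W, ∀ j, G.c j ≫ Φ = g j := by
  refine exists_glued_hom G.c G.c_surjective (fun h => Spec.map (G.ρ h)) G.map_c ?_ g hg
  intro i j x y h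
  obtain ⟨m, mi, mj, z, h1, h2⟩ := G.exists_of_c_eq h
  refine ⟨m, mi, mj, z, ?_⟩
  rw [← G.map_c mi, Scheme.Hom.comp_apply, h1]

/-- The inclusion of `S` into the glued thickening. -/
lemma exists_r : ∃ r : S ⟶ G.glued, ∀ j, G.d j ≫ r = Spec.map (G.p j) ≫ G.c j := by
  refine exists_glued_hom G.d G.d_surjective
    (fun h => Spec.map (S.presheaf.map (homOfLE (G.U_mono h)).op)) G.map_d G.d_directed _ ?_
  intro i j h
  rw [← Spec.map_comp_assoc, ← G.ρ_p h, Spec.map_comp_assoc, G.map_c h]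

/-- The inclusion of `S` into the glued thickening. -/
def r : S ⟶ G.glued := G.exists_r.choose

lemma d_r (j : J) : G.d j ≫ G.r = Spec.map (G.p j) ≫ G.c j := G.exists_r.choose_spec j

lemma d_r_apply (j : J) (x) : G.r (G.d j x) = G.c j (Spec.map (G.p j) x) := by
  rw [← Scheme.Hom.comp_apply, d_r, Scheme.Hom.comp_apply]

/-- The open subset of the glued scheme covered by a chart. -/
def zU (j : J) : G.glued.Opens := (G.c j).opensRange

instance : Surjective G.r where
  surj z := by
    obtain ⟨j, x, rfl⟩ := G.c_surjective z
    obtain ⟨y, rfl⟩ := (G.bijective_p j).2 x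
    exact ⟨G.d j y, G.d_r_apply j y⟩

/-- Two points with the same image in the glued scheme come from one point of a smaller chart, and
`p` is bijective on the points of every chart. -/
lemma r_injective : Function.Injective G.r := by
  intro a b h
  obtain ⟨i, x, rfl⟩ := G.d_surjective a
  obtain ⟨j, y, rfl⟩ := G.d_surjective b
  rw [d_r_apply, d_r_apply] at h
  obtain ⟨m, hi, hj, z, h1, h2⟩ := G.exists_of_c_eq h
  obtain ⟨z, rfl⟩ := (G.bijective_p m).2 z
  rw [ρ_p_apply] at h1 h2
  have h3 := (G.bijective_p i).1 h1
  have h4 := (G.bijective_p j).1 h2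
  rw [← h3, ← h4, ← Scheme.Hom.comp_apply, ← Scheme.Hom.comp_apply, map_d _ hi, map_d _ hj]

lemma r_preimage (j : J) : G.r ⁻¹ᵁ G.zU j = G.U j := by
  ext x
  rw [← G.opensRange_d j]
  constructor
  · rintro ⟨y, hy⟩
    obtain ⟨y, rfl⟩ := (G.bijective_p j).2 y
    have hy : G.c j (Spec.map (G.p j) y) = G.r x := hy
    rw [← d_r_apply] at hy
    exact ⟨y, G.r_injective hy⟩
  · rintro ⟨y, rfl⟩
    exact ⟨Spec.map (G.p j) y, (G.d_r_apply j y).symm⟩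

/-- The pullback property of the inclusion of `S` can be checked on charts. -/
lemma isPullback_r {B B' : Scheme.{u}} {b : S ⟶ B} {b' : G.glued ⟶ B'} {s : B ⟶ B'}
    (h : ∀ j, IsPullback (Spec.map (G.p j)) (G.d j ≫ b) (G.c j ≫ b') s) :
    IsPullback G.r b b' s := by
  refine Scheme.isPullback_of_openCover G.r b b' s (familyCover G.c G.c_surjective) fun j => ?_
  -- Since `r ⁻¹ (zU j) = U j`, over each chart `r` is the morphism `Spec (p j)`.
  have h1 : IsPullback (Spec.map (G.p j)) (G.d j) (G.c j) G.r :=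
    IsOpenImmersion.isPullback _ _ _ _ (G.d_r j) ((G.r_preimage j).trans (G.opensRange_d j).symm)
  have h2 : IsPullback (Limits.pullback.snd G.r (G.c j)) (Limits.pullback.fst G.r (G.c j)) (G.c j) G.r :=
    (IsPullback.of_hasPullback G.r (G.c j)).flip
  refine (h j).of_iso (h1.isoIsPullback _ _ h2) (Iso.refl _) (Iso.refl _) (Iso.refl _) ?_ ?_ ?_ ?_
  · rw [Iso.refl_hom, Category.comp_id]
    exact (h1.isoIsPullback_hom_fst _ _ h2).symm
  · rw [Iso.refl_hom, Category.comp_id]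
    exact (h1.isoIsPullback_hom_snd_assoc _ _ h2 _).symm
  · simp
  · simp

end ThickeningAtlas

end

end PoissonDef
namespace PoissonDef
open TensorProduct

noncomputable section

set_option linter.unusedSectionVars false

/-! ### Sections over the range of an affine chart -/

section AffineChart

variable {Z W : Scheme.{u}} {R : CommRingCat.{u}} (c : Spec R ⟶ Z) [IsOpenImmersion c]

/-- The identification of the functions on an affine open subset with the ring of a chart. -/
def chartHom : Γ(Z, c.opensRange) ⟶ R :=
  c.app c.opensRange ≫ (Spec R).presheaf.map (eqToHom c.preimage_opensRange.symm).op ≫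
    (Scheme.ΓSpecIso R).hom

lemma chartHom_bijective : Function.Bijective (chartHom c).hom := by
  have : IsIso (c.app c.opensRange) := c.isIso_app _ le_rfl
  have : IsIso (chartHom c) := by unfold chartHom; infer_instance
  exact ConcreteCategory.bijective_of_isIso (chartHom c)

lemma chartHom_eq : chartHom c =
    c.appLE c.opensRange ⊤ c.preimage_opensRange.ge ≫ (Scheme.ΓSpecIso R).hom := by
  rw [chartHom, Scheme.Hom.appLE, Category.assoc]; rfl

lemma map_chartHom : Spec.map (chartHom c) ≫ (isAffineOpen_opensRange c).fromSpec = c := by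
  have h := (isAffineOpen_opensRange c).SpecMap_appLE_fromSpec c
    (isAffineOpen_top (Spec R)) (i := c.preimage_opensRange.ge)
  rw [chartHom_eq, Spec.map_comp_assoc, h, IsAffineOpen.fromSpec_top, Scheme.isoSpec_Spec_inv,
    ← Spec.map_comp_assoc, Iso.inv_hom_id, Spec.map_id, Category.id_comp]

/-- Ring homomorphisms can be compared after applying the faithful functor `Spec` and composing with
the monomorphism `fromSpec`. -/
lemma chartHom_appLE {O : W.Opens} (hO : IsAffineOpen O) {Φ : Z ⟶ W} {g : Γ(W, O) ⟶ R}
    (h : c ≫ Φ = Spec.map g ≫ hO.fromSpec) (hle : c.opensRange ≤ Φ ⁻¹ᵁ O) :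
    Φ.appLE O c.opensRange hle ≫ chartHom c = g := by
  apply Spec.map_injective
  rw [← cancel_mono hO.fromSpec, Spec.map_comp_assoc, hO.SpecMap_appLE_fromSpec Φ
    (isAffineOpen_opensRange c) hle, ← Category.assoc, map_chartHom, h]

lemma opensRange_le {O : W.Opens} (hO : IsAffineOpen O) {Φ : Z ⟶ W} {g : Γ(W, O) ⟶ R}
    (h : c ≫ Φ = Spec.map g ≫ hO.fromSpec) : c.opensRange ≤ Φ ⁻¹ᵁ O := by
  rintro _ ⟨x, rfl⟩
  have h1 : hO.fromSpec (Spec.map g x) ∈ hO.fromSpec.opensRange := ⟨Spec.map g x, rfl⟩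
  rw [hO.opensRange_fromSpec, ← Scheme.Hom.comp_apply, ← h] at h1
  exact h1

lemma appLE_chartHom {O : W.Opens} (hO : IsAffineOpen O) {r : W ⟶ Z} {p : R ⟶ Γ(W, O)}
    (h : hO.fromSpec ≫ r = Spec.map p ≫ c) (hle : O ≤ r ⁻¹ᵁ c.opensRange) :
    r.appLE c.opensRange O hle = chartHom c ≫ p := by
  apply Spec.map_injective
  rw [← cancel_mono (isAffineOpen_opensRange c).fromSpec, Spec.map_comp_assoc, map_chartHom, ← h,
    (isAffineOpen_opensRange c).SpecMap_appLE_fromSpec r hO hle]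

lemma map_chartHom_res {R' : CommRingCat.{u}} (c' : Spec R' ⟶ Z) [IsOpenImmersion c'] {ρ : R ⟶ R'}
    (h : Spec.map ρ ≫ c = c') (hle : c'.opensRange ≤ c.opensRange) :
    Z.presheaf.map (homOfLE hle).op ≫ chartHom c' = chartHom c ≫ ρ := by
  apply Spec.map_injective
  rw [← cancel_mono (isAffineOpen_opensRange c).fromSpec, Spec.map_comp_assoc, Spec.map_comp_assoc,
    map_chartHom, h, IsAffineOpen.map_fromSpec _ (isAffineOpen_opensRange c'), map_chartHom]

lemma chartHom_strHom {A : Type u} [CommRing A] {b : Z ⟶ Spec (.of A)} {g : CommRingCat.of A ⟶ R}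
    (h : c ≫ b = Spec.map g) (a : A) : (chartHom c).hom (strHom b c.opensRange a) = g.hom a := by
  have h1 := congrArg (fun φ => φ.hom (strHom b c.opensRange a)) (chartHom_eq c)
  have h2 := comorph_strHom c h c.preimage_opensRange.ge a
  have h3 : strHom (Spec.map g) ⊤ a = (Scheme.ΓSpecIso R).inv.hom (g.hom a) :=
    (comorph_app (Spec.map g) ⊤ le_rfl _).trans
      (congrArg (fun φ => φ.hom a) (Scheme.ΓSpecIso_inv_naturality g)).symm
  refine h1.trans ((congrArg (Scheme.ΓSpecIso R).hom.hom (h2.trans h3)).trans ?_)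
  exact congrArg (fun φ => φ.hom (g.hom a)) (Scheme.ΓSpecIso R).inv_hom_id

end AffineChart
end

end PoissonDef
namespace PoissonDef
open TensorProduct

noncomputable section

set_option linter.unusedSectionVars false

/-! ### Poisson structures given on a basis -/

section BasisBracket

variable {Z : Scheme.{u}} {J : Type*} {z : J → Z.Opens}
  (hz : ∀ (O : Z.Opens) (x : Z), x ∈ O → ∃ j, x ∈ z j ∧ z j ≤ O)

include hz in
lemma section_ext_basis {U : Z.Opens} {x y : Γ(Z, U)}
    (h : ∀ j (hj : z j ≤ U), (z j : Set Z).Nonempty → res hj x = res hj y) : x = y := by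
  refine section_ext fun p hp => ?_
  obtain ⟨j, hpj, hj⟩ := hz U p hp
  exact ⟨z j, hj, hpj, h j hj ⟨p, hpj⟩⟩

/-- The spectrum of a local Artinian ring is a point, so brackets need to be tested only against
global functions of the base. -/
lemma opens_eq_top_of_local {A : Type u} [CommRing A] [IsLocalRing A] [IsArtinianRing A]
    {W : (Spec (.of A)).Opens} (h : (W : Set (Spec (.of A))).Nonempty) : W = ⊤ := by
  obtain ⟨x, hx⟩ := h
  have : Subsingleton (PrimeSpectrum A) := inferInstance
  have : Subsingleton (Spec (.of A)) := this
  ext y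
  simp only [TopologicalSpace.Opens.coe_top, Set.mem_univ, iff_true]
  rw [Subsingleton.elim y x]; exact hx

include hz in
/-- A Poisson structure given on a basis of open subsets. -/
theorem exists_poissonStructure_of_basis {A : Type u} [CommRing A] [IsLocalRing A]
    [IsArtinianRing A] (b : Z ⟶ Spec (.of A)) (B : ∀ j, Γ(Z, z j) → Γ(Z, z j) → Γ(Z, z j))
    (hB : ∀ j, IsBiderivation (B j)) (hself : ∀ j x, B j x x = 0)
    (hjac : ∀ j x y w, jacobiator (B j) x y w = 0)
    (hstr : ∀ j a x, B j (strHom b (z j) a) x = 0)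
    (hres : ∀ i j (h : z i ≤ z j) x y, res h (B j x y) = B i (res h x) (res h y)) :
    ∃ P : PoissonStructure b, ∀ j, P.bracket (z j) = B j := by
  have key : ∀ (U : Z.Opens) (x y : Γ(Z, U)), ∃ w : Γ(Z, U), ∀ j (h : z j ≤ U),
      res h w = B j (res h x) (res h y) := by
    intro U x y
    obtain ⟨w, hw⟩ := exists_glue (U := U) (fun j : {j // z j ≤ U} => z j.1) (fun j => j.2)
      (fun p hp => by
        obtain ⟨j, hpj, hj⟩ := hz U p hp
        exact ⟨⟨j, hj⟩, hpj⟩)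
      (fun j => B j.1 (res j.2 x) (res j.2 y)) (by
        rintro ⟨i, hi⟩ ⟨j, hj⟩ p hpi hpj
        obtain ⟨l, hpl, hl⟩ := hz (z i ⊓ z j) p ⟨hpi, hpj⟩
        refine ⟨z l, hl.trans inf_le_left, hl.trans inf_le_right, hpl, ?_⟩
        rw [hres, hres, res_res, res_res, res_res, res_res])
    exact ⟨w, fun j h => hw ⟨j, h⟩⟩
  choose br hbr using key
  refine ⟨⟨br, ?_, ?_, ?_, ?_, ?_, ?_, ?_⟩, fun j => ?_⟩
  · intro U x y w
    refine section_ext_basis hz fun j hj _ => ?_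
    rw [map_add, hbr, hbr, hbr, map_add, (hB j).add_left]
  · intro U x
    refine section_ext_basis hz fun j hj _ => ?_
    rw [hbr, hself, map_zero]
  · intro U x y
    refine section_ext_basis hz fun j hj _ => ?_
    rw [map_neg, hbr, hbr, (hB j).skew]
  · intro U x y w
    refine section_ext_basis hz fun j hj _ => ?_
    rw [map_add, map_mul, map_mul, hbr, hbr, hbr, map_mul, (hB j).mul_left]
  · intro U W h r x
    refine section_ext_basis hz fun j hj hne => ?_
    obtain ⟨p, hp⟩ := hne
    obtain ⟨a, ha⟩ := exists_eq_strHom (opens_eq_top_of_local ⟨_, h (hj hp)⟩) h r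
    rw [hbr, ha, res_strHom, hstr, map_zero]
  · intro U x y w
    refine section_ext_basis hz fun j hj _ => ?_
    have h := hjac j (res hj x) (res hj y) (res hj w)
    rw [jacobiator, (hB j).skew (B j (res hj x) (res hj y)), (hB j).skew (B j (res hj y) (res hj w)),
      (hB j).skew (B j (res hj w) (res hj x))] at h
    rw [map_add, map_add, hbr, hbr, hbr, hbr, hbr, hbr, map_zero]
    linear_combination - h
  · intro U U' h x y
    refine section_ext_basis hz fun j hj _ => ?_
    rw [res_res, hbr, hbr, res_res, res_res]
  · funext x y
    have := hbr (z j) x y j le_rfl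
    rwa [res_self, res_self, res_self] at this

end BasisBracket

/-- Compatibility with the brackets is a local condition. -/
lemma isPoisson_of_local {X Y S T : Scheme.{u}} {p : X ⟶ S} {q : Y ⟶ T}
    {P : PoissonStructure p} {Q : PoissonStructure q} {f : X ⟶ Y}
    (h : ∀ (V : Y.Opens) (x : X), x ∈ f ⁻¹ᵁ V → ∃ (V' : Y.Opens) (U : X.Opens) (hU : U ≤ f ⁻¹ᵁ V'),
      V' ≤ V ∧ x ∈ U ∧ ∀ a b, comorph f V' U hU (Q.bracket V' a b) =
        P.bracket U (comorph f V' U hU a) (comorph f V' U hU b)) : IsPoisson P Q f := by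
  intro V a b
  refine section_ext fun x hx => ?_
  obtain ⟨V', U, hU, hV, hxU, e⟩ := h V x hx
  refine ⟨U, hU.trans (f.preimage_mono hV), hxU, ?_⟩
  rw [P.bracket_res, res_comorph, res_comorph, res_comorph, ← comorph_res' f hV hU,
    ← comorph_res' f hV hU, ← comorph_res' f hV hU, Q.bracket_res, e]

end

end PoissonDef
namespace PoissonDef
open TensorProduct

noncomputable section

set_option linter.unusedSectionVars false

/-! ### Base change properties of the charts -/

section Pushouts

variable {k : Type u} [Field k]

lemma isPushout_tensor (A O : Type u) [CommRing A] [Algebra k A] [CommRing O] [Algebra k O] :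
    IsPushout (CommRingCat.ofHom (algebraMap k A)) (CommRingCat.ofHom (algebraMap k O))
      (CommRingCat.ofHom (inl (k := k) (A := A) (O := O)))
      (CommRingCat.ofHom (inr (k := k) (A := A) (O := O))) :=
  CommRingCat.isPushout_tensorProduct k A O

lemma isPushout_tlift {A O G : Type u} [CommRing A] [Algebra k A] [CommRing O] [Algebra k O]
    [CommRing G] (a : A →+* G) (τ : O →+* G)
    (h : ∀ c : k, a (algebraMap k A c) = τ (algebraMap k O c))
    (hb : Function.Bijective (tlift a τ h)) :
    IsPushout (CommRingCat.ofHom (algebraMap k A)) (CommRingCat.ofHom (algebraMap k O))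
      (CommRingCat.ofHom a) (CommRingCat.ofHom τ) := by
  refine (isPushout_tensor A O).of_iso (Iso.refl _) (Iso.refl _) (Iso.refl _)
    (RingEquiv.ofBijective _ hb).toCommRingCatIso (by simp) (by simp) ?_ ?_
  · ext x
    change tlift a τ h (inl x) = a x
    change tlift a τ h (x ⊗ₜ 1) = a x
    rw [tlift_tmul, map_one, mul_one]
  · ext x
    change tlift a τ h (1 ⊗ₜ x) = τ x
    rw [tlift_tmul, map_one, one_mul]

lemma isOpenImmersion_map_res {X : Scheme.{u}} {V V' : X.Opens} (hV : IsAffineOpen V)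
    (hV' : IsAffineOpen V') (h : V' ≤ V) :
    IsOpenImmersion (Spec.map (CommRingCat.ofHom (res h))) := by
  have e : Spec.map (CommRingCat.ofHom (res h)) ≫ hV.fromSpec = hV'.fromSpec :=
    hV.map_fromSpec hV' (homOfLE h).op
  have : IsOpenImmersion (Spec.map (CommRingCat.ofHom (res h)) ≫ hV.fromSpec) := by
    rw [e]; infer_instance
  exact .of_comp _ hV.fromSpec

variable {X : Scheme.{u}} (pX : X ⟶ Spec (.of k)) [∀ V : X.Opens, Algebra k Γ(X, V)] [IsAlgOver pX]
  (A' : ArtAlg k)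

/-- Cancellation of pushouts: both `A' ⊗ Γ(X, V)` and `A' ⊗ Γ(X, V')` are base changes from `k`. The
restriction maps of the charts therefore inherit the property of giving open immersions. -/
lemma isPushout_resR {V V' : X.Opens} (h : V' ≤ V) :
    IsPushout (CommRingCat.ofHom (res h)) (CommRingCat.ofHom (inr (A := A'.carrier) (k := k)))
      (CommRingCat.ofHom (inr (A := A'.carrier) (k := k))) (CommRingCat.ofHom (resR pX A' h)) := by
  refine IsPushout.of_left (h₁₁ := CommRingCat.ofHom (algebraMap k Γ(X, V)))
    (h₂₁ := CommRingCat.ofHom (inl (A := A'.carrier) (k := k) (O := Γ(X, V))))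
    (v₁₁ := CommRingCat.ofHom (algebraMap k A'.carrier)) ?_ ?_ (isPushout_tensor _ _).flip
  · convert! (isPushout_tensor A'.carrier Γ(X, V')).flip using 1
    · ext c
      change res h (algebraMap k Γ(X, V) c) = algebraMap k Γ(X, V') c
      rw [IsAlgOver.algebraMap_eq (pX := pX), IsAlgOver.algebraMap_eq (pX := pX), res_strHom]
    · ext a
      exact resR_inl pX h a
  · ext x
    exact (resR_inr pX h x).symm

lemma isOpenImmersion_map_resR {V V' : X.Opens} (hV : IsAffineOpen V)
    (hV' : IsAffineOpen V') (h : V' ≤ V) :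
    IsOpenImmersion (Spec.map (CommRingCat.ofHom (resR pX A' h))) :=
  MorphismProperty.of_isPullback
    (isPullback_SpecMap_of_isPushout _ _ _ _ (isPushout_resR pX A' h))
    (isOpenImmersion_map_res hV hV' h)

variable {pX A'} {Λ₀ : PoissonStructure pX} {A : ArtAlg k} {σ : Deformation Λ₀ A} {ι : Type*}
  {𝒰 : ι → X.Opens} (T : Charts σ 𝒰) (φ : A'.carrier →ₐ[k] A.carrier)

/-- The trivialization writes the functions of `σ` as `A ⊗ Γ(X, V)`, which is `A ⊗_{A'} (A' ⊗ Γ(X,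
V))`; hence the chart over `A'` reduces to `σ` over `A`. -/
lemma Charts.isPushout_p {i : ι} {V : X.Opens} (hV : IsAffineOpen V) (hi : V ≤ 𝒰 i) :
    IsPushout (CommRingCat.ofHom (φ : A'.carrier →+* A.carrier)) (CommRingCat.ofHom inl)
      (CommRingCat.ofHom (σ.str V)) (CommRingCat.ofHom (T.p φ i V hV hi)) := by
  refine IsPushout.of_left (h₁₁ := CommRingCat.ofHom (algebraMap k A'.carrier))
    (h₂₁ := CommRingCat.ofHom (inr (A := A'.carrier) (k := k) (O := Γ(X, V))))
    (v₁₁ := CommRingCat.ofHom (algebraMap k Γ(X, V))) ?_ ?_ (isPushout_tensor _ _)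
  · convert! isPushout_tlift _ _ (T.tlift_compat' hV hi) (T.bijective_triv hV hi) using 1
    · ext c
      exact φ.commutes c
    · ext x
      exact T.p_inr φ hV hi x
  · ext a
    exact (T.p_inl φ hV hi a).symm

end Pushouts

/-! ### The atlas of compatible local lifts -/

section Atlas

variable {k : Type u} [Field k] [CharZero k] {X Y : Scheme.{u}} {pX : X ⟶ Spec (.of k)} {pY : Y ⟶ Spec (.of k)}
  [∀ V : X.Opens, Algebra k Γ(X, V)] [IsAlgOver pX] {Λ₀ : PoissonStructure pX}
  {P₀ : PoissonStructure pY} {f : X ⟶ Y} {A A' B : ArtAlg k}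
  {σ : Deformation Λ₀ A} {η : Deformation P₀ B} {ψ : σ.total ⟶ η.total}
  {hψ : σ.incl ≫ ψ = f ≫ η.incl} {ι : Type*} {𝒰 : ι → X.Opens} {T : Charts σ 𝒰}
  {φ : A'.carrier →ₐ[k] A.carrier} {β : B.carrier →ₐ[k] A'.carrier} {D : LiftData hψ T φ β}
  {t : A'.carrier}

/-- The affine open subsets contained in a member of the cover. -/
abbrev SmallOpen (𝒰 : ι → X.Opens) : Type u := {V : X.Opens // IsAffineOpen V ∧ ∃ i, V ≤ 𝒰 i}

namespace SmallOpen

/-- A member of the cover containing the open subset. -/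
def idx (v : SmallOpen 𝒰) : ι := v.2.2.choose

lemma le_idx (v : SmallOpen 𝒰) : v.1 ≤ 𝒰 v.idx := v.2.2.choose_spec

lemma exists_mem_le (h𝒰 : ⨆ i, 𝒰 i = ⊤) {O : X.Opens} {x : X} (hx : x ∈ O) :
    ∃ v : SmallOpen 𝒰, x ∈ v.1 ∧ v.1 ≤ O := by
  have : x ∈ ⨆ i, 𝒰 i := h𝒰 ▸ TopologicalSpace.Opens.mem_top x
  obtain ⟨i, hi⟩ := TopologicalSpace.Opens.mem_iSup.mp this
  obtain ⟨W, hW, hxW, hle⟩ := exists_affine_mem_le (U := O ⊓ 𝒰 i) ⟨hx, hi⟩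
  exact ⟨⟨W, hW, i, hle.trans inf_le_right⟩, hxW, hle.trans inf_le_left⟩

end SmallOpen

lemma Deformation.mem_up {V : X.Opens} {x : X} : σ.incl x ∈ σ.up V ↔ x ∈ V := by
  change x ∈ σ.incl ⁻¹ᵁ σ.up V ↔ x ∈ V
  rw [σ.incl_preimage_up]

namespace LiftData

section

variable (hD : D.IsCompatible) (hs : IsSmallExtension φ t)
include hD hs

/-- `θ_ii` is the identity up to `t ⊗ Γ(X, V)`, on which it acts trivially. Being idempotent by the
cocycle identity, it is the identity. -/
lemma IsCompatible.θ_self (i V hV hi x) : D.θ i i V hV hi hi x = x := by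
  obtain ⟨o, ho⟩ := T.exists_of_p_eq hV hi hs (D.p_θ i i V hV hi hi x)
  have h := hD.θ_θ i i i V hV hi hi hi x
  have h2 := (D.isTwist i i V hV hi hi).map_tmulBy hs o
  rw [ho, map_add, h2, ho] at h
  have h0 : tmulBy t o = (0 : Rg A' V) := by
    have := add_left_cancel (h.trans (add_zero _).symm)
    exact this
  rw [ho, h0, add_zero]

lemma IsCompatible.θ_bijective (i j V hV hi hj) : Function.Bijective (D.θ i j V hV hi hj) :=
  Function.bijective_iff_has_inverse.mpr ⟨D.θ j i V hV hj hi,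
    fun x => by rw [hD.θ_θ, hD.θ_self hs], fun x => by rw [hD.θ_θ, hD.θ_self hs]⟩

end

variable (D) in
/-- The transition map of the charts. -/
def rho {v w : SmallOpen 𝒰} (h : v ≤ w) : Rg A' w.1 →+* Rg A' v.1 :=
  (D.θ v.idx w.idx v.1 v.2.1 v.le_idx (le_trans h w.le_idx)).comp (resR pX A' h)

variable (D) in
lemma rho_apply {v w : SmallOpen 𝒰} (h : v ≤ w) (x) :
    D.rho h x = D.θ v.idx w.idx v.1 v.2.1 v.le_idx (le_trans h w.le_idx) (resR pX A' h x) := rfl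

variable (D) in
lemma rho_inl {v w : SmallOpen 𝒰} (h : v ≤ w) (a) : D.rho h (inl a) = inl a := by
  rw [rho_apply, resR_inl, D.θ_inl]

variable (D) in
lemma p_rho {v w : SmallOpen 𝒰} (h : v ≤ w) (x) :
    T.p φ v.idx v.1 v.2.1 v.le_idx (D.rho h x) = σ.rs h (T.p φ w.idx w.1 w.2.1 w.le_idx x) := by
  rw [rho_apply, D.p_θ, T.rs_p φ w.2.1 w.le_idx v.2.1 h]

variable (hD : D.IsCompatible)
include hD

lemma IsCompatible.rho_rho {u v w : SmallOpen 𝒰} (h : u ≤ v) (h' : v ≤ w) (x) :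
    D.rho h (D.rho h' x) = D.rho (h.trans h') x := by
  rw [rho_apply, rho_apply, D.res_θ _ _ v.1 u.1 v.2.1 u.2.1 _ _ (le_trans h v.le_idx)
    (le_trans (h.trans h') w.le_idx) h, hD.θ_θ, resR_resR, rho_apply]

lemma IsCompatible.rho_lam {v w : SmallOpen 𝒰} (h : v ≤ w) (x y) :
    D.rho h (D.lam w.idx w.1 w.2.1 w.le_idx x y) =
      D.lam v.idx v.1 v.2.1 v.le_idx (D.rho h x) (D.rho h y) := by
  rw [rho_apply, D.res_lam _ w.1 v.1 w.2.1 v.2.1 _ (le_trans h w.le_idx) h, hD.θ_lam,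
    rho_apply, rho_apply]

lemma IsCompatible.rho_ph {v w : SmallOpen 𝒰} (h : v ≤ w) {V V' : Y.Opens} (hV : IsAffineOpen V)
    (hV' : IsAffineOpen V') (hVV : V' ≤ V) (hw : w.1 ≤ f ⁻¹ᵁ V) (hv : v.1 ≤ f ⁻¹ᵁ V') (x) :
    D.rho h (D.ph w.idx V w.1 hV w.2.1 w.le_idx hw x) =
      D.ph v.idx V' v.1 hV' v.2.1 v.le_idx hv (η.rs hVV x) := by
  rw [rho_apply, D.res_ph _ V V' w.1 v.1 hV hV' w.2.1 v.2.1 _ (le_trans h w.le_idx) _ hv hVV h,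
    hD.θ_ph]

variable (hs : IsSmallExtension φ t)
include hs

lemma IsCompatible.rho_self {v : SmallOpen 𝒰} (h : v ≤ v) (x) : D.rho h x = x := by
  rw [rho_apply, resR_self, hD.θ_self hs]

lemma IsCompatible.isOpenImmersion_map_rho {v w : SmallOpen 𝒰} (h : v ≤ w) :
    IsOpenImmersion (Spec.map (CommRingCat.ofHom (D.rho h))) := by
  have e : CommRingCat.ofHom (D.rho h) = CommRingCat.ofHom (resR pX A' h) ≫ CommRingCat.ofHom
    (D.θ v.idx w.idx v.1 v.2.1 v.le_idx (le_trans h w.le_idx)) := rfl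
  have h1 : IsIso (CommRingCat.ofHom (D.θ v.idx w.idx v.1 v.2.1 v.le_idx (le_trans h w.le_idx))) :=
    (ConcreteCategory.isIso_iff_bijective _).mpr (hD.θ_bijective hs _ _ _ _ _ _)
  have h2 := isOpenImmersion_map_resR pX A' w.2.1 v.2.1 h
  rw [e, Spec.map_comp]
  infer_instance

/-- The charts of the lifted deformation. -/
def IsCompatible.atlas (h𝒰 : ⨆ i, 𝒰 i = ⊤) : ThickeningAtlas σ.total (SmallOpen 𝒰) where
  U v := σ.up v.1
  U_mono h := σ.up_mono h
  isAffineOpen v := σ.isAffineOpen_up v.2.1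
  exists_mem x := by
    obtain ⟨y, rfl⟩ := σ.incl.surjective x
    obtain ⟨v, hv, -⟩ := SmallOpen.exists_mem_le h𝒰 (TopologicalSpace.Opens.mem_top y)
    exact ⟨v, Deformation.mem_up.mpr hv⟩
  exists_le u v x hu hv := by
    obtain ⟨y, rfl⟩ := σ.incl.surjective x
    obtain ⟨w, hw, hle⟩ := SmallOpen.exists_mem_le h𝒰 (O := u.1 ⊓ v.1)
      ⟨Deformation.mem_up.mp hu, Deformation.mem_up.mp hv⟩
    exact ⟨w, hle.trans inf_le_left, hle.trans inf_le_right, Deformation.mem_up.mpr hw⟩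
  R v := .of (Rg A' v.1)
  ρ h := CommRingCat.ofHom (D.rho h)
  ρ_self v h := CommRingCat.hom_ext (RingHom.ext fun x => hD.rho_self hs h x)
  ρ_ρ h h' := CommRingCat.hom_ext (RingHom.ext fun x => hD.rho_rho h h' x)
  isOpenImmersion h := hD.isOpenImmersion_map_rho hs h
  p v := CommRingCat.ofHom (T.p φ v.idx v.1 v.2.1 v.le_idx)
  p_surjective v := T.p_surjective v.2.1 v.le_idx hs
  isNilpotent_ker v := T.isNilpotent_ker_p v.2.1 v.le_idx hs
  ρ_p h := CommRingCat.hom_ext (RingHom.ext fun x => D.p_rho h x)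

end LiftData

end Atlas

end

end PoissonDef
namespace PoissonDef
open TensorProduct

noncomputable section

set_option linter.unusedSectionVars false

lemma fromSpec_comp_eq {X : Scheme.{u}} {R : Type u} [CommRing R] (p : X ⟶ Spec (.of R))
    {V : X.Opens} (hV : IsAffineOpen V) :
    hV.fromSpec ≫ p = Spec.map (CommRingCat.ofHom (strHom p V)) := by
  have h := (isAffineOpen_top (Spec (.of R))).SpecMap_appLE_fromSpec p hV (i := le_top)
  rw [← h, IsAffineOpen.fromSpec_top, Scheme.isoSpec_Spec_inv, ← Spec.map_comp]
  rfl

lemma IsPoisson.comp {X Y Z S T U : Scheme.{u}} {p : X ⟶ S} {q : Y ⟶ T} {r : Z ⟶ U}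
    {P : PoissonStructure p} {Q : PoissonStructure q} {R : PoissonStructure r} {f : X ⟶ Y}
    {g : Y ⟶ Z} (hf : IsPoisson P Q f) (hg : IsPoisson Q R g) : IsPoisson P R (f ≫ g) := by
  intro V a b
  have h := hf (g ⁻¹ᵁ V) (comorph g V (g ⁻¹ᵁ V) le_rfl a) (comorph g V (g ⁻¹ᵁ V) le_rfl b)
  rw [← hg V, comorph_comorph, comorph_comorph, comorph_comorph] at h
  exact h

/-! ### The glued deformation and its morphism to the target -/

section Glue

variable {k : Type u} [Field k] [CharZero k] {X Y : Scheme.{u}} {pX : X ⟶ Spec (.of k)} {pY : Y ⟶ Spec (.of k)}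
  [∀ V : X.Opens, Algebra k Γ(X, V)] [IsAlgOver pX] {Λ₀ : PoissonStructure pX}
  {P₀ : PoissonStructure pY} {f : X ⟶ Y} {A A' B : ArtAlg k}
  {σ : Deformation Λ₀ A} {η : Deformation P₀ B} {ψ : σ.total ⟶ η.total}
  {hψ : σ.incl ≫ ψ = f ≫ η.incl} {ι : Type*} {𝒰 : ι → X.Opens} {T : Charts σ 𝒰}
  {φ : A'.carrier →ₐ[k] A.carrier} {β : B.carrier →ₐ[k] A'.carrier} {D : LiftData hψ T φ β}
  {t : A'.carrier}

/-- The chart of the lift over a small affine open subset. -/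
abbrev SmallOpen.p (T : Charts σ 𝒰) (φ : A'.carrier →ₐ[k] A.carrier) (v : SmallOpen 𝒰) :
    Rg A' v.1 →+* Γ(σ.total, σ.up v.1) := T.p φ v.idx v.1 v.2.1 v.le_idx

/-- The bracket of the chart over a small affine open subset. -/
abbrev LiftData.br (D : LiftData hψ T φ β) (v : SmallOpen 𝒰) : Rg A' v.1 → Rg A' v.1 → Rg A' v.1 :=
  D.lam v.idx v.1 v.2.1 v.le_idx

/-- The lift of `ψ` on the chart over a small affine open subset. -/
abbrev LiftData.phi (D : LiftData hψ T φ β) (v : SmallOpen 𝒰) {V : Y.Opens} (hV : IsAffineOpen V)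
    (h : v.1 ≤ f ⁻¹ᵁ V) : Γ(η.total, η.up V) →+* Rg A' v.1 :=
  D.ph v.idx V v.1 hV v.2.1 v.le_idx h

/-- A scheme glued from the charts of a lift, with the inclusion of the original deformation. -/
structure LiftData.Gluing (D : LiftData hψ T φ β) where
  Z : Scheme.{u}
  c : ∀ v : SmallOpen 𝒰, Spec (.of (Rg A' v.1)) ⟶ Z
  isOpenImmersion : ∀ v, IsOpenImmersion (c v)
  c_surjective : ∀ x, ∃ v y, c v y = x
  map_c : ∀ {v w} (h : v ≤ w), Spec.map (CommRingCat.ofHom (D.rho h)) ≫ c w = c v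
  exists_hom : ∀ (W : Scheme.{u}) (g : ∀ v : SmallOpen 𝒰, Spec (.of (Rg A' v.1)) ⟶ W),
    (∀ {v w} (h : v ≤ w), Spec.map (CommRingCat.ofHom (D.rho h)) ≫ g w = g v) →
    ∃ Φ : Z ⟶ W, ∀ v, c v ≫ Φ = g v
  r : σ.total ⟶ Z
  surjective : Surjective r
  fromSpec_r : ∀ v : SmallOpen 𝒰, (σ.isAffineOpen_up v.2.1).fromSpec ≫ r =
    Spec.map (CommRingCat.ofHom (v.p T φ)) ≫ c v
  r_preimage : ∀ v, r ⁻¹ᵁ (c v).opensRange = σ.up v.1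
  isPullback_r : ∀ {S S' : Scheme.{u}} {b : σ.total ⟶ S} {b' : Z ⟶ S'} {s : S ⟶ S'},
    (∀ v : SmallOpen 𝒰, IsPullback (Spec.map (CommRingCat.ofHom (v.p T φ)))
      ((σ.isAffineOpen_up v.2.1).fromSpec ≫ b) (c v ≫ b') s) → IsPullback r b b' s

lemma LiftData.IsCompatible.nonempty_gluing (hD : D.IsCompatible) (hs : IsSmallExtension φ t)
    (h𝒰 : ⨆ i, 𝒰 i = ⊤) : Nonempty D.Gluing := by
  let G := hD.atlas hs h𝒰
  exact ⟨{
    Z := G.glued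
    c := G.c
    isOpenImmersion := fun v => inferInstanceAs (IsOpenImmersion (G.c v))
    c_surjective := G.c_surjective
    map_c := G.map_c
    exists_hom := fun W g hg => G.exists_hom g hg
    r := G.r
    surjective := inferInstanceAs (Surjective G.r)
    fromSpec_r := G.d_r
    r_preimage := G.r_preimage
    isPullback_r := fun h => G.isPullback_r h }⟩

namespace LiftData.Gluing

variable (E : D.Gluing)

instance (v : SmallOpen 𝒰) : IsOpenImmersion (E.c v) := E.isOpenImmersion v

instance : Surjective E.r := E.surjective

/-- The open subset covered by a chart. -/
def z (v : SmallOpen 𝒰) : E.Z.Opens := (E.c v).opensRange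

lemma z_mono {v w : SmallOpen 𝒰} (h : v ≤ w) : E.z v ≤ E.z w := by
  rintro _ ⟨x, rfl⟩
  refine ⟨Spec.map (CommRingCat.ofHom (D.rho h)) x, ?_⟩
  rw [← Scheme.Hom.comp_apply, map_c]

/-- The functions on the open subset covered by a chart. -/
def sec (v : SmallOpen 𝒰) : Γ(E.Z, E.z v) →+* Rg A' v.1 := (chartHom (E.c v)).hom

lemma sec_bijective (v : SmallOpen 𝒰) : Function.Bijective (E.sec v) := chartHom_bijective (E.c v)

lemma sec_res {v w : SmallOpen 𝒰} (h : v ≤ w) (x : Γ(E.Z, E.z w)) :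
    E.sec v (res (E.z_mono h) x) = D.rho h (E.sec w x) :=
  congrArg (fun φ => φ.hom x) (map_chartHom_res (E.c w) (E.c v) (E.map_c h) (E.z_mono h))

lemma up_le (v : SmallOpen 𝒰) : σ.up v.1 ≤ E.r ⁻¹ᵁ E.z v := (E.r_preimage v).ge

lemma comorph_r (v : SmallOpen 𝒰) (x : Γ(E.Z, E.z v)) :
    comorph E.r (E.z v) (σ.up v.1) (E.up_le v) x = v.p T φ (E.sec v x) :=
  congrArg (fun φ => φ.hom x)
    (appLE_chartHom (E.c v) (σ.isAffineOpen_up v.2.1) (E.fromSpec_r v) (E.up_le v))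

lemma hom_ext {W : Scheme.{u}} {g g' : E.Z ⟶ W} (h : ∀ v, E.c v ≫ g = E.c v ≫ g') : g = g' :=
  hom_ext_of_family E.c E.c_surjective h

lemma exists_toBase : ∃ b : E.Z ⟶ A'.spec, ∀ v, E.c v ≫ b = Spec.map (CommRingCat.ofHom inl) := by
  refine E.exists_hom _ _ fun h => ?_
  rw [← Spec.map_comp]
  congr 1
  exact CommRingCat.hom_ext (RingHom.ext fun a => D.rho_inl h a)

/-- The structure morphism. -/
def toBase : E.Z ⟶ A'.spec := E.exists_toBase.choose

lemma c_toBase (v : SmallOpen 𝒰) : E.c v ≫ E.toBase = Spec.map (CommRingCat.ofHom inl) :=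
  E.exists_toBase.choose_spec v

lemma sec_strHom (v : SmallOpen 𝒰) (a : A'.carrier) : E.sec v (strHom E.toBase (E.z v) a) = inl a :=
  chartHom_strHom (E.c v) (E.c_toBase v) a

/-- On charts this is the pushout property of `p`. -/
lemma isPullback : IsPullback E.r σ.toBase E.toBase (ArtAlg.specMap φ) := by
  refine E.isPullback_r fun v => ?_
  rw [E.c_toBase, fromSpec_comp_eq]
  exact (isPullback_SpecMap_of_isPushout _ _ _ _ (T.isPushout_p φ v.2.1 v.le_idx)).flip

/-- On charts the base acts on `A' ⊗ Γ(X, V)`, which is flat because `Γ(X, V)` is flat over the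
field `k`. -/
lemma flat : Flat E.toBase := by
  have : IsZariskiLocalAtSource @Flat.{u} :=
    HasRingHomProperty.instIsZariskiLocalAtSource (P := @Flat.{u}) (Q := RingHom.Flat)
  refine (IsZariskiLocalAtSource.iff_of_openCover (familyCover E.c E.c_surjective)).mpr fun v => ?_
  change Flat (E.c v ≫ E.toBase)
  rw [c_toBase, Flat.SpecMap_iff]
  change (algebraMap A'.carrier (Rg A' v.1)).Flat
  rw [RingHom.flat_algebraMap_iff]
  infer_instance

/-- The inclusion of the closed fibre. -/
def incl : X ⟶ E.Z := σ.incl ≫ E.r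

instance : Surjective E.incl := by unfold incl; infer_instance

lemma incl_preimage (v : SmallOpen 𝒰) : E.incl ⁻¹ᵁ E.z v = v.1 := by
  change σ.incl ⁻¹ᵁ (E.r ⁻¹ᵁ E.z v) = v.1
  rw [z, r_preimage, σ.incl_preimage_up]

lemma mem_z {v : SmallOpen 𝒰} {x : X} : E.incl x ∈ E.z v ↔ x ∈ v.1 := by
  change x ∈ E.incl ⁻¹ᵁ E.z v ↔ _
  rw [incl_preimage]

lemma z_le_iff {v : SmallOpen 𝒰} {O : E.Z.Opens} : E.z v ≤ O ↔ v.1 ≤ E.incl ⁻¹ᵁ O := by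
  rw [← preimage_le_iff E.incl, incl_preimage]

lemma exists_mem_z (h𝒰 : ⨆ i, 𝒰 i = ⊤) (O : E.Z.Opens) (x : E.Z) (hx : x ∈ O) :
    ∃ v, x ∈ E.z v ∧ E.z v ≤ O := by
  obtain ⟨y, rfl⟩ := E.incl.surjective x
  obtain ⟨v, hv, hle⟩ := SmallOpen.exists_mem_le h𝒰 (O := E.incl ⁻¹ᵁ O) hx
  exact ⟨v, E.mem_z.mpr hv, E.z_le_iff.mpr hle⟩

/-- The chart brackets are transported along the isomorphisms `sec`. They are compatible with
restriction because the twists preserve them, and the corrected brackets satisfy the Jacobi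
identity. -/
lemma exists_poisson (hD : D.IsCompatible) (h𝒰 : ⨆ i, 𝒰 i = ⊤) :
    ∃ P : PoissonStructure E.toBase, ∀ v x y,
      E.sec v (P.bracket (E.z v) x y) = D.br v (E.sec v x) (E.sec v y) := by
  let e := fun v => RingEquiv.ofBijective (E.sec v) (E.sec_bijective v)
  have he : ∀ v x, E.sec v ((e v).symm x) = x := fun v x => (e v).apply_symm_apply x
  have inj := fun v => (E.sec_bijective v).1
  have hb := fun v : SmallOpen 𝒰 => D.isBiderivation v.idx v.1 v.2.1 v.le_idx
  obtain ⟨P, hP⟩ := exists_poissonStructure_of_basis (E.exists_mem_z h𝒰) E.toBase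
    (fun v x y => (e v).symm (D.br v (E.sec v x) (E.sec v y)))
    (fun v => ⟨fun a b c => inj v (by simp only [map_add, he, (hb v).add_left]),
      fun a b => inj v (by simp only [map_neg, he]; exact (hb v).skew _ _),
      fun a b c => inj v (by simp only [map_add, map_mul, he, (hb v).mul_left])⟩)
    (fun v x => inj v (by
      rw [he, map_zero]
      exact eq_zero_of_eq_neg k ((hb v).skew _ _)))
    (fun v x y w => inj v (by
      rw [map_zero, ← hD.jacobi v.idx v.1 v.2.1 v.le_idx (E.sec v x) (E.sec v y) (E.sec v w)]
      simp only [jacobiator, map_add, he]))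
    (fun v a x => inj v (by
      rw [he, map_zero, sec_strHom]
      exact D.lam_inl _ _ _ _ _ _))
    (fun v w h x y => by
      have hvw : v ≤ w := by
        have := E.z_le_iff.mp h
        rwa [incl_preimage] at this
      refine inj v ?_
      rw [he, E.sec_res hvw, he, E.sec_res hvw, E.sec_res hvw]
      exact hD.rho_lam hvw _ _)
  exact ⟨P, fun v x y => by rw [hP]; exact he _ _⟩

/-- The chart of the lift of `ψ`. -/
def chartMap (_ : D.Gluing) (v : SmallOpen 𝒰) {V : Y.Opens} (hV : IsAffineOpen V) (h : v.1 ≤ f ⁻¹ᵁ V) :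
    Spec (.of (Rg A' v.1)) ⟶ η.total :=
  Spec.map (CommRingCat.ofHom (D.phi v hV h)) ≫ (η.isAffineOpen_up hV).fromSpec

lemma map_chartMap (hD : D.IsCompatible) {v w : SmallOpen 𝒰} (h : v ≤ w) {V V' : Y.Opens}
    (hV : IsAffineOpen V) (hV' : IsAffineOpen V') (hVV : V' ≤ V) (hw : w.1 ≤ f ⁻¹ᵁ V)
    (hv : v.1 ≤ f ⁻¹ᵁ V') :
    Spec.map (CommRingCat.ofHom (D.rho h)) ≫ E.chartMap w hV hw = E.chartMap v hV' hv := by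
  have h1 : Spec.map (CommRingCat.ofHom (η.rs hVV)) ≫ (η.isAffineOpen_up hV).fromSpec =
      (η.isAffineOpen_up hV').fromSpec :=
    (η.isAffineOpen_up hV).map_fromSpec (η.isAffineOpen_up hV') (homOfLE (η.up_mono hVV)).op
  rw [chartMap, chartMap, ← h1, ← Spec.map_comp_assoc, ← Spec.map_comp_assoc]
  congr 2
  exact CommRingCat.hom_ext (RingHom.ext fun x => hD.rho_ph h hV hV' hVV hw hv x)

lemma exists_lift_hom (hD : D.IsCompatible) (hs : IsSmallExtension φ t)
    (h𝒰 : ∀ i, ∃ V : Y.Opens, IsAffineOpen V ∧ 𝒰 i ≤ f ⁻¹ᵁ V)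
    (hY : ∀ V V' : Y.Opens, IsAffineOpen V → IsAffineOpen V' → IsAffineOpen (V ⊓ V')) :
    ∃ Φ : E.Z ⟶ η.total, ∀ v V (hV : IsAffineOpen V) h, E.c v ≫ Φ = E.chartMap v hV h := by
  -- The chart of the morphism does not depend on the affine open subset of the target: two choices
  -- are compared on their intersection, which is affine by `hY`.
  have indep : ∀ v V V' (hV : IsAffineOpen V) (hV' : IsAffineOpen V') h h',
      E.chartMap v hV h = E.chartMap v hV' h' := by
    have aux : ∀ v V V' (hV : IsAffineOpen V) (hV' : IsAffineOpen V') (_ : V' ≤ V) h h',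
        E.chartMap v hV h = E.chartMap v hV' h' := by
      intro v V V' hV hV' hVV h h'
      rw [← E.map_chartMap hD le_rfl hV hV' hVV h h']
      have : CommRingCat.ofHom (D.rho (le_refl v)) = 𝟙 _ :=
        CommRingCat.hom_ext (RingHom.ext fun x => hD.rho_self hs le_rfl x)
      rw [this, Spec.map_id, Category.id_comp]
    intro v V V' hV hV' h h'
    have h2 : v.1 ≤ f ⁻¹ᵁ (V ⊓ V') := le_inf h h'
    exact (aux v V _ hV (hY V V' hV hV') inf_le_left h h2).trans
      (aux v V' _ hV' (hY V V' hV hV') inf_le_right h' h2).symm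
  choose V hV hle using h𝒰
  have hle' : ∀ v : SmallOpen 𝒰, v.1 ≤ f ⁻¹ᵁ V v.idx := fun v => v.le_idx.trans (hle _)
  obtain ⟨Φ, hΦ⟩ := E.exists_hom _ (fun v => E.chartMap v (hV v.idx) (hle' v)) fun {v w} h => by
    refine (E.map_chartMap hD h (hV w.idx) (hV w.idx) le_rfl (hle' w) (le_trans h (hle' w))).trans ?_
    exact indep _ _ _ _ _ _ _
  exact ⟨Φ, fun v V hV h => (hΦ v).trans (indep _ _ _ _ _ _ _)⟩

section Hom

variable {Φ : E.Z ⟶ η.total} (hΦ : ∀ v V (hV : IsAffineOpen V) h, E.c v ≫ Φ = E.chartMap v hV h)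
include hΦ

lemma z_le (v : SmallOpen 𝒰) {V : Y.Opens} (hV : IsAffineOpen V) (h : v.1 ≤ f ⁻¹ᵁ V) :
    E.z v ≤ Φ ⁻¹ᵁ η.up V := opensRange_le (E.c v) (η.isAffineOpen_up hV) (hΦ v V hV h)

lemma sec_comorph (v : SmallOpen 𝒰) {V : Y.Opens} (hV : IsAffineOpen V) (h : v.1 ≤ f ⁻¹ᵁ V)
    (x : Γ(η.total, η.up V)) :
    E.sec v (comorph Φ (η.up V) (E.z v) (E.z_le hΦ v hV h) x) = D.phi v hV h x :=
  congrArg (fun φ => φ.hom x)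
    (chartHom_appLE (E.c v) (η.isAffineOpen_up hV) (hΦ v V hV h) (E.z_le hΦ v hV h))

variable (h𝒰 : ∀ i, ∃ V : Y.Opens, IsAffineOpen V ∧ 𝒰 i ≤ f ⁻¹ᵁ V)
include h𝒰

lemma hom_toBase : Φ ≫ η.toBase = E.toBase ≫ ArtAlg.specMap β := by
  refine E.hom_ext fun v => ?_
  obtain ⟨V, hV, hle⟩ := h𝒰 v.idx
  rw [← Category.assoc, hΦ v V hV (v.le_idx.trans hle), chartMap, Category.assoc, fromSpec_comp_eq,
    ← Category.assoc, c_toBase, ArtAlg.specMap, ← Spec.map_comp, ← Spec.map_comp]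
  congr 1
  exact CommRingCat.hom_ext (RingHom.ext fun a => D.ph_str _ _ _ _ _ _ _ a)

lemma r_hom (hcov : ⨆ i, 𝒰 i = ⊤) : E.r ≫ Φ = ψ := by
  refine hom_ext_of_family (fun v : SmallOpen 𝒰 => (σ.isAffineOpen_up v.2.1).fromSpec) ?_ fun v => ?_
  · intro x
    obtain ⟨y, rfl⟩ := σ.incl.surjective x
    obtain ⟨v, hv, -⟩ := SmallOpen.exists_mem_le hcov (TopologicalSpace.Opens.mem_top y)
    have := Deformation.mem_up (σ := σ).mpr hv
    rw [← (σ.isAffineOpen_up v.2.1).opensRange_fromSpec] at this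
    exact ⟨v, this⟩
  · obtain ⟨V, hV, hle⟩ := h𝒰 v.idx
    have h := v.le_idx.trans hle
    rw [← Category.assoc, E.fromSpec_r, Category.assoc, hΦ v V hV h, chartMap, ← Spec.map_comp_assoc]
    refine Eq.trans ?_ ((η.isAffineOpen_up hV).SpecMap_appLE_fromSpec ψ (σ.isAffineOpen_up v.2.1)
      (i := up_le_preimage hψ h))
    congr 2
    exact CommRingCat.hom_ext (RingHom.ext fun a => D.p_ph _ _ _ _ _ _ _ a)

end Hom

end LiftData.Gluing

end Glue

end

end PoissonDef
namespace PoissonDef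
open TensorProduct

noncomputable section

set_option linter.unusedSectionVars false

/-! ### Lifting along a small extension -/

section Lifting

variable {k : Type u} [Field k] {X Y : Scheme.{u}} {pX : X ⟶ Spec (.of k)} {pY : Y ⟶ Spec (.of k)}
  {Λ₀ : PoissonStructure pX}
  {P₀ : PoissonStructure pY} {f : X ⟶ Y} {A A' B : ArtAlg k}
  {σ : Deformation Λ₀ A} {η : Deformation P₀ B} {ψ : σ.total ⟶ η.total}
  {hψ : σ.incl ≫ ψ = f ≫ η.incl} {ι : Type*} {𝒰 : ι → X.Opens}
  {φ : A'.carrier →ₐ[k] A.carrier} {β : B.carrier →ₐ[k] A'.carrier} {t : A'.carrier}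

lemma closedPoint_specMap (φ : A'.carrier →ₐ[k] A.carrier) :
    A.closedPoint ≫ ArtAlg.specMap φ = A'.closedPoint :=
  (Spec.map_comp _ _).symm.trans (congrArg Spec.map
    (CommRingCat.hom_ext (RingHom.ext fun a => ArtAlg.residue_comp φ a)))

/-- A lift of a deformation `σ` and of a morphism `ψ` from `σ` to a fixed deformation of the target
along `φ : A' → A`. -/
structure MorphismLift (η : Deformation P₀ B) (f : X ⟶ Y) (σ : Deformation Λ₀ A)
    (ψ : σ.total ⟶ η.total) (φ : A'.carrier →ₐ[k] A.carrier) (β : B.carrier →ₐ[k] A'.carrier) where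
  source : Deformation Λ₀ A'
  map : source.total ⟶ η.total
  map_toBase : map ≫ η.toBase = source.toBase ≫ ArtAlg.specMap β
  map_isPoisson : IsPoisson source.poisson η.poisson map
  map_incl : source.incl ≫ map = f ≫ η.incl
  baseChange : Deformation.BaseChange φ source σ
  hom_map : baseChange.hom ≫ map = ψ

section

variable [CharZero k] [∀ V : X.Opens, Algebra k Γ(X, V)] [IsAlgOver pX] {T : Charts σ 𝒰} {D : LiftData hψ T φ β}

lemma LiftData.IsCompatible.nonempty_lift (hD : D.IsCompatible) (hs : IsSmallExtension φ t)
    (h𝒰 : IsAdaptedAffineCover f 𝒰)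
    (hY : ∀ V V' : Y.Opens, IsAffineOpen V → IsAffineOpen V' → IsAffineOpen (V ⊓ V')) :
    Nonempty (MorphismLift η f σ ψ φ β) := by
  obtain ⟨E⟩ := hD.nonempty_gluing hs h𝒰.iSup_eq_top
  obtain ⟨P, hP⟩ := E.exists_poisson hD h𝒰.iSup_eq_top
  obtain ⟨Φ, hΦ⟩ := E.exists_lift_hom hD hs h𝒰.le_preimage hY
  -- On charts this is the property `p_lam`: the lifted brackets reduce to the bracket of `σ`.
  have hr : IsPoisson σ.poisson P E.r := by
    refine isPoisson_of_local fun V x hx => ?_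
    obtain ⟨v, hv, hle⟩ := E.exists_mem_z h𝒰.iSup_eq_top V (E.r x) hx
    refine ⟨E.z v, σ.up v.1, E.up_le v, hle, (E.r_preimage v).le hv, fun a b => ?_⟩
    rw [E.comorph_r, E.comorph_r, E.comorph_r, hP]
    exact D.p_lam _ _ _ _ _ _
  have hrΦ : E.r ≫ Φ = ψ := E.r_hom hΦ h𝒰.le_preimage h𝒰.iSup_eq_top
  have hi : E.incl ≫ Φ = f ≫ η.incl := by
    rw [LiftData.Gluing.incl, Category.assoc, hrΦ, hψ]
  have hΦP : IsPoisson P η.poisson Φ := by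
    refine isPoisson_of_local fun V x hx => ?_
    obtain ⟨y, rfl⟩ := E.incl.surjective x
    have hy : η.incl (f y) ∈ V := by
      rw [← Scheme.Hom.comp_apply, ← hi, Scheme.Hom.comp_apply]
      exact hx
    obtain ⟨V₁, hV₁, hfy, hle⟩ := exists_affine_mem_le (U := η.incl ⁻¹ᵁ V) hy
    obtain ⟨v, hv, hvle⟩ := SmallOpen.exists_mem_le h𝒰.iSup_eq_top (O := f ⁻¹ᵁ V₁) hfy
    refine ⟨η.up V₁, E.z v, E.z_le hΦ v hV₁ hvle, η.up_le_iff.mpr hle, E.mem_z.mpr hv, fun a b => ?_⟩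
    apply (E.sec_bijective v).1
    rw [E.sec_comorph hΦ v hV₁ hvle, hP, E.sec_comorph hΦ v hV₁ hvle, E.sec_comorph hΦ v hV₁ hvle]
    exact (hD.lam_ph _ _ _ _ _ _ _ _ _).symm
  let σ' : Deformation Λ₀ A' :=
    { total := E.Z
      toBase := E.toBase
      flat := E.flat
      poisson := P
      incl := E.incl
      isPullback := by
        rw [← closedPoint_specMap φ]
        exact σ.isPullback.paste_horiz E.isPullback
      incl_isPoisson := σ.incl_isPoisson.comp hr }
  exact ⟨{
    source := σ'
    map := Φ
    map_toBase := E.hom_toBase hΦ h𝒰.le_preimage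
    map_isPoisson := hΦP
    map_incl := hi
    baseChange := ⟨E.r, E.isPullback, hr, rfl⟩
    hom_map := hrΦ }⟩

end

/-- Lifting along a small extension. -/
theorem nonempty_lift_of_isSmallExtension [CharZero k] [Smooth pX] [Smooth pY] (hs : IsSmallExtension φ t)
    (hf : f ≫ pY = pX) (hfP : IsPoisson Λ₀ P₀ f) (h𝒰 : IsAdaptedAffineCover f 𝒰)
    (hX : ∀ V V' : X.Opens, IsAffineOpen V → IsAffineOpen V' → IsAffineOpen (V ⊓ V'))
    (hY : ∀ V V' : Y.Opens, IsAffineOpen V → IsAffineOpen V' → IsAffineOpen (V ⊓ V'))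
    (h₁ : Function.Surjective (hyperMap f 𝒰 Λ₀ P₀ hf hfP 1))
    (h₂ : Function.Injective (hyperMap f 𝒰 Λ₀ P₀ hf hfP 2))
    (hψ : σ.incl ≫ ψ = f ≫ η.incl)
    (hψ' : ψ ≫ η.toBase = σ.toBase ≫ ArtAlg.specMap (φ.comp β))
    (hψP : IsPoisson σ.poisson η.poisson ψ) :
    Nonempty (MorphismLift η f σ ψ φ β) := by
  -- The algebra structures assumed so far are the ones given by the structure morphism.
  let : ∀ V : X.Opens, Algebra k Γ(X, V) := fun V => (strHom pX V).toAlgebra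
  have : IsAlgOver pX := ⟨fun _ _ => rfl⟩
  obtain ⟨T⟩ := exists_charts σ 𝒰 h𝒰.isAffineOpen
  obtain ⟨D⟩ := exists_liftData hψ T β hs hψ' h𝒰 hX hY
  obtain ⟨D', hD'⟩ := D.exists_isCompatible hs hψP hf hfP h₁ h₂
  exact hD'.nonempty_lift hs h𝒰 hY

end Lifting

end

end PoissonDef
namespace PoissonDef
open TensorProduct

noncomputable section

set_option linter.unusedSectionVars false

/-! ### Separatedness, quotients and composition of lifts -/

section Separated

attribute [local instance] MvPolynomial.gradedAlgebra

lemma isSeparated_projectiveSpaceToSpec (k : Type u) [Field k] (n : ℕ) :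
    IsSeparated (projectiveSpaceToSpec k n) := by
  have : IsSeparated (Proj.toSpecZero (MvPolynomial.homogeneousSubmodule (Fin (n + 1)) k)) :=
    Proj.isSeparated _
  unfold projectiveSpaceToSpec
  infer_instance

lemma IsProjectiveOver.isSeparated {k : Type u} [Field k] {X : Scheme.{u}} {p : X ⟶ Spec (.of k)}
    (h : IsProjectiveOver k p) : IsSeparated p := by
  obtain ⟨n, i, hi, rfl⟩ := h
  have := isSeparated_projectiveSpaceToSpec k n
  infer_instance

/-- The diagonal of a separated morphism is a closed immersion, hence affine, and the base is
affine. -/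
lemma isAffineOpen_inf {k : Type u} [Field k] {X : Scheme.{u}} (p : X ⟶ Spec (.of k))
    [IsSeparated p] (V V' : X.Opens) (hV : IsAffineOpen V) (hV' : IsAffineOpen V') :
    IsAffineOpen (V ⊓ V') :=
  isAffineHom_diagonal_iff.mp (inferInstance : IsAffineHom (Limits.pullback.diagonal p)) ⊤
    (isAffineOpen_top _) V (fun _ _ => trivial) V' (fun _ _ => trivial) hV hV'

end Separated

section Quotient

variable {k : Type u} [Field k]

lemma bijective_algebraMap_residueField {A C : Type u} [CommRing A] [CommRing C] [Algebra k A]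
    [Algebra k C] [IsLocalRing A] [IsLocalRing C]
    (hA : Function.Surjective (algebraMap k (IsLocalRing.ResidueField A)))
    (π : A →ₐ[k] C) (hπ : Function.Surjective π) :
    Function.Bijective (algebraMap k (IsLocalRing.ResidueField C)) := by
  refine ⟨(algebraMap k _).injective, fun y => ?_⟩
  obtain ⟨c, rfl⟩ := IsLocalRing.residue_surjective y
  obtain ⟨a, rfl⟩ := hπ c
  obtain ⟨x, hx⟩ := hA (IsLocalRing.residue A a)
  refine ⟨x, ?_⟩
  have h1 : IsLocalRing.residue A (algebraMap k A x - a) = 0 := by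
    rw [map_sub, sub_eq_zero]; exact hx
  have h2 : IsLocalRing.residue C (π (algebraMap k A x - a)) = 0 := by
    rw [IsLocalRing.residue_eq_zero_iff] at h1 ⊢
    have : IsLocalHom (π : A →+* C) := hπ.isLocalHom (π : A →+* C)
    exact (IsLocalRing.mem_maximalIdeal _).mpr fun hu =>
      (IsLocalRing.mem_maximalIdeal _).mp h1 (isUnit_of_map_unit (π : A →+* C) _ hu)
  rw [map_sub, π.commutes, map_sub, sub_eq_zero] at h2
  exact h2

/-- The quotient of a local Artinian algebra by a proper ideal. -/
def ArtAlg.quotient (A : ArtAlg k) (I : Ideal A.carrier) (hI : I ≠ ⊤) : ArtAlg k :=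
  have := Ideal.Quotient.nontrivial_iff.mpr hI
  have := IsLocalRing.of_surjective' (Ideal.Quotient.mk I) Ideal.Quotient.mk_surjective
  { carrier := A.carrier ⧸ I
    residue_bijective := bijective_algebraMap_residueField A.residue_bijective.2
      (Ideal.Quotient.mkₐ k I) Ideal.Quotient.mk_surjective }

/-- The base field. -/
def ArtAlg.base (k : Type u) [Field k] : ArtAlg k where
  carrier := k
  residue_bijective := ⟨(algebraMap k _).injective, IsLocalRing.residue_surjective⟩

/-- A nonzero ideal contains a nonzero element killed by the maximal ideal. -/
lemma ArtAlg.exists_socle_mem (A : ArtAlg k) {I : Ideal A.carrier} (hI : I ≠ ⊥) :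
    ∃ t ∈ I, t ≠ 0 ∧ ∀ x ∈ A.maxIdeal, x * t = 0 := by
  obtain ⟨n, hn⟩ := A.isNilpotent_maxIdeal
  -- If the maximal ideal kills `I`, any nonzero element of `I` will do; otherwise `I` is replaced
  -- by its product with the maximal ideal, which needs one power less to vanish.
  have key : ∀ (n : ℕ) (I : Ideal A.carrier), I ≠ ⊥ → A.maxIdeal ^ n * I = ⊥ →
      ∃ t ∈ I, t ≠ 0 ∧ ∀ x ∈ A.maxIdeal, x * t = 0 := by
    intro n
    induction n with
    | zero =>
      intro I hI h
      rw [pow_zero, Ideal.one_eq_top, Ideal.top_mul] at h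
      exact absurd h hI
    | succ n ih =>
      intro I hI h
      by_cases hm : A.maxIdeal * I = ⊥
      · obtain ⟨t, ht, ht0⟩ := Submodule.exists_mem_ne_zero_of_ne_bot hI
        refine ⟨t, ht, ht0, fun x hx => ?_⟩
        have := Ideal.mul_mem_mul hx ht
        rwa [hm, Ideal.mem_bot] at this
      · obtain ⟨t, ht, ht'⟩ := ih (A.maxIdeal * I) hm (by rwa [pow_succ, mul_assoc] at h)
        exact ⟨t, Ideal.mul_le_right ht, ht'⟩
  exact key n I hI (by rw [hn, Ideal.zero_eq_bot, Ideal.bot_mul])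

end Quotient

section Transport

variable {k : Type u} [Field k] {X Y : Scheme.{u}} {pX : X ⟶ Spec (.of k)} {pY : Y ⟶ Spec (.of k)}
  {Λ₀ : PoissonStructure pX} {P₀ : PoissonStructure pY} {f : X ⟶ Y} {A A' B : ArtAlg k}
  {σ : Deformation Λ₀ A} {η : Deformation P₀ B} {ψ : σ.total ⟶ η.total}
  {φ : A'.carrier →ₐ[k] A.carrier} {β : B.carrier →ₐ[k] A'.carrier}

/-- A Poisson structure over `S` viewed over a base `T` under `S`. -/
def PoissonStructure.overComp {X S T : Scheme.{u}} {p : X ⟶ S} (P : PoissonStructure p) (s : S ⟶ T) :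
    PoissonStructure (p ≫ s) where
  bracket := P.bracket
  bracket_add := P.bracket_add
  bracket_self := P.bracket_self
  bracket_skew := P.bracket_skew
  bracket_mul := P.bracket_mul
  bracket_base U W h r a := by
    have h' : U ≤ p ⁻¹ᵁ (s ⁻¹ᵁ W) := h
    have := P.bracket_base U (s ⁻¹ᵁ W) h' (comorph s W (s ⁻¹ᵁ W) le_rfl r) a
    rwa [comorph_comorph] at this
  jacobi := P.jacobi
  bracket_res := P.bracket_res

lemma IsPoisson.id {X S T : Scheme.{u}} {p : X ⟶ S} {q : X ⟶ T} {P : PoissonStructure p}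
    {Q : PoissonStructure q} (h : ∀ U a b, Q.bracket U a b = P.bracket U a b) :
    IsPoisson P Q (𝟙 X) := by
  intro V a b
  have e : ∀ x, comorph (𝟙 X) V (𝟙 X ⁻¹ᵁ V) le_rfl x = x := fun x =>
    (comorph_id (U := V) (V := V) le_rfl x).trans (res_self le_rfl x)
  exact (e _).trans ((h V a b).trans (congrArg₂ (P.bracket V) (e a).symm (e b).symm))

lemma specMap_comp {A B C : ArtAlg k} (φ : B.carrier →ₐ[k] C.carrier) (β : A.carrier →ₐ[k] B.carrier) :
    ArtAlg.specMap (φ.comp β) = ArtAlg.specMap φ ≫ ArtAlg.specMap β :=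
  Spec.map_comp (CommRingCat.ofHom (β : A.carrier →+* B.carrier))
    (CommRingCat.ofHom (φ : B.carrier →+* C.carrier))

lemma specMap_id (A : ArtAlg k) : ArtAlg.specMap (AlgHom.id k A.carrier) = 𝟙 _ := Spec.map_id _

lemma isIso_specMap (hφ : Function.Bijective φ) : IsIso (ArtAlg.specMap φ) := by
  have : IsIso (CommRingCat.ofHom (φ : A'.carrier →+* A.carrier)) :=
    (ConcreteCategory.isIso_iff_bijective _).mpr hφ
  unfold ArtAlg.specMap
  infer_instance

/-- Lifting along an isomorphism. -/
def MorphismLift.ofBijective (hφ : Function.Bijective φ) (hψ : σ.incl ≫ ψ = f ≫ η.incl)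
    (hψ' : ψ ≫ η.toBase = σ.toBase ≫ ArtAlg.specMap (φ.comp β))
    (hψP : IsPoisson σ.poisson η.poisson ψ) : MorphismLift η f σ ψ φ β :=
  have := isIso_specMap hφ
  have := σ.flat
  have hp : IsPullback (𝟙 σ.total) σ.toBase (σ.toBase ≫ ArtAlg.specMap φ) (ArtAlg.specMap φ) :=
    IsPullback.of_horiz_isIso ⟨by rw [Category.id_comp]⟩
  { source :=
      { total := σ.total
        toBase := σ.toBase ≫ ArtAlg.specMap φ
        flat := inferInstance
        poisson := σ.poisson.overComp _
        incl := σ.incl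
        isPullback := by
          have := σ.isPullback.paste_horiz hp
          rwa [Category.comp_id, closedPoint_specMap] at this
        incl_isPoisson := σ.incl_isPoisson }
    map := ψ
    map_toBase := by rw [hψ', specMap_comp, Category.assoc]
    map_isPoisson := hψP
    map_incl := hψ
    baseChange :=
      { hom := 𝟙 _
        isPullback := hp
        isPoisson := IsPoisson.id fun _ _ _ => rfl
        incl := Category.comp_id _ }
    hom_map := Category.id_comp _ }

/-- Composition of lifts. -/
def MorphismLift.trans {A'' : ArtAlg k} {φ' : A''.carrier →ₐ[k] A.carrier}
    {π : A'.carrier →ₐ[k] A''.carrier} {β'' : B.carrier →ₐ[k] A''.carrier}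
    (L : MorphismLift η f σ ψ φ' β'') (L' : MorphismLift η f L.source L.map π β)
    (h : φ'.comp π = φ) : MorphismLift η f σ ψ φ β where
  source := L'.source
  map := L'.map
  map_toBase := L'.map_toBase
  map_isPoisson := L'.map_isPoisson
  map_incl := L'.map_incl
  baseChange :=
    { hom := L.baseChange.hom ≫ L'.baseChange.hom
      isPullback := by
        rw [← h, specMap_comp]
        exact L.baseChange.isPullback.paste_horiz L'.baseChange.isPullback
      isPoisson := L.baseChange.isPoisson.comp L'.baseChange.isPoisson
      incl := by rw [← Category.assoc, L.baseChange.incl, L'.baseChange.incl] }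
  hom_map := by rw [Category.assoc, L'.hom_map, L.hom_map]

end Transport

/-! ### Induction over small extensions -/

section Main

variable {k : Type u} [Field k] [CharZero k] {X Y : Scheme.{u}} {pX : X ⟶ Spec (.of k)}
  {pY : Y ⟶ Spec (.of k)} [Smooth pX] [Smooth pY] [IsSeparated pX] [IsSeparated pY]
  {Λ₀ : PoissonStructure pX} {P₀ : PoissonStructure pY} {f : X ⟶ Y}
  (hf : f ≫ pY = pX) (hfP : IsPoisson Λ₀ P₀ f) {ι : Type*} {𝒰 : ι → X.Opens}
  (h𝒰 : IsAdaptedAffineCover f 𝒰)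
  (h₁ : Function.Surjective (hyperMap f 𝒰 Λ₀ P₀ hf hfP 1))
  (h₂ : Function.Injective (hyperMap f 𝒰 Λ₀ P₀ hf hfP 2))
  {A B : ArtAlg k} {σ : Deformation Λ₀ A} {η : Deformation P₀ B} {ψ : σ.total ⟶ η.total}

include h𝒰 h₁ h₂

/-- Lifting along a surjection, by induction on the kernel of a presentation of its source. -/
theorem nonempty_lift_of_surjective (hψ : σ.incl ≫ ψ = f ≫ η.incl)
    (hψP : IsPoisson σ.poisson η.poisson ψ) (R : ArtAlg k) (I : Ideal R.carrier) :
    ∀ (A' : ArtAlg k) (ρ : R.carrier →ₐ[k] A'.carrier), Function.Surjective ρ → RingHom.ker ρ = I →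
    ∀ (φ : A'.carrier →ₐ[k] A.carrier) (β : B.carrier →ₐ[k] A'.carrier), Function.Surjective φ →
      ψ ≫ η.toBase = σ.toBase ≫ ArtAlg.specMap (φ.comp β) →
      Nonempty (MorphismLift η f σ ψ φ β) := by
  -- Every `A'` in the induction is a quotient of the fixed ring `R`. Ideals of `R` satisfy the
  -- ascending chain condition, so the claim may be assumed for quotients by larger kernels.
  induction I using IsWellFounded.induction (fun I J : Ideal R.carrier => I > J) with
  | ind I ih =>
  rintro A' ρ hρ rfl φ β hφ hψ'
  by_cases hk : RingHom.ker φ = ⊥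
  · exact ⟨.ofBijective ⟨(RingHom.injective_iff_ker_eq_bot _).mpr hk, hφ⟩ hψ hψ' hψP⟩
  obtain ⟨t, htk, ht0, ht⟩ := A'.exists_socle_mem hk
  have htop : Ideal.span {t} ≠ ⊤ := fun h => by
    have h1 : (1 : A'.carrier) ∈ RingHom.ker φ := by
      have : Ideal.span {t} ≤ RingHom.ker φ := (Ideal.span_singleton_le_iff_mem _).mpr htk
      exact this (h ▸ Submodule.mem_top)
    rw [RingHom.mem_ker, map_one] at h1
    exact one_ne_zero h1
  -- A socle element `t` of the kernel is divided out, which makes `A' → A''` a small extension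
  -- through which `φ` factors.
  let A'' := A'.quotient (Ideal.span {t}) htop
  let π : A'.carrier →ₐ[k] A''.carrier := Ideal.Quotient.mkₐ k (Ideal.span {t})
  have hπ : Function.Surjective π := Ideal.Quotient.mk_surjective
  have hπ0 : ∀ x, π x = 0 ↔ x ∈ Ideal.span {t} := fun x => Ideal.Quotient.eq_zero_iff_mem
  let φ' : A''.carrier →ₐ[k] A.carrier := Ideal.Quotient.liftₐ (Ideal.span {t}) φ fun a ha =>
    (Ideal.span_singleton_le_iff_mem _).mpr htk ha
  have hφ' : φ'.comp π = φ := AlgHom.ext fun x => rfl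
  have hs : IsSmallExtension π t :=
    { surjective := hπ
      ne_zero := ht0
      map_eq_zero := (hπ0 t).mpr (Ideal.mem_span_singleton_self t)
      mul_eq_zero := ht
      exists_of_map_eq_zero := fun x hx => by
        obtain ⟨a, rfl⟩ := Ideal.mem_span_singleton'.mp ((hπ0 x).mp hx)
        refine ⟨A'.residue a, ?_⟩
        have := ht _ (A'.sub_residue_mem a)
        rw [sub_mul, sub_eq_zero] at this
        rw [this, Algebra.smul_def] }
  have hlt : RingHom.ker (π.comp ρ) > RingHom.ker ρ := by
    refine lt_of_le_of_ne (fun x hx => ?_) fun h => ?_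
    · rw [RingHom.mem_ker] at hx ⊢
      rw [AlgHom.comp_apply, hx, map_zero]
    · obtain ⟨s, rfl⟩ := hρ t
      refine ht0 ?_
      have : s ∈ RingHom.ker (π.comp ρ) := hs.map_eq_zero
      rwa [← h, RingHom.mem_ker] at this
  -- The lift is first made to `A''` by induction, then to `A'`. The target stays over `B`
  -- throughout: only `β` is composed with the projection, so no intermediate base change of `η` is
  -- needed.
  obtain ⟨L⟩ := ih _ hlt A'' (π.comp ρ) (hπ.comp hρ) rfl φ' (π.comp β)
    (fun a => by
      obtain ⟨x, hx⟩ := hφ a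
      exact ⟨π x, hx⟩) hψ'
  obtain ⟨L'⟩ := nonempty_lift_of_isSmallExtension hs hf hfP h𝒰 (isAffineOpen_inf pX)
    (isAffineOpen_inf pY) h₁ h₂ L.map_incl L.map_toBase L.map_isPoisson
  exact ⟨L.trans L' hφ'⟩

end Main

end

end PoissonDef
namespace PoissonDef

noncomputable section

/-! ### The base field and the trivial deformation -/

section Conclusion

variable {k : Type u} [Field k] {X Y : Scheme.{u}} {pX : X ⟶ Spec (.of k)} {pY : Y ⟶ Spec (.of k)}
  {R : PoissonStructure pY} {A : ArtAlg k}

/-- The identity isomorphism of deformations. -/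
def Deformation.Iso.refl (η : Deformation R A) : Deformation.Iso η η where
  iso := CategoryTheory.Iso.refl _
  hom_toBase := Category.id_comp _
  isPoisson := IsPoisson.id fun _ _ _ => rfl
  incl := Category.comp_id _

/-- The residue homomorphism as a homomorphism of local Artinian algebras. -/
def ArtAlg.toBase (A : ArtAlg k) : A.carrier →ₐ[k] (ArtAlg.base k).carrier :=
  { A.residue with commutes' := A.residue_algebraMap }

lemma ArtAlg.residue_base : (ArtAlg.base k).residue = RingHom.id k :=
  RingHom.ext fun c => (ArtAlg.base k).residue_algebraMap c

lemma ArtAlg.closedPoint_base : (ArtAlg.base k).closedPoint = 𝟙 (Spec (.of k)) :=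
  (congrArg (fun g => Spec.map (CommRingCat.ofHom g)) (ArtAlg.residue_base (k := k))).trans
    (Spec.map_id _)

/-- The deformation over the base field. -/
def Deformation.trivial (R : PoissonStructure pY) [hR : Flat pY] : Deformation R (ArtAlg.base k) where
  total := Y
  toBase := pY
  flat := hR
  poisson := R
  incl := 𝟙 Y
  isPullback := by
    rw [ArtAlg.closedPoint_base]
    exact IsPullback.id_horiz pY
  incl_isPoisson := IsPoisson.id fun _ _ _ => rfl

end Conclusion

end

end PoissonDef
theorem mainTheorem8 {k : Type u} [Field k] [IsAlgClosed k] [CharZero k]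
    {X Y : Scheme.{u}} (pX : X ⟶ Spec (.of k)) (pY : Y ⟶ Spec (.of k))
    [Smooth pX] [Smooth pY] [IsSeparated pY] [QuasiCompact pY]
    (hX : PoissonDef.IsProjectiveOver k pX)
    (Λ₀ : PoissonDef.PoissonStructure pX) (P₀ : PoissonDef.PoissonStructure pY)
    (f : X ⟶ Y) (hf : f ≫ pY = pX) (hfP : PoissonDef.IsPoisson Λ₀ P₀ f)
    {ι : Type*} (𝒰 : ι → X.Opens) (h𝒰 : PoissonDef.IsAdaptedAffineCover f 𝒰)
    (h₁ : Function.Surjective (PoissonDef.hyperMap f 𝒰 Λ₀ P₀ hf hfP 1))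
    (h₂ : Function.Injective (PoissonDef.hyperMap f 𝒰 Λ₀ P₀ hf hfP 2)) :
    PoissonDef.ForgetTargetSmooth Λ₀ P₀ f ∧
    ∀ (A : PoissonDef.ArtAlg k) (η : PoissonDef.Deformation P₀ A),
      ∃ (ξ : PoissonDef.Deformation Λ₀ A) (Φ : ξ.total ⟶ η.total),
        Φ ≫ η.toBase = ξ.toBase ∧ PoissonDef.IsPoisson ξ.poisson η.poisson Φ ∧
        ξ.incl ≫ Φ = f ≫ η.incl := by
  have := hX.isSeparated
  constructor
  · rintro A' A φ hφ ξ η' ⟨s⟩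
    -- The prescribed `η'` over `A'` is the fixed target, with `B = A'` and `β` the identity; `ψ` is
    -- the given morphism followed by the inclusion of its target into `η'`.
    obtain ⟨L⟩ := PoissonDef.nonempty_lift_of_surjective hf hfP h𝒰 h₁ h₂ (σ := ξ.source) (η := η')
      (ψ := ξ.map ≫ s.hom)
      (by rw [← Category.assoc, ξ.map_incl, Category.assoc, s.incl])
      (ξ.map_isPoisson.comp s.isPoisson) A' _ A' (AlgHom.id k _) Function.surjective_id rfl φ
      (AlgHom.id k _) hφ
      (by rw [Category.assoc, s.isPullback.w, ← Category.assoc, ξ.map_over, AlgHom.comp_id])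
    refine ⟨⟨L.source, η', L.map, ?_, L.map_isPoisson, L.map_incl⟩, ⟨L.baseChange, s, L.hom_map⟩,
      ⟨PoissonDef.Deformation.Iso.refl η'⟩⟩
    rw [L.map_toBase, PoissonDef.specMap_id, Category.comp_id]
  · intro A η
    have h : (f ≫ η.incl) ≫ η.toBase = pX ≫ A.closedPoint := by
      rw [Category.assoc, η.isPullback.w, ← Category.assoc, hf]
    -- Over `k` the source is `X` itself, and `f` followed by the inclusion of the closed fibre is a
    -- Poisson morphism into `η`; it is lifted along `A → k`.
    obtain ⟨L⟩ := PoissonDef.nonempty_lift_of_surjective hf hfP h𝒰 h₁ h₂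
      (σ := PoissonDef.Deformation.trivial Λ₀) (η := η) (ψ := f ≫ η.incl) (Category.id_comp _)
      (hfP.comp η.incl_isPoisson) A _ A (AlgHom.id k _) Function.surjective_id rfl A.toBase
      (AlgHom.id k _) A.residue_surjective h
    refine ⟨L.source, L.map, ?_, L.map_isPoisson, L.map_incl⟩
    rw [L.map_toBase, PoissonDef.specMap_id, Category.comp_id]
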